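/- All dga's are graded-commutative, unital, and graded in degrees $\ge 0$. A \emph{filtered dga} $(A,W)$ is a dga with an increasing multiplicative filtration $W$ by graded subcomplexes, with $1\in W_0A$, which is exhaustive ($A=\bigcup_pW_pA$) and regular (for every $n$ there is $q$ with $W_qA^n=0$). A \emph{bifiltered dga} $(A,W,F)$ has moreover a decreasing multiplicative filtration $F$ by graded subcomplexes with $1\in F^0A$. Let $E_1(A)$ be the first term $H^n(\mathrm{Gr}^W_pA)$ of the spectral sequence of $W$, with its differential $d_1:H^n(\mathrm{Gr}^W_pA)\to H^{n+1}(\mathrm{Gr}^W_{p-1}A)$; a morphism $f$ is an \emph{$E_1$-quasi-isomorphism} if $E_1(f)$ is a quasi-isomorphism. \emph{Diagrams.} Fix $\ell\ge 0$, put $s=2(\ell+1)$ and let $I=\{0\to1\leftarrow2\to\cdots\leftarrow s\}$. Let $\Gamma\mathbf A$ be the category of diagrams of type $I$ that consist of a filtered dga $(A_{\mathbb Q},W)$ over $\mathbb Q$ at the vertex $0$, filtered dga's $A_i$ over $\mathbb C$ at the vertices $1,\dots,s-1$, a bifiltered dga $(A_{\mathbb C},W,F)$ over $\mathbb C$ at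 the vertex $s$, and, for every arrow $u:i\to j$, a morphism $\varphi_u:A_i\to A_j$ of filtered dga's over $\mathbb C$ (where $A_0=A_{\mathbb Q}\otimes\mathbb C$, and $F$ is forgotten at $s$). The path object $P(A)$ is $A_i\otimes\Lambda(t,dt)$ at every vertex, with $W_p(A_i\otimes\Lambda(t,dt))=W_pA_i\otimes\Lambda(t)\oplus W_{p+1}A_i\otimes\Lambda(t)\,dt$ and $F^q(A_{\mathbb C}\otimes\Lambda(t,dt))=F^qA_{\mathbb C}\otimes\Lambda(t,dt)$; $\delta^0,\delta^1:P(A)\to A$ are the evaluations at $t=0,1$ and $\iota$ is the inclusion of constant paths. A \emph{ho-morphism} $f=(f_i,F_u):A\rightsquigarrow B$ consists of morphisms $f_i:A_i\to B_i$ (of (bi)filtered dga's, over $\mathbb Q$ for $i=0$) for all vertices $i$, and morphisms $F_u:A_i\to P(B_j)$ of filtered dga's over $\mathbb C$ with $\delta^0F_u=f_j\varphi_u$ and $\delta^1F_u=\varphi_uf_i$ for all arrows $u:i\to j$. A morphism is a ho-morphism with $F_u=\iota f_j\varphi_u$. A ho-morphism $f$ can be composed with morphisms $g$, $h$ of diagrams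 on either side: $fg=(f_ig_i,F_ug_i)$ and $hf=(h_if_i,P(h_j)F_u)$. A homotopy from $f$ to $g$ is a ho-morphism $h:A\rightsquigarrow P(B)$ with $\delta^0h=f$ and $\delta^1h=g$. A \emph{ho-equivalence} is a morphism $f:A\to B$ for which there is a ho-morphism $g:B\rightsquigarrow A$ with chains of homotopies $gf\simeq\cdots\simeq1_A$ and $fg\simeq\cdots\simeq1_B$. Let $\mathcal H$ be the closure under composition of the class of ho-equivalences, and $\mathcal Q$ the class of morphisms of diagrams that are quasi-isomorphisms at each vertex. \emph{Hodge structures.} A pure Hodge structure of weight $w$ on a $\mathbb Q$-vector space $H$ (of any dimension) is a finite decreasing filtration $F$ of $H\otimes\mathbb C$ with $H\otimes\mathbb C=F^p\oplus\overline{F^{w+1-p}}$ for all $p$. A mixed Hodge structure on $V$ consists of a finite increasing filtration $W$ of $V$ and a finite decreasing filtration $F$ of $V\otimes\mathbb C$ such that $F$ induces a pure Hodge structure of weight $n$ on $\mathrm{Gr}^W_nV$ for all $n$. \emph{Mixed Hodge diagrams.} $\mathbf{MHD}$ is the full subcategory of $\Gamma\mathbf A$ of the diagrams $A$ such that: all $\varphi_u$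 are $E_1$-quasi-isomorphisms; $F$ is biregular, i.e. finite on each $A_{\mathbb C}^n$; each $H^n(A_{\mathbb Q})$ is finite-dimensional and the unit $\mathbb Q\to H^0(A_{\mathbb Q})$ is an isomorphism; for all $p$, the differential of $\mathrm{Gr}^W_pA_{\mathbb C}$ is strictly compatible with $F$; and, for all $n,p$, the filtration $F$ induced on $H^n(\mathrm{Gr}^W_pA_{\mathbb C})$ defines a pure Hodge structure of weight $p+n$ on $H^n(\mathrm{Gr}^W_pA_{\mathbb Q})$. In the last condition $H^n(\mathrm{Gr}^W_pA_{\mathbb C})$ is identified with $H^n(\mathrm{Gr}^W_pA_{\mathbb Q})\otimes\mathbb C$ by some isomorphisms that commute with $d_1$ and induce on the cohomology of $E_1$ the isomorphism given by the string of the $\varphi_u$. The classes $\mathcal H$ and $\mathcal Q$ are restricted to $\mathbf{MHD}$. \emph{Mixed Hodge dga's.} A mixed Hodge dga is a filtered dga $(M,W)$ over $\mathbb Q$ with a multiplicative decreasing filtration $F$ of $M\otimes\mathbb C$ by graded subcomplexes, $1\in F^0$, such that each $(M^n,\mathrm{Dec}W,F)$ is a mixed Hodge structure, where $\mathrm{Dec}W_pM^n=\{x\in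 W_{p-n}M^n: dx\in W_{p-n-1}M^{n+1}\}$ (so that differentials and products are morphisms of mixed Hodge structures). It is \emph{minimal} if there are integers $n_i\ge1$ and subspaces $V_i\subseteq M^{n_i}$ ($i\in\mathbb N$) such that, with $M_i$ the subalgebra generated by the $V_j$, $j<i$: $M$ is the free graded-commutative algebra on $\bigoplus_iV_i$; $(V_i,W_{p-n_i}M\cap V_i,F)$ is a mixed Hodge structure; $d(V_i)\subseteq M_i^+\cdot M_i^+$ and $d(V_i\cap W_p)\subseteq W_{p-1}$ for all $p$; and $W$ and $F$ are the multiplicative filtrations of $M$ and $M\otimes\mathbb C$ generated by their restrictions to the $V_i$ and $V_i\otimes\mathbb C$. That is, $M$ is the union of a sequence of minimal mixed Hodge extensions $M_{i+1}=M_i\otimes_\xi\Lambda(V_i)$ starting from $\mathbb Q$. A mixed Hodge dga $M$ is viewed as the diagram with $(M,W)$ at the vertex $0$, $(M\otimes\mathbb C,W)$ at the vertices $1,\dots,s-1$, $(M\otimes\mathbb C,W,F)$ at $s$, and all $\varphi_u$ identities. \textbf{Proposition.} Let $M$ be a minimal mixed Hodge dga with all $H^n(M)$ finite-dimensional. Then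 $M$ is an object of $\mathbf{MHD}$, and in the triple $(\mathbf{MHD},\mathcal H,\mathcal Q)$: (1) $M$ is Cartan--Eilenberg cofibrant: for every morphism $w:A\to B$ in $\mathcal Q$ the map $w_*:\mathbf{MHD}[\mathcal H^{-1}](M,A)\to\mathbf{MHD}[\mathcal H^{-1}](M,B)$ is bijective; (2) $M$ is minimal: every endomorphism of $M$ in $\mathbf{MHD}$ that lies in $\mathcal Q$ is an isomorphism. More generally, if $N$ is a minimal mixed Hodge dga that is an object of $\mathbf{MHD}$, then every morphism $w:M\to N$ of $\mathbf{MHD}$ that lies in $\mathcal Q$ is an isomorphism. -/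

import Mathlib

open CategoryTheory
open scoped TensorProduct

universe u

noncomputable section

namespace MixedHodge

/-! ## Subquotients -/

/-- The subquotient `Z / (B ∩ Z)` of a vector space, for two subspaces `Z` and `B`. -/
abbrev SubQuot {k : Type*} [Field k] {V : Type*} [AddCommGroup V] [Module k V]
    (Z B : Submodule k V) : Type _ :=
  ↥Z ⧸ B.submoduleOf Z

/-- The map of subquotients induced by a linear map `f` with `f Z ⊆ Z'` and `f B ⊆ B'`. -/
def SubQuot.map {k : Type*} [Field k] {V V' : Type*} [AddCommGroup V] [Module k V]
    [AddCommGroup V'] [Module k V'] {Z B : Submodule k V} {Z' B' : Submodule k V'}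
    (f : V →ₗ[k] V') (hZ : ∀ x ∈ Z, f x ∈ Z') (hB : ∀ x ∈ B, f x ∈ B') :
    SubQuot Z B →ₗ[k] SubQuot Z' B' :=
  Submodule.mapQ _ _ (f.restrict hZ) fun x hx => hB x.1 hx

/-- The filtration induced on a subquotient `Z / (B ∩ Z)` by a subspace `S` of the ambient
space: the classes of the elements of `S ∩ Z`. -/
def SubQuot.induced {k : Type*} [Field k] {V : Type*} [AddCommGroup V] [Module k V]
    (Z B S : Submodule k V) : Submodule k (SubQuot Z B) :=
  (S.submoduleOf Z).map (B.submoduleOf Z).mkQ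

/-! ## Differential graded algebras -/

/-- A (graded-)commutative differential graded algebra over a field `k`, in degrees `≥ 0`. -/
structure DGA (k : Type) [Field k] where
  carrier : Type u
  [ring : Ring carrier]
  [algebra : Algebra k carrier]
  gr : ℕ → Submodule k carrier
  [graded : GradedAlgebra gr]
  d : carrier →ₗ[k] carrier
  d_mem : ∀ {n : ℕ} {x : carrier}, x ∈ gr n → d x ∈ gr (n + 1)
  d_d : ∀ x : carrier, d (d x) = 0
  leibniz : ∀ {n : ℕ} {x : carrier}, x ∈ gr n → ∀ y : carrier,
    d (x * y) = d x * y + (-1 : k) ^ n • (x * d y)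
  comm : ∀ {m n : ℕ} {x y : carrier}, x ∈ gr m → y ∈ gr n →
    x * y = (-1 : k) ^ (m * n) • (y * x)

attribute [instance] DGA.ring DGA.algebra DGA.graded

namespace DGA

variable {k : Type} [Field k]

/-- The degree involution `x ↦ (-1)^|x| x`. -/
def sgn (A : DGA.{u} k) : A.carrier →ₗ[k] A.carrier :=
  (DirectSum.toModule k ℕ A.carrier fun n => (-1 : k) ^ n • (A.gr n).subtype) ∘ₗ
    (DirectSum.decomposeLinearEquiv A.gr).toLinearMap

lemma sgn_of_mem (A : DGA.{u} k) {n : ℕ} {x : A.carrier} (hx : x ∈ A.gr n) :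
    A.sgn x = (-1 : k) ^ n • x := by
  rw [sgn, LinearMap.comp_apply, LinearEquiv.coe_coe, DirectSum.decomposeLinearEquiv_apply,
    DirectSum.decompose_of_mem A.gr hx, ← DirectSum.lof_eq_of k, DirectSum.toModule_lof]
  rfl

lemma sgn_mul (A : DGA.{u} k) (x y : A.carrier) : A.sgn (x * y) = A.sgn x * A.sgn y := by
  induction x using DirectSum.Decomposition.inductionOn A.gr with
  | zero => simp
  | add a b ha hb => simp [ha, hb, add_mul]
  | homogeneous a =>
    induction y using DirectSum.Decomposition.inductionOn A.gr with
    | zero => simp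
    | add a b ha hb => simp [ha, hb, mul_add]
    | homogeneous b =>
      rw [A.sgn_of_mem (SetLike.GradedMul.mul_mem a.2 b.2), A.sgn_of_mem a.2, A.sgn_of_mem b.2]
      simp [pow_add, smul_smul, mul_comm]

lemma sgn_one (A : DGA.{u} k) : A.sgn 1 = 1 := by
  simpa using A.sgn_of_mem (SetLike.GradedOne.one_mem (A := A.gr))

/-- The degree involution as a ring homomorphism. -/
def sgnHom (A : DGA.{u} k) : A.carrier →+* A.carrier where
  toFun := A.sgn
  map_one' := A.sgn_one
  map_mul' := A.sgn_mul
  map_zero' := map_zero _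
  map_add' := map_add _

@[simp] lemma sgnHom_apply (A : DGA.{u} k) (x : A.carrier) : A.sgnHom x = A.sgn x := rfl

lemma d_sgn (A : DGA.{u} k) (x : A.carrier) : A.d (A.sgn x) = - A.sgn (A.d x) := by
  induction x using DirectSum.Decomposition.inductionOn A.gr with
  | zero => simp
  | add a b ha hb => simp [ha, hb]; abel
  | homogeneous a => rw [A.sgn_of_mem a.2, A.sgn_of_mem (A.d_mem a.2)]; simp [pow_succ]

lemma leibniz' (A : DGA.{u} k) (x y : A.carrier) :
    A.d (x * y) = A.d x * y + A.sgn x * A.d y := by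
  induction x using DirectSum.Decomposition.inductionOn A.gr with
  | zero => simp
  | add a b ha hb => simp [ha, hb, add_mul]; abel
  | homogeneous a => rw [A.sgn_of_mem a.2, A.leibniz a.2]; simp

lemma d_one (A : DGA.{u} k) : A.d 1 = 0 := by
  have := A.leibniz' 1 1
  simpa [sgn_one] using this

lemma d_algebraMap (A : DGA.{u} k) (c : k) : A.d (algebraMap k A.carrier c) = 0 := by
  rw [Algebra.algebraMap_eq_smul_one, map_smul, d_one, smul_zero]

/-- A degree preserving additive map commutes with the degree involutions. -/
lemma map_sgn {k' : Type} [Field k'] {A : DGA.{u} k} {B : DGA.{u} k'}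
    (f : A.carrier →+* B.carrier) (hf : ∀ n, ∀ x ∈ A.gr n, f x ∈ B.gr n) (x : A.carrier) :
    f (A.sgn x) = B.sgn (f x) := by
  induction x using DirectSum.Decomposition.inductionOn A.gr with
  | zero => simp
  | add a b ha hb => simp [ha, hb]
  | @homogeneous i a =>
    rw [A.sgn_of_mem a.2, B.sgn_of_mem (hf _ _ a.2)]
    rcases Nat.even_or_odd i with h | h
    · simp [h.neg_one_pow]
    · simp [h.neg_one_pow]

/-- If linear maps `π n` are the identity on `gr n` and vanish on `gr m` for `m ≠ n`, they are
the projections to the homogeneous components. -/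
lemma decompose_eq (A : DGA.{u} k) (π : ℕ → A.carrier →ₗ[k] A.carrier)
    (h1 : ∀ n, ∀ x ∈ A.gr n, π n x = x) (h2 : ∀ m n, m ≠ n → ∀ x ∈ A.gr m, π n x = 0)
    (n : ℕ) (x : A.carrier) : (DirectSum.decompose A.gr x n : A.carrier) = π n x := by
  induction x using DirectSum.Decomposition.inductionOn A.gr with
  | zero => simp
  | add a b ha hb => simp [ha, hb]
  | @homogeneous i a =>
    by_cases h : i = n
    · subst h; simp [h1 _ _ a.2]
    · rw [DirectSum.decompose_of_mem_ne A.gr a.2 h, h2 _ _ h _ a.2]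

/-- The `n`-th cohomology space `H^n(A)`. -/
abbrev H (A : DGA.{u} k) (n : ℕ) : Type u :=
  SubQuot (A.gr n ⊓ LinearMap.ker A.d) (LinearMap.range A.d)

/-- The unit map `k → H^0(A)`. -/
def unitH0 (A : DGA.{u} k) : k →ₗ[k] A.H 0 :=
  Submodule.mkQ _ ∘ₗ (Algebra.linearMap k A.carrier).codRestrict _ fun c =>
    ⟨SetLike.algebraMap_mem_graded A.gr c, A.d_algebraMap c⟩

end DGA

/-! ## Coefficientwise constructions on polynomials -/

section Poly

variable {k : Type} [Field k] {R S : Type*} [Ring R] [Algebra k R] [Ring S] [Algebra k S]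


lemma coeff_sum_monomial (f : R →ₗ[k] S) (p : Polynomial R) (n : ℕ) :
    (∑ i ∈ p.support, Polynomial.monomial i (f (p.coeff i))).coeff n = f (p.coeff n) := by
  simp only [Polynomial.finsetSum_coeff, Polynomial.coeff_monomial, Finset.sum_ite_eq',
    Polynomial.mem_support_iff]
  by_cases h1 : p.coeff n = 0 <;> simp_all

/-- Apply a linear map to all coefficients of a polynomial. -/
def polyMap (f : R →ₗ[k] S) : Polynomial R →ₗ[k] Polynomial S where
  toFun p := ∑ i ∈ p.support, Polynomial.monomial i (f (p.coeff i))
  map_add' p q := by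
    ext n
    rw [coeff_sum_monomial, Polynomial.coeff_add, Polynomial.coeff_add, coeff_sum_monomial,
      coeff_sum_monomial, map_add]
  map_smul' c p := by
    ext n
    rw [coeff_sum_monomial, Polynomial.coeff_smul, RingHom.id_apply, Polynomial.coeff_smul,
      coeff_sum_monomial, map_smul]

@[simp] lemma coeff_polyMap (f : R →ₗ[k] S) (p : Polynomial R) (n : ℕ) :
    (polyMap f p).coeff n = f (p.coeff n) :=
  coeff_sum_monomial f p n

/-- The polynomials with all coefficients in a given subspace. -/
def polySub (P : Submodule k R) : Submodule k (Polynomial R) where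
  carrier := {p | ∀ i, p.coeff i ∈ P}
  add_mem' hp hq i := by simpa using P.add_mem (hp i) (hq i)
  zero_mem' i := by simp
  smul_mem' c p hp i := by simpa using P.smul_mem c (hp i)

lemma mem_polySub {P : Submodule k R} {p : Polynomial R} :
    p ∈ polySub P ↔ ∀ i, p.coeff i ∈ P := Iff.rfl

lemma polySub_mul {P Q U : Submodule k R} (h : ∀ x ∈ P, ∀ y ∈ Q, x * y ∈ U)
    {p q : Polynomial R} (hp : p ∈ polySub P) (hq : q ∈ polySub Q) : p * q ∈ polySub U := by
  intro i
  rw [Polynomial.coeff_mul]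
  exact U.sum_mem fun a _ => h _ (hp _) _ (hq _)

/-- Evaluation of a polynomial with coefficients in a `k`-algebra at a scalar. -/
def evalScalar (R : Type*) [Ring R] [Algebra k R] (c : k) : Polynomial R →+* R :=
  Polynomial.eval₂RingHom' (RingHom.id R) (algebraMap k R c)
    fun a => (Algebra.commutes c a).symm

lemma evalScalar_apply (c : k) (p : Polynomial R) :
    evalScalar R c p = p.sum fun i a => a * algebraMap k R c ^ i :=
  Polynomial.eval₂_eq_sum

@[simp] lemma evalScalar_C (c : k) (a : R) : evalScalar R c (Polynomial.C a) = a :=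
  Polynomial.eval₂_C _ _

@[simp] lemma evalScalar_monomial (c : k) (i : ℕ) (a : R) :
    evalScalar R c (Polynomial.monomial i a) = c ^ i • a := by
  refine (Polynomial.eval₂_monomial _ _).trans ?_
  rw [Algebra.smul_def, Algebra.commutes, map_pow]
  rfl

lemma evalScalar_smul (c e : k) (p : Polynomial R) :
    evalScalar R c (e • p) = e • evalScalar R c p := by
  induction p using Polynomial.induction_on' with
  | add p q hp hq => rw [smul_add, map_add, map_add, hp, hq, smul_add]
  | monomial n a =>
    rw [Polynomial.smul_monomial, evalScalar_monomial, evalScalar_monomial, smul_comm]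

lemma evalScalar_mem (c : k) {P : Submodule k R} {p : Polynomial R} (hp : p ∈ polySub P) :
    evalScalar R c p ∈ P := by
  rw [evalScalar_apply, Polynomial.sum]
  refine P.sum_mem fun i _ => ?_
  rw [← map_pow, ← Algebra.commutes, ← Algebra.smul_def]
  exact P.smul_mem _ (hp i)

lemma evalScalar_polyMap (c : k) (f : R →ₗ[k] S) (p : Polynomial R) :
    evalScalar S c (polyMap f p) = f (evalScalar R c p) := by
  induction p using Polynomial.induction_on' with
  | add p q hp hq => simp [hp, hq]
  | monomial n a =>
    have : polyMap f (Polynomial.monomial n a) = Polynomial.monomial n (f a) := by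
      ext i; simp [Polynomial.coeff_monomial]; split_ifs <;> simp
    simp [this]

lemma evalScalar_map {k' : Type} [Field k'] {S' : Type*} [Ring S'] [Algebra k' S']
    (c : k) (c' : k') (f : R →+* S') (hf : f (algebraMap k R c) = algebraMap k' S' c')
    (p : Polynomial R) :
    evalScalar S' c' (p.map f) = f (evalScalar R c p) := by
  induction p using Polynomial.induction_on' with
  | add p q hp hq => simp [hp, hq, Polynomial.map_add]
  | monomial n a =>
    simp only [Polynomial.map_monomial, evalScalar_monomial, Algebra.smul_def, map_mul, map_pow,
      hf]

end Poly

/-! ## The path object -/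

namespace DGA

variable {k : Type} [Field k]

/-- The underlying vector space of `A ⊗ Λ(t, dt)`, with `|t| = 0` and `|dt| = 1`. The pair
`(p, q)` stands for `p(t) + q(t) dt`. -/
@[ext] structure PathCarrier (A : DGA.{u} k) : Type u where
  fst : Polynomial A.carrier
  snd : Polynomial A.carrier

variable (A : DGA.{u} k)

/-- The pairs `(p, q)`. -/
def pathEquiv : A.PathCarrier ≃ Polynomial A.carrier × Polynomial A.carrier where
  toFun x := (x.1, x.2)
  invFun x := ⟨x.1, x.2⟩
  left_inv _ := rfl
  right_inv _ := rfl

instance : AddCommGroup A.PathCarrier := A.pathEquiv.addCommGroup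

instance : Module k A.PathCarrier := A.pathEquiv.module k

/-- The degree involution of `A`, coefficientwise on `A[t]`. -/
def polySgn : Polynomial A.carrier →+* Polynomial A.carrier := Polynomial.mapRingHom A.sgnHom

@[simp] lemma coeff_polySgn (p : Polynomial A.carrier) (i : ℕ) :
    (A.polySgn p).coeff i = A.sgn (p.coeff i) := by
  simp [polySgn]

lemma polySgn_smul (c : k) (p : Polynomial A.carrier) :
    A.polySgn (c • p) = c • A.polySgn p := by
  ext i; simp

/-- `(p + q dt) (p' + q' dt) = p p' + (p q' + q σ(p')) dt`, where `σ` is the degree involution: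
`dt` anticommutes with elements of odd degree. -/
instance : Mul A.PathCarrier :=
  ⟨fun x y => ⟨x.1 * y.1, x.1 * y.2 + x.2 * A.polySgn y.1⟩⟩

instance : One A.PathCarrier := ⟨⟨1, 0⟩⟩

variable {A}

@[simp] lemma path_mul_fst (x y : A.PathCarrier) : (x * y).1 = x.1 * y.1 := rfl
@[simp] lemma path_mul_snd (x y : A.PathCarrier) :
    (x * y).2 = x.1 * y.2 + x.2 * A.polySgn y.1 := rfl
@[simp] lemma path_one_fst : (1 : A.PathCarrier).1 = 1 := rfl
@[simp] lemma path_one_snd : (1 : A.PathCarrier).2 = 0 := rfl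
@[simp] lemma path_add_fst (x y : A.PathCarrier) : (x + y).1 = x.1 + y.1 := rfl
@[simp] lemma path_add_snd (x y : A.PathCarrier) : (x + y).2 = x.2 + y.2 := rfl
@[simp] lemma path_zero_fst : (0 : A.PathCarrier).1 = 0 := rfl
@[simp] lemma path_zero_snd : (0 : A.PathCarrier).2 = 0 := rfl
@[simp] lemma path_smul_fst (c : k) (x : A.PathCarrier) : (c • x).1 = c • x.1 := rfl
@[simp] lemma path_smul_snd (c : k) (x : A.PathCarrier) : (c • x).2 = c • x.2 := rfl

variable (A)

instance : Ring A.PathCarrier :=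
  { (inferInstance : AddCommGroup A.PathCarrier), (inferInstance : Mul A.PathCarrier),
    (inferInstance : One A.PathCarrier) with
    left_distrib := fun x y z => by ext1 <;> simp [mul_add, add_add_add_comm]
    right_distrib := fun x y z => by ext1 <;> simp [add_mul, add_add_add_comm]
    zero_mul := fun x => by ext1 <;> simp
    mul_zero := fun x => by ext1 <;> simp
    mul_assoc := fun x y z => by ext1 <;> simp [mul_add, add_mul, mul_assoc, add_assoc]
    one_mul := fun x => by ext1 <;> simp
    mul_one := fun x => by ext1 <;> simp }

instance : Algebra k A.PathCarrier :=
  Algebra.ofModule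
    (fun c x y => by ext1 <;> simp)
    (fun c x y => by ext1 <;> simp [polySgn_smul])

/-- The grading shifted by one, with `prevGr 0 = 0`. -/
def prevGr : ℕ → Submodule k A.carrier
  | 0 => ⊥
  | n + 1 => A.gr n

/-- The subspace `P ⊗ Λ(t) ⊕ Q ⊗ Λ(t) dt` of `A ⊗ Λ(t, dt)`. -/
def pathSub (P Q : Submodule k A.carrier) : Submodule k A.PathCarrier where
  carrier := {x | x.1 ∈ polySub P ∧ x.2 ∈ polySub Q}
  add_mem' hx hy := ⟨Submodule.add_mem _ hx.1 hy.1, Submodule.add_mem _ hx.2 hy.2⟩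
  zero_mem' := ⟨Submodule.zero_mem _, Submodule.zero_mem _⟩
  smul_mem' c _ hx := ⟨Submodule.smul_mem _ c hx.1, Submodule.smul_mem _ c hx.2⟩

/-- The homogeneous elements of degree `n` of `A ⊗ Λ(t, dt)`: all `p + q dt` such that `p` has
coefficients in degree `n` and `q` in degree `n - 1`. -/
def pathGr (n : ℕ) : Submodule k A.PathCarrier :=
  A.pathSub (A.gr n) (A.prevGr n)

variable {A}

lemma mem_pathGr {n : ℕ} {x : A.PathCarrier} :
    x ∈ A.pathGr n ↔ x.1 ∈ polySub (A.gr n) ∧ x.2 ∈ polySub (A.prevGr n) := Iff.rfl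

lemma mul_mem_gr {m n : ℕ} {x y : A.carrier} (hx : x ∈ A.gr m) (hy : y ∈ A.gr n) :
    x * y ∈ A.gr (m + n) := SetLike.GradedMul.mul_mem hx hy

lemma mul_mem_prevGr {m n : ℕ} {x y : A.carrier} (hx : x ∈ A.gr m) (hy : y ∈ A.prevGr n) :
    x * y ∈ A.prevGr (m + n) := by
  cases n with
  | zero => rw [(Submodule.mem_bot k).1 hy]; simp
  | succ n => exact mul_mem_gr hx hy

lemma mul_mem_prevGr' {m n : ℕ} {x y : A.carrier} (hx : x ∈ A.prevGr m) (hy : y ∈ A.gr n) :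
    x * y ∈ A.prevGr (m + n) := by
  cases m with
  | zero => rw [(Submodule.mem_bot k).1 hx]; simp
  | succ m =>
    have := mul_mem_gr hx hy
    rwa [show m + 1 + n = (m + n) + 1 by omega]

lemma polySgn_of_mem {n : ℕ} {p : Polynomial A.carrier} (hp : p ∈ polySub (A.gr n)) :
    A.polySgn p = (-1 : k) ^ n • p := by
  ext i; simp [A.sgn_of_mem (hp i)]

lemma polySgn_of_mem_prev {n : ℕ} {p : Polynomial A.carrier} (hp : p ∈ polySub (A.prevGr n)) :
    A.polySgn p = - ((-1 : k) ^ n • p) := by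
  cases n with
  | zero =>
    have : p = 0 := by ext i; exact (Submodule.mem_bot k).1 (hp i)
    simp [this]
  | succ n => rw [polySgn_of_mem hp, pow_succ]; simp

lemma polySgn_mem {n : ℕ} {p : Polynomial A.carrier} (hp : p ∈ polySub (A.gr n)) :
    A.polySgn p ∈ polySub (A.gr n) := by
  rw [polySgn_of_mem hp]; exact Submodule.smul_mem _ _ hp

instance : SetLike.GradedMonoid A.pathGr where
  one_mem := ⟨fun i => by
    simp only [path_one_fst, Polynomial.coeff_one]
    split_ifs
    · exact SetLike.GradedOne.one_mem
    · exact Submodule.zero_mem _, Submodule.zero_mem _⟩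
  mul_mem m n x y hx hy := by
    refine ⟨polySub_mul (fun a ha b hb => mul_mem_gr ha hb) hx.1 hy.1, ?_⟩
    refine Submodule.add_mem _ (polySub_mul (fun a ha b hb => mul_mem_prevGr ha hb) hx.1 hy.2)
      (polySub_mul (fun a ha b hb => mul_mem_prevGr' ha hb) hx.2 (polySgn_mem hy.1))

variable (A)

/-- The projection of `A` to its homogeneous component of degree `n`. -/
def proj (n : ℕ) : A.carrier →ₗ[k] A.carrier :=
  (A.gr n).subtype ∘ₗ DirectSum.component k ℕ _ n ∘ₗ
    (DirectSum.decomposeLinearEquiv A.gr).toLinearMap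

lemma proj_apply (n : ℕ) (x : A.carrier) :
    A.proj n x = (DirectSum.decompose A.gr x n : A.carrier) := rfl

lemma proj_of_mem {n : ℕ} {x : A.carrier} (hx : x ∈ A.gr n) : A.proj n x = x := by
  rw [proj_apply, DirectSum.decompose_of_mem_same A.gr hx]

lemma proj_of_mem_ne {m n : ℕ} (h : m ≠ n) {x : A.carrier} (hx : x ∈ A.gr m) :
    A.proj n x = 0 := by
  rw [proj_apply, DirectSum.decompose_of_mem_ne A.gr hx h]

lemma proj_mem (n : ℕ) (x : A.carrier) : A.proj n x ∈ A.gr n :=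
  (DirectSum.decompose A.gr x n).2

/-- The projection to the homogeneous component of degree `n - 1`. -/
def prevProj : ℕ → A.carrier →ₗ[k] A.carrier
  | 0 => 0
  | n + 1 => A.proj n

/-- The projection of `A ⊗ Λ(t, dt)` to its homogeneous component of degree `n`. -/
def pathProj (n : ℕ) : A.PathCarrier →ₗ[k] A.PathCarrier where
  toFun x := ⟨polyMap (A.proj n) x.1, polyMap (A.prevProj n) x.2⟩
  map_add' x y := by ext1 <;> simp
  map_smul' c x := by ext1 <;> simp

variable {A}

lemma pathProj_of_mem {n : ℕ} {x : A.PathCarrier} (hx : x ∈ A.pathGr n) :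
    A.pathProj n x = x := by
  refine PathCarrier.ext (Polynomial.ext fun i => ?_) (Polynomial.ext fun i => ?_)
  · exact (coeff_polyMap _ _ _).trans (A.proj_of_mem (hx.1 i))
  · refine (coeff_polyMap _ _ _).trans ?_
    have := hx.2 i
    cases n with
    | zero => rw [(Submodule.mem_bot k).1 this, map_zero]
    | succ n => exact A.proj_of_mem this

lemma pathProj_of_mem_ne {m n : ℕ} (h : m ≠ n) {x : A.PathCarrier} (hx : x ∈ A.pathGr m) :
    A.pathProj n x = 0 := by
  refine PathCarrier.ext (Polynomial.ext fun i => ?_) (Polynomial.ext fun i => ?_)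
  · exact (coeff_polyMap _ _ _).trans (A.proj_of_mem_ne h (hx.1 i))
  · refine (coeff_polyMap _ _ _).trans ?_
    have := hx.2 i
    cases m with
    | zero => rw [(Submodule.mem_bot k).1 this, map_zero]; rfl
    | succ m =>
      cases n with
      | zero => rfl
      | succ n => exact A.proj_of_mem_ne (by omega) this

lemma mem_iSup_pathGr (x : A.PathCarrier) : x ∈ ⨆ n, A.pathGr n := by
  have hm : ∀ (P : Submodule k A.carrier) (i : ℕ) (a : A.carrier), a ∈ P →
      Polynomial.monomial i a ∈ polySub P := by
    intro P i a ha j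
    rw [Polynomial.coeff_monomial]
    split_ifs
    · exact ha
    · exact P.zero_mem
  have h1 : ∀ p : Polynomial A.carrier, (⟨p, 0⟩ : A.PathCarrier) ∈ ⨆ n, A.pathGr n := by
    intro p
    induction p using Polynomial.induction_on' with
    | add p q hp hq =>
      have e : (⟨p + q, 0⟩ : A.PathCarrier) = ⟨p, 0⟩ + ⟨q, 0⟩ := by ext1 <;> simp
      exact e ▸ Submodule.add_mem _ hp hq
    | monomial i a =>
      induction a using DirectSum.Decomposition.inductionOn A.gr with
      | zero =>
        have e : (⟨Polynomial.monomial i 0, 0⟩ : A.PathCarrier) = 0 := by ext1 <;> simp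
        exact e ▸ Submodule.zero_mem _
      | add a b ha hb =>
        have e : (⟨Polynomial.monomial i (a + b), 0⟩ : A.PathCarrier) =
          ⟨Polynomial.monomial i a, 0⟩ + ⟨Polynomial.monomial i b, 0⟩ := by ext1 <;> simp
        exact e ▸ Submodule.add_mem _ ha hb
      | @homogeneous n a =>
        exact Submodule.mem_iSup_of_mem n ⟨hm _ _ _ a.2, Submodule.zero_mem _⟩
  have h2 : ∀ p : Polynomial A.carrier, (⟨0, p⟩ : A.PathCarrier) ∈ ⨆ n, A.pathGr n := by
    intro p
    induction p using Polynomial.induction_on' with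
    | add p q hp hq =>
      have e : (⟨0, p + q⟩ : A.PathCarrier) = ⟨0, p⟩ + ⟨0, q⟩ := by ext1 <;> simp
      exact e ▸ Submodule.add_mem _ hp hq
    | monomial i a =>
      induction a using DirectSum.Decomposition.inductionOn A.gr with
      | zero =>
        have e : (⟨0, Polynomial.monomial i 0⟩ : A.PathCarrier) = 0 := by ext1 <;> simp
        exact e ▸ Submodule.zero_mem _
      | add a b ha hb =>
        have e : (⟨0, Polynomial.monomial i (a + b)⟩ : A.PathCarrier) =
          ⟨0, Polynomial.monomial i a⟩ + ⟨0, Polynomial.monomial i b⟩ := by ext1 <;> simp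
        exact e ▸ Submodule.add_mem _ ha hb
      | @homogeneous n a =>
        exact Submodule.mem_iSup_of_mem (n + 1) ⟨Submodule.zero_mem _, hm _ _ _ a.2⟩
  have e : x = ⟨x.1, 0⟩ + ⟨0, x.2⟩ := by ext1 <;> simp
  rw [e]
  exact Submodule.add_mem _ (h1 x.1) (h2 x.2)

lemma isInternal_pathGr : DirectSum.IsInternal A.pathGr := by
  rw [DirectSum.isInternal_submodule_iff_iSupIndep_and_iSup_eq_top]
  refine ⟨?_, Submodule.eq_top_iff'.2 fun x => mem_iSup_pathGr x⟩
  intro n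
  rw [Submodule.disjoint_def]
  intro x hx hx'
  rw [← pathProj_of_mem hx]
  have : (⨆ (j) (_ : j ≠ n), A.pathGr j) ≤ LinearMap.ker (A.pathProj n) :=
    iSup₂_le fun j hj y hy => pathProj_of_mem_ne hj hy
  exact this hx'

instance : GradedAlgebra A.pathGr :=
  { isInternal_pathGr.chooseDecomposition, (inferInstance : SetLike.GradedMonoid A.pathGr) with }

variable (A)

/-- The differential of `A ⊗ Λ(t, dt)`: `d(p + q dt) = dp + (σ(p)' + dq) dt`. -/
def pathD : A.PathCarrier →ₗ[k] A.PathCarrier where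
  toFun x := ⟨polyMap A.d x.1, Polynomial.derivative (A.polySgn x.1) + polyMap A.d x.2⟩
  map_add' x y := by ext1 <;> simp [add_add_add_comm]
  map_smul' c x := by ext1 <;> simp [polySgn_smul]

variable {A}

@[simp] lemma pathD_fst (x : A.PathCarrier) : (A.pathD x).1 = polyMap A.d x.1 := rfl
@[simp] lemma pathD_snd (x : A.PathCarrier) :
    (A.pathD x).2 = Polynomial.derivative (A.polySgn x.1) + polyMap A.d x.2 := rfl

lemma polyMap_d_mul (p q : Polynomial A.carrier) :
    polyMap A.d (p * q) = polyMap A.d p * q + A.polySgn p * polyMap A.d q := by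
  ext n
  simp [Polynomial.coeff_mul, A.leibniz', Finset.sum_add_distrib]

lemma polyMap_d_polySgn (p : Polynomial A.carrier) :
    polyMap A.d (A.polySgn p) = - A.polySgn (polyMap A.d p) := by
  ext n; simp [A.d_sgn]

lemma polySub_smul_comm {P Q : Submodule k A.carrier} {c : k}
    (h : ∀ x ∈ P, ∀ y ∈ Q, x * y = c • (y * x)) {p q : Polynomial A.carrier}
    (hp : p ∈ polySub P) (hq : q ∈ polySub Q) : p * q = c • (q * p) := by
  ext n
  rw [Polynomial.coeff_smul, Polynomial.coeff_mul, Polynomial.coeff_mul,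
    ← Finset.Nat.sum_antidiagonal_swap, Finset.smul_sum]
  exact Finset.sum_congr rfl fun a _ => h _ (hp _) _ (hq _)

variable (A)

/-- The path object `A ⊗ Λ(t, dt)`. -/
def path : DGA.{u} k where
  carrier := A.PathCarrier
  gr := A.pathGr
  d := A.pathD
  d_mem {n x} hx := by
    refine ⟨fun i => ?_, Submodule.add_mem _ (fun i => ?_) (fun i => ?_)⟩
    · simpa using A.d_mem (hx.1 i)
    · rw [Polynomial.coeff_derivative, coeff_polySgn, A.sgn_of_mem (hx.1 _), ← Nat.cast_succ,
        ← nsmul_eq_mul']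
      exact nsmul_mem (Submodule.smul_mem _ _ (hx.1 _)) _
    · have := hx.2 i
      rw [coeff_polyMap]
      cases n with
      | zero => rw [(Submodule.mem_bot k).1 this]; simp
      | succ n => exact A.d_mem this
  d_d x := by
    refine PathCarrier.ext (by ext n; simp [A.d_d]) ?_
    ext n
    simp only [pathD_snd, pathD_fst, map_add, Polynomial.coeff_add, Polynomial.coeff_derivative,
      coeff_polySgn, coeff_polyMap, A.d_d, path_zero_snd, Polynomial.coeff_zero, add_zero]
    rw [← Nat.cast_succ, ← nsmul_eq_mul', ← nsmul_eq_mul', map_nsmul, A.d_sgn]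
    simp
  leibniz {n x} hx y := by
    have h1 := polySgn_of_mem hx.1
    have h2 := polySgn_of_mem_prev hx.2
    refine PathCarrier.ext ?_ ?_
    · simp [polyMap_d_mul, h1]
    · simp only [pathD_snd, path_mul_fst, path_mul_snd, map_add, polyMap_d_mul, map_mul,
        Polynomial.derivative_mul, path_add_snd, path_smul_snd, pathD_fst, h1, h2,
        polyMap_d_polySgn]
      simp only [mul_add, add_mul, smul_mul_assoc, smul_add, mul_neg, neg_mul, neg_neg]
      abel
  comm {m n x y} hx hy := by
    have e1 := polySgn_of_mem hx.1
    have e2 := polySgn_of_mem hy.1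
    have h11 : x.1 * y.1 = (-1 : k) ^ (m * n) • (y.1 * x.1) :=
      polySub_smul_comm (fun a ha b hb => A.comm ha hb) hx.1 hy.1
    have h12 : x.1 * y.2 = ((-1 : k) ^ (m * n) * (-1 : k) ^ m) • (y.2 * x.1) := by
      refine polySub_smul_comm (fun a ha b hb => ?_) hx.1 hy.2
      cases n with
      | zero => rw [(Submodule.mem_bot k).1 hb]; simp
      | succ n =>
        rw [A.comm ha hb, ← pow_add, show m * (n + 1) + m = m * n + 2 * m by ring, pow_add,
          pow_mul (-1 : k) 2]
        simp
    have h21 : x.2 * y.1 = ((-1 : k) ^ (m * n) * (-1 : k) ^ n) • (y.1 * x.2) := by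
      refine polySub_smul_comm (fun a ha b hb => ?_) hx.2 hy.1
      cases m with
      | zero => rw [(Submodule.mem_bot k).1 ha]; simp
      | succ m =>
        rw [A.comm ha hb, ← pow_add, show (m + 1) * n + n = m * n + 2 * n by ring, pow_add,
          pow_mul (-1 : k) 2]
        simp
    refine PathCarrier.ext h11 ?_
    rw [path_mul_snd, path_smul_snd, path_mul_snd, e1, e2, h12, mul_smul_comm, h21, smul_smul,
      mul_smul_comm, smul_add, smul_smul, add_comm, mul_comm ((-1 : k) ^ n), mul_assoc,
      ← pow_add, ← two_mul, pow_mul (-1 : k) 2]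
    simp

end DGA

/-! ## Extension of scalars -/

namespace DGA

/-- The extension of scalars `A ⊗_ℚ ℂ` of a dga over `ℚ`. -/
def baseChange (A : DGA.{u} ℚ) : DGA.{u} ℂ where
  carrier := ℂ ⊗[ℚ] A.carrier
  gr n := (A.gr n).baseChange ℂ
  d := A.d.baseChange ℂ
  d_mem {n x} hx := by
    revert x
    change (A.gr n).baseChange ℂ ≤ ((A.gr (n + 1)).baseChange ℂ).comap (A.d.baseChange ℂ)
    rw [Submodule.baseChange_eq_span, Submodule.span_le]
    rintro _ ⟨x, hx, rfl⟩
    exact Submodule.tmul_mem_baseChange_of_mem _ (A.d_mem hx)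
  d_d x := by
    induction x using TensorProduct.induction_on with
    | zero => simp
    | tmul c a => simp [A.d_d]
    | add x y hx hy => simp only [map_add, hx, hy, add_zero]
  leibniz {n x} hx y := by
    induction y using TensorProduct.induction_on with
    | zero => simp
    | add y z hy hz => simp only [mul_add, map_add, hy, hz, smul_add]; abel
    | tmul c b =>
      rw [Submodule.baseChange_eq_span] at hx
      induction hx using Submodule.span_induction with
      | zero => simp
      | add x z _ _ hx hz => simp only [add_mul, map_add, hx, hz, smul_add]; abel
      | smul e x _ hx =>
        rw [smul_mul_assoc, map_smul, hx, map_smul, smul_add, smul_mul_assoc, smul_mul_assoc,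
          smul_comm e]
      | mem x hx =>
        obtain ⟨a, ha, rfl⟩ := hx
        rw [TensorProduct.mk_apply, Algebra.TensorProduct.tmul_mul_tmul,
          LinearMap.baseChange_tmul, A.leibniz ha, TensorProduct.tmul_add,
          LinearMap.baseChange_tmul, LinearMap.baseChange_tmul,
          Algebra.TensorProduct.tmul_mul_tmul, Algebra.TensorProduct.tmul_mul_tmul]
        rcases Nat.even_or_odd n with h | h
        · simp [h.neg_one_pow]
        · simp [h.neg_one_pow, TensorProduct.tmul_neg]
  comm {m n x y} hx hy := by
    rw [Submodule.baseChange_eq_span] at hx hy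
    induction hx using Submodule.span_induction with
    | zero => simp
    | add x z _ _ hx hz => simp only [add_mul, mul_add, hx, hz, smul_add]
    | smul e x _ hx => rw [smul_mul_assoc, hx, mul_smul_comm, smul_comm e]
    | mem x hx =>
      obtain ⟨a, ha, rfl⟩ := hx
      induction hy using Submodule.span_induction with
      | zero => simp
      | add x z _ _ hx hz => simp only [add_mul, mul_add, hx, hz, smul_add]
      | smul e x _ hx => rw [mul_smul_comm, hx, smul_mul_assoc, smul_comm e]
      | mem y hy =>
        obtain ⟨b, hb, rfl⟩ := hy
        rw [TensorProduct.mk_apply, TensorProduct.mk_apply,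
          Algebra.TensorProduct.tmul_mul_tmul, Algebra.TensorProduct.tmul_mul_tmul, A.comm ha hb]
        rcases Nat.even_or_odd (m * n) with h | h
        · simp [h.neg_one_pow]
        · simp [h.neg_one_pow, TensorProduct.tmul_neg]

lemma baseChange_proj (A : DGA.{u} ℚ) (n : ℕ) (x : A.baseChange.carrier) :
    A.baseChange.proj n x = (A.proj n).baseChange ℂ x := by
  refine A.baseChange.decompose_eq (fun n => (A.proj n).baseChange ℂ) ?_ ?_ n x
  · intro n
    change (A.gr n).baseChange ℂ ≤ LinearMap.eqLocus ((A.proj n).baseChange ℂ) LinearMap.id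
    rw [Submodule.baseChange_eq_span, Submodule.span_le]
    rintro _ ⟨x, hx, rfl⟩
    change (A.proj n).baseChange ℂ (1 ⊗ₜ x) = 1 ⊗ₜ x
    rw [LinearMap.baseChange_tmul, A.proj_of_mem hx]
  · intro m n hmn
    change (A.gr m).baseChange ℂ ≤ LinearMap.ker ((A.proj n).baseChange ℂ)
    rw [Submodule.baseChange_eq_span, Submodule.span_le]
    rintro _ ⟨x, hx, rfl⟩
    change (A.proj n).baseChange ℂ (1 ⊗ₜ x) = 0
    rw [LinearMap.baseChange_tmul, A.proj_of_mem_ne hmn hx, TensorProduct.tmul_zero]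

lemma sgn_mem {k : Type} [Field k] (A : DGA.{u} k) {P : Submodule k A.carrier}
    (hP : ∀ x ∈ P, ∀ n, A.proj n x ∈ P) {x : A.carrier} (hx : x ∈ P) : A.sgn x ∈ P := by
  classical
  rw [← DirectSum.sum_support_decompose A.gr x, map_sum]
  refine P.sum_mem fun i _ => ?_
  rw [A.sgn_of_mem (DirectSum.decompose A.gr x i).2]
  exact P.smul_mem _ (hP x hx i)

lemma polySgn_mem_polySub {k : Type} [Field k] (A : DGA.{u} k) {P : Submodule k A.carrier}
    (hP : ∀ x ∈ P, ∀ n, A.proj n x ∈ P) {p : Polynomial A.carrier} (hp : p ∈ polySub P) :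
    A.polySgn p ∈ polySub P := fun i => by
  rw [coeff_polySgn]
  exact A.sgn_mem hP (hp i)

lemma derivative_mem_polySub {k : Type} [Field k] (A : DGA.{u} k) {P : Submodule k A.carrier}
    {p : Polynomial A.carrier} (hp : p ∈ polySub P) : Polynomial.derivative p ∈ polySub P :=
  fun i => by
  rw [Polynomial.coeff_derivative, ← Nat.cast_succ, ← nsmul_eq_mul']
  exact nsmul_mem (hp _) _

lemma polyMap_mem_polySub {k : Type} [Field k] (A : DGA.{u} k) {P : Submodule k A.carrier}
    {f : A.carrier →ₗ[k] A.carrier} (hf : ∀ x ∈ P, f x ∈ P) {p : Polynomial A.carrier}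
    (hp : p ∈ polySub P) : polyMap f p ∈ polySub P := fun i => by
  rw [coeff_polyMap]
  exact hf _ (hp i)

lemma one_mem_pathSub {k : Type} [Field k] (A : DGA.{u} k) {P Q : Submodule k A.carrier}
    (h : 1 ∈ P) : (1 : A.PathCarrier) ∈ A.pathSub P Q := by
  refine ⟨fun i => ?_, Submodule.zero_mem _⟩
  rw [path_one_fst, Polynomial.coeff_one]
  split_ifs
  · exact h
  · exact Submodule.zero_mem _

lemma pathProj_mem_pathSub {k : Type} [Field k] (A : DGA.{u} k) {P Q : Submodule k A.carrier}
    (hP : ∀ x ∈ P, ∀ n, A.proj n x ∈ P) (hQ : ∀ x ∈ Q, ∀ n, A.proj n x ∈ Q) (n : ℕ)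
    {x : A.PathCarrier} (hx : x ∈ A.pathSub P Q) : A.pathProj n x ∈ A.pathSub P Q := by
  refine ⟨A.polyMap_mem_polySub (fun x hx => hP x hx n) hx.1, ?_⟩
  cases n with
  | zero => exact A.polyMap_mem_polySub (f := 0) (fun x hx => Q.zero_mem) hx.2
  | succ n => exact A.polyMap_mem_polySub (fun x hx => hQ x hx n) hx.2

lemma path_proj {k : Type} [Field k] (A : DGA.{u} k) (n : ℕ) (x : A.path.carrier) :
    A.path.proj n x = A.pathProj n x :=
  A.path.decompose_eq A.pathProj (fun _ _ hx => pathProj_of_mem hx)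
    (fun _ _ h _ hx => pathProj_of_mem_ne h hx) n x

end DGA

/-- A linear map sending a rational subspace `P` to a subspace `Q` sends `P ⊗ ℂ` to any complex
subspace containing the `1 ⊗ y` with `y ∈ Q`. -/
lemma baseChange_le_comap {V : Type*} [AddCommGroup V] [Module ℚ V] {V' : Type*}
    [AddCommGroup V'] [Module ℂ V'] {P : Submodule ℚ V} {Q : Submodule ℂ V'}
    (f : ℂ ⊗[ℚ] V →ₗ[ℂ] V') (h : ∀ x ∈ P, f (1 ⊗ₜ x) ∈ Q) :
    ∀ x ∈ P.baseChange ℂ, f x ∈ Q := by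
  intro x hx
  have : P.baseChange ℂ ≤ Q.comap f := by
    rw [Submodule.baseChange_eq_span, Submodule.span_le]
    rintro _ ⟨x, hx, rfl⟩
    exact h x hx
  exact this hx

/-! ## Filtered and bifiltered dga's -/

/-- A filtered dga: an increasing multiplicative filtration `W` by graded subcomplexes, with
`1 ∈ W 0`, which is regular and exhaustive. -/
structure FDGA (k : Type) [Field k] extends DGA.{u} k where
  W : ℤ → Submodule k carrier
  W_mono : Monotone W
  proj_mem_W : ∀ {p : ℤ} {x : carrier}, x ∈ W p → ∀ n, toDGA.proj n x ∈ W p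
  one_mem_W : 1 ∈ W 0
  mul_mem_W : ∀ {p q : ℤ} {x y : carrier}, x ∈ W p → y ∈ W q → x * y ∈ W (p + q)
  d_mem_W : ∀ {p : ℤ} {x : carrier}, x ∈ W p → d x ∈ W p
  W_regular : ∀ n, ∃ q, W q ⊓ gr n = ⊥
  W_exhaustive : ∀ x, ∃ p, x ∈ W p

/-- A bifiltered dga: a filtered dga with a second, decreasing multiplicative filtration `F` by
graded subcomplexes, with `1 ∈ F 0`. -/
structure FFDGA (k : Type) [Field k] extends FDGA.{u} k where
  F : ℤ → Submodule k carrier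
  F_anti : Antitone F
  proj_mem_F : ∀ {p : ℤ} {x : carrier}, x ∈ F p → ∀ n, toDGA.proj n x ∈ F p
  one_mem_F : 1 ∈ F 0
  mul_mem_F : ∀ {p q : ℤ} {x y : carrier}, x ∈ F p → y ∈ F q → x * y ∈ F (p + q)
  d_mem_F : ∀ {p : ℤ} {x : carrier}, x ∈ F p → d x ∈ F p

namespace FDGA

variable {k : Type} [Field k]

/-- Morphisms of filtered dga's. -/
@[ext] structure Hom (A B : FDGA.{u} k) where
  toAlgHom : A.carrier →ₐ[k] B.carrier
  map_gr : ∀ n, ∀ x ∈ A.gr n, toAlgHom x ∈ B.gr n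
  map_d : ∀ x, toAlgHom (A.d x) = B.d (toAlgHom x)
  map_W : ∀ p, ∀ x ∈ A.W p, toAlgHom x ∈ B.W p

/-- The underlying linear map of a morphism. -/
abbrev Hom.lin {A B : FDGA.{u} k} (f : Hom A B) : A.carrier →ₗ[k] B.carrier :=
  f.toAlgHom.toLinearMap

/-- The identity. -/
def Hom.id (A : FDGA.{u} k) : Hom A A := ⟨AlgHom.id k _, fun _ _ h => h, fun _ => rfl,
  fun _ _ h => h⟩

/-- The composite of `f` followed by `g`. -/
def Hom.comp {A B C : FDGA.{u} k} (f : Hom A B) (g : Hom B C) : Hom A C :=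
  ⟨g.toAlgHom.comp f.toAlgHom, fun n x h => g.map_gr n _ (f.map_gr n x h),
    fun x => by simp [f.map_d, g.map_d], fun p x h => g.map_W p _ (f.map_W p x h)⟩

@[simp] lemma Hom.id_comp {A B : FDGA.{u} k} (f : Hom A B) : (Hom.id A).comp f = f := rfl
@[simp] lemma Hom.comp_id {A B : FDGA.{u} k} (f : Hom A B) : f.comp (Hom.id B) = f := rfl
lemma Hom.comp_assoc {A B C D : FDGA.{u} k} (f : Hom A B) (g : Hom B C) (h : Hom C D) :
    (f.comp g).comp h = f.comp (g.comp h) := rfl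

/-- The `1`-path `P_1(A)`: the dga `A ⊗ Λ(t, dt)` with
`W_p = W_p A ⊗ Λ(t) ⊕ W_{p+1} A ⊗ Λ(t) dt`. -/
def path (A : FDGA.{u} k) : FDGA.{u} k where
  toDGA := A.toDGA.path
  W p := A.toDGA.pathSub (A.W p) (A.W (p + 1))
  W_mono p q h _ hx := ⟨fun i => A.W_mono h (hx.1 i),
    fun i => A.W_mono (by omega) (hx.2 i)⟩
  proj_mem_W {p x} hx n := by
    rw [DGA.path_proj]
    exact A.toDGA.pathProj_mem_pathSub (fun _ h => A.proj_mem_W h) (fun _ h => A.proj_mem_W h) n hx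
  one_mem_W := A.toDGA.one_mem_pathSub A.one_mem_W
  mul_mem_W {p q x y} hx hy := by
    refine ⟨polySub_mul (fun a ha b hb => A.mul_mem_W ha hb) hx.1 hy.1, ?_⟩
    refine Submodule.add_mem _ (polySub_mul (fun a ha b hb => ?_) hx.1 hy.2)
      (polySub_mul (fun a ha b hb => ?_) hx.2
        (A.toDGA.polySgn_mem_polySub (fun _ h => A.proj_mem_W h) hy.1))
    · exact add_assoc p q 1 ▸ A.mul_mem_W ha hb
    · exact add_right_comm p 1 q ▸ A.mul_mem_W ha hb
  d_mem_W {p x} hx := by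
    refine ⟨A.toDGA.polyMap_mem_polySub (fun _ h => A.d_mem_W h) hx.1, Submodule.add_mem _
      (A.toDGA.derivative_mem_polySub (A.toDGA.polySgn_mem_polySub
        (fun _ h => A.proj_mem_W h) fun i => A.W_mono (by omega) (hx.1 i)))
      (A.toDGA.polyMap_mem_polySub (fun _ h => A.d_mem_W h) hx.2)⟩
  W_regular n := by
    have key : ∀ n, ∃ q, ∀ r ≤ q, ∀ x ∈ A.W r, x ∈ A.gr n → x = 0 := by
      intro n
      obtain ⟨q, hq⟩ := A.W_regular n
      refine ⟨q, fun r hr x hx hx' => ?_⟩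
      have : x ∈ A.W q ⊓ A.gr n := ⟨A.W_mono hr hx, hx'⟩
      rwa [hq, Submodule.mem_bot] at this
    have key' : ∃ q, ∀ r ≤ q, ∀ x ∈ A.W r, x ∈ A.toDGA.prevGr n → x = 0 := by
      cases n with
      | zero => exact ⟨0, fun r _ x _ hx => (Submodule.mem_bot k).1 hx⟩
      | succ n => exact key n
    obtain ⟨q, hq⟩ := key n
    obtain ⟨q', hq'⟩ := key'
    refine ⟨min q (q' - 1), (Submodule.eq_bot_iff _).2 fun x hx => ?_⟩
    refine DGA.PathCarrier.ext (Polynomial.ext fun i => ?_) (Polynomial.ext fun i => ?_)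
    · exact hq _ (min_le_left _ _) _ (hx.1.1 i) (hx.2.1 i)
    · exact hq' _ (by omega) _ (hx.1.2 i) (hx.2.2 i)
  W_exhaustive x := by
    have key : ∀ p : Polynomial A.carrier, ∃ q, p ∈ polySub (A.W q) := by
      intro p
      induction p using Polynomial.induction_on' with
      | add p q hp hq =>
        obtain ⟨r, hr⟩ := hp
        obtain ⟨s, hs⟩ := hq
        exact ⟨max r s, Submodule.add_mem _ (fun i => A.W_mono (le_max_left r s) (hr i))
          (fun i => A.W_mono (le_max_right r s) (hs i))⟩
      | monomial n a =>
        obtain ⟨q, hq⟩ := A.W_exhaustive a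
        refine ⟨q, fun i => ?_⟩
        rw [Polynomial.coeff_monomial]
        split_ifs
        · exact hq
        · exact Submodule.zero_mem _
    obtain ⟨q, hq⟩ := key x.1
    obtain ⟨r, hr⟩ := key x.2
    exact ⟨max q r, fun i => A.W_mono (le_max_left q r) (hq i),
      fun i => A.W_mono (by omega) (hr i)⟩

/-- Extension of scalars: `W_p (A ⊗ ℂ) = W_p A ⊗ ℂ`. -/
def baseChange (A : FDGA.{u} ℚ) : FDGA.{u} ℂ where
  toDGA := A.toDGA.baseChange
  W p := (A.W p).baseChange ℂ
  W_mono p q h := Submodule.baseChange_mono ℂ (A.W_mono h)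
  proj_mem_W {p x} hx n := by
    rw [DGA.baseChange_proj]
    exact baseChange_le_comap ((A.proj n).baseChange ℂ)
      (fun x hx => Submodule.tmul_mem_baseChange_of_mem _ (A.proj_mem_W hx n)) x hx
  one_mem_W := Submodule.tmul_mem_baseChange_of_mem _ A.one_mem_W
  mul_mem_W {p q x y} hx hy := by
    refine baseChange_le_comap (LinearMap.mulRight ℂ y) (fun a ha => ?_) x hx
    refine baseChange_le_comap (LinearMap.mulLeft ℂ ((1 : ℂ) ⊗ₜ[ℚ] a)) (fun b hb => ?_) y hy
    change ((1 : ℂ) ⊗ₜ[ℚ] a) * ((1 : ℂ) ⊗ₜ[ℚ] b) ∈ _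
    rw [Algebra.TensorProduct.tmul_mul_tmul]
    exact Submodule.tmul_mem_baseChange_of_mem _ (A.mul_mem_W ha hb)
  d_mem_W {p x} hx := baseChange_le_comap (A.d.baseChange ℂ)
      (fun x hx => Submodule.tmul_mem_baseChange_of_mem _ (A.d_mem_W hx)) x hx
  W_regular n := by
    obtain ⟨q, hq⟩ := A.W_regular n
    refine ⟨q, (Submodule.eq_bot_iff _).2 fun x hx => ?_⟩
    rw [← A.toDGA.baseChange.proj_of_mem hx.2, DGA.baseChange_proj]
    refine (Submodule.mem_bot ℂ).1 (baseChange_le_comap ((A.proj n).baseChange ℂ)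
      (fun x hx => ?_) x hx.1)
    have : A.proj n x ∈ A.W q ⊓ A.gr n := ⟨A.proj_mem_W hx n, A.proj_mem n x⟩
    rw [hq, Submodule.mem_bot] at this
    rw [LinearMap.baseChange_tmul, this, TensorProduct.tmul_zero]
    exact Submodule.zero_mem _
  W_exhaustive x := by
    induction x using TensorProduct.induction_on with
    | zero => exact ⟨0, Submodule.zero_mem _⟩
    | tmul c a =>
      obtain ⟨p, hp⟩ := A.W_exhaustive a
      exact ⟨p, Submodule.tmul_mem_baseChange_of_mem _ hp⟩
    | add x y hx hy =>
      obtain ⟨p, hp⟩ := hx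
      obtain ⟨q, hq⟩ := hy
      exact ⟨max p q, Submodule.add_mem _
        (Submodule.baseChange_mono ℂ (A.W_mono (le_max_left p q)) hp)
        (Submodule.baseChange_mono ℂ (A.W_mono (le_max_right p q)) hq)⟩

end FDGA

/-! ## Functoriality of paths and of the extension of scalars -/

namespace DGA

/-- The ring homomorphism `A ⊗ Λ(t, dt) → B ⊗ Λ(t, dt)` induced by a degree preserving ring
homomorphism `A → B` (possibly between dga's over different fields). -/
def pathRingHom {k k' : Type} [Field k] [Field k'] {A : DGA.{u} k} {B : DGA.{u} k'}
    (f : A.carrier →+* B.carrier) (hf : ∀ n, ∀ x ∈ A.gr n, f x ∈ B.gr n) :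
    A.PathCarrier →+* B.PathCarrier where
  toFun x := ⟨x.1.map f, x.2.map f⟩
  map_one' := by ext1 <;> simp
  map_zero' := by ext1 <;> simp
  map_add' x y := by ext1 <;> simp [Polynomial.map_add]
  map_mul' x y := by
    have h : ∀ p : Polynomial A.carrier, (A.polySgn p).map f = B.polySgn (p.map f) := fun p => by
      ext i; simp [DGA.map_sgn f hf]
    ext1 <;> simp [Polynomial.map_add, Polynomial.map_mul, h]

section

variable {k k' : Type} [Field k] [Field k'] {A : DGA.{u} k} {B : DGA.{u} k'}
  (f : A.carrier →+* B.carrier) (hf : ∀ n, ∀ x ∈ A.gr n, f x ∈ B.gr n)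

lemma map_mem_polySub {P : Submodule k A.carrier} {P' : Submodule k' B.carrier}
    (hP : ∀ x ∈ P, f x ∈ P') {p : Polynomial A.carrier} (hp : p ∈ polySub P) :
    p.map f ∈ polySub P' := fun i => by
  rw [Polynomial.coeff_map]
  exact hP _ (hp i)

lemma pathRingHom_mem {P Q : Submodule k A.carrier} {P' Q' : Submodule k' B.carrier}
    (hP : ∀ x ∈ P, f x ∈ P') (hQ : ∀ x ∈ Q, f x ∈ Q') {x : A.PathCarrier}
    (hx : x ∈ A.pathSub P Q) : pathRingHom f hf x ∈ B.pathSub P' Q' :=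
  ⟨map_mem_polySub f hP hx.1, map_mem_polySub f hQ hx.2⟩

lemma pathRingHom_mem_gr {n : ℕ} {x : A.PathCarrier} (hx : x ∈ A.pathGr n) :
    pathRingHom f hf x ∈ B.pathGr n := by
  refine pathRingHom_mem f hf (hf n) (fun y hy => ?_) hx
  cases n with
  | zero =>
    rw [(Submodule.mem_bot k).1 hy, map_zero]
    exact Submodule.zero_mem _
  | succ n => exact hf n y hy

lemma pathRingHom_d (hd : ∀ x, f (A.d x) = B.d (f x)) (x : A.PathCarrier) :
    pathRingHom f hf (A.pathD x) = B.pathD (pathRingHom f hf x) := by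
  refine PathCarrier.ext (Polynomial.ext fun i => ?_) (Polynomial.ext fun i => ?_)
  · change ((polyMap A.d x.fst).map f).coeff i = (polyMap B.d (x.fst.map f)).coeff i
    simp [hd]
  · change ((Polynomial.derivative (A.polySgn x.fst) + polyMap A.d x.snd).map f).coeff i =
      (Polynomial.derivative (B.polySgn (x.fst.map f)) + polyMap B.d (x.snd.map f)).coeff i
    simp [Polynomial.coeff_derivative, hd, DGA.map_sgn f hf]

end

/-- The evaluation `δ : A ⊗ Λ(t, dt) → A` at `t = c`, `dt = 0`. -/
def pathEval {k : Type} [Field k] (A : DGA.{u} k) (c : k) : A.PathCarrier →ₐ[k] A.carrier :=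
  AlgHom.ofLinearMap
    { toFun := fun x => evalScalar A.carrier c x.1
      map_add' := fun x y => by simp
      map_smul' := fun e x => by simp [evalScalar_smul] }
    (by simp) (fun x y => by simp)

/-- The inclusion `ι : A → A ⊗ Λ(t, dt)` of the constant paths. -/
def pathConst {k : Type} [Field k] (A : DGA.{u} k) : A.carrier →ₐ[k] A.PathCarrier :=
  AlgHom.ofLinearMap
    { toFun := fun a => ⟨Polynomial.C a, 0⟩
      map_add' := fun x y => by ext1 <;> simp
      map_smul' := fun e x => by ext1 <;> simp [Polynomial.smul_C] }
    (by ext1 <;> simp) (fun x y => by ext1 <;> simp)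

/-- The inclusion `x ↦ x ⊗ 1` of `A` in its extension of scalars. -/
def incl (A : DGA.{u} ℚ) : A.carrier →+* A.baseChange.carrier :=
  (Algebra.TensorProduct.includeRight (R := ℚ) (A := ℂ) (B := A.carrier)).toRingHom

lemma incl_mem {A : DGA.{u} ℚ} {P : Submodule ℚ A.carrier} {x : A.carrier} (hx : x ∈ P) :
    A.incl x ∈ (P.baseChange ℂ : Submodule ℂ A.baseChange.carrier) :=
  Submodule.tmul_mem_baseChange_of_mem _ hx

lemma incl_mem_gr (A : DGA.{u} ℚ) (n : ℕ) (x : A.carrier) (hx : x ∈ A.gr n) :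
    A.incl x ∈ A.baseChange.gr n := incl_mem hx

lemma d_incl (A : DGA.{u} ℚ) (x : A.carrier) : A.baseChange.d (A.incl x) = A.incl (A.d x) :=
  LinearMap.baseChange_tmul _ _ _

lemma incl_algebraMap (A : DGA.{u} ℚ) (c : ℚ) :
    A.incl (algebraMap ℚ A.carrier c) = algebraMap ℂ A.baseChange.carrier (c : ℂ) := by
  change (1 : ℂ) ⊗ₜ[ℚ] (algebraMap ℚ A.carrier c) = (c : ℂ) ⊗ₜ[ℚ] (1 : A.carrier)
  rw [Algebra.algebraMap_eq_smul_one, ← TensorProduct.smul_tmul, Algebra.smul_def, mul_one]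
  rfl

/-- Two complex linear maps on an extension of scalars that agree on rational elements agree. -/
lemma baseChange_ext {A : DGA.{u} ℚ} {V : Type*} [AddCommGroup V] [Module ℂ V]
    {f g : A.baseChange.carrier →ₗ[ℂ] V} (h : ∀ x, f (A.incl x) = g (A.incl x))
    (z : A.baseChange.carrier) : f z = g z := by
  induction z using TensorProduct.induction_on with
  | zero => exact (map_zero f).trans (map_zero g).symm
  | add x y hx hy => exact (map_add f x y).trans ((congrArg₂ _ hx hy).trans (map_add g x y).symm)
  | tmul c x =>
    have : (c ⊗ₜ[ℚ] x : ℂ ⊗[ℚ] A.carrier) = c • ((1 : ℂ) ⊗ₜ[ℚ] x) := by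
      simp [TensorProduct.smul_tmul']
    rw [this]
    exact (map_smul f c (A.incl x)).trans ((congrArg _ (h x)).trans (map_smul g c _).symm)

/-- A complex linear map sends `P ⊗ ℂ` to `Q` as soon as it sends `P` to `Q`. -/
lemma map_baseChange_mem {A : DGA.{u} ℚ} {V : Type*} [AddCommGroup V] [Module ℂ V]
    {P : Submodule ℚ A.carrier} {Q : Submodule ℂ V} (f : A.baseChange.carrier →ₗ[ℂ] V)
    (h : ∀ x ∈ P, f (A.incl x) ∈ Q) (z : A.baseChange.carrier) (hz : z ∈ P.baseChange ℂ) :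
    f z ∈ Q :=
  baseChange_le_comap f h z hz

/-- The canonical map `(A ⊗ Λ(t, dt)) ⊗_ℚ ℂ → (A ⊗_ℚ ℂ) ⊗ Λ(t, dt)`. -/
def pathBaseChangeHom (A : DGA.{u} ℚ) :
    A.path.baseChange.carrier →ₐ[ℂ] A.baseChange.path.carrier :=
  letI : Algebra ℚ A.baseChange.path.carrier :=
    Algebra.compHom A.baseChange.path.carrier (algebraMap ℚ ℂ)
  haveI : IsScalarTower ℚ ℂ A.baseChange.path.carrier := IsScalarTower.of_algebraMap_eq' rfl
  Algebra.TensorProduct.lift (Algebra.ofId ℂ A.baseChange.path.carrier)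
    (RingHom.toRatAlgHom (pathRingHom A.incl A.incl_mem_gr))
    (fun c _ => Algebra.commutes c _)

lemma pathBaseChangeHom_incl (A : DGA.{u} ℚ) (x : A.path.carrier) :
    A.pathBaseChangeHom (A.path.incl x) = pathRingHom A.incl A.incl_mem_gr x := by
  let : Algebra ℚ A.baseChange.path.carrier :=
    Algebra.compHom A.baseChange.path.carrier (algebraMap ℚ ℂ)
  have : IsScalarTower ℚ ℂ A.baseChange.path.carrier := IsScalarTower.of_algebraMap_eq' rfl
  refine (Algebra.TensorProduct.lift_tmul _ _ _ _ _).trans ?_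
  rw [map_one, one_mul]
  rfl

end DGA

namespace FDGA

variable {k : Type} [Field k]

/-- The morphism `P_1(A) → P_1(B)` induced by a morphism `A → B`. -/
def Hom.path {A B : FDGA.{u} k} (f : Hom A B) : Hom A.path B.path where
  toAlgHom :=
    { DGA.pathRingHom (A := A.toDGA) (B := B.toDGA) f.toAlgHom.toRingHom f.map_gr with
      commutes' := fun c => by
        have e : ∀ (D : FDGA.{u} k), algebraMap k D.path.carrier c =
          (⟨c • 1, 0⟩ : D.toDGA.PathCarrier) := fun D => by
          rw [Algebra.algebraMap_eq_smul_one]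
          refine DGA.PathCarrier.ext rfl ?_
          exact smul_zero c
        rw [e, e]
        refine DGA.PathCarrier.ext ?_ ?_
        · refine Polynomial.ext fun i => ?_
          change ((c • (1 : Polynomial A.carrier)).map _).coeff i =
            (c • (1 : Polynomial B.carrier)).coeff i
          rw [Polynomial.coeff_map, Polynomial.coeff_smul, Polynomial.coeff_smul,
            Polynomial.coeff_one, Polynomial.coeff_one]
          change f.toAlgHom _ = _
          split_ifs <;> simp
        · exact Polynomial.map_zero f.toAlgHom.toRingHom }
  map_gr n x hx := DGA.pathRingHom_mem_gr f.toAlgHom.toRingHom f.map_gr hx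
  map_d x := DGA.pathRingHom_d f.toAlgHom.toRingHom f.map_gr f.map_d x
  map_W p x hx :=
    DGA.pathRingHom_mem f.toAlgHom.toRingHom f.map_gr (f.map_W p) (f.map_W (p + 1)) hx

/-- The evaluation `δ : P_1(A) → A` at `t = c`. -/
def evalAt (A : FDGA.{u} k) (c : k) : Hom A.path A where
  toAlgHom := A.toDGA.pathEval c
  map_gr _ _ hx := evalScalar_mem c hx.1
  map_d x := evalScalar_polyMap c A.d x.fst
  map_W _ _ hx := evalScalar_mem c hx.1

/-- `δ^0 : P_1(A) → A`, the evaluation at `t = 0`. -/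
def δ0 (A : FDGA.{u} k) : Hom A.path A := A.evalAt 0

/-- `δ^1 : P_1(A) → A`, the evaluation at `t = 1`. -/
def δ1 (A : FDGA.{u} k) : Hom A.path A := A.evalAt 1

lemma C_mem_pathSub {A : DGA.{u} k} {P Q : Submodule k A.carrier} {a : A.carrier} (ha : a ∈ P) :
    (⟨Polynomial.C a, 0⟩ : A.PathCarrier) ∈ A.pathSub P Q := by
  refine ⟨fun i => ?_, Submodule.zero_mem _⟩
  rw [Polynomial.coeff_C]
  split_ifs
  · exact ha
  · exact P.zero_mem

/-- `ι : A → P_1(A)`, the inclusion of constant paths. -/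
def ι (A : FDGA.{u} k) : Hom A A.path where
  toAlgHom := A.toDGA.pathConst
  map_gr _ _ hx := C_mem_pathSub hx
  map_d x := by
    refine DGA.PathCarrier.ext (Polynomial.ext fun i => ?_) (Polynomial.ext fun i => ?_)
    · change (Polynomial.C (A.d x)).coeff i = (polyMap A.d (Polynomial.C x)).coeff i
      rw [coeff_polyMap, Polynomial.coeff_C, Polynomial.coeff_C]
      split_ifs <;> simp
    · change (0 : Polynomial A.carrier).coeff i =
        (Polynomial.derivative (A.toDGA.polySgn (Polynomial.C x)) + polyMap A.d 0).coeff i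
      simp [DGA.polySgn]
  map_W _ _ hx := C_mem_pathSub hx

lemma path_comp_evalAt {A B : FDGA.{u} k} (f : Hom A B) (c : k) :
    f.path.comp (B.evalAt c) = (A.evalAt c).comp f := by
  refine Hom.ext (AlgHom.ext fun x => ?_)
  exact evalScalar_map c c f.toAlgHom.toRingHom (f.toAlgHom.commutes c) x.fst

lemma ι_comp_evalAt (A : FDGA.{u} k) (c : k) : A.ι.comp (A.evalAt c) = Hom.id A :=
  Hom.ext (AlgHom.ext fun x => evalScalar_C c x)

/-- The algebra map induced by a morphism on extensions of scalars. -/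
def Hom.baseChangeHom {A B : FDGA.{u} ℚ} (f : Hom A B) :
    A.baseChange.carrier →ₐ[ℂ] B.baseChange.carrier :=
  Algebra.TensorProduct.map (AlgHom.id ℂ ℂ) f.toAlgHom

lemma Hom.baseChangeHom_incl {A B : FDGA.{u} ℚ} (f : Hom A B) (x : A.carrier) :
    f.baseChangeHom (A.incl x) = B.incl (f.toAlgHom x) :=
  Algebra.TensorProduct.map_tmul _ _ _ _

/-- The morphism induced by a morphism on extensions of scalars. -/
def Hom.baseChange {A B : FDGA.{u} ℚ} (f : Hom A B) : Hom A.baseChange B.baseChange where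
  toAlgHom := f.baseChangeHom
  map_gr n x hx := by
    refine DGA.map_baseChange_mem f.baseChangeHom.toLinearMap (fun y hy => ?_) x hx
    exact (f.baseChangeHom_incl y).symm ▸ DGA.incl_mem (f.map_gr n y hy)
  map_d x := by
    refine DGA.baseChange_ext (f := f.baseChangeHom.toLinearMap ∘ₗ A.baseChange.d)
      (g := B.baseChange.d ∘ₗ f.baseChangeHom.toLinearMap) (fun y => ?_) x
    change f.baseChangeHom (A.baseChange.d (A.incl y)) =
      B.baseChange.d (f.baseChangeHom (A.incl y))
    refine (congrArg f.baseChangeHom (A.toDGA.d_incl y)).trans ?_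
    rw [f.baseChangeHom_incl, f.baseChangeHom_incl, f.map_d]
    exact (B.toDGA.d_incl _).symm
  map_W p x hx := by
    refine DGA.map_baseChange_mem f.baseChangeHom.toLinearMap (fun y hy => ?_) x hx
    exact (f.baseChangeHom_incl y).symm ▸ DGA.incl_mem (f.map_W p y hy)

lemma Hom.ext_baseChange {A : FDGA.{u} ℚ} {B : FDGA.{u} ℂ} {f g : Hom A.baseChange B}
    (h : ∀ x : A.carrier, f.toAlgHom (A.incl x) = g.toAlgHom (A.incl x)) : f = g :=
  Hom.ext (AlgHom.ext fun z =>
    DGA.baseChange_ext (f := f.toAlgHom.toLinearMap) (g := g.toAlgHom.toLinearMap) h z)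

lemma Hom.baseChange_incl {A B : FDGA.{u} ℚ} (f : Hom A B) (x : A.carrier) :
    f.baseChange.toAlgHom (A.incl x) = B.incl (f.toAlgHom x) :=
  f.baseChangeHom_incl x

lemma Hom.baseChange_id (A : FDGA.{u} ℚ) : (Hom.id A).baseChange = Hom.id A.baseChange :=
  Hom.ext_baseChange fun x => Hom.baseChange_incl _ x

lemma Hom.baseChange_comp {A B C : FDGA.{u} ℚ} (f : Hom A B) (g : Hom B C) :
    (f.comp g).baseChange = f.baseChange.comp g.baseChange :=
  Hom.ext_baseChange fun x => by
    refine ((f.comp g).baseChange_incl x).trans ?_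
    change _ = g.baseChange.toAlgHom (f.baseChange.toAlgHom (A.incl x))
    rw [Hom.baseChange_incl, Hom.baseChange_incl]
    rfl

/-- The canonical morphism `P_1(A) ⊗ ℂ → P_1(A ⊗ ℂ)`. -/
def pathBaseChange (A : FDGA.{u} ℚ) : Hom A.path.baseChange A.baseChange.path where
  toAlgHom := A.toDGA.pathBaseChangeHom
  map_gr n x hx := by
    refine DGA.map_baseChange_mem A.toDGA.pathBaseChangeHom.toLinearMap (fun y hy => ?_) x hx
    have h := DGA.pathRingHom_mem_gr A.incl A.toDGA.incl_mem_gr hy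
    exact (A.toDGA.pathBaseChangeHom_incl y).symm ▸ h
  map_d x := by
    refine DGA.baseChange_ext
      (f := A.toDGA.pathBaseChangeHom.toLinearMap ∘ₗ A.path.baseChange.d)
      (g := A.baseChange.path.d ∘ₗ A.toDGA.pathBaseChangeHom.toLinearMap) (fun y => ?_) x
    have h := DGA.pathRingHom_d A.incl A.toDGA.incl_mem_gr (fun z => (A.toDGA.d_incl z).symm) y
    refine (congrArg A.toDGA.pathBaseChangeHom (A.path.toDGA.d_incl y)).trans ?_
    refine (A.toDGA.pathBaseChangeHom_incl _).trans (h.trans ?_)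
    exact (congrArg A.baseChange.toDGA.pathD (A.toDGA.pathBaseChangeHom_incl y)).symm
  map_W p x hx := by
    refine DGA.map_baseChange_mem A.toDGA.pathBaseChangeHom.toLinearMap (fun y hy => ?_) x hx
    have h := DGA.pathRingHom_mem A.incl A.toDGA.incl_mem_gr
      (P' := A.baseChange.W p) (Q' := A.baseChange.W (p + 1))
      (fun z hz => DGA.incl_mem hz) (fun z hz => DGA.incl_mem hz) hy
    exact (A.toDGA.pathBaseChangeHom_incl y).symm ▸ h

lemma pathBaseChange_comp_evalAt (A : FDGA.{u} ℚ) (c : ℚ) :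
    A.pathBaseChange.comp (A.baseChange.evalAt (c : ℂ)) = (A.evalAt c).baseChange := by
  refine Hom.ext_baseChange fun x => ?_
  refine Eq.trans ?_ ((A.evalAt c).baseChange_incl x).symm
  refine (congrArg (A.baseChange.toDGA.pathEval (c : ℂ))
    (A.toDGA.pathBaseChangeHom_incl x)).trans ?_
  exact evalScalar_map c (c : ℂ) A.incl (A.toDGA.incl_algebraMap c) x.fst

end FDGA

namespace FFDGA

variable {k : Type} [Field k]

/-- Morphisms of bifiltered dga's. -/
@[ext] structure Hom (A B : FFDGA.{u} k) extends FDGA.Hom A.toFDGA B.toFDGA where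
  map_F : ∀ p, ∀ x ∈ A.F p, toAlgHom x ∈ B.F p

/-- The identity. -/
def Hom.id (A : FFDGA.{u} k) : Hom A A := ⟨FDGA.Hom.id _, fun _ _ h => h⟩

/-- The composite of `f` followed by `g`. -/
def Hom.comp {A B C : FFDGA.{u} k} (f : Hom A B) (g : Hom B C) : Hom A C :=
  ⟨f.toHom.comp g.toHom, fun p x h => g.map_F p _ (f.map_F p x h)⟩

/-- The `(1,0)`-path `P_{1,0}(A)`: the filtered dga `P_1(A)` with
`F^q = F^q A ⊗ Λ(t) ⊕ F^q A ⊗ Λ(t) dt`. -/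
def path (A : FFDGA.{u} k) : FFDGA.{u} k where
  toFDGA := A.toFDGA.path
  F p := A.toDGA.pathSub (A.F p) (A.F p)
  F_anti p q h _ hx := ⟨fun i => A.F_anti h (hx.1 i), fun i => A.F_anti h (hx.2 i)⟩
  proj_mem_F {p x} hx n := by
    have := A.toDGA.pathProj_mem_pathSub (fun _ h => A.proj_mem_F h) (fun _ h => A.proj_mem_F h)
      n hx
    exact (A.toDGA.path_proj n x).symm ▸ this
  one_mem_F := A.toDGA.one_mem_pathSub A.one_mem_F
  mul_mem_F {p q x y} hx hy := by
    refine ⟨polySub_mul (fun a ha b hb => A.mul_mem_F ha hb) hx.1 hy.1, ?_⟩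
    exact Submodule.add_mem _ (polySub_mul (fun a ha b hb => A.mul_mem_F ha hb) hx.1 hy.2)
      (polySub_mul (fun a ha b hb => A.mul_mem_F ha hb) hx.2
        (A.toDGA.polySgn_mem_polySub (fun _ h => A.proj_mem_F h) hy.1))
  d_mem_F {p x} hx := by
    exact ⟨A.toDGA.polyMap_mem_polySub (fun _ h => A.d_mem_F h) hx.1, Submodule.add_mem _
      (A.toDGA.derivative_mem_polySub (A.toDGA.polySgn_mem_polySub
        (fun _ h => A.proj_mem_F h) hx.1))
      (A.toDGA.polyMap_mem_polySub (fun _ h => A.d_mem_F h) hx.2)⟩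

/-- The morphism of paths induced by a morphism. -/
def Hom.path {A B : FFDGA.{u} k} (f : Hom A B) : Hom A.path B.path where
  toHom := f.toHom.path
  map_F p _ hx :=
    DGA.pathRingHom_mem f.toAlgHom.toRingHom f.map_gr (f.map_F p) (f.map_F p) hx

/-- The evaluation `P_{1,0}(A) → A` at `t = c`. -/
def evalAt (A : FFDGA.{u} k) (c : k) : Hom A.path A where
  toHom := A.toFDGA.evalAt c
  map_F _ _ hx := evalScalar_mem c hx.1

end FFDGA

/-! ## The first terms of the weight spectral sequence -/

namespace FDGA

variable {k : Type} [Field k]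

/-- The elements of `W_p A^n` whose differential is in `W_{p-1}`. -/
def Z1 (A : FDGA.{u} k) (n : ℕ) (p : ℤ) : Submodule k A.carrier :=
  A.W p ⊓ A.gr n ⊓ (A.W (p - 1)).comap A.d

/-- `W_{p-1} A + d (W_p A)`. -/
def B1 (A : FDGA.{u} k) (p : ℤ) : Submodule k A.carrier :=
  A.W (p - 1) ⊔ (A.W p).map A.d

/-- `H^n(Gr_p^W A)`, the term `E_1^{-p,n+p}` of the spectral sequence of `W`. -/
abbrev E1 (A : FDGA.{u} k) (n : ℕ) (p : ℤ) : Type u := SubQuot (A.Z1 n p) (A.B1 p)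

/-- The class in `E_1` of an element of `Z_1`. -/
abbrev toE1 (A : FDGA.{u} k) (n : ℕ) (p : ℤ) : A.Z1 n p →ₗ[k] A.E1 n p := Submodule.mkQ _

/-- The differential `d_1 : H^n(Gr_p^W A) → H^{n+1}(Gr_{p-1}^W A)`. -/
def d1 (A : FDGA.{u} k) {n n' : ℕ} {p p' : ℤ} (hn : n + 1 = n') (hp : p' + 1 = p) :
    A.E1 n p →ₗ[k] A.E1 n' p' :=
  SubQuot.map A.d
    (by
      obtain rfl : p' = p - 1 := by omega
      subst hn
      exact fun x hx => ⟨⟨hx.2, A.d_mem hx.1.2⟩, by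
        change A.d (A.d x) ∈ A.W (p - 1 - 1)
        rw [A.d_d]
        exact Submodule.zero_mem _⟩)
    (by
      obtain rfl : p' = p - 1 := by omega
      intro x hx
      obtain ⟨y, hy, z, ⟨w, -, rfl⟩, rfl⟩ := Submodule.mem_sup.1 hx
      rw [map_add, A.d_d, add_zero]
      exact Submodule.mem_sup_right ⟨y, hy, rfl⟩)

/-- The cycles of `d_1` in `E_1`. -/
abbrev Z2 (A : FDGA.{u} k) (n : ℕ) (p : ℤ) : Submodule k (A.E1 n p) :=
  LinearMap.ker (A.d1 rfl (sub_add_cancel p 1))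

/-- The boundaries of `d_1` in `E_1`. -/
abbrev B2 (A : FDGA.{u} k) (n : ℕ) (p : ℤ) : Submodule k (A.E1 n p) :=
  ⨆ (m : ℕ) (h : m + 1 = n), LinearMap.range (A.d1 h (rfl : p + 1 = p + 1))

/-- The cohomology of `E_1` with respect to `d_1`. -/
abbrev E2 (A : FDGA.{u} k) (n : ℕ) (p : ℤ) : Type u := SubQuot (A.Z2 n p) (A.B2 n p)

/-- The element `e` of `E_2` is the class of the element `c` of `E_1`. -/
def IsClass (A : FDGA.{u} k) {n : ℕ} {p : ℤ} (c : A.E1 n p) (e : A.E2 n p) : Prop :=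
  ∃ h : c ∈ A.Z2 n p, Submodule.Quotient.mk ⟨c, h⟩ = e

lemma Hom.map_Z1 {A B : FDGA.{u} k} (f : Hom A B) {n : ℕ} {p : ℤ} :
    ∀ x ∈ A.Z1 n p, f.lin x ∈ B.Z1 n p := fun x hx =>
  ⟨⟨f.map_W _ _ hx.1.1, f.map_gr _ _ hx.1.2⟩, by
    change B.d (f.toAlgHom x) ∈ B.W (p - 1)
    rw [← f.map_d]
    exact f.map_W _ _ hx.2⟩

lemma Hom.map_B1 {A B : FDGA.{u} k} (f : Hom A B) {p : ℤ} :
    ∀ x ∈ A.B1 p, f.lin x ∈ B.B1 p := fun x hx => by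
  obtain ⟨y, hy, z, ⟨w, hw, rfl⟩, rfl⟩ := Submodule.mem_sup.1 hx
  rw [map_add]
  exact Submodule.add_mem _ (Submodule.mem_sup_left (f.map_W _ _ hy))
    (Submodule.mem_sup_right ⟨f.toAlgHom w, f.map_W _ _ hw, (f.map_d w).symm⟩)

/-- The map induced on `E_1` by a morphism. -/
def Hom.E1 {A B : FDGA.{u} k} (f : Hom A B) (n : ℕ) (p : ℤ) : A.E1 n p →ₗ[k] B.E1 n p :=
  SubQuot.map f.lin f.map_Z1 f.map_B1

lemma Hom.E1_d1 {A B : FDGA.{u} k} (f : Hom A B) {n n' : ℕ} {p p' : ℤ} (hn : n + 1 = n')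
    (hp : p' + 1 = p) (c : A.E1 n p) : f.E1 n' p' (A.d1 hn hp c) = B.d1 hn hp (f.E1 n p c) := by
  obtain ⟨x, rfl⟩ := Submodule.Quotient.mk_surjective _ c
  exact congrArg (B.toE1 n' p') (Subtype.ext (f.map_d x.1))

lemma Hom.map_Z2 {A B : FDGA.{u} k} (f : Hom A B) {n : ℕ} {p : ℤ} :
    ∀ c ∈ A.Z2 n p, f.E1 n p c ∈ B.Z2 n p := fun c hc => by
  have h : A.d1 rfl (sub_add_cancel p 1) c = 0 := hc
  change B.d1 rfl (sub_add_cancel p 1) (f.E1 n p c) = 0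
  rw [← f.E1_d1, h, map_zero]

lemma Hom.map_B2 {A B : FDGA.{u} k} (f : Hom A B) {n : ℕ} {p : ℤ} :
    ∀ c ∈ A.B2 n p, f.E1 n p c ∈ B.B2 n p := by
  change A.B2 n p ≤ (B.B2 n p).comap (f.E1 n p)
  refine iSup₂_le fun m h => ?_
  rintro _ ⟨c, rfl⟩
  change f.E1 n p (A.d1 h rfl c) ∈ B.B2 n p
  rw [f.E1_d1]
  exact Submodule.mem_iSup_of_mem m (Submodule.mem_iSup_of_mem h ⟨_, rfl⟩)

/-- The map induced on `E_2` by a morphism. -/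
def Hom.E2 {A B : FDGA.{u} k} (f : Hom A B) (n : ℕ) (p : ℤ) : A.E2 n p →ₗ[k] B.E2 n p :=
  SubQuot.map (f.E1 n p) f.map_Z2 f.map_B2

/-- An `E_1`-quasi-isomorphism: the map `E_1(f)` is a quasi-isomorphism. -/
def Hom.IsE1QuasiIso {A B : FDGA.{u} k} (f : Hom A B) : Prop :=
  ∀ n p, Function.Bijective (f.E2 n p)

/-- The map induced on cohomology by a morphism. -/
def Hom.H {A B : FDGA.{u} k} (f : Hom A B) (n : ℕ) : A.H n →ₗ[k] B.H n :=
  SubQuot.map f.lin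
    (fun x hx => ⟨f.map_gr n x hx.1, by
      have h : A.d x = 0 := hx.2
      change B.d (f.toAlgHom x) = 0
      rw [← f.map_d, h, map_zero]⟩)
    (by
      rintro _ ⟨x, rfl⟩
      exact ⟨f.toAlgHom x, (f.map_d x).symm⟩)

/-- A quasi-isomorphism: a morphism inducing isomorphisms on cohomology. -/
def Hom.IsQuasiIso {A B : FDGA.{u} k} (f : Hom A B) : Prop :=
  ∀ n, Function.Bijective (f.H n)

/-- The inclusion of `Z_1` of `A` in `Z_1` of `A ⊗ ℂ`. -/
def inclZ1 (A : FDGA.{u} ℚ) {n : ℕ} {p : ℤ} (x : A.Z1 n p) : A.baseChange.Z1 n p :=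
  ⟨A.incl x.1, ⟨DGA.incl_mem x.2.1.1, DGA.incl_mem x.2.1.2⟩, by
    change A.baseChange.d (A.incl x.1) ∈ A.baseChange.W (p - 1)
    have h : A.incl (A.d x.1) ∈ A.baseChange.W (p - 1) := DGA.incl_mem x.2.2
    exact (A.toDGA.d_incl x.1).symm ▸ h⟩

end FDGA

/-! ## Diagrams of filtered dga's -/

/-- The sources of the arrows of the zig-zag `0 → 1 ← 2 → ⋯ ← 2(ℓ+1)`: the vertex `0`, the
even vertices `2, …, 2ℓ`, and the vertex `2(ℓ+1)`. -/
inductive Src (ℓ : ℕ) : Type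
  | rat : Src ℓ
  | mid (j : Fin ℓ) : Src ℓ
  | hodge : Src ℓ

/-- The zig-zag has two arrows with target the `j`-th odd vertex `2j+1`. For `b = false` this is
the source `2j` of the one on the left, for `b = true` the source `2j+2` of the one on the
right. -/
def src {ℓ : ℕ} (j : Fin (ℓ + 1)) : Bool → Src ℓ
  | false => Fin.cases Src.rat Src.mid j
  | true => Fin.lastCases Src.hodge Src.mid j

/-- A family of objects indexed by the vertices of the zig-zag: a filtered dga over `ℚ` at the
vertex `0`, a bifiltered dga over `ℂ` at the last vertex, and filtered dga's over `ℂ` at the other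
vertices. -/
structure FFam (ℓ : ℕ) where
  AQ : FDGA.{u} ℚ
  mid : Fin ℓ → FDGA.{u} ℂ
  odd : Fin (ℓ + 1) → FDGA.{u} ℂ
  AC : FFDGA.{u} ℂ

namespace FFam

variable {ℓ : ℕ}

/-- The filtered dga over `ℂ` at an even vertex: extend the scalars at the vertex `0`, and forget
`F` at the last one. -/
def ev (A : FFam.{u} ℓ) : Src ℓ → FDGA.{u} ℂ
  | .rat => A.AQ.baseChange
  | .mid j => A.mid j
  | .hodge => A.AC.toFDGA

/-- A family of morphisms, one for each vertex. -/
@[ext] structure Hom (A B : FFam.{u} ℓ) where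
  fQ : FDGA.Hom A.AQ B.AQ
  fmid : ∀ j, FDGA.Hom (A.mid j) (B.mid j)
  fodd : ∀ j, FDGA.Hom (A.odd j) (B.odd j)
  fC : FFDGA.Hom A.AC B.AC

/-- The morphism over `ℂ` at an even vertex. -/
def Hom.ev {A B : FFam.{u} ℓ} (f : Hom A B) : ∀ s, FDGA.Hom (A.ev s) (B.ev s)
  | .rat => f.fQ.baseChange
  | .mid j => f.fmid j
  | .hodge => f.fC.toHom

/-- The identity. -/
def Hom.id (A : FFam.{u} ℓ) : Hom A A :=
  ⟨FDGA.Hom.id _, fun _ => FDGA.Hom.id _, fun _ => FDGA.Hom.id _, FFDGA.Hom.id _⟩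

/-- The composite of `f` followed by `g`. -/
def Hom.comp {A B C : FFam.{u} ℓ} (f : Hom A B) (g : Hom B C) : Hom A C :=
  ⟨f.fQ.comp g.fQ, fun j => (f.fmid j).comp (g.fmid j), fun j => (f.fodd j).comp (g.fodd j),
    f.fC.comp g.fC⟩

lemma Hom.id_ev (A : FFam.{u} ℓ) (s : Src ℓ) : (Hom.id A).ev s = FDGA.Hom.id (A.ev s) := by
  cases s
  · exact FDGA.Hom.baseChange_id _
  · rfl
  · rfl

lemma Hom.comp_ev {A B C : FFam.{u} ℓ} (f : Hom A B) (g : Hom B C) (s : Src ℓ) :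
    (f.comp g).ev s = (f.ev s).comp (g.ev s) := by
  cases s
  · exact FDGA.Hom.baseChange_comp _ _
  · rfl
  · rfl

/-- The vertex-wise path objects. -/
def path (A : FFam.{u} ℓ) : FFam.{u} ℓ :=
  ⟨A.AQ.path, fun j => (A.mid j).path, fun j => (A.odd j).path, A.AC.path⟩

/-- The comparison of the path object at a vertex with the path object of the filtered dga over
`ℂ` at this vertex. -/
def evPath (A : FFam.{u} ℓ) : ∀ s, FDGA.Hom (A.path.ev s) (A.ev s).path
  | .rat => A.AQ.pathBaseChange
  | .mid j => FDGA.Hom.id (A.mid j).path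
  | .hodge => FDGA.Hom.id A.AC.toFDGA.path

/-- The vertex-wise evaluation of paths at `t = c`. -/
def evalAt (A : FFam.{u} ℓ) (c : ℚ) : Hom A.path A :=
  ⟨A.AQ.evalAt c, fun j => (A.mid j).evalAt (c : ℂ), fun j => (A.odd j).evalAt (c : ℂ),
    A.AC.evalAt (c : ℂ)⟩

lemma evalAt_ev (A : FFam.{u} ℓ) (c : ℚ) (s : Src ℓ) :
    (A.evalAt c).ev s = (A.evPath s).comp ((A.ev s).evalAt (c : ℂ)) := by
  cases s
  · exact (A.AQ.pathBaseChange_comp_evalAt c).symm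
  · rfl
  · rfl

end FFam

/-- The category `ΓA` of diagrams of filtered dga's `(A_ℚ, W) ⇠⇢ (A_ℂ, W, F)`, whose type is the
zig-zag with `2(ℓ+1)` arrows. -/
structure FDiag (ℓ : ℕ) extends FFam.{u} ℓ where
  φ : ∀ (j : Fin (ℓ + 1)) (b : Bool), FDGA.Hom (toFFam.ev (src j b)) (odd j)

namespace FDiag

variable {ℓ : ℕ}

/-- Morphisms of diagrams. -/
@[ext] structure Hom (A B : FDiag.{u} ℓ) extends FFam.Hom A.toFFam B.toFFam where
  comm : ∀ j b, (A.φ j b).comp (fodd j) = (toHom.ev (src j b)).comp (B.φ j b)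

instance : Category (FDiag.{u} ℓ) where
  Hom := Hom
  id A := ⟨FFam.Hom.id _, fun j b => by rw [FFam.Hom.id_ev]; rfl⟩
  comp f g := ⟨f.toHom.comp g.toHom, fun j b => by
    rw [FFam.Hom.comp_ev, FDGA.Hom.comp_assoc, ← g.comm, ← FDGA.Hom.comp_assoc, ← f.comm]
    rfl⟩
  id_comp _ := rfl
  comp_id _ := rfl
  assoc _ _ _ := rfl

/-- The path object `P(A)` of a diagram. -/
def path (A : FDiag.{u} ℓ) : FDiag.{u} ℓ where
  toFFam := A.toFFam.path
  φ j b := (A.toFFam.evPath (src j b)).comp (A.φ j b).path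

/-- The evaluation of paths at `t = c`. -/
def evalAt (A : FDiag.{u} ℓ) (c : ℚ) : A.path ⟶ A :=
  Hom.mk (A.toFFam.evalAt c) fun j b => by
    refine Eq.trans ?_ (congrArg (fun z => FDGA.Hom.comp z (A.φ j b))
      (A.toFFam.evalAt_ev c (src j b))).symm
    rw [FDGA.Hom.comp_assoc, ← FDGA.path_comp_evalAt]
    rfl

/-- `δ^0 : P(A) → A`, the evaluation at `t = 0`. -/
def δ0 (A : FDiag.{u} ℓ) : A.path ⟶ A := A.evalAt 0

/-- `δ^1 : P(A) → A`, the evaluation at `t = 1`. -/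
def δ1 (A : FDiag.{u} ℓ) : A.path ⟶ A := A.evalAt 1

end FDiag

/-! ## Ho-morphisms and ho-equivalences -/

/-- A ho-morphism `A ⇝ B`: morphisms `f_i : A_i → B_i` for all vertices `i`, and homotopies
`F_u : A_i → P(B_j)` from `f_j φ_u` to `φ_u f_i` for all arrows `u : i → j`. -/
@[ext] structure HoMor {ℓ : ℕ} (A B : FDiag.{u} ℓ) extends FFam.Hom A.toFFam B.toFFam where
  htpy : ∀ j b, FDGA.Hom (A.ev (src j b)) (B.odd j).path
  h0 : ∀ j b, (htpy j b).comp (B.odd j).δ0 = (A.φ j b).comp (fodd j)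
  h1 : ∀ j b, (htpy j b).comp (B.odd j).δ1 = (toHom.ev (src j b)).comp (B.φ j b)

namespace HoMor

variable {ℓ : ℕ}

/-- A morphism of diagrams as a ho-morphism with constant homotopies. -/
def ofHom {A B : FDiag.{u} ℓ} (f : A ⟶ B) : HoMor A B where
  toHom := FDiag.Hom.toHom f
  htpy j b := ((A.φ j b).comp (FDiag.Hom.toHom f |>.fodd j)).comp (B.odd j).ι
  h0 j b := by
    rw [FDGA.Hom.comp_assoc, FDGA.δ0, FDGA.ι_comp_evalAt]
    rfl
  h1 j b := by
    rw [FDGA.Hom.comp_assoc, FDGA.δ1, FDGA.ι_comp_evalAt]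
    exact FDiag.Hom.comm f j b

/-- The composite `(f_i g_i, F_u g_i)` of a morphism `g` followed by a ho-morphism `f`. -/
def precomp {A B C : FDiag.{u} ℓ} (g : A ⟶ B) (f : HoMor B C) : HoMor A C where
  toHom := (FDiag.Hom.toHom g).comp f.toHom
  htpy j b := ((FDiag.Hom.toHom g).ev (src j b)).comp (f.htpy j b)
  h0 j b := by
    rw [FDGA.Hom.comp_assoc, f.h0, ← FDGA.Hom.comp_assoc, ← FDiag.Hom.comm g j b]
    rfl
  h1 j b := by
    rw [FDGA.Hom.comp_assoc, f.h1, ← FDGA.Hom.comp_assoc, FFam.Hom.comp_ev]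

/-- The composite `(h_i f_i, P(h_j) F_u)` of a ho-morphism `f` followed by a morphism `h`. -/
def postcomp {A B C : FDiag.{u} ℓ} (f : HoMor A B) (h : B ⟶ C) : HoMor A C where
  toHom := f.toHom.comp (FDiag.Hom.toHom h)
  htpy j b := (f.htpy j b).comp (FDGA.Hom.path ((FDiag.Hom.toHom h).fodd j))
  h0 j b := by
    rw [FDGA.Hom.comp_assoc, FDGA.δ0, FDGA.path_comp_evalAt, ← FDGA.Hom.comp_assoc]
    exact congrArg (fun z => FDGA.Hom.comp z ((FDiag.Hom.toHom h).fodd j)) (f.h0 j b)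
  h1 j b := by
    rw [FDGA.Hom.comp_assoc, FDGA.δ1, FDGA.path_comp_evalAt, ← FDGA.Hom.comp_assoc]
    refine (congrArg (fun z => FDGA.Hom.comp z ((FDiag.Hom.toHom h).fodd j)) (f.h1 j b)).trans ?_
    rw [FDGA.Hom.comp_assoc, FDiag.Hom.comm h j b, FFam.Hom.comp_ev, FDGA.Hom.comp_assoc]

/-- There is a homotopy from `f` to `g`, i.e., a ho-morphism `h : A ⇝ P(B)` with `δ^0 h = f` and
`δ^1 h = g`. -/
def Homotopic {A B : FDiag.{u} ℓ} (f g : HoMor A B) : Prop :=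
  ∃ h : HoMor A B.path, h.postcomp B.δ0 = f ∧ h.postcomp B.δ1 = g

end HoMor

/-- The ho-equivalences: the morphisms `f` that have an inverse ho-morphism `g` up to chains of
homotopies. -/
def hoEquiv (ℓ : ℕ) : MorphismProperty (FDiag.{u} ℓ) := fun A B f =>
  ∃ g : HoMor B A,
    Relation.ReflTransGen HoMor.Homotopic (g.precomp f) (HoMor.ofHom (𝟙 A)) ∧
    Relation.ReflTransGen HoMor.Homotopic (g.postcomp f) (HoMor.ofHom (𝟙 B))

/-- The level-wise quasi-isomorphisms of diagrams. -/
def levelwiseQuasiIso (ℓ : ℕ) : MorphismProperty (FDiag.{u} ℓ) := fun _ _ f =>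
  (FDiag.Hom.toHom f).fQ.IsQuasiIso ∧ (∀ j, ((FDiag.Hom.toHom f).fmid j).IsQuasiIso) ∧
    (∀ j, ((FDiag.Hom.toHom f).fodd j).IsQuasiIso) ∧ (FDiag.Hom.toHom f).fC.toHom.IsQuasiIso

/-! ## Hodge structures -/

section Hodge

variable {V : Type*} [AddCommGroup V] [Module ℚ V]

/-- The complex conjugate of a subspace of `ℂ ⊗ V`, for a rational vector space `V`. -/
def conjSub (P : Submodule ℂ (ℂ ⊗[ℚ] V)) : Submodule ℂ (ℂ ⊗[ℚ] V) where
  carrier := {z | LinearMap.rTensor V (Complex.conjAe.toLinearMap.restrictScalars ℚ) z ∈ P}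
  add_mem' {a b} ha hb := by
    change LinearMap.rTensor V _ (a + b) ∈ P
    rw [map_add]
    exact P.add_mem ha hb
  zero_mem' := by
    change LinearMap.rTensor V _ 0 ∈ P
    rw [map_zero]
    exact P.zero_mem
  smul_mem' c z hz := by
    have h : LinearMap.rTensor V (Complex.conjAe.toLinearMap.restrictScalars ℚ) (c • z) =
        (starRingEnd ℂ c) •
          LinearMap.rTensor V (Complex.conjAe.toLinearMap.restrictScalars ℚ) z := by
      clear hz
      induction z using TensorProduct.induction_on with
      | zero => simp
      | add x y hx hy =>
        rw [smul_add, map_add, map_add, smul_add, hx, hy]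
      | tmul e v => simp [TensorProduct.smul_tmul']
    change LinearMap.rTensor V _ (c • z) ∈ P
    rw [h]
    exact P.smul_mem _ hz

/-- `F` is the Hodge filtration of a pure Hodge structure of weight `w` on the rational vector
space `V`: a finite decreasing filtration of `ℂ ⊗ V` such that `F^p` and the conjugate of
`F^{w+1-p}` are complementary, for all `p`. -/
structure IsPureHS (V : Type*) [AddCommGroup V] [Module ℚ V] (w : ℤ)
    (F : ℤ → Submodule ℂ (ℂ ⊗[ℚ] V)) : Prop where
  anti : Antitone F
  exists_top : ∃ p, F p = ⊤
  exists_bot : ∃ p, F p = ⊥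
  compl : ∀ p, IsCompl (F p) (conjSub (F (w + 1 - p)))

/-- The filtration of `ℂ ⊗ (P / (Q ∩ P))` induced by a filtration `F` of `ℂ ⊗ V`. -/
def inducedF (P Q : Submodule ℚ V) (F : ℤ → Submodule ℂ (ℂ ⊗[ℚ] V)) (q : ℤ) :
    Submodule ℂ (ℂ ⊗[ℚ] SubQuot P Q) :=
  ((F q).comap (P.subtype.baseChange ℂ)).map ((Q.submoduleOf P).mkQ.baseChange ℂ)

/-- A mixed Hodge structure on the rational vector space `V`: a finite increasing filtration `W`
of `V` and a finite decreasing filtration `F` of `ℂ ⊗ V`, such that `F` induces a pure Hodge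
structure of weight `n` on `Gr_n^W V`, for all `n`. -/
structure IsMHS (V : Type*) [AddCommGroup V] [Module ℚ V] (W : ℤ → Submodule ℚ V)
    (F : ℤ → Submodule ℂ (ℂ ⊗[ℚ] V)) : Prop where
  W_mono : Monotone W
  W_exists_top : ∃ p, W p = ⊤
  W_exists_bot : ∃ p, W p = ⊥
  F_anti : Antitone F
  F_exists_top : ∃ p, F p = ⊤
  F_exists_bot : ∃ p, F p = ⊥
  pure : ∀ n, IsPureHS (SubQuot (W n) (W (n - 1))) n (inducedF (W n) (W (n - 1)) F)

end Hodge

/-! ## Mixed Hodge diagrams -/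

/-- The filtration `F` induced on `H^n(Gr_p^W A)` for a bifiltered dga `A`. -/
def FFDGA.E1F (A : FFDGA.{u} ℂ) (n : ℕ) (p q : ℤ) : Submodule ℂ (A.E1 n p) :=
  SubQuot.induced (A.Z1 n p) (A.B1 p) (A.F q)

/-- A rational structure on `E_1(A_ℂ, W)` that is compatible with the string `φ`: isomorphisms
`H^n(Gr_p^W A_ℚ) ⊗ ℂ ≅ H^n(Gr_p^W A_ℂ)` that commute with `d_1` and induce on `E_2` the
isomorphism given by the string of `E_1`-quasi-isomorphisms `φ`. In the latter condition, `e` is a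
family of classes at the even vertices such that neighbours have the same image at the odd vertex
between them. -/
structure IsRationalStructure {ℓ : ℕ} (A : FDiag.{u} ℓ)
    (ρ : ∀ n p, ℂ ⊗[ℚ] A.AQ.E1 n p ≃ₗ[ℂ] A.AC.E1 n p) : Prop where
  map_d1 : ∀ (n n' : ℕ) (p p' : ℤ) (hn : n + 1 = n') (hp : p' + 1 = p)
    (z : ℂ ⊗[ℚ] A.AQ.E1 n p),
    ρ n' p' ((A.AQ.d1 hn hp).baseChange ℂ z) = A.AC.d1 hn hp (ρ n p z)
  compat : ∀ (n : ℕ) (p : ℤ) (x : A.AQ.Z1 n p), A.AQ.toE1 n p x ∈ A.AQ.Z2 n p →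
    ∃ e : ∀ s, (A.ev s).E2 n p,
      A.AQ.baseChange.IsClass (A.AQ.baseChange.toE1 n p (A.AQ.inclZ1 x)) (e .rat) ∧
      A.AC.IsClass (ρ n p (1 ⊗ₜ A.AQ.toE1 n p x)) (e .hodge) ∧
      ∀ j, (A.φ j false).E2 n p (e (src j false)) = (A.φ j true).E2 n p (e (src j true))

/-- Mixed Hodge diagrams of dga's over `ℚ` (always assumed to be `0`-connected). -/
structure IsMHD {ℓ : ℕ} (A : FDiag.{u} ℓ) : Prop where
  e1 : ∀ j b, (A.φ j b).IsE1QuasiIso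
  biregular : ∀ n, (∃ q, A.AC.F q ⊓ A.AC.gr n = ⊥) ∧ ∃ q, A.AC.gr n ≤ A.AC.F q
  finite : ∀ n, Module.Finite ℚ (A.AQ.H n)
  connected : Function.Bijective A.AQ.unitH0
  strict : ∀ (p q : ℤ) (x : A.AC.carrier), x ∈ A.AC.W p →
    A.AC.d x ∈ (A.AC.F q ⊓ A.AC.W p) ⊔ A.AC.W (p - 1) →
    ∃ y ∈ A.AC.F q ⊓ A.AC.W p, A.AC.d x - A.AC.d y ∈ A.AC.W (p - 1)
  pure : ∃ ρ : ∀ n p, ℂ ⊗[ℚ] A.AQ.E1 n p ≃ₗ[ℂ] A.AC.E1 n p, IsRationalStructure A ρ ∧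
    ∀ (n : ℕ) (p : ℤ), IsPureHS (A.AQ.E1 n p) (p + n) fun q =>
      (A.AC.E1F n p q).comap (ρ n p).toLinearMap

/-- The category of mixed Hodge diagrams, as a full subcategory of the category of diagrams. -/
abbrev MHD (ℓ : ℕ) := ObjectProperty.FullSubcategory fun A : FDiag.{u} ℓ => IsMHD A

/-- The inclusion of the mixed Hodge diagrams in all diagrams. -/
abbrev MHD.incl (ℓ : ℕ) : MHD.{u} ℓ ⥤ FDiag.{u} ℓ := ObjectProperty.ι _

/-- The class `H` of strong equivalences: the closure by composition of the class of
ho-equivalences. -/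
def MHD.H (ℓ : ℕ) : MorphismProperty (MHD.{u} ℓ) :=
  (hoEquiv ℓ).multiplicativeClosure.inverseImage (MHD.incl ℓ)

/-- The class `Q` of level-wise quasi-isomorphisms. -/
def MHD.Q (ℓ : ℕ) : MorphismProperty (MHD.{u} ℓ) :=
  (levelwiseQuasiIso ℓ).inverseImage (MHD.incl ℓ)

/-! ## Mixed Hodge dga's -/

/-- The canonical map `V ⊗ ℂ → A ⊗ ℂ` for a subspace `V` of `A`. -/
def DGA.inclSub (A : DGA.{u} ℚ) (V : Submodule ℚ A.carrier) :
    ℂ ⊗[ℚ] V →ₗ[ℂ] A.baseChange.carrier :=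
  V.subtype.baseChange ℂ

/-- The décalage of the weight filtration: `Dec W_p A^n` consists of the `x` in `W_{p-n} A^n` with
`d x` in `W_{p-n-1} A^{n+1}`. -/
def FDGA.decW (A : FDGA.{u} ℚ) (n : ℕ) (p : ℤ) : Submodule ℚ A.carrier :=
  A.W (p - n) ⊓ A.gr n ⊓ (A.W (p - n - 1)).comap A.d

/-- A mixed Hodge dga: a filtered dga `(A, W)` over `ℚ` with a filtration `F` of `A ⊗ ℂ` such that
all `(A^n, Dec W, F)` are mixed Hodge structures, and differentials and products are morphisms of
mixed Hodge structures. (Differentials and products always respect `Dec W`.) -/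
structure MixedHodgeDGA extends FDGA.{u} ℚ where
  F : ℤ → Submodule ℂ toFDGA.baseChange.carrier
  F_anti : Antitone F
  proj_mem_F : ∀ {p : ℤ} {x : toFDGA.baseChange.carrier}, x ∈ F p →
    ∀ n, toFDGA.baseChange.toDGA.proj n x ∈ F p
  one_mem_F : 1 ∈ F 0
  mul_mem_F : ∀ {p q : ℤ} {x y : toFDGA.baseChange.carrier}, x ∈ F p → y ∈ F q →
    x * y ∈ F (p + q)
  d_mem_F : ∀ {p : ℤ} {x : toFDGA.baseChange.carrier}, x ∈ F p →
    toFDGA.baseChange.d x ∈ F p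
  mhs : ∀ n, IsMHS (gr n) (fun p => (toFDGA.decW n p).submoduleOf (gr n))
    (fun q => (F q).comap (toDGA.inclSub (gr n)))

/-- The products of elements of the sets `S p`, with the sum of the indices. -/
inductive ProdMem {R : Type*} [Ring R] (S : ℤ → Set R) : ℤ → R → Prop
  | one : ProdMem S 0 1
  | mul {p q : ℤ} {x y : R} (hx : x ∈ S p) (hy : ProdMem S q y) : ProdMem S (p + q) (x * y)

namespace MixedHodgeDGA

/-- The bifiltered dga `(M ⊗ ℂ, W, F)`. -/
def toFFDGA (M : MixedHodgeDGA.{u}) : FFDGA.{u} ℂ where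
  toFDGA := M.toFDGA.baseChange
  F := M.F
  F_anti := M.F_anti
  proj_mem_F := M.proj_mem_F
  one_mem_F := M.one_mem_F
  mul_mem_F := M.mul_mem_F
  d_mem_F := M.d_mem_F

/-- A mixed Hodge dga as a diagram, all the maps of which are identities. -/
def toDiag (ℓ : ℕ) (M : MixedHodgeDGA.{u}) : FDiag.{u} ℓ where
  AQ := M.toFDGA
  mid _ := M.toFDGA.baseChange
  odd _ := M.toFDGA.baseChange
  AC := M.toFFDGA
  φ j b :=
    match src j b with
    | .rat => FDGA.Hom.id M.toFDGA.baseChange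
    | .mid _ => FDGA.Hom.id M.toFDGA.baseChange
    | .hodge => FDGA.Hom.id M.toFDGA.baseChange

/-- The subalgebra generated by the first `i` of a sequence of subspaces. -/
def stage (M : MixedHodgeDGA.{u}) (V : ℕ → Submodule ℚ M.carrier) (i : ℕ) :
    Subalgebra ℚ M.carrier :=
  Algebra.adjoin ℚ (⋃ j < i, (V j : Set M.carrier))

/-- The augmentation ideal of the subalgebra generated by the first `i` of a sequence of
subspaces: its elements of positive degree. -/
def stagePos (M : MixedHodgeDGA.{u}) (V : ℕ → Submodule ℚ M.carrier) (i : ℕ) :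
    Submodule ℚ M.carrier :=
  Subalgebra.toSubmodule (M.stage V i) ⊓ ⨆ m : ℕ, M.gr (m + 1)

/-- A mixed Hodge dga `M` is minimal if it is the union of a sequence of minimal mixed Hodge
extensions `M_{i+1} = M_i ⊗_ξ Λ(V_i)` starting from `M_0 = ℚ`: here `V_i` is a mixed Hodge
structure that generates the extension freely in the degree `deg i ≥ 1`, the map `ξ`, i.e., the
restriction of `d` to `V_i`, is a morphism of mixed Hodge structures with values in
`M_i^+ · M_i^+`, and the filtrations of `M` are the multiplicative extensions of those of the
`V_i`. -/
structure IsMinimalWith (M : MixedHodgeDGA.{u}) (deg : ℕ → ℕ)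
    (V : ℕ → Submodule ℚ M.carrier) : Prop where
  deg_pos : ∀ i, 1 ≤ deg i
  V_le : ∀ i, V i ≤ M.gr (deg i)
  mhs : ∀ i, IsMHS (V i) (fun p => (M.W (p - deg i)).submoduleOf (V i))
    (fun q => (M.F q).comap (M.inclSub (V i)))
  d_W : ∀ (i : ℕ) (p : ℤ) (x : M.carrier), x ∈ V i → x ∈ M.W p → M.d x ∈ M.W (p - 1)
  d_mem : ∀ (i : ℕ) (x : M.carrier), x ∈ V i → M.d x ∈ M.stagePos V i * M.stagePos V i
  free : ∀ (C : DGA.{u} ℚ) (g : ∀ i, V i →ₗ[ℚ] C.carrier),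
    (∀ i v, g i v ∈ C.gr (deg i)) →
    ∃! f : M.carrier →ₐ[ℚ] C.carrier,
      (∀ n, ∀ x ∈ M.gr n, f x ∈ C.gr n) ∧ ∀ i (v : V i), f v = g i v
  W_eq : ∀ p, M.W p = Submodule.span ℚ
    {x | ∃ p' ≤ p, ProdMem (fun r => ⋃ i, ((V i ⊓ M.W r : Submodule ℚ M.carrier) :
      Set M.carrier)) p' x}
  F_eq : ∀ q, M.F q = Submodule.span ℂ
    {x | ∃ q' ≥ q, ProdMem (fun r => ⋃ i, ((LinearMap.range (M.inclSub (V i)) ⊓ M.F r :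
      Submodule ℂ M.toFDGA.baseChange.carrier) : Set M.toFDGA.baseChange.carrier)) q' x}

/-- Minimal mixed Hodge dga's. -/
def IsMinimal (M : MixedHodgeDGA.{u}) : Prop :=
  ∃ (deg : ℕ → ℕ) (V : ℕ → Submodule ℚ M.carrier), M.IsMinimalWith deg V

end MixedHodgeDGA

/-! ## Cartan-Eilenberg cofibrant and minimal objects -/

/-- An object `M` of a category with classes `S` and `W` of strong and weak equivalences is
Cartan-Eilenberg cofibrant if for every weak equivalence `w : A ⟶ B` the map
`w_* : C[S⁻¹](M, A) → C[S⁻¹](M, B)` is bijective. -/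
def CECofibrant {C : Type*} [Category C] (S W : MorphismProperty C) (M : C) : Prop :=
  ∀ (A B : C) (w : A ⟶ B), W w →
    Function.Bijective fun g : S.Q.obj M ⟶ S.Q.obj A => g ≫ S.Q.map w

/-- An object is minimal if all its endomorphisms that are weak equivalences are isomorphisms. -/
def CEMinimal {C : Type*} [Category C] (W : MorphismProperty C) (M : C) : Prop :=
  ∀ w : M ⟶ M, W w → IsIso w

end MixedHodge

end

noncomputable section

open Submodule (mem_sup_left mem_sup_right mem_sup add_mem_sup mem_bot mem_iSup_of_mem comap_mono
  linearMap_qext span_le)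
open Submodule.Quotient (mk_surjective mk_eq_zero)
open LinearMap (range ker baseChange_comp baseChange_tmul)
open Polynomial (monomial coeff_monomial derivative coeff_add coeff_map map_monomial)
open Function (Injective Surjective Bijective update_self update_of_ne)
open MixedHodge.FDiag.Hom (toHom)

namespace MixedHodge

instance {k : Type} [Field k] {A B : FDGA.{u} k} :
    CoeFun (FDGA.Hom A B) fun _ => A.carrier → B.carrier := ⟨fun f => f.toAlgHom⟩

instance {k : Type} [Field k] {A B : FFDGA.{u} k} :
    CoeFun (FFDGA.Hom A B) fun _ => A.carrier → B.carrier := ⟨fun f => f.toAlgHom⟩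

/-! ## Strictness of maps of opposite filtrations -/

section Opposite

variable {K : Type*} [Field K] {V V' : Type*} [AddCommGroup V] [Module K V]
  [AddCommGroup V'] [Module K V']

/-- Three filtrations `W`, `F`, `G` of a vector space, all containing the subspace `N` and finite
modulo `N`, such that `F` and `G` are `m`-opposite on the graded pieces of `W` of weight `m`. -/
structure OppositeFiltrations (W F G : ℤ → Submodule K V) (N : Submodule K V) : Prop where
  W_mono : Monotone W
  F_anti : Antitone F
  G_anti : Antitone G
  N_le_W : ∀ m, N ≤ W m
  N_le_F : ∀ m, N ≤ F m
  N_le_G : ∀ m, N ≤ G m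
  W_bot : ∃ m, W m ≤ N
  W_top : ∀ x, ∃ m, x ∈ W m
  F_bot : ∃ a, F a ≤ N
  F_top : ∃ a, F a = ⊤
  span : ∀ (m a : ℤ), ∀ x ∈ W m, ∃ y ∈ F a ⊓ W m, ∃ z ∈ G (m + 1 - a) ⊓ W m, x - y - z ∈ W (m - 1)
  indep : ∀ (m a b : ℤ), a + b = m + 1 → ∀ x ∈ F a ⊓ W m, ∀ y ∈ G b ⊓ W m,
    x - y ∈ W (m - 1) → x ∈ W (m - 1)

/-- The correction terms in the definition of Deligne's splitting. -/
def oppositeTail (W G : ℤ → Submodule K V) (q M : ℤ) (k : ℕ) : Submodule K V :=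
  ⨆ j : ℕ, G (q - (j + k : ℕ)) ⊓ W (M - 1 - (j + k : ℕ))

lemma oppositeTail_eq (W G : ℤ → Submodule K V) (q M : ℤ) (k : ℕ) :
    oppositeTail W G q M k = (G (q - k) ⊓ W (M - 1 - k)) ⊔ oppositeTail W G q M (k + 1) := by
  have := sup_iSup_nat_succ (fun j : ℕ => G (q - (j + k : ℕ)) ⊓ W (M - 1 - (j + k : ℕ)))
  rw [oppositeTail, ← this, oppositeTail]
  simp only [Nat.zero_add, Nat.add_assoc, Nat.add_comm 1 k]

/-- Deligne's subspace `I^{p,q}` attached to three filtrations. -/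
def deligneI (W F G : ℤ → Submodule K V) (p q : ℤ) : Submodule K V :=
  F p ⊓ W (p + q) ⊓ ((G q ⊓ W (p + q)) ⊔ oppositeTail W G q (p + q) 1)

namespace OppositeFiltrations

variable {W F G : ℤ → Submodule K V} {N : Submodule K V} (h : OppositeFiltrations W F G N)

include h

lemma tail_le (q M : ℤ) (k : ℕ) : oppositeTail W G q M k ≤ W (M - 1 - k) :=
  iSup_le fun j => inf_le_right.trans (h.W_mono (by push_cast; omega))

lemma mem_N_of_forall {x : V} {M : ℤ} (hx : ∀ k : ℕ, x ∈ W (M - k)) : x ∈ N := by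
  obtain ⟨m, hm⟩ := h.W_bot
  exact hm (h.W_mono (by omega : M - (M - m).toNat ≤ m) (hx _))

lemma deligneI_inf {p q : ℤ} {x : V} (hx : x ∈ deligneI W F G p q) (hx' : x ∈ W (p + q - 1)) :
    x ∈ N := by
  have key : ∀ k : ℕ, x ∈ W (p + q - 1 - k) ∧
      ∃ g ∈ G (q - k), x - g ∈ oppositeTail W G q (p + q) (k + 1) := by
    intro k
    induction k with
    | zero =>
      obtain ⟨g, hg, r, hr, e⟩ := mem_sup.1 hx.2
      refine ⟨by simpa using hx', g, by simpa using hg.1, ?_⟩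
      rw [← e]
      simpa using hr
    | succ k ih =>
      obtain ⟨h1, g, hg, hr⟩ := ih
      have hrW := h.tail_le _ _ _ hr
      have hgW : g ∈ W (p + q - 1 - k) := by
        have : g = x - (x - g) := by abel
        rw [this]
        exact sub_mem h1 (h.W_mono (by push_cast; omega) hrW)
      have h2 : x ∈ W (p + q - 1 - k - 1) := by
        refine h.indep _ p (q - k) (by ring) x ⟨hx.1.1, h1⟩ g ⟨hg, hgW⟩
          (h.W_mono (by push_cast; omega) hrW)
      refine ⟨h.W_mono (by push_cast; omega) h2, ?_⟩
      rw [oppositeTail_eq] at hr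
      obtain ⟨g', hg', r', hr', e⟩ := mem_sup.1 hr
      refine ⟨g + g', add_mem (h.G_anti (by push_cast; omega) hg) hg'.1, ?_⟩
      have : x - (g + g') = r' := by rw [← sub_sub, ← e]; abel
      rwa [this]
  exact h.mem_N_of_forall fun k => (key k).1

lemma exists_deligneI {p q : ℤ} {v u : V} (hv : v ∈ F p ⊓ W (p + q)) (hu : u ∈ G q ⊓ W (p + q))
    (huv : v - u ∈ W (p + q - 1)) : ∃ x ∈ deligneI W F G p q, v - x ∈ W (p + q - 1) := by
  have key : ∀ k : ℕ, ∃ v' ∈ F p ⊓ W (p + q), v - v' ∈ W (p + q - 1) ∧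
      ∃ u' ∈ (G q ⊓ W (p + q)) ⊔ oppositeTail W G q (p + q) 1, v' - u' ∈ W (p + q - 1 - k) := by
    intro k
    induction k with
    | zero => exact ⟨v, hv, by simp, u, mem_sup_left hu, by simpa using huv⟩
    | succ k ih =>
      obtain ⟨v', hv', hvv, u', hu', hd⟩ := ih
      obtain ⟨y, hy, z, hz, hyz⟩ := h.span _ p _ hd
      refine ⟨v' - y, sub_mem hv' ⟨hy.1, h.W_mono (by omega) hy.2⟩, ?_, u' + z, add_mem hu' ?_, ?_⟩
      · have : v - (v' - y) = (v - v') + y := by abel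
        rw [this]
        exact add_mem hvv (h.W_mono (by omega) hy.2)
      · cases k with
        | zero =>
          refine mem_sup_left ⟨?_, h.W_mono (by simp) hz.2⟩
          convert hz.1 using 2; push_cast; ring_nf
        | succ k =>
          refine mem_sup_right (mem_iSup_of_mem k ⟨?_, ?_⟩)
          · convert hz.1 using 2; push_cast; ring_nf
          · convert hz.2 using 2
      · have : v' - y - (u' + z) = v' - u' - y - z := by abel
        rw [this]
        convert hyz using 2; push_cast; ring_nf
  obtain ⟨m, hm⟩ := h.W_bot
  obtain ⟨v', hv', hvv, u', hu', hd⟩ := key (p + q - 1 - m).toNat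
  have hN : v' - u' ∈ N := hm (h.W_mono (by omega) hd)
  refine ⟨v', ⟨hv', ?_⟩, hvv⟩
  have : v' = u' + (v' - u') := by abel
  rw [this]
  exact add_mem hu' (mem_sup_left ⟨h.N_le_G _ hN, h.N_le_W _ hN⟩)

lemma exists_type {a M : ℤ} {x : V} (hx : x ∈ F a ⊓ W M) :
    ∃ v ∈ deligneI W F G a (M - a), ∃ y ∈ F (a + 1) ⊓ W M, x - v - y ∈ W (M - 1) := by
  obtain ⟨y, hy, z, hz, hyz⟩ := h.span M (a + 1) x hx.2
  have e : M + 1 - (a + 1) = M - a := by ring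
  have e' : a + (M - a) = M := by ring
  rw [e] at hz
  obtain ⟨v, hv, hv'⟩ := h.exists_deligneI (p := a) (q := M - a) (v := x - y) (u := z)
    (by rw [e']; exact sub_mem hx ⟨h.F_anti (by omega) hy.1, hy.2⟩)
    (by rwa [e']) (by rwa [e'])
  rw [e'] at hv'
  refine ⟨v, hv, y, hy, ?_⟩
  have : x - v - y = x - y - v := by abel
  rwa [this]

end OppositeFiltrations

lemma map_deligneI {W F G : ℤ → Submodule K V} {W' F' G' : ℤ → Submodule K V'} (f : V →ₗ[K] V')
    (hW : ∀ m, ∀ x ∈ W m, f x ∈ W' m) (hF : ∀ m, ∀ x ∈ F m, f x ∈ F' m)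
    (hG : ∀ m, ∀ x ∈ G m, f x ∈ G' m) {p q : ℤ} {x : V} (hx : x ∈ deligneI W F G p q) :
    f x ∈ deligneI W' F' G' p q := by
  refine ⟨⟨hF _ _ hx.1.1, hW _ _ hx.1.2⟩, ?_⟩
  have : (G q ⊓ W (p + q)) ⊔ oppositeTail W G q (p + q) 1 ≤
      ((G' q ⊓ W' (p + q)) ⊔ oppositeTail W' G' q (p + q) 1).comap f := by
    refine sup_le (fun y hy => mem_sup_left ⟨hG _ _ hy.1, hW _ _ hy.2⟩)
      (iSup_le fun j y hy => mem_sup_right (mem_iSup_of_mem j ⟨hG _ _ hy.1, hW _ _ hy.2⟩))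
  exact this hx.2

section Strict

variable {W F G : ℤ → Submodule K V} {N : Submodule K V} (h : OppositeFiltrations W F G N)
  {W' F' G' : ℤ → Submodule K V'} {N' : Submodule K V'} (h' : OppositeFiltrations W' F' G' N')
  (f : V →ₗ[K] V') (hW : ∀ m, ∀ x ∈ W m, f x ∈ W' m) (hF : ∀ m, ∀ x ∈ F m, f x ∈ F' m)
  (hG : ∀ m, ∀ x ∈ G m, f x ∈ G' m)

include h h' hW hF hG

lemma OppositeFiltrations.strict_step {a M : ℤ} {x : V} (hx : x ∈ W M)
    (hfx : f x ∈ F' a ⊔ W' (M - 1)) :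
    ∃ y ∈ F a ⊓ W M, ∃ w ∈ W (M - 1), f x - f (y + w) ∈ N' := by
  obtain ⟨c₀, hc₀⟩ := h.F_top
  have key : ∀ k : ℕ, c₀ + k ≤ a →
      ∃ y ∈ F (c₀ + k) ⊓ W M, ∃ w ∈ W (M - 1), f x - f (y + w) ∈ N' := by
    intro k
    induction k with
    | zero =>
      intro _
      exact ⟨x, ⟨by simp [hc₀], hx⟩, 0, zero_mem _, by simp⟩
    | succ k ih =>
      intro hk
      obtain ⟨y, hy, w, hw, hyw⟩ := ih (by push_cast at hk; omega)
      obtain ⟨v, hv, y', hy', hr⟩ := h.exists_type hy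
      have hfv := map_deligneI f hW hF hG hv
      have e' : c₀ + (k : ℤ) + (M - (c₀ + k)) = M := by ring
      have hfvN : f v ∈ N' := by
        refine h'.deligneI_inf hfv ?_
        rw [e']
        have hfvM : f v ∈ W' M := by simpa [e'] using hfv.1.2
        have h1 : f v ∈ F' (c₀ + k + 1) ⊔ W' (M - 1) := by
          have : f v = f x - f y' - (f x - f (y + w)) - f w - f (y - v - y') := by
            simp only [map_add, map_sub]; abel
          rw [this]
          refine sub_mem (sub_mem (sub_mem (sub_mem ?_ ?_) ?_) ?_) ?_
          · exact sup_le_sup_right (h'.F_anti (by push_cast at hk; omega)) _ hfx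
          · exact mem_sup_left (hF _ _ hy'.1)
          · exact mem_sup_left (h'.N_le_F _ hyw)
          · exact mem_sup_right (hW _ _ hw)
          · exact mem_sup_right (hW _ _ hr)
        obtain ⟨s, hs, t, ht, est⟩ := mem_sup.1 h1
        obtain ⟨g, hg, r, hr', egr⟩ := mem_sup.1 hfv.2
        rw [e'] at hr'
        have hrW : r ∈ W' (M - 1) := h'.W_mono (by push_cast; omega) (h'.tail_le _ _ _ hr')
        have hsW : s ∈ W' M := by
          have : s = f v - t := by rw [← est]; abel
          rw [this]
          exact sub_mem hfvM (h'.W_mono (by omega) ht)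
        have hs' : s ∈ W' (M - 1) := by
          refine h'.indep M (c₀ + k + 1) (M - (c₀ + k)) (by ring) s ⟨hs, hsW⟩ g
            ⟨hg.1, by simpa [e'] using hg.2⟩ ?_
          have : s - g = r - t := by
            have e1 : s = f v - t := by rw [← est]; abel
            have e2 : g = f v - r := by rw [← egr]; abel
            rw [e1, e2]; abel
          rw [this]
          exact sub_mem hrW ht
        rw [← est]
        exact add_mem hs' ht
      refine ⟨y', by push_cast; rw [← add_assoc]; exact hy', w + (y - v - y'), add_mem hw hr, ?_⟩
      have : f x - f (y' + (w + (y - v - y'))) = f x - f (y + w) + f v := by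
        simp only [map_add, map_sub]; abel
      rw [this]
      exact add_mem hyw hfvN
  by_cases hca : c₀ ≤ a
  · have := key (a - c₀).toNat (by omega)
    rwa [show c₀ + ((a - c₀).toNat : ℤ) = a by omega] at this
  · have : F a = ⊤ := top_le_iff.1 (hc₀ ▸ h.F_anti (by omega))
    exact ⟨x, ⟨by simp [this], hx⟩, 0, zero_mem _, by simp⟩

/-- Maps that are compatible with opposite filtrations are strict. -/
lemma OppositeFiltrations.strict {a m : ℤ} {x : V} (hxF : f x ∈ F' a) (hxW : f x ∈ W' m) :
    ∃ y ∈ F a ⊓ W m, f x - f y ∈ N' := by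
  have step1 : ∀ k : ℕ, ∀ x ∈ W (m + k), f x ∈ W' m → ∃ y ∈ W m, f x - f y ∈ N' := by
    intro k
    induction k with
    | zero => exact fun x hx _ => ⟨x, by simpa using hx, by simp⟩
    | succ k ih =>
      intro x hx hfx
      obtain ⟨b, hb⟩ := h.F_bot
      obtain ⟨y, hy, w, hw, hyw⟩ := h.strict_step h' f hW hF hG (a := b) hx
        (mem_sup_right (h'.W_mono (by push_cast; omega) hfx))
      have hyw' : y + w ∈ W (m + k) := add_mem (h.N_le_W _ (hb hy.1))
        (h.W_mono (by push_cast; omega) hw)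
      obtain ⟨z, hz, hz'⟩ := ih _ hyw' (by
        have : f (y + w) = f x - (f x - f (y + w)) := by abel
        rw [this]
        exact sub_mem hfx (h'.N_le_W _ hyw))
      refine ⟨z, hz, ?_⟩
      have : f x - f z = (f x - f (y + w)) + (f (y + w) - f z) := by abel
      rw [this]
      exact add_mem hyw hz'
  have step2 : ∀ k : ℕ, ∀ M : ℤ, W (M - k) ≤ N → ∀ x ∈ W M, f x ∈ F' a →
      ∃ y ∈ F a ⊓ W M, f x - f y ∈ N' := by
    intro k
    induction k with
    | zero =>
      intro M hM x hx _
      exact ⟨x, ⟨h.N_le_F _ (hM (by simpa using hx)), hx⟩, by simp⟩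
    | succ k ih =>
      intro M hM x hx hfx
      obtain ⟨y, hy, w, hw, hyw⟩ := h.strict_step h' f hW hF hG (a := a) hx (mem_sup_left hfx)
      obtain ⟨z, hz, hz'⟩ := ih (M - 1) (by
          convert hM using 2; push_cast; ring_nf) w hw (by
        have : f w = f x - f y - (f x - f (y + w)) := by rw [map_add]; abel
        rw [this]
        exact sub_mem (sub_mem hfx (hF _ _ hy.1)) (h'.N_le_F _ hyw))
      refine ⟨y + z, add_mem hy ⟨hz.1, h.W_mono (by omega) hz.2⟩, ?_⟩
      have : f x - f (y + z) = (f x - f (y + w)) + (f w - f z) := by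
        simp only [map_add]; abel
      rw [this]
      exact add_mem hyw hz'
  obtain ⟨M, hM⟩ := h.W_top x
  obtain ⟨y, hy, hxy⟩ := step1 (M - m).toNat x (h.W_mono (by omega) hM) hxW
  obtain ⟨b, hb⟩ := h.W_bot
  obtain ⟨z, hz, hyz⟩ := step2 (m - b).toNat m (fun v hv => hb (h.W_mono (by omega) hv)) y hy (by
    have : f y = f x - (f x - f y) := by abel
    rw [this]
    exact sub_mem hxF (h'.N_le_F _ hxy))
  refine ⟨z, hz, ?_⟩
  have : f x - f z = (f x - f y) + (f y - f z) := by abel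
  rw [this]
  exact add_mem hxy hyz

end Strict

end Opposite

/-! ## Bases adapted to two filtrations -/

section Adapted

variable {K : Type*} [Field K] {V : Type u} [AddCommGroup V] [Module K V]

/-- A basis adapted to an increasing filtration `W` and a decreasing filtration `F`. -/
structure AdaptedBasis (W F : ℤ → Submodule K V) where
  ι : Type u
  basis : Module.Basis ι K V
  r : ι → ℤ
  q : ι → ℤ
  mem_W : ∀ i, basis i ∈ W (r i)
  mem_F : ∀ i, basis i ∈ F (q i)
  W_le : ∀ m, W m ≤ Submodule.span K (basis '' {i | r i ≤ m})
  F_le : ∀ p, F p ≤ Submodule.span K (basis '' {i | p ≤ q i})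

lemma AdaptedBasis.exists (W F : ℤ → Submodule K V) (W_mono : Monotone W) (F_anti : Antitone F)
    (W_bot : ∃ m, W m = ⊥) (W_top : ∃ m, W m = ⊤) (F_bot : ∃ p, F p = ⊥)
    (F_top : ∃ p, F p = ⊤) : Nonempty (AdaptedBasis W F) := by
  classical
  have hC : ∀ x : ℤ × ℤ, ∃ C : Submodule K V, C ≤ W x.1 ⊓ F x.2 ∧
      Disjoint C ((W (x.1 - 1) ⊓ F x.2) ⊔ (W x.1 ⊓ F (x.2 + 1))) ∧
      W x.1 ⊓ F x.2 ≤ C ⊔ ((W (x.1 - 1) ⊓ F x.2) ⊔ (W x.1 ⊓ F (x.2 + 1))) := by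
    intro x
    obtain ⟨C, hC⟩ := Submodule.exists_isCompl ((W (x.1 - 1) ⊓ F x.2) ⊔ (W x.1 ⊓ F (x.2 + 1)))
    have hle : (W (x.1 - 1) ⊓ F x.2) ⊔ (W x.1 ⊓ F (x.2 + 1)) ≤ W x.1 ⊓ F x.2 :=
      sup_le (inf_le_inf_right _ (W_mono (by omega))) (inf_le_inf_left _ (F_anti (by omega)))
    refine ⟨C ⊓ (W x.1 ⊓ F x.2), inf_le_right, hC.disjoint.symm.mono_left inf_le_left, ?_⟩
    intro v hv
    have : v ∈ ((W (x.1 - 1) ⊓ F x.2) ⊔ (W x.1 ⊓ F (x.2 + 1))) ⊔ C := by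
      rw [hC.sup_eq_top]; trivial
    obtain ⟨s, hs, t, ht, e⟩ := mem_sup.1 this
    refine mem_sup.2 ⟨t, ⟨ht, ?_⟩, s, hs, by rw [← e, add_comm]⟩
    have : t = v - s := by rw [← e]; abel
    rw [this]
    exact sub_mem hv (hle hs)
  choose C hCle hCd hCs using hC
  have hspan : ∀ (k l : ℕ) (m p : ℤ), W (m - k) = ⊥ → F (p + l) = ⊥ →
      W m ⊓ F p ≤ ⨆ x : {x : ℤ × ℤ // x.1 ≤ m ∧ p ≤ x.2}, C x.1 := by
    intro k
    induction k with
    | zero => 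
      intro l m p h1 _
      rw [show m = m - ((0 : ℕ) : ℤ) by simp, h1, bot_inf_eq]
      exact bot_le
    | succ k ihk =>
      intro l
      induction l with
      | zero => 
        intro m p _ h1
        rw [show p = p + ((0 : ℕ) : ℤ) by simp, h1, inf_bot_eq]
        exact bot_le
      | succ l ihl =>
        intro m p hm hp
        refine (hCs (m, p)).trans (sup_le ?_ (sup_le ?_ ?_))
        · exact le_iSup (fun x : {x : ℤ × ℤ // x.1 ≤ m ∧ p ≤ x.2} => C x.1) ⟨(m, p), le_rfl, le_rfl⟩
        · refine (ihk (l + 1) (m - 1) p (by convert hm using 2; push_cast; ring_nf) hp).trans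
            (iSup_le fun x => ?_)
          exact le_iSup (fun x : {x : ℤ × ℤ // x.1 ≤ m ∧ p ≤ x.2} => C x.1)
            ⟨x.1, by have := x.2.1; omega, x.2.2⟩
        · refine (ihl m (p + 1) hm (by convert hp using 2; push_cast; ring_nf)).trans
            (iSup_le fun x => ?_)
          exact le_iSup (fun x : {x : ℤ × ℤ // x.1 ≤ m ∧ p ≤ x.2} => C x.1)
            ⟨x.1, x.2.1, by have := x.2.2; omega⟩
  obtain ⟨m₀, hm₀⟩ := W_bot
  obtain ⟨m₁, hm₁⟩ := W_top
  obtain ⟨p₀, hp₀⟩ := F_bot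
  obtain ⟨p₁, hp₁⟩ := F_top
  have hspan' : ∀ m p, W m ⊓ F p ≤ ⨆ x : {x : ℤ × ℤ // x.1 ≤ m ∧ p ≤ x.2}, C x.1 := fun m p =>
    hspan (m - m₀).toNat (p₀ - p).toNat m p (le_bot_iff.1 (hm₀ ▸ W_mono (by omega)))
      (le_bot_iff.1 (hp₀ ▸ F_anti (by omega)))
  have hind : iSupIndep C := by
    rw [iSupIndep_iff_finsetSum_eq_zero_imp_eq_zero]
    intro s
    induction s using Finset.strongInduction with
    | H s ih =>
      intro v hv hv0
      rcases s.eq_empty_or_nonempty with rfl | hs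
      · simp
      obtain ⟨x, hx, hmax⟩ := s.exists_max_image (fun x : ℤ × ℤ => toLex (x.1, -x.2)) hs
      have hx0 : v x = 0 := by
        rw [← Finset.add_sum_erase s v hx] at hv0
        have h1 : ∑ y ∈ s.erase x, v y ∈ W (x.1 - 1) ⊔ (W x.1 ⊓ F (x.2 + 1)) := by
          refine sum_mem fun y hy => ?_
          obtain ⟨hyx, hys⟩ := Finset.mem_erase.1 hy
          have hlt := hmax y hys
          have hyC := hCle _ (hv y hys)
          rw [Prod.Lex.toLex_le_toLex] at hlt
          rcases hlt with hlt | ⟨heq, hle⟩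
          · exact mem_sup_left (W_mono (by simp at hlt; omega) hyC.1)
          · have : x.2 ≠ y.2 := fun e => hyx (Prod.ext heq e.symm)
            simp only at heq hle
            exact mem_sup_right ⟨heq ▸ hyC.1, F_anti (by omega) hyC.2⟩
        have h2 : v x ∈ W (x.1 - 1) ⊔ (W x.1 ⊓ F (x.2 + 1)) := by
          rw [eq_neg_of_add_eq_zero_left hv0]
          exact neg_mem h1
        obtain ⟨s', hs', t, ht, e⟩ := mem_sup.1 h2
        refine (Submodule.disjoint_def.1 (hCd x)) _ (hv x hx) ?_
        rw [← e]
        refine add_mem (mem_sup_left ⟨hs', ?_⟩) (mem_sup_right ht)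
        have : s' = v x - t := by rw [← e]; abel
        rw [this]
        exact sub_mem (hCle _ (hv x hx)).2 (F_anti (by omega) ht.2)
      intro y hy
      by_cases hyx : y = x
      · rw [hyx, hx0]
      · refine ih (s.erase x) (Finset.erase_ssubset hx) v
          (fun z hz => hv z (Finset.mem_of_mem_erase hz)) ?_ y (Finset.mem_erase.2 ⟨hyx, hy⟩)
        rw [← Finset.add_sum_erase s v hx, hx0, zero_add] at hv0
        exact hv0
  have htop : iSup C = ⊤ := by
    refine top_le_iff.1 ?_
    have := hspan' m₁ p₁
    rw [hm₁, hp₁, top_inf_eq] at this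
    exact this.trans (iSup_le fun x => le_iSup C x.1)
  have hint : DirectSum.IsInternal C :=
    DirectSum.isInternal_submodule_of_iSupIndep_of_iSup_eq_top hind htop
  let b := fun x => Module.Basis.ofVectorSpace K (C x)
  have hbm : ∀ i, hint.collectedBasis b i ∈ C i.1 := fun i => by
    simp
  have hsp : ∀ S : Set (ℤ × ℤ), ∀ x ∈ S, C x ≤
      Submodule.span K (hint.collectedBasis b '' {i | i.1 ∈ S}) := by
    intro S x hx v hv
    have h1 := (b x).span_eq
    have : (⟨v, hv⟩ : C x) ∈ Submodule.span K (Set.range (b x)) := by rw [h1]; trivial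
    have h2 := Submodule.mem_map_of_mem (f := (C x).subtype) this
    rw [Submodule.map_span] at h2
    refine Submodule.span_mono ?_ h2
    rintro _ ⟨_, ⟨j, rfl⟩, rfl⟩
    exact ⟨⟨x, j⟩, hx, by simp⟩
  refine ⟨⟨_, hint.collectedBasis b, fun i => i.1.1, fun i => i.1.2,
    fun i => (hCle _ (hbm i)).1, fun i => (hCle _ (hbm i)).2, fun m => ?_, fun p => ?_⟩⟩
  · have := hspan' m p₁
    rw [hp₁, inf_top_eq] at this
    exact this.trans (iSup_le fun x => hsp {x | x.1 ≤ m} x.1 x.2.1)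
  · have := hspan' m₁ p
    rw [hm₁, top_inf_eq] at this
    exact this.trans (iSup_le fun x => hsp {x | p ≤ x.2} x.1 x.2.2)

end Adapted

namespace DGA

variable {k : Type} [Field k] (A : DGA.{u} k)

lemma sum_proj (x : A.carrier) : ∃ s : Finset ℕ, x = ∑ n ∈ s, A.proj n x := by
  classical
  exact ⟨_, (DirectSum.sum_support_decompose A.gr x).symm⟩

lemma proj_d (n : ℕ) (x : A.carrier) : A.proj n (A.d x) = A.d (A.prevProj n x) := by
  induction x using DirectSum.Decomposition.inductionOn A.gr with
  | zero => simp
  | add a b ha hb => simp only [map_add, ha, hb]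
  | @homogeneous i a =>
    cases n with
    | zero => rw [A.proj_of_mem_ne (by omega) (A.d_mem a.2)]; simp [prevProj]
    | succ n =>
      change _ = A.d (A.proj n a)
      by_cases h : i = n
      · subst h
        rw [A.proj_of_mem (A.d_mem a.2), A.proj_of_mem a.2]
      · rw [A.proj_of_mem_ne (by omega) (A.d_mem a.2), A.proj_of_mem_ne h a.2, map_zero]

lemma prevProj_mem (n : ℕ) (x : A.carrier) : A.prevProj n x ∈ A.prevGr n := by
  cases n with
  | zero => exact zero_mem _
  | succ n => exact A.proj_mem n x

lemma d_mem_prev {n : ℕ} {x : A.carrier} (hx : x ∈ A.prevGr n) : A.d x ∈ A.gr n := by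
  cases n with
  | zero => rw [(mem_bot k).1 hx]; simp
  | succ n => exact A.d_mem hx

lemma prevProj_mem_of {P : Submodule k A.carrier} (hP : ∀ x ∈ P, ∀ n, A.proj n x ∈ P) (n : ℕ)
    {x : A.carrier} (hx : x ∈ P) : A.prevProj n x ∈ P := by
  cases n with
  | zero => exact zero_mem _
  | succ n => exact hP x hx n

lemma eq_zero_of_prevGr_zero {x : A.carrier} (hx : x ∈ A.prevGr 0) : x = 0 := (mem_bot k).1 hx

end DGA

namespace FDGA

variable {k : Type} [Field k] (A : FDGA.{u} k)

/-- The elements of `W_p A^n` with differential in `W_{p-2}`. -/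
def precyc (n : ℕ) (p : ℤ) : Submodule k A.carrier := A.W p ⊓ A.gr n ⊓ (A.W (p - 2)).comap A.d

/-- `W_{p-1} + d W_{p+1}`. -/
def bdry (p : ℤ) : Submodule k A.carrier := A.W (p - 1) ⊔ (A.W (p + 1)).map A.d

/-- The closed elements of `W_p A^n` in a subspace `S`. -/
def cyc (S : Submodule k A.carrier) (n : ℕ) (p : ℤ) : Submodule k A.carrier :=
  A.W p ⊓ A.gr n ⊓ S ⊓ ker A.d

/-- The differentials of the elements of `W_p A^{n-1}` in a subspace `S`. -/
def bd (S : Submodule k A.carrier) (n : ℕ) (p : ℤ) : Submodule k A.carrier :=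
  (A.W p ⊓ A.prevGr n ⊓ S).map A.d

variable {A}

lemma proj_W {p : ℤ} : ∀ x ∈ A.W p, ∀ n, A.proj n x ∈ A.W p := fun _ hx n => A.proj_mem_W hx n

lemma bdry_homogeneous {n : ℕ} {p q : ℤ} {x : A.carrier} (hx : x ∈ A.gr n)
    (hx' : x ∈ A.W p ⊔ (A.W q).map A.d) :
    ∃ u ∈ A.W p ⊓ A.gr n, ∃ v ∈ A.W q ⊓ A.prevGr n, x = u + A.d v := by
  obtain ⟨u, hu, _, ⟨v, hv, rfl⟩, e⟩ := mem_sup.1 hx'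
  refine ⟨A.proj n u, ⟨A.proj_mem_W hu n, A.proj_mem n u⟩, A.prevProj n v,
    ⟨A.prevProj_mem_of proj_W n hv, A.prevProj_mem n v⟩, ?_⟩
  rw [← A.proj_d, ← map_add, e, A.proj_of_mem hx]

lemma exact_homogeneous {n : ℕ} {q : ℤ} {x v : A.carrier} (hx : x ∈ A.gr n) (hv : v ∈ A.W q)
    (e : x = A.d v) : ∃ v ∈ A.W q ⊓ A.prevGr n, x = A.d v :=
  ⟨A.prevProj n v, ⟨A.prevProj_mem_of proj_W n hv, A.prevProj_mem n v⟩, by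
    rw [← A.proj_d, ← e, A.proj_of_mem hx]⟩

lemma mem_Z2_iff {n : ℕ} {p : ℤ} (x : A.Z1 n p) : A.toE1 n p x ∈ A.Z2 n p ↔ A.d x ∈ A.B1 (p - 1) :=
  (mk_eq_zero _ : _ ↔ _)

lemma B1_le_bdry (p : ℤ) : A.B1 p ≤ A.bdry p :=
  sup_le_sup_left (Submodule.map_mono (A.W_mono (by omega))) _

lemma toE1_eq_zero_iff {n : ℕ} {p : ℤ} (x : A.Z1 n p) : A.toE1 n p x = 0 ↔ x.1 ∈ A.B1 p :=
  mk_eq_zero _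

lemma mem_B2_iff {n : ℕ} {p : ℤ} (x : A.Z1 n p) : A.toE1 n p x ∈ A.B2 n p ↔ x.1 ∈ A.bdry p := by
  constructor
  · intro h
    have hle : A.B2 n p ≤ ((A.bdry p).submoduleOf (A.Z1 n p)).map (A.toE1 n p) := by
      refine iSup₂_le fun m hm => ?_
      rintro _ ⟨c, rfl⟩
      obtain ⟨v, rfl⟩ := mk_surjective _ c
      refine ⟨⟨A.d v.1, ?_⟩, mem_sup_right ⟨v.1, v.2.1.1, rfl⟩, rfl⟩
      subst hm
      refine ⟨⟨by simpa using v.2.2, A.d_mem v.2.1.2⟩, ?_⟩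
      change A.d (A.d v.1) ∈ A.W (p - 1)
      rw [A.d_d]; exact zero_mem _
    obtain ⟨y, hy, e⟩ := hle h
    have h0 : A.toE1 n p (x - y) = 0 := by rw [map_sub, e, sub_self]
    rw [toE1_eq_zero_iff] at h0
    have e1 : x.1 = (x - y : A.Z1 n p).1 + y.1 := by simp
    rw [e1]
    exact add_mem (B1_le_bdry p h0) hy
  · intro h
    obtain ⟨u, hu, v, hv, e⟩ := bdry_homogeneous x.2.1.2 h
    cases n with
    | zero =>
      have hv0 := A.eq_zero_of_prevGr_zero hv.2
      have : A.toE1 0 p x = 0 := by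
        rw [toE1_eq_zero_iff, e, hv0, map_zero, add_zero]
        exact mem_sup_left hu.1
      rw [this]; exact zero_mem _
    | succ m =>
      have hvZ : v ∈ A.Z1 m (p + 1) := by
        refine ⟨hv, ?_⟩
        change A.d v ∈ A.W (p + 1 - 1)
        have : A.d v = x.1 - u := by rw [e]; abel
        rw [this, add_sub_cancel_right]
        exact sub_mem x.2.1.1 (A.W_mono (by omega) hu.1)
      refine mem_iSup_of_mem m (mem_iSup_of_mem rfl ⟨A.toE1 m (p + 1) ⟨v, hvZ⟩, ?_⟩)
      refine (Submodule.Quotient.eq _).2 ?_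
      change A.d v - x.1 ∈ A.B1 p
      have : A.d v - x.1 = -u := by rw [e]; abel
      rw [this]
      exact neg_mem (mem_sup_left hu.1)

lemma precyc_le_Z1 (n : ℕ) (p : ℤ) : A.precyc n p ≤ A.Z1 n p := fun _ hx =>
  ⟨hx.1, A.W_mono (by omega) hx.2⟩

lemma toE1_precyc_mem {n : ℕ} {p : ℤ} (x : A.precyc n p) :
    A.toE1 n p ⟨x.1, precyc_le_Z1 n p x.2⟩ ∈ A.Z2 n p := by
  rw [mem_Z2_iff]
  exact mem_sup_left (A.W_mono (by omega) x.2.2)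

variable (A) in
/-- The class in `E_2` of an element of `W_p` with differential in `W_{p-2}`. -/
def toE2 (n : ℕ) (p : ℤ) : A.precyc n p →ₗ[k] A.E2 n p :=
  Submodule.mkQ _ ∘ₗ ((A.toE1 n p ∘ₗ Submodule.inclusion (precyc_le_Z1 n p)).codRestrict _
    fun x => toE1_precyc_mem x)

lemma toE2_eq_zero_iff {n : ℕ} {p : ℤ} (x : A.precyc n p) : A.toE2 n p x = 0 ↔ x.1 ∈ A.bdry p := by
  rw [← mem_B2_iff ⟨x.1, precyc_le_Z1 n p x.2⟩]
  exact mk_eq_zero _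

lemma exists_precyc {n : ℕ} {p : ℤ} {x : A.carrier} (hx : x ∈ A.Z1 n p)
    (h : A.d x ∈ A.B1 (p - 1)) : ∃ v ∈ A.W (p - 1) ⊓ A.gr n, x - v ∈ A.precyc n p := by
  obtain ⟨u, hu, v, hv, e⟩ := bdry_homogeneous (A.d_mem hx.1.2) h
  refine ⟨v, hv, ⟨sub_mem hx.1.1 (A.W_mono (by omega) hv.1), sub_mem hx.1.2 hv.2⟩, ?_⟩
  change A.d (x - v) ∈ A.W (p - 2)
  rw [map_sub, e, add_sub_cancel_right]
  exact A.W_mono (by omega) hu.1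

lemma toE2_surjective (n : ℕ) (p : ℤ) : Surjective (A.toE2 n p) := by
  intro c
  obtain ⟨⟨c, hc⟩, rfl⟩ := mk_surjective _ c
  obtain ⟨x, rfl⟩ := mk_surjective _ c
  obtain ⟨v, hv, hxv⟩ := exists_precyc x.2 ((mem_Z2_iff x).1 hc)
  refine ⟨⟨_, hxv⟩, congrArg (Submodule.Quotient.mk (p := (A.B2 n p).submoduleOf (A.Z2 n p)))
    (Subtype.ext ?_)⟩
  refine (Submodule.Quotient.eq _).2 ?_
  change x.1 - v - x.1 ∈ A.B1 p
  rw [sub_sub_cancel_left]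
  exact neg_mem (mem_sup_left hv.1)

lemma isClass_iff {n : ℕ} {p : ℤ} (x : A.Z1 n p) (y : A.precyc n p) :
    A.IsClass (A.toE1 n p x) (A.toE2 n p y) ↔ x.1 - y.1 ∈ A.bdry p := by
  have hy := toE1_precyc_mem y
  set y' : A.Z1 n p := ⟨y.1, precyc_le_Z1 n p y.2⟩
  constructor
  · rintro ⟨h, e⟩
    have : A.toE1 n p x - A.toE1 n p y' ∈ A.B2 n p :=
      (Submodule.Quotient.eq ((A.B2 n p).submoduleOf (A.Z2 n p))).1 e
    rw [← map_sub, mem_B2_iff] at this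
    exact this
  · intro h
    have h2 : A.toE1 n p (x - y') ∈ A.B2 n p := (mem_B2_iff _).2 h
    have h3 : A.B2 n p ≤ A.Z2 n p := by
      refine iSup₂_le fun m hm => ?_
      rintro _ ⟨c, rfl⟩
      obtain ⟨v, rfl⟩ := mk_surjective _ c
      refine (mk_eq_zero _).2 ?_
      change A.d (A.d v.1) ∈ A.B1 (p - 1)
      rw [A.d_d]; exact zero_mem _
    have hx : A.toE1 n p x ∈ A.Z2 n p := by
      have e : A.toE1 n p x = A.toE1 n p (x - y') + A.toE1 n p y' := by rw [map_sub]; abel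
      rw [e]
      exact add_mem (h3 h2) hy
    refine ⟨hx, (Submodule.Quotient.eq _).2 ?_⟩
    rw [map_sub] at h2
    exact h2

variable {B : FDGA.{u} k} (f : Hom A B)

lemma Hom.map_precyc {n : ℕ} {p : ℤ} {x : A.carrier} (hx : x ∈ A.precyc n p) : f x ∈ B.precyc n p :=
  ⟨⟨f.map_W _ _ hx.1.1, f.map_gr _ _ hx.1.2⟩, by
    change B.d (f x) ∈ B.W (p - 2)
    rw [← f.map_d]; exact f.map_W _ _ hx.2⟩

lemma Hom.map_bdry {p : ℤ} {x : A.carrier} (hx : x ∈ A.bdry p) : f x ∈ B.bdry p := by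
  obtain ⟨u, hu, _, ⟨v, hv, rfl⟩, rfl⟩ := mem_sup.1 hx
  rw [map_add, f.map_d]
  exact add_mem (mem_sup_left (f.map_W _ _ hu)) (mem_sup_right ⟨_, f.map_W _ _ hv, rfl⟩)

lemma Hom.E2_toE2 {n : ℕ} {p : ℤ} (x : A.precyc n p) :
    f.E2 n p (A.toE2 n p x) = B.toE2 n p ⟨f x, f.map_precyc x.2⟩ := rfl

lemma Hom.E2_injective_iff {n : ℕ} {p : ℤ} : Injective (f.E2 n p) ↔
    ∀ a ∈ A.precyc n p, f a ∈ B.bdry p → a ∈ A.bdry p := by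
  rw [injective_iff_map_eq_zero]
  constructor
  · intro h a ha hfa
    rw [← toE2_eq_zero_iff ⟨a, ha⟩]
    refine h _ ?_
    rw [f.E2_toE2, toE2_eq_zero_iff]
    exact hfa
  · intro h c hc
    obtain ⟨x, rfl⟩ := toE2_surjective n p c
    rw [f.E2_toE2, toE2_eq_zero_iff] at hc
    rw [toE2_eq_zero_iff]
    exact h _ x.2 hc

lemma Hom.E2_surjective_iff {n : ℕ} {p : ℤ} : Surjective (f.E2 n p) ↔
    ∀ b ∈ B.precyc n p, ∃ a ∈ A.precyc n p, b - f a ∈ B.bdry p := by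
  constructor
  · intro h b hb
    obtain ⟨c, hc⟩ := h (B.toE2 n p ⟨b, hb⟩)
    obtain ⟨x, rfl⟩ := toE2_surjective n p c
    refine ⟨x.1, x.2, ?_⟩
    rw [f.E2_toE2, eq_comm, ← sub_eq_zero, ← map_sub, toE2_eq_zero_iff] at hc
    exact hc
  · intro h c
    obtain ⟨y, rfl⟩ := toE2_surjective n p c
    obtain ⟨a, ha, hab⟩ := h y.1 y.2
    refine ⟨A.toE2 n p ⟨a, ha⟩, ?_⟩
    rw [f.E2_toE2, eq_comm, ← sub_eq_zero, ← map_sub, toE2_eq_zero_iff]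
    exact hab

/-- The maps induced on the cohomology of the décalage of `W`, intersected with subspaces `S`
and `S'`, are isomorphisms. -/
structure Hom.IsDecQuasiIso (S : Submodule k A.carrier) (S' : Submodule k B.carrier) : Prop where
  inj : ∀ n p, ∀ a ∈ A.cyc S n p, f a ∈ B.bd S' n (p + 1) → a ∈ A.bd S n (p + 1)
  surj : ∀ n p, ∀ b ∈ B.cyc S' n p, ∃ a ∈ A.cyc S n p, b - f a ∈ B.bd S' n (p + 1)

/-- A trivial fibration: solutions of `d y = z` lift, compatibly with the filtration by weight and
with subspaces `S` and `S'`. -/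
def Hom.IsTrivFib (S : Submodule k A.carrier) (S' : Submodule k B.carrier) : Prop :=
  ∀ n p, ∀ z ∈ A.cyc S n p, ∀ b ∈ B.W (p + 1) ⊓ B.prevGr n ⊓ S', B.d b = f z →
    ∃ y ∈ A.W (p + 1) ⊓ A.prevGr n ⊓ S, A.d y = z ∧ f y = b

lemma bd_mono (S : Submodule k A.carrier) (n : ℕ) {p q : ℤ} (h : p ≤ q) : A.bd S n p ≤ A.bd S n q :=
  Submodule.map_mono (inf_le_inf_right _ (inf_le_inf_right _ (A.W_mono h)))

lemma exists_W_eq_bot (n : ℕ) : ∃ q, ∀ p ≤ q, ∀ x ∈ A.W p ⊓ A.gr n, x = 0 := by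
  obtain ⟨q, hq⟩ := A.W_regular n
  refine ⟨q, fun p hp x hx => ?_⟩
  have : x ∈ A.W q ⊓ A.gr n := ⟨A.W_mono hp hx.1, hx.2⟩
  rwa [hq, mem_bot] at this

lemma weight_induction {P : ℤ → Prop} (h0 : ∃ q, ∀ p ≤ q, P p) (h1 : ∀ p, P (p - 1) → P p)
    (p : ℤ) : P p := by
  obtain ⟨q, hq⟩ := h0
  have : ∀ m : ℕ, P (q + m) := by
    intro m
    induction m with
    | zero => exact hq _ (by simp)
    | succ m ih =>
      refine h1 _ ?_
      have : q + ((m + 1 : ℕ) : ℤ) - 1 = q + m := by push_cast; ring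
      rwa [this]
  by_cases h : p ≤ q
  · exact hq p h
  · have := this (p - q).toNat
    rwa [show q + ((p - q).toNat : ℤ) = p by omega] at this

lemma mem_cyc_top {n : ℕ} {p : ℤ} {x : A.carrier} :
    x ∈ A.cyc ⊤ n p ↔ x ∈ A.W p ∧ x ∈ A.gr n ∧ A.d x = 0 := by
  simp [cyc, and_assoc]

lemma mem_bd_top {n : ℕ} {p : ℤ} {x : A.carrier} :
    x ∈ A.bd ⊤ n p ↔ ∃ v, v ∈ A.W p ∧ v ∈ A.prevGr n ∧ A.d v = x := by
  simp [bd, and_assoc]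

lemma mem_bd_top_of_gr {n : ℕ} {p : ℤ} {v : A.carrier} (hv : v ∈ A.W p) (h : A.d v ∈ A.gr n) :
    A.d v ∈ A.bd ⊤ n p := by
  obtain ⟨w, hw, e⟩ := exact_homogeneous h hv rfl
  rw [e]
  exact mem_bd_top.2 ⟨w, hw.1, hw.2, rfl⟩

variable {f}

lemma Hom.IsE1QuasiIso.isDecQuasiIso (hf : f.IsE1QuasiIso) : f.IsDecQuasiIso ⊤ ⊤ := by
  have inj2 : ∀ n p, ∀ a ∈ A.precyc n p, f a ∈ B.bdry p → a ∈ A.bdry p :=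
    fun n p => f.E2_injective_iff.1 (hf n p).1
  have surj2 : ∀ n p, ∀ b ∈ B.precyc n p, ∃ a ∈ A.precyc n p, b - f a ∈ B.bdry p :=
    fun n p => f.E2_surjective_iff.1 (hf n p).2
  have inj : ∀ n p, ∀ a ∈ A.cyc ⊤ n p, f a ∈ B.bd ⊤ n (p + 1) → a ∈ A.bd ⊤ n (p + 1) := by
    intro n p
    induction p using weight_induction with
    | h0 =>
      obtain ⟨q, hq⟩ := A.exists_W_eq_bot n
      refine ⟨q, fun p hp a ha _ => ?_⟩
      rw [hq p hp a ha.1.1]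
      exact zero_mem _
    | h1 p ih =>
      intro a ha hfa
      rw [mem_cyc_top] at ha
      rw [mem_bd_top] at hfa
      obtain ⟨haW, hag, had⟩ := ha
      obtain ⟨b, hbW, hbg, hb⟩ := hfa
      have h1 := inj2 n p a ⟨⟨haW, hag⟩, by
        change A.d a ∈ A.W (p - 2); rw [had]; exact zero_mem _⟩ (by
        rw [← hb]; exact mem_sup_right ⟨b, hbW, rfl⟩)
      obtain ⟨u, hu, v, hv, e⟩ := bdry_homogeneous hag h1
      have hud : A.d u = 0 := by
        have : A.d a = A.d u := by rw [e, map_add, A.d_d, add_zero]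
        rw [← this, had]
      have hy : B.d (b - f v) = f u := by
        rw [map_sub, hb, ← f.map_d, e, map_add]; abel
      have key : ∃ x ∈ A.W (p + 1), A.d x ∈ A.W (p - 1) ∧ A.d x ∈ A.gr n ∧
          ∃ u' ∈ B.W p, f u - f (A.d x) = B.d u' := by
        cases n with
        | zero =>
          refine ⟨0, zero_mem _, by simp, by simp, 0, zero_mem _, ?_⟩
          rw [← hy, B.eq_zero_of_prevGr_zero hbg, A.eq_zero_of_prevGr_zero hv.2]; simp
        | succ n =>
          obtain ⟨x, hx, hxb⟩ := surj2 n (p + 1) (b - f v) ⟨⟨sub_mem hbW (f.map_W _ _ hv.1),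
              sub_mem hbg (f.map_gr _ _ hv.2)⟩, by
              change B.d (b - f v) ∈ B.W (p + 1 - 2)
              rw [hy]
              exact B.W_mono (by omega) (f.map_W _ _ hu.1)⟩
          obtain ⟨u', hu', w, ⟨v', _, hw⟩, e'⟩ := mem_sup.1 hxb
          refine ⟨x, hx.1.1, A.W_mono (by omega) hx.2, A.d_mem hx.1.2, u',
            B.W_mono (by omega) hu', ?_⟩
          rw [f.map_d, ← hy, ← map_sub, ← e', map_add, ← hw, B.d_d, add_zero]
      obtain ⟨x, hxW, hdx, hdxg, u', hu', e'⟩ := key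
      have h2 : u - A.d x ∈ A.bd ⊤ n (p - 1 + 1) := by
        refine ih _ (mem_cyc_top.2 ⟨sub_mem hu.1 hdx, sub_mem hu.2 hdxg,
          by rw [map_sub, hud, A.d_d, sub_zero]⟩) ?_
        rw [map_sub, e', sub_add_cancel]
        refine mem_bd_top_of_gr hu' ?_
        rw [← e', ← map_sub]
        exact f.map_gr _ _ (sub_mem hu.2 hdxg)
      have e2 : a = (u - A.d x) + (A.d x + A.d v) := by rw [e]; abel
      rw [e2]
      refine add_mem (bd_mono _ _ (by omega) h2) (add_mem
        (mem_bd_top_of_gr hxW hdxg) (mem_bd_top.2 ⟨v, hv.1, hv.2, rfl⟩))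
  refine ⟨inj, ?_⟩
  intro n p
  induction p using weight_induction with
  | h0 =>
    obtain ⟨q, hq⟩ := B.exists_W_eq_bot n
    refine ⟨q, fun p hp b hb => ⟨0, zero_mem _, ?_⟩⟩
    rw [hq p hp b hb.1.1]
    simp
  | h1 p ih =>
    intro b hb
    rw [mem_cyc_top] at hb
    obtain ⟨hbW, hbg, hbd⟩ := hb
    obtain ⟨a, ha, hab⟩ := surj2 n p b ⟨⟨hbW, hbg⟩, by
      change B.d b ∈ B.W (p - 2); rw [hbd]; exact zero_mem _⟩
    obtain ⟨u, hu, v, hv, e⟩ := bdry_homogeneous (sub_mem hbg (f.map_gr _ _ ha.1.2)) hab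
    have hda : A.d a ∈ A.bd ⊤ (n + 1) (p - 2 + 1) := by
      refine inj _ _ _ (mem_cyc_top.2 ⟨ha.2, A.d_mem ha.1.2, A.d_d a⟩) ?_
      have : f (A.d a) = B.d (-u) := by
        have h := congrArg B.d e
        rw [map_sub, hbd, map_add, B.d_d, add_zero, zero_sub] at h
        rw [f.map_d, map_neg, ← h, neg_neg]
      rw [this]
      exact mem_bd_top.2 ⟨-u, neg_mem (B.W_mono (by omega) hu.1), neg_mem hu.2, rfl⟩
    obtain ⟨a', ha'W, ha'g, ha'⟩ := mem_bd_top.1 hda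
    have hcl : A.d (a - a') = 0 := by rw [map_sub, ha', sub_self]
    have hmem : u + f a' ∈ B.cyc ⊤ n (p - 1) := by
      refine mem_cyc_top.2 ⟨add_mem hu.1 (f.map_W _ _ (A.W_mono (by omega) ha'W)),
        add_mem hu.2 (f.map_gr _ _ ha'g), ?_⟩
      have : u + f a' = b - f (a - a') - B.d v := by
        rw [map_sub]
        have : u = b - f a - B.d v := by rw [e]; abel
        rw [this]; abel
      rw [this, map_sub, map_sub, hbd, ← f.map_d, hcl, B.d_d]; simp
    obtain ⟨c, hc, hc'⟩ := ih _ hmem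
    rw [mem_cyc_top] at hc
    refine ⟨a - a' + c, mem_cyc_top.2 ⟨add_mem (sub_mem ha.1.1
      (A.W_mono (by omega) ha'W)) (A.W_mono (by omega) hc.1), add_mem
      (sub_mem ha.1.2 ha'g) hc.2.1, by rw [map_add, hcl, hc.2.2, add_zero]⟩, ?_⟩
    have : b - f (a - a' + c) = (u + f a' - f c) + B.d v := by
      rw [map_add, map_sub]
      have : u = b - f a - B.d v := by rw [e]; abel
      rw [this]; abel
    rw [this]
    exact add_mem (bd_mono _ _ (by omega) hc') (mem_bd_top.2 ⟨v, hv.1, hv.2, rfl⟩)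

lemma Hom.IsDecQuasiIso.isE1QuasiIso (hf : f.IsDecQuasiIso ⊤ ⊤) : f.IsE1QuasiIso := by
  intro n p
  refine ⟨f.E2_injective_iff.2 fun a ha hfa => ?_, f.E2_surjective_iff.2 fun b hb => ?_⟩
  · obtain ⟨u, hu, v, hv, e⟩ := bdry_homogeneous (f.map_gr _ _ ha.1.2) hfa
    have h1 : f (A.d a) = B.d u := by rw [f.map_d, e, map_add, B.d_d, add_zero]
    have hda : A.d a ∈ A.bd ⊤ (n + 1) (p - 2 + 1) := by
      refine hf.inj _ _ _ (mem_cyc_top.2 ⟨ha.2, A.d_mem ha.1.2, A.d_d a⟩) ?_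
      rw [h1]
      exact mem_bd_top.2 ⟨u, B.W_mono (by omega) hu.1, hu.2, rfl⟩
    obtain ⟨a', ha'W, ha'g, ha'⟩ := mem_bd_top.1 hda
    have ha'g : a' ∈ A.gr n := ha'g
    have ha'W : a' ∈ A.W (p - 1) := A.W_mono (by omega) ha'W
    have hcl : A.d (a - a') = 0 := by rw [map_sub, ha', sub_self]
    obtain ⟨c, hc, hc'⟩ := hf.surj n (p - 1) (u - f a')
      (mem_cyc_top.2 ⟨sub_mem hu.1 (f.map_W _ _ ha'W), sub_mem hu.2 (f.map_gr _ _ ha'g), by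
        rw [map_sub, ← f.map_d, ha', h1, sub_self]⟩)
    rw [mem_cyc_top] at hc
    have h2 : a - a' - c ∈ A.bd ⊤ n (p + 1) := by
      refine hf.inj _ _ _ (mem_cyc_top.2 ⟨sub_mem (sub_mem ha.1.1
        (A.W_mono (by omega) ha'W)) (A.W_mono (by omega) hc.1), sub_mem
        (sub_mem ha.1.2 ha'g) hc.2.1, by rw [map_sub, hcl, hc.2.2, sub_zero]⟩) ?_
      have : f (a - a' - c) = (u - f a' - f c) + B.d v := by
        rw [map_sub, map_sub, e]; abel
      rw [this]
      exact add_mem (bd_mono _ _ (by omega) hc') (mem_bd_top.2 ⟨v, hv.1, hv.2, rfl⟩)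
    obtain ⟨w, hwW, _, hw⟩ := mem_bd_top.1 h2
    have : a = (a' + c) + A.d w := by rw [hw]; abel
    rw [this]
    exact add_mem (mem_sup_left (add_mem ha'W hc.1)) (mem_sup_right ⟨w, hwW, rfl⟩)
  · obtain ⟨c, hc, hc'⟩ := hf.surj (n + 1) (p - 2) (B.d b)
      (mem_cyc_top.2 ⟨hb.2, B.d_mem hb.1.2, B.d_d b⟩)
    rw [mem_cyc_top] at hc
    obtain ⟨e, heW, heg, he⟩ := mem_bd_top.1 hc'
    have heg : e ∈ B.gr n := heg
    have heW : e ∈ B.W (p - 1) := B.W_mono (by omega) heW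
    have h1 : f c = B.d (b - e) := by rw [map_sub, he]; abel
    have h2 : c ∈ A.bd ⊤ (n + 1) (p - 1 + 1) := by
      refine hf.inj _ _ _ (mem_cyc_top.2 ⟨A.W_mono (by omega) hc.1, hc.2⟩) ?_
      rw [h1, sub_add_cancel]
      exact mem_bd_top.2 ⟨b - e, sub_mem hb.1.1 (B.W_mono (by omega) heW), sub_mem hb.1.2 heg, rfl⟩
    obtain ⟨a, haW, hag, ha⟩ := mem_bd_top.1 h2
    have hag : a ∈ A.gr n := hag
    have haW : a ∈ A.W p := A.W_mono (by omega) haW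
    obtain ⟨c', hc1, hc2⟩ := hf.surj n p (b - e - f a) (mem_cyc_top.2 ⟨sub_mem (sub_mem hb.1.1
        (B.W_mono (by omega) heW)) (f.map_W _ _ haW), sub_mem (sub_mem
        hb.1.2 heg) (f.map_gr _ _ hag), by rw [map_sub, ← h1, ← ha, ← f.map_d, sub_self]⟩)
    rw [mem_cyc_top] at hc1
    obtain ⟨w, hwW, _, hw⟩ := mem_bd_top.1 hc2
    refine ⟨a + c', ⟨⟨add_mem haW hc1.1, add_mem hag hc1.2.1⟩, ?_⟩, ?_⟩
    · change A.d (a + c') ∈ A.W (p - 2)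
      rw [map_add, hc1.2.2, add_zero, ha]
      exact hc.1
    · have : b - f (a + c') = e + B.d w := by rw [hw, map_add]; abel
      rw [this]
      exact add_mem (mem_sup_left heW) (mem_sup_right ⟨w, hwW, rfl⟩)

lemma Hom.IsTrivFib.isDecQuasiIso {S : Submodule k A.carrier} {S' : Submodule k B.carrier}
    (hf : f.IsTrivFib S S') : f.IsDecQuasiIso S S' := by
  refine ⟨fun n p a ha hfa => ?_, fun n p b hb => ?_⟩
  · obtain ⟨b, hb, e⟩ := hfa
    obtain ⟨y, hy, hy', _⟩ := hf n p a ha b hb e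
    exact ⟨y, hy, hy'⟩
  · obtain ⟨y, hy, hy', hyb⟩ := hf (n + 1) (p - 1) 0 (zero_mem _) b
      ⟨⟨by rw [sub_add_cancel]; exact hb.1.1.1, hb.1.1.2⟩, hb.1.2⟩ (by
        rw [map_zero]; exact hb.2)
    refine ⟨y, ⟨⟨⟨by have := hy.1.1; rwa [sub_add_cancel] at this, hy.1.2⟩, hy.2⟩, hy'⟩, ?_⟩
    rw [hyb, sub_self]
    exact zero_mem _

/-- A map that is a quasi-isomorphism for the décalage is a quasi-isomorphism. -/
lemma Hom.IsDecQuasiIso.isQuasiIso (hf : f.IsDecQuasiIso ⊤ ⊤) : f.IsQuasiIso := by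
  intro n
  constructor
  · rw [injective_iff_map_eq_zero]
    intro c hc
    obtain ⟨x, rfl⟩ := mk_surjective _ c
    have h1 : f x.1 ∈ range B.d :=  (mk_eq_zero ((range B.d).submoduleOf _)).1 hc
    refine (mk_eq_zero _).2 ?_
    obtain ⟨y, hy⟩ := h1
    obtain ⟨p, hp⟩ := A.W_exhaustive x.1
    obtain ⟨q, hq⟩ := B.W_exhaustive y
    have h2 := hf.inj n (max p q) x.1 (mem_cyc_top.2 ⟨A.W_mono (le_max_left _ _) hp, x.2.1, x.2.2⟩)
      (by rw [← hy]
          refine mem_bd_top_of_gr (B.W_mono (by omega) hq) ?_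
          rw [hy]
          exact f.map_gr _ _ x.2.1)
    obtain ⟨v, _, _, hv⟩ := mem_bd_top.1 h2
    exact ⟨v, hv⟩
  · intro c
    obtain ⟨y, rfl⟩ := mk_surjective _ c
    obtain ⟨p, hp⟩ := B.W_exhaustive y.1
    obtain ⟨a, ha, hab⟩ := hf.surj n p y.1 (mem_cyc_top.2 ⟨hp, y.2.1, y.2.2⟩)
    rw [mem_cyc_top] at ha
    obtain ⟨v, _, _, hv⟩ := mem_bd_top.1 hab
    refine ⟨Submodule.Quotient.mk ⟨a, ha.2.1, ha.2.2⟩, (Submodule.Quotient.eq _).2 ?_⟩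
    refine ⟨-v, ?_⟩
    rw [map_neg, hv]
    change -(y.1 - f a) = f a - y.1
    abel

end FDGA

/-! ## Integration of polynomials -/

section Poly

variable {k : Type} [Field k] {R : Type*} [Ring R] [Algebra k R]

/-- The antiderivative of a polynomial without constant term. -/
def polyInt (k : Type) [Field k] {R : Type*} [Ring R] [Algebra k R] :
    Polynomial R →ₗ[k] Polynomial R :=
  Polynomial.lsum fun i => ((i + 1 : ℕ) : k)⁻¹ • (monomial (i + 1)).restrictScalars k

lemma polyInt_monomial (i : ℕ) (a : R) : polyInt k (monomial i a) =
    monomial (i + 1) ((((i + 1 : ℕ) : k)⁻¹) • a) := by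
  rw [polyInt, Polynomial.lsum_apply, Polynomial.sum_monomial_index _ _ (by simp only [map_zero]),
    ← Polynomial.smul_monomial]
  rfl

@[simp] lemma coeff_polyInt_zero (p : Polynomial R) : (polyInt k p).coeff 0 = 0 := by
  induction p using Polynomial.induction_on' with
  | add p q hp hq => rw [map_add, coeff_add, hp, hq, add_zero]
  | monomial i a => rw [polyInt_monomial, coeff_monomial, if_neg (by omega)]

@[simp] lemma coeff_polyInt_succ (p : Polynomial R) (n : ℕ) :
    (polyInt k p).coeff (n + 1) = (((n + 1 : ℕ) : k)⁻¹) • p.coeff n := by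
  induction p using Polynomial.induction_on' with
  | add p q hp hq => rw [map_add, coeff_add, hp, hq, coeff_add, smul_add]
  | monomial i a =>
    rw [polyInt_monomial, coeff_monomial, coeff_monomial]
    by_cases h : i = n
    · subst h; simp
    · rw [if_neg (by omega), if_neg h, smul_zero]

lemma derivative_polyInt [CharZero k] (p : Polynomial R) : derivative (polyInt k p) = p := by
  ext n
  rw [Polynomial.coeff_derivative, coeff_polyInt_succ, ← Nat.cast_succ, ← nsmul_eq_mul',
    ← Nat.cast_smul_eq_nsmul k, smul_smul, mul_inv_cancel₀ (Nat.cast_ne_zero.2 (Nat.succ_ne_zero n)),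
    one_smul]

lemma polyInt_derivative [CharZero k] (p : Polynomial R) :
    polyInt k (derivative p) = p - Polynomial.C (p.coeff 0) := by
  ext n
  cases n with
  | zero => simp
  | succ n =>
    rw [coeff_polyInt_succ, Polynomial.coeff_derivative, ← Nat.cast_succ, ← nsmul_eq_mul',
      ← Nat.cast_smul_eq_nsmul k, smul_smul,
      inv_mul_cancel₀ (Nat.cast_ne_zero.2 (Nat.succ_ne_zero n)), one_smul, Polynomial.coeff_sub,
      Polynomial.coeff_C_of_ne_zero (Nat.succ_ne_zero n), sub_zero]

lemma polyInt_mem {P : Submodule k R} {p : Polynomial R} (hp : p ∈ polySub P) :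
    polyInt k p ∈ polySub P := by
  intro i
  cases i with
  | zero => rw [coeff_polyInt_zero]; exact P.zero_mem
  | succ i => rw [coeff_polyInt_succ]; exact P.smul_mem _ (hp i)

lemma polyMap_polyInt {S : Type*} [Ring S] [Algebra k S] (f : R →ₗ[k] S) (p : Polynomial R) :
    polyMap f (polyInt k p) = polyInt k (polyMap f p) := by
  ext n
  cases n with
  | zero => simp
  | succ n => simp

lemma monomial_mem_polySub {P : Submodule k R} (i : ℕ) {a : R} (ha : a ∈ P) :
    monomial i a ∈ polySub P := by
  intro j
  rw [coeff_monomial]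
  split_ifs
  · exact ha
  · exact P.zero_mem

end Poly

namespace DGA

variable {k : Type} [Field k] (A : DGA.{u} k)

lemma sgn_sgn (x : A.carrier) : A.sgn (A.sgn x) = x := by
  induction x using DirectSum.Decomposition.inductionOn A.gr with
  | zero => simp
  | add a b ha hb => simp [ha, hb]
  | homogeneous a =>
    rw [A.sgn_of_mem a.2, map_smul, A.sgn_of_mem a.2, smul_smul, ← mul_pow]
    simp

lemma polySgn_polySgn (p : Polynomial A.carrier) : A.polySgn (A.polySgn p) = p := by
  ext n; simp [sgn_sgn]

/-- The path `a t^i`. -/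
def tpow (i : ℕ) : A.carrier →ₗ[k] A.PathCarrier where
  toFun a := (⟨monomial i a, 0⟩ : A.PathCarrier)
  map_add' x y := by
    refine PathCarrier.ext ?_ ?_
    · exact map_add _ x y
    · exact (add_zero (0 : Polynomial A.carrier)).symm
  map_smul' c x := by
    refine PathCarrier.ext ?_ ?_
    · exact (Polynomial.smul_monomial c i x).symm
    · exact (smul_zero c : c • (0 : Polynomial A.carrier) = 0).symm

/-- Integration along paths from `t = 0`. -/
def integ : A.PathCarrier →ₗ[k] A.PathCarrier where
  toFun x := (⟨A.polySgn (polyInt k x.2), 0⟩ : A.PathCarrier)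
  map_add' x y := by
    refine PathCarrier.ext ?_ ?_
    · change A.polySgn (polyInt k (x.2 + y.2)) = _
      rw [map_add, map_add]; rfl
    · exact (add_zero (0 : Polynomial A.carrier)).symm
  map_smul' c x := by
    refine PathCarrier.ext ?_ ?_
    · change A.polySgn (polyInt k (c • x.2)) = _
      rw [map_smul, polySgn_smul]; rfl
    · exact (smul_zero c : c • (0 : Polynomial A.carrier) = 0).symm

lemma d_integ_add [CharZero k] (x : A.PathCarrier) :
    A.pathD (A.integ x) + A.integ (A.pathD x) = x - A.pathConst (A.pathEval 0 x) := by
  have hev : A.pathEval 0 x = x.1.coeff 0 := by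
    change evalScalar A.carrier 0 x.1 = _
    rw [evalScalar_apply, map_zero, Polynomial.sum, Finset.sum_eq_single 0]
    · simp
    · intro i _ hi; simp [hi]
    · intro h; simpa using h
  rw [hev]
  refine PathCarrier.ext ?_ ?_
  · change polyMap A.d (A.polySgn (polyInt k x.2)) + A.polySgn (polyInt k
      (derivative (A.polySgn x.1) + polyMap A.d x.2)) =
      x.1 - Polynomial.C (x.1.coeff 0)
    rw [map_add, map_add, polyInt_derivative, polyMap_d_polySgn, polyMap_polyInt, map_sub,
      polySgn_polySgn, coeff_polySgn]
    have : A.polySgn (Polynomial.C (A.sgn (x.1.coeff 0))) = Polynomial.C (x.1.coeff 0) := by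
      simp [polySgn, sgn_sgn]
    rw [this]
    abel
  · change derivative (A.polySgn (A.polySgn (polyInt k x.2))) + polyMap A.d 0 + 0 = x.2 - 0
    rw [polySgn_polySgn, derivative_polyInt]
    simp

end DGA

namespace FDGA

variable {k : Type} [Field k] (A : FDGA.{u} k)

abbrev pathS (S : Submodule k A.carrier) : Submodule k A.path.carrier := A.pathSub S S

/-- The path `a t^i`. -/
def tpow (i : ℕ) : A.carrier →ₗ[k] A.path.carrier := A.toDGA.tpow i

/-- Integration along paths from `t = 0`. -/
def integ : A.path.carrier →ₗ[k] A.path.carrier := A.toDGA.integ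

variable {A}

@[simp] lemma evalAt_tpow (c : k) (i : ℕ) (a : A.carrier) : (A.evalAt c) (A.tpow i a) = c ^ i • a :=
  evalScalar_monomial c i a

@[simp] lemma evalAt_ι (c : k) (a : A.carrier) : (A.evalAt c) (A.ι a) = a := evalScalar_C c a

lemma tpow_mem_W (i : ℕ) {a : A.carrier} {p : ℤ} (ha : a ∈ A.W p) :
    A.tpow i a ∈ A.path.W p := ⟨monomial_mem_polySub i ha, zero_mem _⟩

lemma tpow_mem_gr (i : ℕ) {a : A.carrier} {n : ℕ} (ha : a ∈ A.gr n) :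
    A.tpow i a ∈ A.path.gr n := ⟨monomial_mem_polySub i ha, zero_mem _⟩

lemma tpow_mem_prevGr (i : ℕ) {a : A.carrier} {n : ℕ} (ha : a ∈ A.prevGr n) :
    A.tpow i a ∈ A.path.prevGr n := by
  cases n with
  | zero => rw [A.eq_zero_of_prevGr_zero ha, map_zero]; exact zero_mem _
  | succ n => exact tpow_mem_gr i ha

lemma tpow_mem_pathS (i : ℕ) {a : A.carrier} {S : Submodule k A.carrier} (ha : a ∈ S) :
    A.tpow i a ∈ A.pathS S := ⟨monomial_mem_polySub i ha, zero_mem _⟩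

lemma d_tpow_mem_W (i : ℕ) {a : A.carrier} {p : ℤ} (ha : a ∈ A.W (p + 1)) (hda : A.d a ∈ A.W p) :
    A.path.d (A.tpow i a) ∈ A.path.W p := by
  refine ⟨fun j => ?_, add_mem (A.toDGA.derivative_mem_polySub
    (A.toDGA.polySgn_mem_polySub proj_W (monomial_mem_polySub i ha))) fun j => ?_⟩
  · change (polyMap A.d (monomial i a)).coeff j ∈ _
    rw [coeff_polyMap, coeff_monomial]
    split_ifs
    · exact hda
    · rw [map_zero]; exact zero_mem _
  · change (polyMap A.d 0).coeff j ∈ A.W (p + 1)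
    rw [map_zero]
    exact zero_mem _

lemma d_mem_pathS {S : Submodule k A.carrier} (hS : ∀ x ∈ S, ∀ n, A.proj n x ∈ S)
    (hd : ∀ x ∈ S, A.d x ∈ S) {x : A.path.carrier} (hx : x ∈ A.pathS S) :
    A.path.d x ∈ A.pathS S :=
  ⟨A.polyMap_mem_polySub hd hx.1, add_mem (A.derivative_mem_polySub (A.polySgn_mem_polySub hS hx.1))
    (A.polyMap_mem_polySub hd hx.2)⟩

lemma integ_mem_W {p : ℤ} {x : A.path.carrier} (hx : x ∈ A.path.W p) :
    A.integ x ∈ A.path.W (p + 1) :=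
  ⟨A.toDGA.polySgn_mem_polySub proj_W (polyInt_mem hx.2), zero_mem _⟩

lemma integ_mem_prevGr {n : ℕ} {x : A.path.carrier} (hx : x ∈ A.path.gr n) :
    A.integ x ∈ A.path.prevGr n := by
  cases n with
  | zero =>
    have h0 : (x : A.toDGA.PathCarrier).2 = 0 := by
      ext i; exact A.eq_zero_of_prevGr_zero (hx.2 i)
    have : A.integ x = 0 := by
      refine DGA.PathCarrier.ext ?_ rfl
      change A.toDGA.polySgn (polyInt k (x : A.toDGA.PathCarrier).2) = 0
      rw [h0, map_zero, map_zero]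
    rw [this]
    exact zero_mem _
  | succ n => exact ⟨DGA.polySgn_mem (polyInt_mem hx.2), zero_mem _⟩

lemma integ_mem_pathS {S : Submodule k A.carrier} (hS : ∀ x ∈ S, ∀ n, A.proj n x ∈ S)
    {x : A.path.carrier} (hx : x ∈ A.pathS S) : A.integ x ∈ A.pathS S :=
  ⟨A.toDGA.polySgn_mem_polySub hS (polyInt_mem hx.2), zero_mem _⟩

lemma evalAt_zero_eq (x : A.path.carrier) : (A.evalAt 0) x = (x : A.PathCarrier).1.coeff 0 := by
  change evalScalar A.carrier 0 (x : A.PathCarrier).1 = _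
  rw [evalScalar_apply, map_zero, Polynomial.sum, Finset.sum_eq_single 0]
  · simp
  · intro i _ hi; simp [hi]
  · intro h; simpa using h

@[simp] lemma evalAt_zero_integ (x : A.path.carrier) : (A.evalAt 0) (A.integ x) = 0 := by
  rw [evalAt_zero_eq]
  change (A.toDGA.polySgn (polyInt k (x : A.toDGA.PathCarrier).2)).coeff 0 = 0
  simp

lemma d_integ_add [CharZero k] (x : A.path.carrier) : A.path.d (A.integ x) + A.integ (A.path.d x) =
      x - A.ι ((A.evalAt 0) x) :=
  A.toDGA.d_integ_add x

lemma d_integ_of_closed [CharZero k] {x : A.path.carrier} (hx : A.path.d x = 0) :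
    A.path.d (A.integ x) = x - A.ι ((A.evalAt 0) x) := by
  rw [← d_integ_add, hx, map_zero, add_zero]

lemma evalAt_mem_prevGr (c : k) {n : ℕ} {x : A.path.carrier} (hx : x ∈ A.path.prevGr n) :
    (A.evalAt c) x ∈ A.prevGr n := by
  cases n with
  | zero => rw [A.path.eq_zero_of_prevGr_zero hx, map_zero]; exact zero_mem _
  | succ n => exact (A.evalAt c).map_gr _ _ hx

lemma evalAt_mem_S (c : k) {S : Submodule k A.carrier} {x : A.path.carrier} (hx : x ∈ A.pathS S) :
    (A.evalAt c) x ∈ S := evalScalar_mem c hx.1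

lemma Hom.map_prevGr {B : FDGA.{u} k} (f : Hom A B) {n : ℕ} {x : A.carrier}
    (hx : x ∈ A.prevGr n) : f x ∈ B.prevGr n := by
  cases n with
  | zero => rw [A.eq_zero_of_prevGr_zero hx, map_zero]; exact zero_mem _
  | succ n => exact f.map_gr _ _ hx

lemma Hom.path_tpow {B : FDGA.{u} k} (f : Hom A B) (i : ℕ) (a : A.carrier) :
    f.path (A.tpow i a) = B.tpow i (f a) := by
  refine DGA.PathCarrier.ext ?_ ?_
  · exact map_monomial f.toAlgHom.toRingHom
  · exact Polynomial.map_zero f.toAlgHom.toRingHom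

lemma Hom.path_fst {B : FDGA.{u} k} (f : Hom A B) (x : A.path.carrier) (i : ℕ) :
    (f.path x : B.PathCarrier).1.coeff i = f ((x : A.PathCarrier).1.coeff i) :=
  coeff_map _ _

lemma Hom.path_snd {B : FDGA.{u} k} (f : Hom A B) (x : A.path.carrier) (i : ℕ) :
    (f.path x : B.PathCarrier).2.coeff i = f ((x : A.PathCarrier).2.coeff i) :=
  coeff_map _ _

lemma path_ext {x y : A.path.carrier}
    (h1 : ∀ i, (x : A.PathCarrier).1.coeff i = (y : A.PathCarrier).1.coeff i)
    (h2 : ∀ i, (x : A.PathCarrier).2.coeff i = (y : A.PathCarrier).2.coeff i) :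
    x = y :=
  DGA.PathCarrier.ext (Polynomial.ext h1) (Polynomial.ext h2)

lemma Hom.path_mem_pathS {B : FDGA.{u} k} (f : Hom A B) {S : Submodule k A.carrier}
    {S' : Submodule k B.carrier} (hS : ∀ x ∈ S, f x ∈ S') {x : A.path.carrier}
    (hx : x ∈ A.pathS S) : f.path x ∈ B.pathS S' := by
  refine ⟨fun i => ?_, fun i => ?_⟩
  · rw [f.path_fst]; exact hS _ (hx.1 i)
  · rw [f.path_snd]; exact hS _ (hx.2 i)

lemma evalAt_path {B : FDGA.{u} k} (f : Hom A B) (c : k) (x : A.path.carrier) :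
    (B.evalAt c) (f.path x) = f ((A.evalAt c) x) :=
  congrArg (fun g : Hom A.path B => g x) (path_comp_evalAt f c)

lemma Hom.map_proj {A C : FDGA.{u} k} (f : Hom A C) (n : ℕ) (x : A.carrier) :
    f (A.proj n x) = C.proj n (f x) := by
  induction x using DirectSum.Decomposition.inductionOn A.gr with
  | zero => simp
  | add a b ha hb => simp only [map_add, ha, hb]
  | @homogeneous i a =>
    by_cases h : i = n
    · subst h
      rw [A.proj_of_mem a.2, C.proj_of_mem (f.map_gr _ _ a.2)]
    · rw [A.proj_of_mem_ne h a.2, C.proj_of_mem_ne h (f.map_gr _ _ a.2), map_zero]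

/-- The inverse of a bijective morphism that reflects the weight filtration. -/
def Hom.inverse {B : FDGA.{u} k} (f : Hom A B) (hf : Bijective f.toAlgHom)
    (hW : ∀ p x, f.toAlgHom x ∈ B.W p → x ∈ A.W p) : Hom B A where
  toAlgHom := (AlgEquiv.ofBijective f.toAlgHom hf).symm.toAlgHom
  map_gr n y hy := by
    obtain ⟨x, rfl⟩ := hf.2 y
    have e : (AlgEquiv.ofBijective f.toAlgHom hf).symm.toAlgHom (f.toAlgHom x) = x :=
      (AlgEquiv.ofBijective f.toAlgHom hf).symm_apply_apply x
    rw [e]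
    have h : f.toAlgHom (A.proj n x) = f.toAlgHom x := by
      rw [f.map_proj, B.proj_of_mem hy]
    rw [← hf.1 h]
    exact A.proj_mem n x
  map_d y := by
    obtain ⟨x, rfl⟩ := hf.2 y
    have e : ∀ x, (AlgEquiv.ofBijective f.toAlgHom hf).symm.toAlgHom (f.toAlgHom x) = x :=
      (AlgEquiv.ofBijective f.toAlgHom hf).symm_apply_apply
    rw [e, ← f.map_d, e]
  map_W p y hy := by
    obtain ⟨x, rfl⟩ := hf.2 y
    have e : (AlgEquiv.ofBijective f.toAlgHom hf).symm.toAlgHom (f.toAlgHom x) = x :=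
      (AlgEquiv.ofBijective f.toAlgHom hf).symm_apply_apply x
    rw [e]
    exact hW p x hy

lemma Hom.comp_inverse {B : FDGA.{u} k} (f : Hom A B) (hf : Bijective f.toAlgHom)
    (hW : ∀ p x, f.toAlgHom x ∈ B.W p → x ∈ A.W p) : f.comp (f.inverse hf hW) = Hom.id A :=
  Hom.ext (AlgHom.ext fun x => (AlgEquiv.ofBijective f.toAlgHom hf).symm_apply_apply x)

lemma Hom.inverse_comp {B : FDGA.{u} k} (f : Hom A B) (hf : Bijective f.toAlgHom)
    (hW : ∀ p x, f.toAlgHom x ∈ B.W p → x ∈ A.W p) : (f.inverse hf hW).comp f = Hom.id B :=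
  Hom.ext (AlgHom.ext fun x => (AlgEquiv.ofBijective f.toAlgHom hf).apply_symm_apply x)

end FDGA

/-- Projections on graded pieces that determine a grading. -/
abbrev gradedAlgebraOfProj {k X : Type*} [Field k] [Ring X] [Algebra k X] (gr : ℕ → Submodule k X)
    [SetLike.GradedMonoid gr] (π : ℕ → X →ₗ[k] X) (h1 : ∀ n, ∀ x ∈ gr n, π n x = x)
    (h2 : ∀ m n, m ≠ n → ∀ x ∈ gr m, π n x = 0) (h3 : ∀ x, x ∈ ⨆ n, gr n) : GradedAlgebra gr :=
  have : DirectSum.IsInternal gr := by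
    rw [DirectSum.isInternal_submodule_iff_iSupIndep_and_iSup_eq_top]
    refine ⟨?_, Submodule.eq_top_iff'.2 h3⟩
    intro n
    rw [Submodule.disjoint_def]
    intro x hx hx'
    rw [← h1 n x hx]
    have : (⨆ (j) (_ : j ≠ n), gr j) ≤ ker (π n) := iSup₂_le fun j hj y hy => h2 j n hj y hy
    exact this hx'
  { this.chooseDecomposition, (inferInstance : SetLike.GradedMonoid gr) with }

namespace FDGA

variable {k : Type} [Field k]

section Pullback

variable {A B C : FDGA.{u} k} (f : Hom A C) (g : Hom B C)

def pullbackAlg : Subalgebra k (A.carrier × B.carrier) :=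
  AlgHom.equalizer (f.toAlgHom.comp (AlgHom.fst k _ _)) (g.toAlgHom.comp (AlgHom.snd k _ _))

variable {f g} in
lemma mem_pullbackAlg {x : A.carrier × B.carrier} : x ∈ pullbackAlg f g ↔ f x.1 = g x.2 := Iff.rfl

/-- The pairs with components in given subspaces. -/
def pairSub (P : Submodule k A.carrier) (Q : Submodule k B.carrier) :
    Submodule k (pullbackAlg f g) :=
  (P.prod Q).comap (pullbackAlg f g).val.toLinearMap

variable {f g} in
lemma mem_pairSub {P : Submodule k A.carrier} {Q : Submodule k B.carrier}
    {x : pullbackAlg f g} : x ∈ pairSub f g P Q ↔ x.1.1 ∈ P ∧ x.1.2 ∈ Q := Iff.rfl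

def pairMap (a : A.carrier →ₗ[k] A.carrier) (b : B.carrier →ₗ[k] B.carrier)
    (h : ∀ x ∈ pullbackAlg f g, f (a x.1) = g (b x.2)) :
    pullbackAlg f g →ₗ[k] pullbackAlg f g where
  toFun x := ⟨(a x.1.1, b x.1.2), h x.1 x.2⟩
  map_add' _ _ := Subtype.ext (Prod.ext (map_add a _ _) (map_add b _ _))
  map_smul' _ _ := Subtype.ext (Prod.ext (map_smul a _ _) (map_smul b _ _))

/-- The projections of a fibre product to its homogeneous components. -/
def pullbackProj (n : ℕ) : pullbackAlg f g →ₗ[k] pullbackAlg f g :=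
  pairMap f g (A.proj n) (B.proj n) fun x hx => by
    rw [f.map_proj, g.map_proj, mem_pullbackAlg.1 hx]

instance : SetLike.GradedMonoid fun n => pairSub f g (A.gr n) (B.gr n) where
  one_mem := ⟨SetLike.GradedOne.one_mem (A := A.gr), SetLike.GradedOne.one_mem (A := B.gr)⟩
  mul_mem _ _ _ _ hx hy := ⟨DGA.mul_mem_gr hx.1 hy.1, DGA.mul_mem_gr hx.2 hy.2⟩

instance : GradedAlgebra fun n => pairSub f g (A.gr n) (B.gr n) :=
  gradedAlgebraOfProj _ (pullbackProj f g)
    (fun n x hx => Subtype.ext (Prod.ext (A.proj_of_mem hx.1) (B.proj_of_mem hx.2)))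
    (fun m n h x hx => Subtype.ext (Prod.ext (A.proj_of_mem_ne h hx.1) (B.proj_of_mem_ne h hx.2)))
    (fun x => by
      classical
      have e : x = ∑ n ∈ (DirectSum.decompose A.gr x.1.1).support ∪
          (DirectSum.decompose B.gr x.1.2).support, pullbackProj f g n x := by
        refine Subtype.ext (Prod.ext ?_ ?_)
        · rw [AddSubmonoidClass.coe_finsetSum, Prod.fst_sum]
          conv_lhs => rw [← DirectSum.sum_support_decompose A.gr x.1.1]
          refine Finset.sum_subset Finset.subset_union_left fun n _ hn => ?_
          change (DirectSum.decompose A.gr x.1.1 n : A.carrier) = 0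
          simpa using hn
        · rw [AddSubmonoidClass.coe_finsetSum, Prod.snd_sum]
          conv_lhs => rw [← DirectSum.sum_support_decompose B.gr x.1.2]
          refine Finset.sum_subset Finset.subset_union_right fun n _ hn => ?_
          change (DirectSum.decompose B.gr x.1.2 n : B.carrier) = 0
          simpa using hn
      rw [e]
      refine sum_mem fun n _ => mem_iSup_of_mem n ?_
      exact ⟨A.proj_mem n _, B.proj_mem n _⟩)

def pullbackDGA : DGA.{u} k where
  carrier := pullbackAlg f g
  gr n := pairSub f g (A.gr n) (B.gr n)
  d := pairMap f g A.d B.d fun x hx => by rw [f.map_d, g.map_d, mem_pullbackAlg.1 hx]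
  d_mem hx := ⟨A.d_mem hx.1, B.d_mem hx.2⟩
  d_d x := Subtype.ext (Prod.ext (A.d_d _) (B.d_d _))
  leibniz hx y := Subtype.ext (Prod.ext (A.leibniz hx.1 _) (B.leibniz hx.2 _))
  comm hx hy := Subtype.ext (Prod.ext (A.comm hx.1 hy.1) (B.comm hx.2 hy.2))

lemma pullbackDGA_proj (n : ℕ) (x : (pullbackDGA f g).carrier) :
    (pullbackDGA f g).proj n x = pullbackProj f g n x :=
  (pullbackDGA f g).decompose_eq (pullbackProj f g)
    (fun _ _ hx => Subtype.ext (Prod.ext (A.proj_of_mem hx.1) (B.proj_of_mem hx.2)))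
    (fun _ _ h _ hx => Subtype.ext
      (Prod.ext (A.proj_of_mem_ne h hx.1) (B.proj_of_mem_ne h hx.2))) n x

lemma proj_mem_pairSub {P : Submodule k A.carrier} {Q : Submodule k B.carrier}
    (hP : ∀ x ∈ P, ∀ n, A.proj n x ∈ P) (hQ : ∀ x ∈ Q, ∀ n, B.proj n x ∈ Q)
    {x : (pullbackDGA f g).carrier} (hx : x ∈ pairSub f g P Q) (n : ℕ) :
    (pullbackDGA f g).proj n x ∈ pairSub f g P Q := by
  rw [pullbackDGA_proj]
  exact ⟨hP _ hx.1 n, hQ _ hx.2 n⟩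

def pullback : FDGA.{u} k where
  toDGA := pullbackDGA f g
  W p := pairSub f g (A.W p) (B.W p)
  W_mono _ _ h _ hx := ⟨A.W_mono h hx.1, B.W_mono h hx.2⟩
  proj_mem_W hx n := proj_mem_pairSub f g proj_W proj_W hx n
  one_mem_W := ⟨A.one_mem_W, B.one_mem_W⟩
  mul_mem_W hx hy := ⟨A.mul_mem_W hx.1 hy.1, B.mul_mem_W hx.2 hy.2⟩
  d_mem_W hx := ⟨A.d_mem_W hx.1, B.d_mem_W hx.2⟩
  W_regular n := by
    obtain ⟨q, hq⟩ := A.exists_W_eq_bot n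
    obtain ⟨q', hq'⟩ := B.exists_W_eq_bot n
    refine ⟨min q q', (Submodule.eq_bot_iff _).2 fun x hx => Subtype.ext (Prod.ext ?_ ?_)⟩
    · exact hq _ (min_le_left _ _) _ ⟨hx.1.1, hx.2.1⟩
    · exact hq' _ (min_le_right _ _) _ ⟨hx.1.2, hx.2.2⟩
  W_exhaustive x := by
    obtain ⟨p, hp⟩ := A.W_exhaustive x.1.1
    obtain ⟨q, hq⟩ := B.W_exhaustive x.1.2
    exact ⟨max p q, A.W_mono (le_max_left p q) hp, B.W_mono (le_max_right p q) hq⟩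

def pullbackFst : Hom (pullback f g) A :=
  ⟨(AlgHom.fst k _ _).comp (pullbackAlg f g).val, fun _ _ hx => hx.1, fun _ => rfl,
    fun _ _ hx => hx.1⟩

def pullbackSnd : Hom (pullback f g) B :=
  ⟨(AlgHom.snd k _ _).comp (pullbackAlg f g).val, fun _ _ hx => hx.2, fun _ => rfl,
    fun _ _ hx => hx.2⟩

lemma pullback_condition : (pullbackFst f g).comp f = (pullbackSnd f g).comp g :=
  Hom.ext (AlgHom.ext fun x => x.2)

variable {f g}

def pullbackMk (a : A.carrier) (b : B.carrier) (h : f a = g b) :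
    (pullback f g).carrier := (⟨(a, b), h⟩ : pullbackAlg f g)

@[simp] lemma pullbackFst_mk (a : A.carrier) (b : B.carrier) (h : f a = g b) :
    (pullbackFst f g) (pullbackMk a b h) = a := rfl

@[simp] lemma pullbackSnd_mk (a : A.carrier) (b : B.carrier) (h : f a = g b) :
    (pullbackSnd f g) (pullbackMk a b h) = b := rfl

lemma pullback_ext {x y : (pullback f g).carrier} (h1 : (pullbackFst f g) x = (pullbackFst f g) y)
    (h2 : (pullbackSnd f g) x = (pullbackSnd f g) y) : x = y :=
  Subtype.ext (Prod.ext h1 h2)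

lemma pullback_cond_apply (x : (pullback f g).carrier) :
    f ((pullbackFst f g) x) = g ((pullbackSnd f g) x) := x.2

lemma pullbackHom_ext {Z : FDGA.{u} k} {x y : Hom Z (pullback f g)}
    (h1 : x.comp (pullbackFst f g) = y.comp (pullbackFst f g))
    (h2 : x.comp (pullbackSnd f g) = y.comp (pullbackSnd f g)) : x = y :=
  Hom.ext (AlgHom.ext fun z => pullback_ext
    (congrArg (fun h : Hom Z A => h z) h1) (congrArg (fun h : Hom Z B => h z) h2))

def pullbackLift {Z : FDGA.{u} k} (a : Hom Z A) (b : Hom Z B) (h : a.comp f = b.comp g) :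
    Hom Z (pullback f g) where
  toAlgHom := (AlgHom.prod a.toAlgHom b.toAlgHom).codRestrict (pullbackAlg f g)
    fun z => congrArg (fun h : Hom Z C => h.toAlgHom z) h
  map_gr n x hx := ⟨a.map_gr n x hx, b.map_gr n x hx⟩
  map_d x := Subtype.ext (Prod.ext (a.map_d x) (b.map_d x))
  map_W p x hx := ⟨a.map_W p x hx, b.map_W p x hx⟩

lemma mk_mem_prevGr {a : A.carrier} {b : B.carrier} (h : f a = g b) {n : ℕ}
    (ha : a ∈ A.prevGr n) (hb : b ∈ B.prevGr n) : pullbackMk a b h ∈ (pullback f g).prevGr n := by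
  cases n with
  | zero =>
    have h1 := A.eq_zero_of_prevGr_zero ha
    have h2 := B.eq_zero_of_prevGr_zero hb
    have : pullbackMk a b h = 0 := pullback_ext (by rw [pullbackFst_mk, h1, map_zero])
      (by rw [pullbackSnd_mk, h2, map_zero])
    rw [this]; exact zero_mem _
  | succ n => exact ⟨ha, hb⟩

/-! ### Paths in a fibre product -/

variable (f g)

/-- The comparison of paths in a fibre product with pairs of paths. -/
def pullbackPath : Hom (pullback f g).path (pullback f.path g.path) :=
  pullbackLift (pullbackFst f g).path (pullbackSnd f g).path <| by
    refine Hom.ext (AlgHom.ext fun x => path_ext (fun i => ?_) fun i => ?_)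
    · change (f.path _ : C.PathCarrier).1.coeff i = (g.path _ : C.PathCarrier).1.coeff i
      refine (f.path_fst _ i).trans (Eq.trans ?_ (g.path_fst _ i).symm)
      exact (congrArg f ((pullbackFst f g).path_fst x i)).trans
        ((pullback_cond_apply _).trans (congrArg g ((pullbackSnd f g).path_fst x i)).symm)
    · change (f.path _ : C.PathCarrier).2.coeff i = (g.path _ : C.PathCarrier).2.coeff i
      refine (f.path_snd _ i).trans (Eq.trans ?_ (g.path_snd _ i).symm)
      exact (congrArg f ((pullbackFst f g).path_snd x i)).trans
        ((pullback_cond_apply _).trans (congrArg g ((pullbackSnd f g).path_snd x i)).symm)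

lemma exists_pairPoly (p : Polynomial A.carrier) (q : Polynomial B.carrier)
    (h : ∀ i, f (p.coeff i) = g (q.coeff i)) :
    ∃ r : Polynomial (pullback f g).carrier, ∀ i, r.coeff i = pullbackMk _ _ (h i) := by
  classical
  refine ⟨∑ i ∈ p.support ∪ q.support, monomial i (pullbackMk _ _ (h i)), fun i => ?_⟩
  simp only [Polynomial.finsetSum_coeff, coeff_monomial, Finset.sum_ite_eq']
  split_ifs with hi
  · rfl
  · simp only [Finset.mem_union, Polynomial.mem_support_iff, not_or, not_not] at hi
    exact pullback_ext (by rw [pullbackFst_mk, hi.1, map_zero])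
      (by rw [pullbackSnd_mk, hi.2, map_zero])

lemma pullbackPath_bijective : Bijective (pullbackPath f g).toAlgHom := by
  constructor
  · intro x y hxy
    have h1 : (pullbackFst f g).path.toAlgHom x = (pullbackFst f g).path.toAlgHom y :=
      congrArg (pullbackFst f.path g.path).toAlgHom hxy
    have h2 : (pullbackSnd f g).path.toAlgHom x = (pullbackSnd f g).path.toAlgHom y :=
      congrArg (pullbackSnd f.path g.path).toAlgHom hxy
    refine path_ext (fun i => pullback_ext ?_ ?_) fun i => pullback_ext ?_ ?_
    · rw [← Hom.path_fst, h1, Hom.path_fst]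
    · rw [← Hom.path_fst, h2, Hom.path_fst]
    · rw [← Hom.path_snd, h1, Hom.path_snd]
    · rw [← Hom.path_snd, h2, Hom.path_snd]
  · intro z
    have hz := pullback_cond_apply z
    obtain ⟨r, hr⟩ := exists_pairPoly f g ((pullbackFst f.path g.path).toAlgHom z : A.PathCarrier).1
      ((pullbackSnd f.path g.path).toAlgHom z : B.PathCarrier).1 fun i => by
        have := congrArg (fun x : C.PathCarrier => x.1.coeff i) hz
        exact ((f.path_fst _ i).symm.trans this).trans (g.path_fst _ i)
    obtain ⟨s, hs⟩ := exists_pairPoly f g ((pullbackFst f.path g.path).toAlgHom z : A.PathCarrier).2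
      ((pullbackSnd f.path g.path).toAlgHom z : B.PathCarrier).2 fun i => by
        have := congrArg (fun x : C.PathCarrier => x.2.coeff i) hz
        exact ((f.path_snd _ i).symm.trans this).trans (g.path_snd _ i)
    refine ⟨(⟨r, s⟩ : (pullback f g).PathCarrier), pullback_ext ?_ ?_⟩
    · refine path_ext (fun i => ?_) fun i => ?_
      · refine ((pullbackFst f g).path_fst _ i).trans ?_
        exact congrArg (pullbackFst f g).toAlgHom (hr i)
      · refine ((pullbackFst f g).path_snd _ i).trans ?_
        exact congrArg (pullbackFst f g).toAlgHom (hs i)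
    · refine path_ext (fun i => ?_) fun i => ?_
      · refine ((pullbackSnd f g).path_fst _ i).trans ?_
        exact congrArg (pullbackSnd f g).toAlgHom (hr i)
      · refine ((pullbackSnd f g).path_snd _ i).trans ?_
        exact congrArg (pullbackSnd f g).toAlgHom (hs i)

def pathPullback : Hom (pullback f.path g.path) (pullback f g).path :=
  (pullbackPath f g).inverse (pullbackPath_bijective f g) fun p x hx => by
    refine ⟨fun i => ⟨?_, ?_⟩, fun i => ⟨?_, ?_⟩⟩
    · exact (congrArg (· ∈ A.W _) ((pullbackFst f g).path_fst x i)).mp (hx.1.1 i)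
    · exact (congrArg (· ∈ B.W _) ((pullbackSnd f g).path_fst x i)).mp (hx.2.1 i)
    · exact (congrArg (· ∈ A.W _) ((pullbackFst f g).path_snd x i)).mp (hx.1.2 i)
    · exact (congrArg (· ∈ B.W _) ((pullbackSnd f g).path_snd x i)).mp (hx.2.2 i)

variable {f g}

/-- A pair of morphisms to path objects as a morphism to the path object of a fibre product. -/
def pathLift {Z : FDGA.{u} k} (a : Hom Z A.path) (b : Hom Z B.path)
    (h : a.comp f.path = b.comp g.path) : Hom Z (pullback f g).path :=
  (pullbackLift a b h).comp (pathPullback f g)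

lemma pathLift_fst {Z : FDGA.{u} k} (a : Hom Z A.path) (b : Hom Z B.path)
    (h : a.comp f.path = b.comp g.path) :
    (pathLift a b h).comp (pullbackFst f g).path = a := by
  have : (pathPullback f g).comp (pullbackPath f g) = Hom.id _ := Hom.inverse_comp _ _ _
  change (pullbackLift a b h).comp ((pathPullback f g).comp ((pullbackPath f g).comp
    (pullbackFst f.path g.path))) = a
  rw [← Hom.comp_assoc (pathPullback f g), this]
  rfl

lemma pathLift_snd {Z : FDGA.{u} k} (a : Hom Z A.path) (b : Hom Z B.path)
    (h : a.comp f.path = b.comp g.path) :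
    (pathLift a b h).comp (pullbackSnd f g).path = b := by
  have : (pathPullback f g).comp (pullbackPath f g) = Hom.id _ := Hom.inverse_comp _ _ _
  change (pullbackLift a b h).comp ((pathPullback f g).comp ((pullbackPath f g).comp
    (pullbackSnd f.path g.path))) = b
  rw [← Hom.comp_assoc (pathPullback f g), this]
  rfl

end Pullback

section TrivFib

variable {A B : FDGA.{u} k} (w : Hom A B)

/-- The mapping path object `A ×_B P(B)`. -/
abbrev mapPath : FDGA.{u} k := pullback w (B.evalAt 0)

/-- The end point of a path. -/
abbrev mapPathEnd : Hom (mapPath w) B := (pullbackSnd w (B.evalAt 0)).comp (B.evalAt 1)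

variable (S : Submodule k A.carrier) (S' : Submodule k B.carrier)

/-- The subspace of the mapping path object induced by subspaces of `A` and `B`. -/
abbrev mapPathS : Submodule k (mapPath w).carrier := pairSub w (B.evalAt 0) S (B.pathS S')

variable {w S S'} [CharZero k]

lemma mapPath_fst_isTrivFib (hw : ∀ x ∈ S, w x ∈ S') (hS' : ∀ x ∈ S', ∀ n, B.proj n x ∈ S') :
    (pullbackFst w (B.evalAt 0)).IsTrivFib (mapPathS w S S') S := by
  intro n p z hz a ha hda
  set β := (pullbackSnd w (B.evalAt 0)) z with hβ
  have hβd : B.path.d β = 0 := by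
    rw [hβ, ← Hom.map_d, show (mapPath w).d z = 0 from hz.2, map_zero]
  have hcond : w (A.d a) = (B.evalAt 0) β := by
    rw [hda, hβ, pullback_cond_apply]
  refine ⟨pullbackMk a (B.integ β + B.ι (w a)) (by
    rw [map_add, evalAt_zero_integ, evalAt_ι, zero_add]), ⟨⟨⟨ha.1.1, ?_⟩, ?_⟩, ⟨ha.2, ?_⟩⟩, ?_, rfl⟩
  · exact add_mem (integ_mem_W hz.1.1.1.2) (B.ι.map_W _ _ (w.map_W _ _ ha.1.1))
  · exact mk_mem_prevGr _ ha.1.2 (add_mem (integ_mem_prevGr hz.1.1.2.2)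
      (B.ι.map_prevGr (w.map_prevGr ha.1.2)))
  · exact add_mem (integ_mem_pathS hS' hz.1.2.2) (tpow_mem_pathS 0 (hw _ ha.2))
  · refine pullback_ext hda ?_
    change B.path.d (B.integ β + B.ι (w a)) = β
    rw [map_add, d_integ_of_closed hβd, ← B.ι.map_d, ← w.map_d, hcond, sub_add_cancel]

lemma mapPathEnd_isTrivFib (hQ : w.IsDecQuasiIso S S')
    (hw : ∀ x ∈ S, w x ∈ S') (hS' : ∀ x ∈ S', ∀ n, B.proj n x ∈ S')
    (hd : ∀ x ∈ S', B.d x ∈ S') :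
    (mapPathEnd w).IsTrivFib (mapPathS w S S') S' := by
  intro n p z hz b hb hdb
  set β := (pullbackSnd w (B.evalAt 0)) z with hβ
  set a := (pullbackFst w (B.evalAt 0)) z with ha
  have hβd : B.path.d β = 0 := by
    rw [hβ, ← Hom.map_d, show (mapPath w).d z = 0 from hz.2, map_zero]
  have hcond : w a = (B.evalAt 0) β := pullback_cond_apply z
  have hdI := d_integ_of_closed hβd
  have hI1 : B.d ((B.evalAt 1) (B.integ β)) = (B.evalAt 1) β - w a := by
    rw [← Hom.map_d, hdI, map_sub, evalAt_ι, hcond]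
  have hdb' : B.d b = (B.evalAt 1) β := hdb
  set c₀ := b - (B.evalAt 1) (B.integ β) with hc₀
  have hc₀d : B.d c₀ = w a := by rw [hc₀, map_sub, hI1, hdb']; abel
  have hIW : (B.integ β) ∈ B.path.W (p + 1) := integ_mem_W hz.1.1.1.2
  have hIg : (B.integ β) ∈ B.path.prevGr n := integ_mem_prevGr hz.1.1.2.2
  have hIS : (B.integ β) ∈ B.pathS S' := integ_mem_pathS hS' hz.1.2.2
  have hc₀m : c₀ ∈ B.W (p + 1) ⊓ B.prevGr n ⊓ S' := ⟨⟨sub_mem hb.1.1 ((B.evalAt 1).map_W _ _ hIW),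
      sub_mem hb.1.2 (evalAt_mem_prevGr 1 hIg)⟩,
      sub_mem hb.2 (evalAt_mem_S 1 hIS)⟩
  obtain ⟨a₁, ha₁, hda₁⟩ := hQ.inj n p a ⟨⟨⟨hz.1.1.1.1, hz.1.1.2.1⟩, hz.1.2.1⟩, by
    change A.d a = 0
    rw [ha, ← Hom.map_d, show (mapPath w).d z = 0 from hz.2, map_zero]⟩ ⟨c₀, hc₀m, hc₀d⟩
  have key : ∃ c ∈ A.W (p + 1) ⊓ A.prevGr n ⊓ S, A.d c = 0 ∧ ∃ y ∈ B.path.W (p + 1) ⊓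
      B.path.prevGr n ⊓ B.pathS S', B.path.d y = 0 ∧ (B.evalAt 0) y = 0 ∧
      (B.evalAt 1) y = c₀ - w a₁ - w c := by
    cases n with
    | zero =>
      refine ⟨0, zero_mem _, by simp, 0, zero_mem _, by simp, by simp, ?_⟩
      rw [B.eq_zero_of_prevGr_zero hc₀m.1.2, A.eq_zero_of_prevGr_zero ha₁.1.2]
      simp
    | succ m =>
      obtain ⟨c, hc, e, he, hce⟩ := hQ.surj m (p + 1) (c₀ - w a₁)
        ⟨⟨⟨sub_mem hc₀m.1.1 (w.map_W _ _ ha₁.1.1), sub_mem hc₀m.1.2 (w.map_gr _ _ ha₁.1.2)⟩,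
          sub_mem hc₀m.2 (hw _ ha₁.2)⟩, by
          change B.d (c₀ - w a₁) = 0
          rw [map_sub, hc₀d, ← w.map_d, hda₁, sub_self]⟩
      have hde : B.d e ∈ B.W (p + 1) := by
        rw [hce]
        exact sub_mem (sub_mem hc₀m.1.1 (w.map_W _ _ ha₁.1.1)) (w.map_W _ _ hc.1.1.1)
      refine ⟨c, hc.1, hc.2, B.path.d (B.tpow 1 e), ⟨⟨d_tpow_mem_W 1 he.1.1 hde,
        B.path.d_mem_prev (tpow_mem_prevGr 1 he.1.2)⟩,
        d_mem_pathS hS' hd (tpow_mem_pathS 1 he.2)⟩, B.path.d_d _, ?_, ?_⟩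
      · rw [Hom.map_d, evalAt_tpow]; simp
      · rw [Hom.map_d, evalAt_tpow, one_pow, one_smul, hce]
  obtain ⟨c, hc, hcd, y, hy, hyd, hy0, hy1⟩ := key
  have hwc : w (A.d (a₁ + c)) = (B.evalAt 0) β := by
    rw [map_add, hda₁, hcd, add_zero, hcond]
  have hac : a₁ + c ∈ A.W (p + 1) ⊓ A.prevGr n ⊓ S := add_mem ha₁ hc
  refine ⟨pullbackMk (a₁ + c) (B.integ β + B.ι (w (a₁ + c)) + y) (by
    rw [map_add (B.evalAt 0).toAlgHom, map_add (B.evalAt 0).toAlgHom, evalAt_zero_integ,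
      evalAt_ι, zero_add, hy0, add_zero]),
    ⟨⟨⟨hac.1.1, ?_⟩, ?_⟩, ⟨hac.2, ?_⟩⟩, ?_, ?_⟩
  · exact add_mem (add_mem hIW (B.ι.map_W _ _ (w.map_W _ _ hac.1.1))) hy.1.1
  · exact mk_mem_prevGr _ hac.1.2 (add_mem (add_mem hIg
      (B.ι.map_prevGr (w.map_prevGr hac.1.2))) hy.1.2)
  · exact add_mem (add_mem hIS (tpow_mem_pathS 0 (hw _ hac.2))) hy.2
  · refine pullback_ext ?_ ?_
    · change A.d (a₁ + c) = a
      rw [map_add, hda₁, hcd, add_zero]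
    · change B.path.d (B.integ β + B.ι (w (a₁ + c)) + y) = β
      rw [map_add B.path.d, map_add B.path.d, hdI, ← B.ι.map_d, ← w.map_d, hwc, hyd, add_zero, sub_add_cancel]
  · change (B.evalAt 1) (B.integ β + B.ι (w (a₁ + c)) + y) = b
    rw [map_add (B.evalAt 1).toAlgHom, map_add (B.evalAt 1).toAlgHom, evalAt_ι, hy1, hc₀,
      map_add w.toAlgHom]
    abel

end TrivFib

section PathFib

variable {E B : FDGA.{u} k} (π : Hom E B)

/-- `E ×_B P(B) ×_B E`: paths in `B` with lifts of the end points. -/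
abbrev endPaths : FDGA.{u} k := pullback (mapPathEnd π) π

/-- The morphism `P(E) → E ×_B P(B) ×_B E`. -/
def toEndPaths : Hom E.path (endPaths π) :=
  pullbackLift (pullbackLift (E.evalAt 0) π.path (path_comp_evalAt π 0).symm) (E.evalAt 1)
    (path_comp_evalAt π 1)

variable (S : Submodule k E.carrier) (S' : Submodule k B.carrier)

/-- The subspace of `E ×_B P(B) ×_B E` induced by subspaces of `E` and `B`. -/
abbrev endPathsS : Submodule k (endPaths π).carrier := pairSub (mapPathEnd π) π (mapPathS π S S') S

variable {π S S'}

lemma Hom.IsTrivFib.exists_lift (hπ : π.IsTrivFib S S') (hd : ∀ x ∈ S', B.d x ∈ S') {n : ℕ} {p : ℤ}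
    {b : B.carrier} (hb : b ∈ B.W (p + 1) ⊓ B.prevGr n ⊓ S') (hdb : B.d b ∈ B.W p) :
    ∃ y ∈ E.W (p + 1) ⊓ E.prevGr n ⊓ S, E.d y ∈ E.W p ∧ π y = b := by
  obtain ⟨z, hz, hzd, hzb⟩ := hπ (n + 1) (p - 1) 0 (zero_mem _) (B.d b)
    ⟨⟨by rwa [sub_add_cancel], B.d_mem_prev hb.1.2⟩, hd _ hb.2⟩ (by rw [B.d_d, map_zero])
  rw [sub_add_cancel] at hz
  obtain ⟨y, hy, hyd, hyb⟩ := hπ n p z ⟨hz, hzd⟩ b hb hzb.symm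
  exact ⟨y, hy, by rw [hyd]; exact hz.1.1, hyb⟩

variable [CharZero k]

lemma toEndPaths_isTrivFib (hπ : π.IsTrivFib S S') (hπS : ∀ x ∈ S, π.toAlgHom x ∈ S')
    (hS : ∀ x ∈ S, ∀ n, E.proj n x ∈ S) (hdS : ∀ x ∈ S, E.d x ∈ S)
    (hS' : ∀ x ∈ S', ∀ n, B.proj n x ∈ S')
    (hd : ∀ x ∈ S', B.d x ∈ S') : (toEndPaths π).IsTrivFib (E.pathS S) (endPathsS π S S') := by
  intro n p z hz x hx hdx
  have hzd : E.path.d z = 0 := hz.2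
  set e₀ := (pullbackFst π (B.evalAt 0)).toAlgHom
    ((pullbackFst (mapPathEnd π) π).toAlgHom x) with he₀
  set β := (pullbackSnd π (B.evalAt 0)).toAlgHom ((pullbackFst (mapPathEnd π) π).toAlgHom x) with hβ
  set e₁ := (pullbackSnd (mapPathEnd π) π).toAlgHom x with he₁
  have hβ0 : π.toAlgHom e₀ = (B.evalAt 0).toAlgHom β := pullback_cond_apply _
  have hβ1 : (B.evalAt 1).toAlgHom β = π.toAlgHom e₁ := pullback_cond_apply x
  have hde₀ : E.d e₀ = (E.evalAt 0).toAlgHom z := by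
    rw [he₀, ← Hom.map_d, ← Hom.map_d, hdx]; rfl
  have hdβ : B.path.d β = π.path.toAlgHom z := by
    rw [hβ, ← Hom.map_d, ← Hom.map_d, hdx]; rfl
  have hde₁ : E.d e₁ = (E.evalAt 1).toAlgHom z := by
    rw [he₁, ← Hom.map_d, hdx]; rfl
  have hdI := d_integ_of_closed hzd
  have hIW : (E.integ z) ∈ E.path.W (p + 1) := integ_mem_W hz.1.1.1
  have hIg : (E.integ z) ∈ E.path.prevGr n := integ_mem_prevGr hz.1.1.2
  have hIS : (E.integ z) ∈ E.pathS S := integ_mem_pathS hS hz.1.2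
  have he₀m : e₀ ∈ E.W (p + 1) ⊓ E.prevGr n ⊓ S :=
    ⟨⟨hx.1.1.1.1, Hom.map_prevGr _ (Hom.map_prevGr _ hx.1.2)⟩, hx.2.1.1⟩
  have he₁m : e₁ ∈ E.W (p + 1) ⊓ E.prevGr n ⊓ S := ⟨⟨hx.1.1.2, Hom.map_prevGr _ hx.1.2⟩, hx.2.2⟩
  have hβm : β ∈ B.path.W (p + 1) ⊓ B.path.prevGr n ⊓ B.pathS S' :=
    ⟨⟨hx.1.1.1.2, Hom.map_prevGr _ (Hom.map_prevGr _ hx.1.2)⟩, hx.2.1.2⟩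
  set y₀ := E.integ z + E.ι.toAlgHom e₀ with hy₀
  have hy₀d : E.path.d y₀ = z := by
    rw [hy₀, map_add, hdI, ← E.ι.map_d, hde₀, sub_add_cancel]
  have hy₀0 : (E.evalAt 0).toAlgHom y₀ = e₀ := by
    rw [hy₀, map_add, evalAt_zero_integ, evalAt_ι, zero_add]
  have hy₀m : y₀ ∈ E.path.W (p + 1) ⊓ E.path.prevGr n ⊓ E.pathS S :=
    ⟨⟨add_mem hIW (E.ι.map_W _ _ he₀m.1.1), add_mem hIg (E.ι.map_prevGr he₀m.1.2)⟩,
      add_mem hIS (tpow_mem_pathS 0 he₀m.2)⟩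
  have key : ∃ y ∈ E.path.W (p + 1) ⊓ E.path.prevGr n ⊓ E.pathS S, E.path.d y = 0 ∧
      (E.evalAt 0).toAlgHom y = 0 ∧ (E.evalAt 1).toAlgHom y = e₁ - (E.evalAt 1).toAlgHom y₀ ∧
      π.path.toAlgHom y = β - π.path.toAlgHom y₀ := by
    cases n with
    | zero =>
      refine ⟨0, zero_mem _, by simp, by simp, ?_, ?_⟩
      · rw [E.eq_zero_of_prevGr_zero he₁m.1.2, E.path.eq_zero_of_prevGr_zero hy₀m.1.2]; simp
      · rw [B.path.eq_zero_of_prevGr_zero hβm.1.2, E.path.eq_zero_of_prevGr_zero hy₀m.1.2]; simp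
    | succ m =>
      set ε := e₁ - (E.evalAt 1).toAlgHom y₀ with hε
      set β' := β - π.path.toAlgHom y₀ with hβ'
      have hβ'd : B.path.d β' = 0 := by
        rw [hβ', map_sub, hdβ, ← Hom.map_d, hy₀d, sub_self]
      have hεd : E.d ε = 0 := by rw [hε, map_sub, hde₁, ← Hom.map_d, hy₀d, sub_self]
      have hβ'0 : (B.evalAt 0).toAlgHom β' = 0 := by
        rw [hβ', map_sub, evalAt_path, hy₀0, hβ0, sub_self]
      have hβ'1 : (B.evalAt 1).toAlgHom β' = π.toAlgHom ε := by
        rw [hβ', map_sub, evalAt_path, hβ1, hε, map_sub]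
      have hβ'm : β' ∈ B.path.W (p + 1) ⊓ B.path.gr m ⊓ B.pathS S' :=
        ⟨⟨sub_mem hβm.1.1 (π.path.map_W _ _ hy₀m.1.1),
          sub_mem hβm.1.2 (π.path.map_gr _ _ hy₀m.1.2)⟩,
          sub_mem hβm.2 (π.path_mem_pathS hπS hy₀m.2)⟩
      have hεm : ε ∈ E.W (p + 1) ⊓ E.gr m ⊓ S := ⟨⟨sub_mem he₁m.1.1 (Hom.map_W _ _ _ hy₀m.1.1),
          sub_mem he₁m.1.2 (Hom.map_gr _ _ _ hy₀m.1.2)⟩,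
          sub_mem he₁m.2 (evalAt_mem_S 1 hy₀m.2)⟩
      set K := B.integ β' with hK
      have hKd : B.path.d K = β' := by
        rw [hK, d_integ_of_closed hβ'd, hβ'0, map_zero, sub_zero]
      have hKW : K ∈ B.path.W (p + 1 + 1) := integ_mem_W hβ'm.1.1
      have hKg : K ∈ B.path.prevGr m := integ_mem_prevGr hβ'm.1.2
      have hKS : K ∈ B.pathS S' := integ_mem_pathS hS' hβ'm.2
      have hK0 : (B.evalAt 0).toAlgHom K = 0 := evalAt_zero_integ _
      obtain ⟨η, hη, hηd, hηK⟩ := hπ m (p + 1) ε ⟨hεm, hεd⟩ ((B.evalAt 1).toAlgHom K)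
        ⟨⟨(B.evalAt 1).map_W _ _ hKW, evalAt_mem_prevGr 1 hKg⟩, evalAt_mem_S 1 hKS⟩ (by
          rw [← Hom.map_d, hKd, hβ'1])
      have hKfst : ∃ q : Polynomial B.carrier, K = (⟨q, 0⟩ : B.PathCarrier) := ⟨_, rfl⟩
      obtain ⟨q, hq⟩ := hKfst
      have hqW : ∀ i, q.coeff i ∈ B.W (p + 1 + 1) := by rw [hq] at hKW; exact hKW.1
      have hqS : ∀ i, q.coeff i ∈ S' := by rw [hq] at hKS; exact hKS.1
      have hqg : ∀ i, q.coeff i ∈ B.prevGr m := by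
        intro i
        cases m with
        | zero =>
          have : K = 0 := B.path.eq_zero_of_prevGr_zero hKg
          rw [hq] at this
          have : q = 0 := congrArg DGA.PathCarrier.fst this
          rw [this]; exact zero_mem _
        | succ m => rw [hq] at hKg; exact hKg.1 i
      have hqd : ∀ i, B.d (q.coeff i) ∈ B.W (p + 1) := by
        intro i
        have := hβ'm.1.1.1 i
        rw [← hKd, hq] at this
        change (polyMap B.d q).coeff i ∈ _ at this
        rwa [coeff_polyMap] at this
      choose l hl hld hlq using fun i => hπ.exists_lift hd ⟨⟨hqW i, hqg i⟩, hqS i⟩ (hqd i)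
      have hKsum : K = ∑ i ∈ q.support, B.tpow i (q.coeff i) := by
        rw [hq]
        refine path_ext (fun i => ?_) fun i => ?_
        · have h1 : ∀ s : Finset ℕ, ((∑ j ∈ s, B.tpow j (q.coeff j) : B.path.carrier) :
              B.PathCarrier).1 = ∑ j ∈ s, monomial j (q.coeff j) := by
            intro s
            induction s using Finset.cons_induction with
            | empty => rfl
            | cons a s ha ih => rw [Finset.sum_cons, Finset.sum_cons, ← ih]; rfl
          rw [h1]
          exact congrArg (fun r : Polynomial B.carrier => r.coeff i) q.as_sum_support
        · have h1 : ∀ s : Finset ℕ, ((∑ j ∈ s, B.tpow j (q.coeff j) : B.path.carrier) :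
              B.PathCarrier).2 = 0 := by
            intro s
            induction s using Finset.cons_induction with
            | empty => rfl
            | cons a s ha ih =>
              rw [Finset.sum_cons]
              exact (congrArg (fun r : Polynomial B.carrier => 0 + r) ih).trans (add_zero 0)
          rw [h1]
      have hq0 : q.coeff 0 = 0 := by
        rw [evalAt_zero_eq, hq] at hK0; exact hK0
      set L := ∑ i ∈ q.support, l i with hL
      set J := ∑ i ∈ q.support, E.tpow i (l i) + E.tpow 1 (η - L) with hJ
      have hLm : L ∈ E.W (p + 1 + 1) ⊓ E.prevGr m ⊓ S := sum_mem fun i _ => hl i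
      have hLd : E.d L ∈ E.W (p + 1) := by
        rw [hL, map_sum]; exact sum_mem fun i _ => hld i
      have hηL : η - L ∈ E.W (p + 1 + 1) ⊓ E.prevGr m ⊓ S := sub_mem hη hLm
      have hπL : π.toAlgHom L = (B.evalAt 1).toAlgHom K := by
        rw [hL, map_sum, hKsum, map_sum]
        refine Finset.sum_congr rfl fun i _ => ?_
        rw [hlq, evalAt_tpow, one_pow, one_smul]
      have hJW : E.path.d J ∈ E.path.W (p + 1) := by
        rw [hJ, map_add, map_sum]
        refine add_mem (sum_mem fun i _ =>
          d_tpow_mem_W i (hl i).1.1 (hld i)) (d_tpow_mem_W 1 hηL.1.1 ?_)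
        rw [map_sub, hηd]
        exact sub_mem hεm.1.1 hLd
      have hJg : J ∈ E.path.prevGr m := add_mem (sum_mem fun i _ =>
        tpow_mem_prevGr i (hl i).1.2) (tpow_mem_prevGr 1 hηL.1.2)
      have hJS : J ∈ E.pathS S := add_mem (sum_mem fun i _ =>
        tpow_mem_pathS i (hl i).2) (tpow_mem_pathS 1 hηL.2)
      have hJ0 : (E.evalAt 0).toAlgHom J = 0 := by
        rw [hJ, map_add, map_sum, evalAt_tpow]
        rw [Finset.sum_eq_zero, zero_pow one_ne_zero, zero_smul, add_zero]
        intro i hi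
        have : i ≠ 0 := by rintro rfl; simp [hq0] at hi
        rw [evalAt_tpow, zero_pow this, zero_smul]
      have hJ1 : (E.evalAt 1).toAlgHom J = η := by
        rw [hJ, map_add, map_sum, evalAt_tpow, one_pow, one_smul]
        have : ∑ i ∈ q.support, (E.evalAt 1).toAlgHom (E.tpow i (l i)) = L :=
          Finset.sum_congr rfl fun i _ => by rw [evalAt_tpow, one_pow, one_smul]
        rw [this]; abel
      have hJK : π.path.toAlgHom J = K := by
        rw [hJ, map_add, map_sum, Hom.path_tpow, map_sub, hηK, hπL, sub_self, map_zero, add_zero]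
        conv_rhs => rw [hKsum]
        exact Finset.sum_congr rfl fun i _ => by rw [Hom.path_tpow, hlq]
      refine ⟨E.path.d J, ⟨⟨hJW, E.path.d_mem_prev hJg⟩, d_mem_pathS hS hdS hJS⟩, E.path.d_d J,
        ?_, ?_, ?_⟩
      · rw [Hom.map_d, hJ0, map_zero]
      · rw [Hom.map_d, hJ1, hηd]
      · rw [Hom.map_d, hJK, hKd]
  obtain ⟨y, hy, hyd, hy0, hy1, hyβ⟩ := key
  refine ⟨y₀ + y, add_mem hy₀m hy, ?_, pullback_ext (pullback_ext ?_ ?_) ?_⟩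
  · rw [map_add, hy₀d, hyd, add_zero]
  · change (E.evalAt 0).toAlgHom (y₀ + y) = e₀
    rw [map_add, hy₀0, hy0, add_zero]
  · change π.path.toAlgHom (y₀ + y) = β
    rw [map_add, hyβ]; abel
  · change (E.evalAt 1).toAlgHom (y₀ + y) = e₁
    rw [map_add, hy1]; abel

end PathFib

end FDGA

/-- Dependent choice along a transitive well-founded relation, for a condition at `i` that only
involves the values at `i` and at the predecessors of `i`. -/
lemma exists_forall_of_wellFounded {ι : Type*} {X : ι → Type*} [∀ i, Inhabited (X i)]
    {r : ι → ι → Prop} (wf : WellFounded r) (htrans : ∀ {a b c}, r a b → r b c → r a c)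
    (P : ι → (∀ i, X i) → Prop)
    (hlocal : ∀ i g g', (∀ j, r j i ∨ j = i → g j = g' j) → P i g → P i g')
    [DecidableEq ι]
    (step : ∀ i g, (∀ j, r j i → P j g) → ∃ x, P i (Function.update g i x)) :
    ∃ g, ∀ i, P i g := by
  classical
  let G : ∀ i, (∀ j, r j i → X j) → X i := fun i rec =>
    let g : ∀ j, X j := fun j => if h : r j i then rec j h else default
    if h : ∃ x, P i (Function.update g i x) then h.choose else default
  let g : ∀ i, X i := wf.fix G
  have hirr : ∀ i, ¬ r i i := fun i h => wf.irrefl.irrefl i h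
  refine ⟨g, fun i => ?_⟩
  induction i using wf.induction with
  | _ i ih =>
    let gi : ∀ j, X j := fun j => if r j i then g j else default
    have hex : ∃ x, P i (Function.update gi i x) := by
      refine step i gi fun j hj => hlocal j g gi (fun l hl => ?_) (ih j hj)
      have : r l i := by
        rcases hl with hl | rfl
        · exact htrans hl hj
        · exact hj
      simp [gi, this]
    have hg : g i = hex.choose := by
      have h1 : g i = G i fun j _ => g j := wf.fix_eq G i
      rw [h1]
      have h2 : (fun j => if h : r j i then g j else default) = gi := by
        funext j; by_cases h : r j i <;> simp [gi, h]
      simp only [G]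
      rw [dif_pos (by rw [h2]; exact hex)]
    have := hex.choose_spec
    rw [← hg] at this
    refine hlocal i _ g (fun j hj => ?_) this
    by_cases hji : j = i
    · subst hji; simp
    · have hr : r j i := hj.resolve_right hji
      simp [update_of_ne hji, gi, hr]

lemma ProdMem.mono {R : Type*} [Ring R] {S T : ℤ → Set R} (h : ∀ r, S r ⊆ T r) {p : ℤ} {x : R}
    (hx : ProdMem S p x) : ProdMem T p x := by
  induction hx with
  | one => exact ProdMem.one
  | mul hx _ ih => exact ProdMem.mul (h _ hx) ih

namespace FDGA

variable {k : Type} [Field k]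

/-- The filtered dga `Λ` is obtained from `k` by attaching the spaces of generators `V i`, in the
degrees `deg i`. -/
structure IsCellular (Λ : FDGA.{u} k) (deg : ℕ → ℕ) (V : ℕ → Submodule k Λ.carrier) : Prop where
  V_le : ∀ i, V i ≤ Λ.gr (deg i)
  d_mem : ∀ i, ∀ x ∈ V i, Λ.d x ∈ Algebra.adjoin k (⋃ j < i, (V j : Set Λ.carrier))
  d_W : ∀ p, ∀ x ∈ Λ.W p, Λ.d x ∈ Λ.W (p - 1)
  free : ∀ (C : DGA.{u} k) (g : ∀ i, V i →ₗ[k] C.carrier), (∀ i v, g i v ∈ C.gr (deg i)) →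
    ∃ f : Λ.carrier →ₐ[k] C.carrier, (∀ n, ∀ x ∈ Λ.gr n, f x ∈ C.gr n) ∧ ∀ i (v : V i), f v = g i v
  V_le_W : ∀ i, ∃ p, V i ≤ Λ.W p
  W_le : ∀ p, Λ.W p ≤ Submodule.span k
    {x | ∃ p' ≤ p, ProdMem (fun r => ⋃ i, ((V i ⊓ Λ.W r : Submodule k Λ.carrier) :
      Set Λ.carrier)) p' x}

lemma prodMem_mem {A : Type*} [Ring A] [Algebra k A] {S : ℤ → Set A} (B : Subalgebra k A)
    (hS : ∀ r, S r ⊆ B) {p : ℤ} {x : A} (hx : ProdMem S p x) : x ∈ B := by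
  induction hx with
  | one => exact B.one_mem
  | mul hx _ ih => exact B.mul_mem (hS _ hx) ih

namespace IsCellular

variable {Λ : FDGA.{u} k} {deg : ℕ → ℕ} {V : ℕ → Submodule k Λ.carrier}

lemma adjoin_eq_top (h : Λ.IsCellular deg V) :
    Algebra.adjoin k (⋃ j, (V j : Set Λ.carrier)) = ⊤ := by
  rw [eq_top_iff]
  intro x _
  obtain ⟨p, hp⟩ := Λ.W_exhaustive x
  have := h.W_le p hp
  refine span_le (p := Subalgebra.toSubmodule
    (Algebra.adjoin k (⋃ j, (V j : Set Λ.carrier)))).2 ?_ this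
  rintro y ⟨p', -, hy⟩
  refine prodMem_mem _ (fun r => ?_) hy
  exact (Set.iUnion_mono fun i => fun x hx => hx.1).trans Algebra.subset_adjoin

lemma _root_.MixedHodge.map_mem_of_prodMem {A B : Type*} [Ring A] [Algebra k A] [Ring B]
    [Algebra k B]
    (f : A →ₐ[k] B) {S : ℤ → Set A} {G : ℤ → Submodule k B} (h1 : 1 ∈ G 0)
    (hmul : ∀ {p q : ℤ} {x y : B}, x ∈ G p → y ∈ G q → x * y ∈ G (p + q))
    (hS : ∀ r, ∀ x ∈ S r, f x ∈ G r) {p : ℤ} {x : A} (hx : ProdMem S p x) : f x ∈ G p := by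
  induction hx with
  | one => rwa [map_one]
  | mul hx _ ih => rw [map_mul]; exact hmul (hS _ _ hx) ih

lemma map_W (h : Λ.IsCellular deg V) {E : FDGA.{u} k} (f : Λ.carrier →ₐ[k] E.carrier)
    (hf : ∀ i r, ∀ x ∈ V i ⊓ Λ.W r, f x ∈ E.W r) (p : ℤ) : ∀ x ∈ Λ.W p, f x ∈ E.W p := by
  intro x hx
  have := h.W_le p hx
  refine span_le (p := (E.W p).comap f.toLinearMap).2 ?_ this
  rintro y ⟨p', hp', hy⟩
  refine E.W_mono hp' ?_
  refine map_mem_of_prodMem f E.one_mem_W E.mul_mem_W (fun r x hx => ?_) hy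
  obtain ⟨i, hi⟩ := Set.mem_iUnion.1 hx
  exact hf i r x hi

lemma map_d_adjoin {A E : DGA.{u} k} (f : A.carrier →ₐ[k] E.carrier)
    (hgr : ∀ n, ∀ x ∈ A.gr n, f x ∈ E.gr n) {s : Set A.carrier}
    (hs : ∀ x ∈ s, f (A.d x) = E.d (f x)) {x : A.carrier} (hx : x ∈ Algebra.adjoin k s) :
    f (A.d x) = E.d (f x) := by
  induction hx using Algebra.adjoin_induction with
  | mem x hx => exact hs x hx
  | algebraMap c => rw [A.d_algebraMap, AlgHom.commutes, E.d_algebraMap, map_zero]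
  | add x y _ _ hx hy => rw [map_add, map_add, map_add, map_add, hx, hy]
  | mul x y _ _ hx hy =>
    have := DGA.map_sgn f.toRingHom hgr x
    change f (A.sgn x) = E.sgn (f x) at this
    rw [A.leibniz', map_mul, E.leibniz', map_add, map_mul, map_mul, hx, hy, this]

lemma eqOn_adjoin {A E : Type*} [Ring A] [Algebra k A] [Ring E] [Algebra k E]
    (f g : A →ₐ[k] E) {s : Set A}
    (hs : ∀ x ∈ s, f x = g x) {x : A} (hx : x ∈ Algebra.adjoin k s) : f x = g x := by
  have : Algebra.adjoin k s ≤ AlgHom.equalizer f g := Algebra.adjoin_le hs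
  exact this hx

/-- The right lifting property of trivial fibrations with respect to cellular filtered dga's. -/
lemma exists_lift (h : Λ.IsCellular deg V) {FΛ : ℤ → Submodule k Λ.carrier}
    (hV : ∀ i, Nonempty (AdaptedBasis (fun p => (Λ.W p).submoduleOf (V i))
      fun q => (FΛ q).submoduleOf (V i)))
    {E B : FDGA.{u} k} (π : Hom E B) {FE : ℤ → Submodule k E.carrier}
    (hFE : Antitone FE) {FB : ℤ → Submodule k B.carrier} (hπ : ∀ q, π.IsTrivFib (FE q) (FB q))
    (hdF : ∀ q, ∀ x ∈ FΛ q, Λ.d x ∈ FΛ q)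
    (hF : ∀ f : Λ.carrier →ₐ[k] E.carrier, (∀ i q, ∀ x ∈ V i ⊓ FΛ q, f x ∈ FE q) →
      ∀ q, ∀ x ∈ FΛ q, f x ∈ FE q)
    (b : Hom Λ B) (hb : ∀ q, ∀ x ∈ FΛ q, b.toAlgHom x ∈ FB q) :
    ∃ e : Hom Λ E, (∀ q, ∀ x ∈ FΛ q, e.toAlgHom x ∈ FE q) ∧ e.comp π = b := by
  classical
  let P : ℕ → (∀ i, V i →ₗ[k] E.carrier) → Prop := fun i g =>
    (∀ v, g i v ∈ E.gr (deg i)) ∧ (∀ v : V i, π.toAlgHom (g i v) = b.toAlgHom v) ∧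
    (∀ r, ∀ v : V i, v.1 ∈ Λ.W r → g i v ∈ E.W r) ∧
    (∀ q, ∀ v : V i, v.1 ∈ FΛ q → g i v ∈ FE q) ∧
    ∀ f : Λ.carrier →ₐ[k] E.carrier, (∀ n, ∀ x ∈ Λ.gr n, f x ∈ E.gr n) →
      (∀ j < i, ∀ v : V j, f v = g j v) → ∀ v : V i, E.d (g i v) = f (Λ.d v)
  have hext : ∃ g : ∀ i, V i →ₗ[k] E.carrier, ∀ i, P i g := by
    refine exists_forall_of_wellFounded (wellFounded_lt (α := ℕ)) lt_trans P ?_ ?_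
    · rintro i g g' hg ⟨h1, h2, h3, h4, h5⟩
      have e : g i = g' i := hg i (Or.inr rfl)
      refine ⟨by rwa [← e], by rwa [← e], by rwa [← e], by rwa [← e], fun f hf hfg => ?_⟩
      rw [← e]
      exact h5 f hf fun j hj v => (hfg j hj v).trans (by rw [hg j (Or.inl hj)])
    · intro i g hg
      obtain ⟨f, hfgr, hf⟩ := h.free E.toDGA (fun j => if j < i then g j else 0) fun j v => by
        split_ifs with hj
        · exact (hg j hj).1 v
        · exact zero_mem _
      have hf1 : ∀ j < i, ∀ v : V j, f v = g j v := fun j hj v => by rw [hf, if_pos hj]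
      have hf2 : ∀ j, ¬ j < i → ∀ v : V j, f v = 0 := fun j hj v => by
        rw [hf, if_neg hj]; rfl
      have hfW : ∀ p, ∀ x ∈ Λ.W p, f x ∈ E.W p := by
        refine h.map_W f fun j r x hx => ?_
        by_cases hj : j < i
        · exact (hf1 j hj ⟨x, hx.1⟩).symm ▸ (hg j hj).2.2.1 r ⟨x, hx.1⟩ hx.2
        · exact (hf2 j hj ⟨x, hx.1⟩).symm ▸ zero_mem _
      have hfF : ∀ q, ∀ x ∈ FΛ q, f x ∈ FE q := by
        refine hF f fun j r x hx => ?_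
        by_cases hj : j < i
        · exact (hf1 j hj ⟨x, hx.1⟩).symm ▸ (hg j hj).2.2.2.1 r ⟨x, hx.1⟩ hx.2
        · exact (hf2 j hj ⟨x, hx.1⟩).symm ▸ zero_mem _
      have hfd : ∀ x ∈ Algebra.adjoin k (⋃ j < i, (V j : Set Λ.carrier)),
          f (Λ.d x) = E.d (f x) := fun x hx => by
        refine map_d_adjoin f hfgr (fun x hx => ?_) hx
        simp only [Set.mem_iUnion] at hx
        obtain ⟨j, hj, hx⟩ := hx
        have := (hg j hj).2.2.2.2 f hfgr (fun l hl v => hf1 l (hl.trans hj) v) ⟨x, hx⟩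
        rw [← this]
        exact congrArg E.d (hf1 j hj ⟨x, hx⟩).symm
      have hfπ : ∀ x ∈ Algebra.adjoin k (⋃ j < i, (V j : Set Λ.carrier)),
          π.toAlgHom (f x) = b.toAlgHom x := fun x hx => by
        refine eqOn_adjoin (π.toAlgHom.comp f) b.toAlgHom (fun x hx => ?_) hx
        simp only [Set.mem_iUnion] at hx
        obtain ⟨j, hj, hx⟩ := hx
        exact (congrArg π.toAlgHom (hf1 j hj ⟨x, hx⟩)).trans ((hg j hj).2.1 ⟨x, hx⟩)
      obtain ⟨β⟩ := hV i
      have key : ∀ a, ∃ y ∈ E.W (β.r a) ⊓ E.gr (deg i) ⊓ FE (β.q a),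
          E.d y = f (Λ.d (β.basis a)) ∧ π.toAlgHom y = b.toAlgHom (β.basis a) := by
        intro a
        have hW : (β.basis a).1 ∈ Λ.W (β.r a) := β.mem_W a
        have hFa : (β.basis a).1 ∈ FΛ (β.q a) := β.mem_F a
        have hgr := h.V_le i (β.basis a).2
        have hst := h.d_mem i _ (β.basis a).2
        have := hπ (β.q a) (deg i + 1) (β.r a - 1) (f (Λ.d (β.basis a)))
          ⟨⟨⟨hfW _ _ (h.d_W _ _ hW), hfgr _ _ (Λ.d_mem hgr)⟩, hfF _ _ (hdF _ _ hFa)⟩, by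
            change E.d _ = 0
            rw [← hfd _ hst, Λ.d_d, map_zero]⟩ (b.toAlgHom (β.basis a))
          ⟨⟨by rw [sub_add_cancel]; exact b.map_W _ _ hW, b.map_gr _ _ hgr⟩, hb _ _ hFa⟩
          (by rw [hfπ _ hst, b.map_d])
        rwa [sub_add_cancel] at this
      choose y hy hyd hyb using key
      set x := β.basis.constr k y with hx
      have hxa : ∀ a, x (β.basis a) = y a := fun a => by rw [hx, Module.Basis.constr_basis]
      have hspan : ∀ {s : Set β.ι} {U : Submodule k E.carrier}, (∀ a ∈ s, y a ∈ U) →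
          ∀ v ∈ Submodule.span k (β.basis '' s), x v ∈ U := by
        intro s U hs v hv
        refine span_le (p := U.comap x).2 ?_ hv
        rintro _ ⟨a, ha, rfl⟩
        change x (β.basis a) ∈ U
        rw [hxa]; exact hs a ha
      refine ⟨x, ?_, ?_, ?_, ?_, ?_⟩
      · rw [update_self]
        intro v
        refine hspan (s := Set.univ) (fun a _ => (hy a).1.2) v ?_
        rw [Set.image_univ, β.basis.span_eq]; trivial
      · rw [update_self]
        intro v
        have : π.toAlgHom.toLinearMap ∘ₗ x = b.toAlgHom.toLinearMap ∘ₗ (V i).subtype :=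
          β.basis.ext fun a => by
            change π.toAlgHom (x (β.basis a)) = _
            rw [hxa]; exact hyb a
        exact LinearMap.congr_fun this v
      · rw [update_self]
        intro r v hv
        exact hspan (fun a ha => E.W_mono ha (hy a).1.1) v (β.W_le r hv)
      · rw [update_self]
        intro q v hv
        refine Submodule.span_induction (p := fun v _ => x v ∈ FE q) ?_ ?_ ?_ ?_ (β.F_le q hv)
        · rintro _ ⟨a, ha, rfl⟩
          change x (β.basis a) ∈ FE q
          rw [hxa]
          exact hFE ha (hy a).2
        · simp
        · intro v w _ _ hv hw; rw [map_add]; exact add_mem hv hw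
        · intro c v _ hv; rw [map_smul]; exact Submodule.smul_mem _ _ hv
      · rw [update_self]
        intro f' hf' hfg v
        have hfg' : ∀ j < i, ∀ v : V j, f' v = f v := fun j hj v => by
          rw [hfg j hj, update_of_ne (Nat.ne_of_lt hj), hf1 j hj]
        have hff : f' (Λ.d v) = f (Λ.d v) := by
          refine eqOn_adjoin f' f (fun x hx => ?_) (h.d_mem i v v.2)
          simp only [Set.mem_iUnion] at hx
          obtain ⟨j, hj, hx⟩ := hx
          exact hfg' j hj ⟨x, hx⟩
        rw [hff]
        have : E.d ∘ₗ x = f.toLinearMap ∘ₗ Λ.d ∘ₗ (V i).subtype := β.basis.ext fun a => by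
            change E.d (x (β.basis a)) = _
            rw [hxa]; exact hyd a
        exact LinearMap.congr_fun this v
  obtain ⟨g, hg⟩ := hext
  obtain ⟨f, hfgr, hf⟩ := h.free E.toDGA g fun i v => (hg i).1 v
  refine ⟨⟨f, hfgr, fun x => ?_, ?_⟩, ?_, ?_⟩
  · refine map_d_adjoin f hfgr (fun x hx => ?_)
      (show x ∈ Algebra.adjoin k (⋃ j, (V j : Set Λ.carrier)) by rw [h.adjoin_eq_top]; trivial)
    obtain ⟨j, hj⟩ := Set.mem_iUnion.1 hx
    rw [← (hg j).2.2.2.2 f hfgr (fun l _ v => hf l v) ⟨x, hj⟩]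
    exact congrArg E.d (hf j ⟨x, hj⟩).symm
  · exact h.map_W f fun i r x hx => (hf i ⟨x, hx.1⟩).symm ▸ (hg i).2.2.1 r ⟨x, hx.1⟩ hx.2
  · exact hF f fun i r x hx => (hf i ⟨x, hx.1⟩).symm ▸ (hg i).2.2.2.1 r ⟨x, hx.1⟩ hx.2
  · refine Hom.ext (AlgHom.ext fun x => ?_)
    refine eqOn_adjoin (π.toAlgHom.comp f) b.toAlgHom (fun x hx => ?_)
      (show x ∈ Algebra.adjoin k (⋃ j, (V j : Set Λ.carrier)) by rw [h.adjoin_eq_top]; trivial)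
    obtain ⟨j, hj⟩ := Set.mem_iUnion.1 hx
    exact (congrArg π.toAlgHom (hf j ⟨x, hj⟩)).trans ((hg j).2.1 ⟨x, hj⟩)

lemma adaptedBasis (h : Λ.IsCellular deg V) (i : ℕ) {F : ℤ → Submodule k Λ.carrier}
    (hF : Antitone F) (hbot : ∃ q, V i ⊓ F q = ⊥) (htop : ∃ q, V i ≤ F q) :
    Nonempty (AdaptedBasis (fun p => (Λ.W p).submoduleOf (V i))
      fun q => (F q).submoduleOf (V i)) := by
  refine AdaptedBasis.exists _ _ (fun p q hpq x hx => Λ.W_mono hpq hx)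
    (fun p q hpq x hx => hF hpq hx) ?_ ?_ ?_ ?_
  · obtain ⟨q, hq⟩ := Λ.exists_W_eq_bot (deg i)
    refine ⟨q, (Submodule.eq_bot_iff _).2 fun x hx => Subtype.ext ?_⟩
    exact hq q le_rfl _ ⟨hx, h.V_le i x.2⟩
  · obtain ⟨p, hp⟩ := h.V_le_W i
    exact ⟨p, Submodule.eq_top_iff'.2 fun x => hp x.2⟩
  · obtain ⟨q, hq⟩ := hbot
    refine ⟨q, (Submodule.eq_bot_iff _).2 fun x hx => Subtype.ext ?_⟩
    exact (Submodule.eq_bot_iff _).1 hq _ ⟨x.2, hx⟩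
  · obtain ⟨p, hp⟩ := htop
    exact ⟨p, Submodule.eq_top_iff'.2 fun x => hp x.2⟩

lemma exists_lift_top (h : Λ.IsCellular deg V) {E B : FDGA.{u} k} (π : Hom E B)
    (hπ : π.IsTrivFib ⊤ ⊤) (b : Hom Λ B) : ∃ e : Hom Λ E, e.comp π = b := by
  let F : ∀ A : FDGA.{u} k, ℤ → Submodule k A.carrier := fun _ q => if q ≤ 0 then ⊤ else ⊥
  have hF0 : ∀ {A : FDGA.{u} k} {q : ℤ}, q ≤ 0 → F A q = ⊤ := fun hq => if_pos hq
  have hF1 : ∀ {A : FDGA.{u} k} {q : ℤ}, ¬ q ≤ 0 → F A q = ⊥ := fun hq => if_neg hq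
  have hanti : ∀ A : FDGA.{u} k, Antitone (F A) := fun A p q hpq => by
    by_cases hp : p ≤ 0
    · rw [hF0 hp]; exact le_top
    · rw [hF1 (fun hq => hp (hpq.trans hq))]; exact bot_le
  have hmap : ∀ {A C : FDGA.{u} k} (f : A.carrier →ₗ[k] C.carrier) (q : ℤ), ∀ x ∈ F A q,
      f x ∈ F C q := fun {A C} f q x hx => by
    by_cases hq : q ≤ 0
    · rw [hF0 hq]; trivial
    · rw [hF1 hq, mem_bot] at hx
      rw [hx, map_zero]; exact zero_mem _
  have hfib : ∀ q, π.IsTrivFib (F E q) (F B q) := fun q n p z hz b hb hdb => by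
    by_cases hq : q ≤ 0
    · obtain ⟨y, hy, hy'⟩ := hπ n p z ⟨⟨hz.1.1, trivial⟩, hz.2⟩ b ⟨hb.1, trivial⟩ hdb
      exact ⟨y, ⟨hy.1, by rw [hF0 hq]; trivial⟩, hy'⟩
    · have hz0 : z ∈ F E q := hz.1.2
      have hb0 : b ∈ F B q := hb.2
      rw [hF1 hq, mem_bot] at hz0 hb0
      exact ⟨0, zero_mem _, by rw [map_zero, hz0], by rw [map_zero, hb0]⟩
  obtain ⟨e, -, he⟩ := h.exists_lift (FΛ := F Λ)
    (fun i => h.adaptedBasis i (hanti Λ) ⟨1, by rw [hF1 (by norm_num), inf_bot_eq]⟩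
      ⟨0, by rw [hF0 le_rfl]; exact le_top⟩) π (hanti E) hfib (fun q => hmap Λ.d q)
    (fun f _ => hmap f.toLinearMap) b (hmap b.lin)
  exact ⟨e, he⟩

end IsCellular

end FDGA

namespace FFDGA

variable {k : Type} [Field k]

/-- Cellular bifiltered dga's. -/
structure IsCellular (Λ : FFDGA.{u} k) (deg : ℕ → ℕ) (V : ℕ → Submodule k Λ.carrier) : Prop
    extends Λ.toFDGA.IsCellular deg V where
  F_bot : ∀ i, ∃ q, V i ⊓ Λ.F q = ⊥
  F_top : ∀ i, ∃ q, V i ≤ Λ.F q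
  F_le : ∀ q, Λ.F q ≤ Submodule.span k
    {x | ∃ q' ≥ q, ProdMem (fun r => ⋃ i, ((V i ⊓ Λ.F r : Submodule k Λ.carrier) :
      Set Λ.carrier)) q' x}

variable {Λ : FFDGA.{u} k} {deg : ℕ → ℕ} {V : ℕ → Submodule k Λ.carrier}

lemma IsCellular.map_F (h : Λ.IsCellular deg V) {E : FFDGA.{u} k} (f : Λ.carrier →ₐ[k] E.carrier)
    (hf : ∀ i r, ∀ x ∈ V i ⊓ Λ.F r, f x ∈ E.F r) (p : ℤ) : ∀ x ∈ Λ.F p, f x ∈ E.F p := by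
  intro x hx
  have := h.F_le p hx
  refine span_le (p := (E.F p).comap f.toLinearMap).2 ?_ this
  rintro y ⟨p', hp', hy⟩
  refine E.F_anti hp' ?_
  refine map_mem_of_prodMem f E.one_mem_F E.mul_mem_F (fun r x hx => ?_) hy
  obtain ⟨i, hi⟩ := Set.mem_iUnion.1 hx
  exact hf i r x hi

lemma IsCellular.exists_lift_hom (h : Λ.IsCellular deg V) {E B : FFDGA.{u} k} (π : Hom E B)
    (hπ : ∀ q, π.toHom.IsTrivFib (E.F q) (B.F q)) (b : Hom Λ B) :
    ∃ e : Hom Λ E, e.comp π = b := by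
  obtain ⟨e, he, hb⟩ := h.toIsCellular.exists_lift
    (fun i => h.toIsCellular.adaptedBasis i Λ.F_anti (h.F_bot i) (h.F_top i)) π.toHom E.F_anti hπ
    (fun q x hx => Λ.d_mem_F hx) (fun f hf => h.map_F f hf) b.toHom b.map_F
  exact ⟨⟨e, he⟩, Hom.ext (congrArg FDGA.Hom.toAlgHom hb)⟩

end FFDGA

section Slice

variable {V V' : Type*} [AddCommGroup V] [Module ℚ V] [AddCommGroup V'] [Module ℚ V']

/-- The contraction `ℂ ⊗ V → V` with a linear form on `ℂ`. -/
def slice (V : Type*) [AddCommGroup V] [Module ℚ V] (l : ℂ →ₗ[ℚ] ℚ) : ℂ ⊗[ℚ] V →ₗ[ℚ] V :=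
  (TensorProduct.lid ℚ V).toLinearMap ∘ₗ LinearMap.rTensor V l

@[simp] lemma slice_tmul (l : ℂ →ₗ[ℚ] ℚ) (c : ℂ) (v : V) : slice V l (c ⊗ₜ v) = l c • v := by
  simp [slice]

lemma slice_baseChange (l : ℂ →ₗ[ℚ] ℚ) (f : V →ₗ[ℚ] V') (z : ℂ ⊗[ℚ] V) :
    slice V' l (f.baseChange ℂ z) = f (slice V l z) := by
  induction z using TensorProduct.induction_on with
  | zero => simp
  | tmul c v => simp
  | add x y hx hy => rw [map_add, map_add, hx, hy, map_add, map_add]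

lemma exists_slice_one : ∃ l : ℂ →ₗ[ℚ] ℚ, l 1 = 1 := by
  have h : Injective (Algebra.linearMap ℚ ℂ) := (algebraMap ℚ ℂ).injective
  obtain ⟨l, hl⟩ := (Algebra.linearMap ℚ ℂ).exists_leftInverse_of_injective
    (LinearMap.ker_eq_bot.2 h)
  refine ⟨l, ?_⟩
  have := LinearMap.congr_fun hl 1
  simpa using this

lemma slice_mem (l : ℂ →ₗ[ℚ] ℚ) {P : Submodule ℚ V} {z : ℂ ⊗[ℚ] V} (hz : z ∈ P.baseChange ℂ) :
    slice V l z ∈ P := by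
  rw [Submodule.baseChange_eq_span] at hz
  have : ∀ c : ℂ, slice V l (c • z) ∈ P := by
    induction hz using Submodule.span_induction with
    | zero => intro c; rw [smul_zero, map_zero]; exact P.zero_mem
    | add x y _ _ hx hy => intro c; rw [smul_add, map_add]; exact P.add_mem (hx c) (hy c)
    | smul e x _ hx => intro c; rw [smul_smul]; exact hx _
    | mem x hx =>
      obtain ⟨v, hv, rfl⟩ := hx
      intro c
      rw [TensorProduct.mk_apply, TensorProduct.smul_tmul', slice_tmul]
      exact P.smul_mem _ hv
  simpa using this 1

lemma mem_baseChange_of_slice {P : Submodule ℚ V} {z : ℂ ⊗[ℚ] V}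
    (hz : ∀ l, slice V l z ∈ P) : z ∈ P.baseChange ℂ := by
  classical
  set β := Module.Basis.ofVectorSpace ℚ ℂ
  have h : ∀ z : ℂ ⊗[ℚ] V, ∃ s : Finset (Module.Basis.ofVectorSpaceIndex ℚ ℂ), ∀ t, s ⊆ t →
      z = ∑ i ∈ t, β i ⊗ₜ[ℚ] slice V (β.coord i) z := by
    intro z
    induction z using TensorProduct.induction_on with
    | zero => exact ⟨∅, fun t _ => by simp⟩
    | tmul c v =>
      refine ⟨(β.repr c).support, fun t ht => ?_⟩
      simp only [slice_tmul, Module.Basis.coord_apply]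
      rw [Finset.sum_congr rfl fun i _ => (TensorProduct.smul_tmul (β.repr c i) (β i) v).symm,
        ← TensorProduct.sum_tmul]
      congr 1
      conv_lhs => rw [← β.linearCombination_repr c, Finsupp.linearCombination_apply, Finsupp.sum]
      exact Finset.sum_subset ht fun i _ hi => by
        rw [Finsupp.notMem_support_iff.1 hi, zero_smul]
    | add x y hx hy =>
      obtain ⟨s, hs⟩ := hx
      obtain ⟨t, ht⟩ := hy
      refine ⟨s ∪ t, fun r hr => ?_⟩
      simp only [map_add, TensorProduct.tmul_add, Finset.sum_add_distrib]
      rw [← hs r (Finset.union_subset_left hr), ← ht r (Finset.union_subset_right hr)]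
  obtain ⟨s, hs⟩ := h z
  rw [hs s subset_rfl]
  refine sum_mem fun i _ => ?_
  exact Submodule.tmul_mem_baseChange_of_mem _ (hz _)

lemma eq_zero_of_slice {z : ℂ ⊗[ℚ] V} (hz : ∀ l, slice V l z = 0) : z = 0 := by
  have : z ∈ (⊥ : Submodule ℚ V).baseChange ℂ :=
    mem_baseChange_of_slice fun l => by rw [hz l]; exact zero_mem _
  rwa [Submodule.baseChange_bot, mem_bot] at this

lemma exists_baseChange_subtype {P : Submodule ℚ V} {z : ℂ ⊗[ℚ] V} (hz : z ∈ P.baseChange ℂ) :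
    ∃ y : ℂ ⊗[ℚ] P, P.subtype.baseChange ℂ y = z := by
  rw [Submodule.baseChange_eq_span] at hz
  have : Submodule.span ℂ (P.map (TensorProduct.mk ℚ ℂ V 1) : Set (ℂ ⊗[ℚ] V)) ≤
      range (P.subtype.baseChange ℂ) := by
    rw [span_le]
    rintro _ ⟨x, hx, rfl⟩
    exact ⟨1 ⊗ₜ ⟨x, hx⟩, by simp⟩
  exact this hz

lemma baseChange_subtype_mem {P : Submodule ℚ V} (y : ℂ ⊗[ℚ] P) :
    P.subtype.baseChange ℂ y ∈ P.baseChange ℂ :=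
  mem_baseChange_of_slice fun l => by rw [slice_baseChange]; exact (slice P l y).2

lemma baseChange_injective {f : V →ₗ[ℚ] V'} (hf : Injective f) : Injective (f.baseChange ℂ) := by
  rw [injective_iff_map_eq_zero]
  intro z hz
  refine eq_zero_of_slice fun l => hf ?_
  rw [← slice_baseChange, hz, map_zero, map_zero]

lemma baseChange_surjective {f : V →ₗ[ℚ] V'} (hf : Surjective f) : Surjective (f.baseChange ℂ) := by
  intro z
  induction z using TensorProduct.induction_on with
  | zero => exact ⟨0, map_zero _⟩
  | tmul c v =>
    obtain ⟨w, rfl⟩ := hf v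
    exact ⟨c ⊗ₜ w, by simp⟩
  | add x y hx hy =>
    obtain ⟨a, rfl⟩ := hx
    obtain ⟨b, rfl⟩ := hy
    exact ⟨a + b, map_add _ _ _⟩

variable {Z B : Submodule ℚ V} {Z' B' : Submodule ℂ (ℂ ⊗[ℚ] V)}

/-- The canonical map from an extension of scalars of a subquotient to a subquotient of an
extension of scalars. -/
def SubQuot.baseChangeMap (hZ : Z' = Z.baseChange ℂ) (hB : B' = B.baseChange ℂ) :
    ℂ ⊗[ℚ] SubQuot Z B →ₗ[ℂ] SubQuot Z' B' :=
  LinearMap.liftBaseChange ℂ (Submodule.liftQ (B.submoduleOf Z)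
      (((Submodule.mkQ (B'.submoduleOf Z')).restrictScalars ℚ) ∘ₗ
        ((TensorProduct.mk ℚ ℂ V 1) ∘ₗ Z.subtype).codRestrict (Z'.restrictScalars ℚ) (fun x => by
          subst hZ; exact Submodule.tmul_mem_baseChange_of_mem _ x.2))
      (fun x hx => by
        subst hB
        refine (mk_eq_zero _).2 ?_
        exact Submodule.tmul_mem_baseChange_of_mem (1 : ℂ) hx))

lemma SubQuot.baseChangeMap_mkQ (hZ : Z' = Z.baseChange ℂ) (hB : B' = B.baseChange ℂ)
    (y : ℂ ⊗[ℚ] Z) : SubQuot.baseChangeMap hZ hB ((B.submoduleOf Z).mkQ.baseChange ℂ y) =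
      Submodule.Quotient.mk ⟨Z.subtype.baseChange ℂ y, hZ ▸ baseChange_subtype_mem y⟩ := by
  induction y using TensorProduct.induction_on with
  | zero =>
    rw [map_zero, map_zero]
    symm
    refine (mk_eq_zero _).2 ?_
    change Z.subtype.baseChange ℂ 0 ∈ B'
    rw [map_zero]; exact B'.zero_mem
  | add x y hx hy =>
    rw [map_add, map_add, hx, hy, ← Submodule.Quotient.mk_add]
    congr 1
    exact Subtype.ext (map_add _ _ _).symm
  | tmul c x =>
    rw [baseChange_tmul]
    refine (LinearMap.liftBaseChange_tmul _ _ _ _).trans ?_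
    refine (Submodule.Quotient.mk_smul _ _ _).symm.trans ?_
    congr 1
    refine Subtype.ext ?_
    change c • ((1 : ℂ) ⊗ₜ[ℚ] (x : V)) = Z.subtype.baseChange ℂ (c ⊗ₜ x)
    rw [TensorProduct.smul_tmul', smul_eq_mul, mul_one, baseChange_tmul]
    rfl

lemma SubQuot.baseChangeMap_bijective (hZ : Z' = Z.baseChange ℂ) (hB : B' = B.baseChange ℂ) :
    Bijective (SubQuot.baseChangeMap hZ hB) := by
  constructor
  · rw [injective_iff_map_eq_zero]
    intro z hz
    obtain ⟨y, rfl⟩ := baseChange_surjective (Submodule.mkQ_surjective (B.submoduleOf Z)) z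
    rw [SubQuot.baseChangeMap_mkQ, mk_eq_zero] at hz
    have hz' : Z.subtype.baseChange ℂ y ∈ B' := hz
    refine eq_zero_of_slice fun l => ?_
    rw [slice_baseChange]
    refine (mk_eq_zero _).2 ?_
    rw [hB] at hz'
    have := slice_mem l hz'
    rwa [slice_baseChange] at this
  · intro c
    obtain ⟨⟨x, hx⟩, rfl⟩ := mk_surjective _ c
    obtain ⟨y, hy⟩ := exists_baseChange_subtype (hZ ▸ hx : x ∈ Z.baseChange ℂ)
    refine ⟨(B.submoduleOf Z).mkQ.baseChange ℂ y, ?_⟩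
    rw [SubQuot.baseChangeMap_mkQ]
    congr 1
    exact Subtype.ext hy

end Slice

section Conj

variable {V V' : Type*} [AddCommGroup V] [Module ℚ V] [AddCommGroup V'] [Module ℚ V']

/-- The complex conjugation of `ℂ ⊗ V`. -/
def conjT (V : Type*) [AddCommGroup V] [Module ℚ V] : ℂ ⊗[ℚ] V →ₗ[ℚ] ℂ ⊗[ℚ] V :=
  LinearMap.rTensor V (Complex.conjAe.toLinearMap.restrictScalars ℚ)

lemma mem_conjSub {P : Submodule ℂ (ℂ ⊗[ℚ] V)} {z : ℂ ⊗[ℚ] V} :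
    z ∈ conjSub P ↔ conjT V z ∈ P := Iff.rfl

@[simp] lemma conjT_tmul (c : ℂ) (v : V) : conjT V (c ⊗ₜ v) = (starRingEnd ℂ c) ⊗ₜ v := rfl

lemma conjT_conjT (z : ℂ ⊗[ℚ] V) : conjT V (conjT V z) = z := by
  induction z using TensorProduct.induction_on with
  | zero => simp
  | tmul c v => simp
  | add x y hx hy => rw [map_add, map_add, hx, hy]

lemma conjT_baseChange (f : V →ₗ[ℚ] V') (z : ℂ ⊗[ℚ] V) :
    conjT V' (f.baseChange ℂ z) = f.baseChange ℂ (conjT V z) := by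
  induction z using TensorProduct.induction_on with
  | zero => simp
  | tmul c v => simp
  | add x y hx hy => simp only [map_add, hx, hy]

lemma conjT_mem_baseChange {P : Submodule ℚ V} {z : ℂ ⊗[ℚ] V} (hz : z ∈ P.baseChange ℂ) :
    conjT V z ∈ P.baseChange ℂ := by
  obtain ⟨y, rfl⟩ := exists_baseChange_subtype hz
  rw [conjT_baseChange]
  exact baseChange_subtype_mem _

lemma IsPureHS.of_equiv {w : ℤ} {F : ℤ → Submodule ℂ (ℂ ⊗[ℚ] V')} (h : IsPureHS V' w F)
    (e : V ≃ₗ[ℚ] V') {F' : ℤ → Submodule ℂ (ℂ ⊗[ℚ] V)}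
    (hF : ∀ q z, z ∈ F' q ↔ e.toLinearMap.baseChange ℂ z ∈ F q) : IsPureHS V w F' where
  anti p q hpq z hz := (hF _ _).2 (h.anti hpq ((hF _ _).1 hz))
  exists_top := by
    obtain ⟨p, hp⟩ := h.exists_top
    exact ⟨p, Submodule.eq_top_iff'.2 fun z => (hF _ _).2 (by rw [hp]; trivial)⟩
  exists_bot := by
    obtain ⟨p, hp⟩ := h.exists_bot
    refine ⟨p, (Submodule.eq_bot_iff _).2 fun z hz => ?_⟩
    have := (hF _ _).1 hz
    rw [hp, mem_bot] at this
    exact baseChange_injective e.injective (this.trans (map_zero _).symm)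
  compl p := by
    have hc := h.compl p
    constructor
    · rw [Submodule.disjoint_def]
      intro z hz hz'
      have h1 := (hF _ _).1 hz
      have h2 : e.toLinearMap.baseChange ℂ z ∈ conjSub (F (w + 1 - p)) := by
        rw [mem_conjSub, conjT_baseChange]
        exact (hF _ _).1 hz'
      have := Submodule.disjoint_def.1 hc.disjoint _ h1 h2
      exact baseChange_injective e.injective (this.trans (map_zero _).symm)
    · rw [codisjoint_iff, Submodule.eq_top_iff']
      intro z
      have : e.toLinearMap.baseChange ℂ z ∈ F p ⊔ conjSub (F (w + 1 - p)) := by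
        rw [hc.sup_eq_top]; trivial
      obtain ⟨a, ha, b, hb, hab⟩ := mem_sup.1 this
      obtain ⟨a, rfl⟩ := baseChange_surjective (f := e.toLinearMap) e.surjective a
      obtain ⟨b, rfl⟩ := baseChange_surjective (f := e.toLinearMap) e.surjective b
      refine mem_sup.2 ⟨a, (hF _ _).2 ha, b, ?_, ?_⟩
      · rw [mem_conjSub] at hb ⊢
        rw [conjT_baseChange] at hb
        exact (hF _ _).2 hb
      · rw [← map_add] at hab
        exact baseChange_injective e.injective hab

end Conj

namespace FDGA

variable (A : FDGA.{u} ℚ)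

lemma baseChange_Z1_eq (n : ℕ) (p : ℤ) : A.baseChange.Z1 n p = (A.Z1 n p).baseChange ℂ := by
  refine le_antisymm (fun x hx => ?_) fun x hx => ?_
  · refine mem_baseChange_of_slice fun l => ⟨⟨slice_mem l hx.1.1, slice_mem l hx.1.2⟩, ?_⟩
    have h := slice_mem l hx.2
    have e : slice A.carrier l (A.baseChange.d x) = A.d (slice A.carrier l x) :=
      slice_baseChange l A.d x
    change A.d (slice A.carrier l x) ∈ A.W (p - 1)
    rw [← e]
    exact h
  · refine ⟨⟨Submodule.baseChange_mono ℂ (show A.Z1 n p ≤ A.W p from fun _ h => h.1.1) hx,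
      Submodule.baseChange_mono ℂ (show A.Z1 n p ≤ A.gr n from fun _ h => h.1.2) hx⟩, ?_⟩
    exact baseChange_le_comap (P := A.Z1 n p) (A.d.baseChange ℂ)
      (fun y hy => Submodule.tmul_mem_baseChange_of_mem _ hy.2) x hx

lemma baseChange_B1_eq (p : ℤ) : A.baseChange.B1 p = (A.B1 p).baseChange ℂ := by
  refine le_antisymm (sup_le (Submodule.baseChange_mono ℂ le_sup_left) ?_) fun x hx => ?_
  · rintro _ ⟨v, hv, rfl⟩
    exact baseChange_le_comap (Q := (A.B1 p).baseChange ℂ) (A.d.baseChange ℂ)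
      (fun y hy => Submodule.tmul_mem_baseChange_of_mem _ (mem_sup_right ⟨y, hy, rfl⟩)) v hv
  · refine baseChange_le_comap (Q := A.baseChange.B1 p) LinearMap.id (fun y hy => ?_) x hx
    obtain ⟨u, hu, _, ⟨v, hv, rfl⟩, rfl⟩ := mem_sup.1 hy
    refine mem_sup.2 ⟨A.incl u, DGA.incl_mem hu, A.incl (A.d v), ?_, (map_add A.incl _ _).symm⟩
    exact ⟨A.incl v, DGA.incl_mem hv, A.d_incl v⟩

/-- The canonical isomorphism `E_1(A) ⊗ ℂ ≅ E_1(A ⊗ ℂ)`. -/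
def E1BaseChange (n : ℕ) (p : ℤ) : ℂ ⊗[ℚ] A.E1 n p ≃ₗ[ℂ] A.baseChange.E1 n p :=
  LinearEquiv.ofBijective _
    (SubQuot.baseChangeMap_bijective (A.baseChange_Z1_eq n p) (A.baseChange_B1_eq p))

lemma E1BaseChange_mkQ {n : ℕ} {p : ℤ} (y : ℂ ⊗[ℚ] A.Z1 n p)
    (hy : (A.Z1 n p).subtype.baseChange ℂ y ∈ A.baseChange.Z1 n p) :
    A.E1BaseChange n p ((A.toE1 n p).baseChange ℂ y) = A.baseChange.toE1 n p
      ⟨(A.Z1 n p).subtype.baseChange ℂ y, hy⟩ :=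
  SubQuot.baseChangeMap_mkQ (A.baseChange_Z1_eq n p) (A.baseChange_B1_eq p) y

lemma E1BaseChange_tmul {n : ℕ} {p : ℤ} (x : A.Z1 n p) : A.E1BaseChange n p (1 ⊗ₜ A.toE1 n p x) =
      A.baseChange.toE1 n p (A.inclZ1 x) := by
  refine Eq.trans (congrArg _ (baseChange_tmul _ _ _).symm) (A.E1BaseChange_mkQ (1 ⊗ₜ x) ?_)
  exact (A.inclZ1 x).2

lemma E1BaseChange_d1 {n n' : ℕ} {p p' : ℤ} (hn : n + 1 = n') (hp : p' + 1 = p)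
    (z : ℂ ⊗[ℚ] A.E1 n p) : A.E1BaseChange n' p' ((A.d1 hn hp).baseChange ℂ z) =
      A.baseChange.d1 hn hp (A.E1BaseChange n p z) := by
  obtain rfl : p' = p - 1 := by omega
  subst hn
  have key : ∀ x : A.Z1 n p, A.E1BaseChange (n + 1) (p - 1) (1 ⊗ₜ[ℚ] A.d1 rfl hp (A.toE1 n p x)) =
        A.baseChange.d1 rfl hp (A.E1BaseChange n p (1 ⊗ₜ A.toE1 n p x)) := fun x => by
    rw [A.E1BaseChange_tmul]
    refine (A.E1BaseChange_tmul ⟨A.d x.1, ⟨x.2.2, A.d_mem x.2.1.2⟩, ?_⟩).trans ?_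
    · change A.d (A.d x.1) ∈ A.W (p - 1 - 1)
      rw [A.d_d]; exact zero_mem _
    · exact congrArg (A.baseChange.toE1 (n + 1) (p - 1)) (Subtype.ext (A.d_incl x.1).symm)
  induction z using TensorProduct.induction_on with
  | zero => simp only [map_zero]
  | add x y hx hy => simp only [map_add, hx, hy]
  | tmul c x =>
    obtain ⟨x, rfl⟩ := mk_surjective _ x
    have e : (c ⊗ₜ[ℚ] A.toE1 n p x : ℂ ⊗[ℚ] A.E1 n p) = c • ((1 : ℂ) ⊗ₜ[ℚ] A.toE1 n p x) := by
      rw [TensorProduct.smul_tmul', smul_eq_mul, mul_one]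
    change A.E1BaseChange (n + 1) (p - 1) ((A.d1 rfl hp).baseChange ℂ (c ⊗ₜ[ℚ] A.toE1 n p x)) =
        A.baseChange.d1 rfl hp (A.E1BaseChange n p (c ⊗ₜ[ℚ] A.toE1 n p x))
    rw [e, map_smul, map_smul, map_smul, map_smul, baseChange_tmul, key]

end FDGA

lemma IsPureHS.of_submoduleOf {V : Type*} [AddCommGroup V] [Module ℚ V] {G Z B : Submodule ℚ V}
    {P Q : Submodule ℚ G} {Z' B' : Submodule ℂ (ℂ ⊗[ℚ] V)} (hZ : Z' = Z.baseChange ℂ)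
    (hB : B' = B.baseChange ℂ) (hZG : Z ≤ G) (hP : ∀ x : G, x ∈ P ↔ x.1 ∈ Z)
    (hQ : ∀ x : G, x ∈ Q ↔ x.1 ∈ B) {F : ℤ → Submodule ℂ (ℂ ⊗[ℚ] V)} {w : ℤ}
    (hp : IsPureHS (SubQuot P Q) w (inducedF P Q fun q => (F q).comap (G.subtype.baseChange ℂ))) :
    IsPureHS (SubQuot Z B) w fun q =>
      (SubQuot.induced Z' B' (F q)).comap (SubQuot.baseChangeMap hZ hB) := by
  let r : P →ₗ[ℚ] Z := G.subtype.restrict fun x hx => (hP x).1 hx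
  have hr : Surjective r := fun x => ⟨⟨⟨x.1, hZG x.2⟩, (hP _).2 x.2⟩, rfl⟩
  let e₀ : SubQuot P Q →ₗ[ℚ] SubQuot Z B :=
    SubQuot.map G.subtype (fun x hx => (hP x).1 hx) fun x hx => (hQ x).1 hx
  have he₀ : Bijective e₀ := by
    constructor
    · rw [injective_iff_map_eq_zero]
      intro c hc
      obtain ⟨x, rfl⟩ := mk_surjective _ c
      exact (mk_eq_zero _).2 ((hQ x.1).2 ((mk_eq_zero (B.submoduleOf Z) (x := r x)).1 hc))
    · intro c
      obtain ⟨x, rfl⟩ := mk_surjective _ c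
      obtain ⟨y, rfl⟩ := hr x
      exact ⟨Submodule.Quotient.mk y, rfl⟩
  have hsub : ∀ y : ℂ ⊗[ℚ] P, Z.subtype.baseChange ℂ (r.baseChange ℂ y) =
      G.subtype.baseChange ℂ (P.subtype.baseChange ℂ y) := fun y => by
    rw [← LinearMap.comp_apply, ← baseChange_comp, ← LinearMap.comp_apply, ← baseChange_comp]
    rfl
  have hcomm : ∀ y : ℂ ⊗[ℚ] P, e₀.baseChange ℂ ((Q.submoduleOf P).mkQ.baseChange ℂ y) =
      (B.submoduleOf Z).mkQ.baseChange ℂ (r.baseChange ℂ y) := fun y => by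
    rw [← LinearMap.comp_apply, ← baseChange_comp, ← LinearMap.comp_apply, ← baseChange_comp]
    rfl
  refine hp.of_equiv (LinearEquiv.ofBijective e₀ he₀).symm fun q z => ?_
  obtain ⟨z, rfl⟩ := baseChange_surjective (f := e₀) he₀.2 z
  have hz : ((LinearEquiv.ofBijective e₀ he₀).symm : _ →ₗ[ℚ] _).baseChange ℂ
      (e₀.baseChange ℂ z) = z := by
    rw [← LinearMap.comp_apply, ← baseChange_comp]
    have : ((LinearEquiv.ofBijective e₀ he₀).symm : _ →ₗ[ℚ] _) ∘ₗ e₀ = LinearMap.id :=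
      LinearMap.ext fun x => (LinearEquiv.ofBijective e₀ he₀).symm_apply_apply x
    rw [this, LinearMap.baseChange_id]; rfl
  rw [hz]
  constructor
  · rintro ⟨⟨f, hfZ⟩, hf, hfz⟩
    obtain ⟨y, rfl⟩ := baseChange_surjective (Submodule.mkQ_surjective (Q.submoduleOf P)) z
    obtain ⟨w, hw⟩ := exists_baseChange_subtype (hZ ▸ hfZ : f ∈ Z.baseChange ℂ)
    obtain ⟨w, rfl⟩ := baseChange_surjective hr w
    refine ⟨w, ?_, ?_⟩
    · change G.subtype.baseChange ℂ (P.subtype.baseChange ℂ w) ∈ F q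
      rw [← hsub, hw]; exact hf
    · refine baseChange_injective he₀.1 ((SubQuot.baseChangeMap_bijective hZ hB).1 ?_)
      rw [hcomm w, SubQuot.baseChangeMap_mkQ]
      exact (congrArg (B'.submoduleOf Z').mkQ (Subtype.ext hw)).trans hfz
  · rintro ⟨y, hy, rfl⟩
    have hy' : G.subtype.baseChange ℂ (P.subtype.baseChange ℂ y) ∈ F q := hy
    rw [Submodule.mem_comap, hcomm, SubQuot.baseChangeMap_mkQ]
    exact ⟨⟨_, _⟩, (by rw [← hsub] at hy'; exact hy'), rfl⟩

namespace DGA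

/-- The restriction of scalars of a dga over `ℂ` to `ℚ`. -/
def restrictRat (C : DGA.{u} ℂ) : DGA.{u} ℚ :=
  letI : Algebra ℚ C.carrier := Algebra.compHom C.carrier (algebraMap ℚ ℂ)
  haveI : IsScalarTower ℚ ℂ C.carrier := IsScalarTower.of_algebraMap_eq' rfl
  haveI : SetLike.GradedMonoid fun n => (C.gr n).restrictScalars ℚ :=
    { one_mem := SetLike.GradedOne.one_mem (A := C.gr)
      mul_mem := fun _ _ _ _ hx hy => DGA.mul_mem_gr hx hy }
  { carrier := C.carrier
    gr := fun n => (C.gr n).restrictScalars ℚ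
    graded := gradedAlgebraOfProj _ (fun n => (C.proj n).restrictScalars ℚ)
      (fun _ _ hx => C.proj_of_mem hx) (fun _ _ h _ hx => C.proj_of_mem_ne h hx) fun x => by
        obtain ⟨s, hs⟩ := C.sum_proj x
        rw [hs]
        exact sum_mem fun n _ => mem_iSup_of_mem n (C.proj_mem n x)
    d := C.d.restrictScalars ℚ
    d_mem := fun hx => C.d_mem hx
    d_d := C.d_d
    leibniz := fun {n x} hx y => by
      refine (C.leibniz hx y).trans ?_
      rcases Nat.even_or_odd n with h | h <;> simp [h.neg_one_pow]
    comm := fun {m n x y} hx hy => by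
      refine (C.comm hx hy).trans ?_
      rcases Nat.even_or_odd (m * n) with h | h <;> simp [h.neg_one_pow] }

def ratDGA : DGA.{u} ℚ :=
  haveI : SetLike.GradedMonoid fun n : ℕ => (if n = 0 then ⊤ else ⊥ : Submodule ℚ (ULift.{u} ℚ)) :=
    { one_mem := trivial
      mul_mem := fun m n x y hx hy => by
        by_cases hm : m = 0
        · by_cases hn : n = 0
          · subst hm hn; trivial
          · have : y = 0 := by simpa [hn] using hy
            rw [this, mul_zero]; exact zero_mem _
        · have : x = 0 := by simpa [hm] using hx
          rw [this, zero_mul]; exact zero_mem _ }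
  { carrier := ULift.{u} ℚ
    gr := fun n => if n = 0 then ⊤ else ⊥
    graded := gradedAlgebraOfProj _ (fun n => if n = 0 then LinearMap.id else 0)
      (fun n x hx => by split_ifs at hx ⊢ <;> simp_all)
      (fun m n h x hx => by split_ifs at hx ⊢ <;> simp_all)
      (fun x => mem_iSup_of_mem 0 trivial)
    d := 0
    d_mem := fun _ => zero_mem _
    d_d := fun _ => rfl
    leibniz := fun _ _ => by simp
    comm := fun {m n x y} hx hy => by
      split_ifs at hx hy
      · simp_all [mul_comm]
      all_goals simp_all }

lemma prodMem_gr {k : Type} [Field k] {A : DGA.{u} k} {deg : ℕ → ℕ} {S : ℤ → Set A.carrier}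
    (hdeg : ∀ i, 1 ≤ deg i) (hS : ∀ r, ∀ x ∈ S r, ∃ i, x ∈ A.gr (deg i)) {p : ℤ} {x : A.carrier}
    (hx : ProdMem S p x) : x = 1 ∨ ∃ n, x ∈ A.gr (n + 1) := by
  have : x = 1 ∧ x ∈ A.gr 0 ∨ ∃ n, x ∈ A.gr (n + 1) := by
    induction hx with
    | one => exact Or.inl ⟨rfl, SetLike.GradedOne.one_mem (A := A.gr)⟩
    | @mul p q x y hx hy ih =>
      right
      obtain ⟨i, hi⟩ := hS _ _ hx
      obtain ⟨m, hm⟩ : ∃ m, deg i = m + 1 := ⟨deg i - 1, by have := hdeg i; omega⟩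
      rw [hm] at hi
      rcases ih with ⟨-, h⟩ | ⟨n, h⟩
      · exact ⟨m, add_zero (m + 1) ▸ DGA.mul_mem_gr hi h⟩
      · exact ⟨m + 1 + n, by
          rw [add_assoc]; exact DGA.mul_mem_gr hi h⟩
  exact this.imp (·.1) id

end DGA

namespace MixedHodgeDGA

/-- The subspace `U ⊗ ℂ` of `M ⊗ ℂ`. -/
def extend (M : MixedHodgeDGA.{u}) (U : Submodule ℚ M.carrier) : Submodule ℂ M.toFFDGA.carrier :=
  U.baseChange ℂ

section

variable (M : MixedHodgeDGA.{u})

def inclC (M : MixedHodgeDGA.{u}) : M.carrier →+* M.toFFDGA.carrier := M.incl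

lemma inclC_algebraMap (c : ℚ) :
    M.inclC (algebraMap ℚ M.carrier c) = algebraMap ℂ M.toFFDGA.carrier (c : ℂ) :=
  M.incl_algebraMap c

lemma d_inclC (x : M.carrier) : M.toFFDGA.d (M.inclC x) = M.inclC (M.d x) := M.d_incl x

lemma inclC_mem_extend {U : Submodule ℚ M.carrier} {x : M.carrier} (hx : x ∈ U) :
    M.inclC x ∈ M.extend U :=
  DGA.incl_mem hx

lemma extend_le {U : Submodule ℚ M.carrier} {Q : Submodule ℂ M.toFFDGA.carrier}
    (hQ : ∀ x ∈ U, M.inclC x ∈ Q) : M.extend U ≤ Q :=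
  fun x hx => DGA.map_baseChange_mem (A := M.toDGA) (V := M.toFFDGA.carrier) LinearMap.id hQ x hx

lemma mem_extend {U : Submodule ℚ M.carrier} {x : M.toFFDGA.carrier} :
    x ∈ M.extend U ↔ ∃ y, M.inclSub U y = x :=
  ⟨fun hx => exists_baseChange_subtype hx, by rintro ⟨y, rfl⟩; exact baseChange_subtype_mem y⟩

lemma inclC_smul (c : ℚ) (x : M.carrier) :
    M.inclC (c • x) = (algebraMap ℂ M.toFFDGA.carrier c) * M.inclC x := by
  rw [Algebra.smul_def, map_mul, M.inclC_algebraMap]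

end

variable {M : MixedHodgeDGA.{u}} {deg : ℕ → ℕ} {V : ℕ → Submodule ℚ M.carrier}

section

variable (M) (ℓ : ℕ)

/-- The identity, as a morphism from an even vertex of the diagram defined by `M`. -/
def idHom : ∀ s : Src ℓ, FDGA.Hom ((M.toDiag ℓ).ev s) M.baseChange
  | .rat => FDGA.Hom.id M.baseChange
  | .mid _ => FDGA.Hom.id M.baseChange
  | .hodge => FDGA.Hom.id M.baseChange

lemma toDiag_φ (j : Fin (ℓ + 1)) (b : Bool) : (M.toDiag ℓ).φ j b = M.idHom ℓ (src j b) := by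
  unfold toDiag
  dsimp only
  generalize src j b = s
  cases s <;> rfl

variable {M} in
lemma id_E2 {n : ℕ} {p : ℤ} (x : M.baseChange.E2 n p) :
    (FDGA.Hom.id M.baseChange).E2 n p x = x := by
  obtain ⟨⟨y, hy⟩, rfl⟩ := mk_surjective _ x
  obtain ⟨z, rfl⟩ := mk_surjective _ y
  rfl

def constE2 {n : ℕ} {p : ℤ} (c : M.baseChange.E2 n p) : ∀ s : Src ℓ, ((M.toDiag ℓ).ev s).E2 n p
  | .rat => c
  | .mid _ => c
  | .hodge => c

lemma toDiag_φ_E2 (j : Fin (ℓ + 1)) (b : Bool) {n : ℕ} {p : ℤ} (c : M.baseChange.E2 n p) :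
    ((M.toDiag ℓ).φ j b).E2 n p (M.constE2 ℓ c (src j b)) = c := by
  rw [toDiag_φ]
  generalize src j b = s
  cases s <;> exact id_E2 c

lemma toDiag_φ_e1 (j : Fin (ℓ + 1)) (b : Bool) : ((M.toDiag ℓ).φ j b).IsE1QuasiIso := by
  have hid : (FDGA.Hom.id M.baseChange).IsE1QuasiIso := fun n p => by
    rw [show (FDGA.Hom.id M.baseChange).E2 n p = LinearMap.id from
      LinearMap.ext fun x => id_E2 x]
    exact Function.bijective_id
  rw [toDiag_φ]
  generalize src j b = s
  cases s <;> exact hid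

end

namespace IsMinimalWith

variable (h : M.IsMinimalWith deg V)
include h

lemma d_W' {p : ℤ} {x : M.carrier} (hx : x ∈ M.W p) : M.d x ∈ M.W (p - 1) := by
  rw [h.W_eq p] at hx
  refine span_le (p := (M.W (p - 1)).comap M.d).2 ?_ hx
  rintro y ⟨p', hp', hy⟩
  refine M.W_mono (sub_le_sub_right hp' 1) ?_
  have : y ∈ M.W p' ∧ M.d y ∈ M.W (p' - 1) := by
    clear hp' hx
    induction hy with
    | one => exact ⟨M.one_mem_W, by rw [M.d_one]; exact zero_mem _⟩
    | @mul p q x y hx _ ih =>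
      obtain ⟨i, hi⟩ := Set.mem_iUnion.1 hx
      refine ⟨M.mul_mem_W hi.2 ih.1, ?_⟩
      rw [M.leibniz']
      refine add_mem ?_ ?_
      · rw [show p + q - 1 = (p - 1) + q by ring]
        exact M.mul_mem_W (h.d_W i p x hi.1 hi.2) ih.1
      · rw [show p + q - 1 = p + (q - 1) by ring]
        exact M.mul_mem_W (M.sgn_mem (fun _ hx n => M.proj_mem_W hx n) hi.2) ih.2
  exact this.2

lemma exists_W_top (i : ℕ) : ∃ p, V i ≤ M.W p := by
  obtain ⟨p, hp⟩ := (h.mhs i).W_exists_top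
  exact ⟨p - deg i, fun x hx => by
    have : (⟨x, hx⟩ : V i) ∈ (M.W (p - deg i)).submoduleOf (V i) := by rw [hp]; trivial
    exact this⟩

lemma isCellular : M.toFDGA.IsCellular deg V where
  V_le := h.V_le
  d_mem i x hx := by
    have : M.stagePos V i * M.stagePos V i ≤ Subalgebra.toSubmodule (M.stage V i) :=
      Submodule.mul_le.2 fun a ha b hb => (M.stage V i).mul_mem ha.1 hb.1
    exact this (h.d_mem i x hx)
  d_W _ _ hx := h.d_W' hx
  free C g hg := (h.free C g hg).exists
  V_le_W := h.exists_W_top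
  W_le p := (h.W_eq p).le

lemma isCellular_baseChange : M.toFFDGA.IsCellular deg fun i => M.extend (V i) where
  V_le i := M.extend_le fun x hx => DGA.incl_mem (h.V_le i hx)
  d_mem i := by
    have key : ∀ x ∈ Algebra.adjoin ℚ (⋃ j < i, (V j : Set M.carrier)), M.inclC x ∈
        Algebra.adjoin ℂ (⋃ j < i, (M.extend (V j) : Set M.toFFDGA.carrier)) := by
      intro x hx
      induction hx using Algebra.adjoin_induction with
      | mem x hx =>
        simp only [Set.mem_iUnion] at hx
        obtain ⟨j, hj, hx⟩ := hx
        refine Algebra.subset_adjoin ?_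
        simp only [Set.mem_iUnion]
        exact ⟨j, hj, M.inclC_mem_extend hx⟩
      | algebraMap c =>
        rw [M.inclC_algebraMap]
        exact Subalgebra.algebraMap_mem _ _
      | add x y _ _ hx hy => rw [map_add]; exact Subalgebra.add_mem _ hx hy
      | mul x y _ _ hx hy => rw [map_mul]; exact Subalgebra.mul_mem _ hx hy
    refine M.extend_le (Q := (Subalgebra.toSubmodule (Algebra.adjoin ℂ
      (⋃ j < i, (M.extend (V j) : Set M.toFFDGA.carrier)))).comap M.toFFDGA.d) fun x hx => ?_
    have := key _ (h.isCellular.d_mem i x hx)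
    rw [← M.d_inclC] at this
    exact this
  d_W p := M.extend_le (U := M.W p) (Q := (M.toFFDGA.W (p - 1)).comap M.toFFDGA.d) fun x hx => by
    have : M.inclC (M.d x) ∈ M.toFFDGA.W (p - 1) := DGA.incl_mem (h.d_W' hx)
    rw [← M.d_inclC] at this
    exact this
  free C g hg := by
    let : Algebra ℚ C.carrier := Algebra.compHom C.carrier (algebraMap ℚ ℂ)
    have : IsScalarTower ℚ ℂ C.carrier := IsScalarTower.of_algebraMap_eq' rfl
    have hsm : ∀ (c : ℚ) (x : C.carrier), c • x = (c : ℂ) • x := fun _ _ => rfl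
    let g' : ∀ i, V i →ₗ[ℚ] C.carrier := fun i =>
      { toFun := fun v => g i ⟨M.inclC v, M.inclC_mem_extend v.2⟩
        map_add' := fun v w => by
          rw [← map_add]
          exact congrArg (g i) (Subtype.ext (map_add M.inclC (v : M.carrier) w))
        map_smul' := fun c v => by
          rw [hsm, RingHom.id_apply, ← map_smul]
          refine congrArg (g i) (Subtype.ext ((M.inclC_smul c v).trans ?_))
          exact (Algebra.smul_def _ _).symm }
    obtain ⟨f, hf, hfg⟩ := (h.free C.restrictRat g' fun i v => hg i _).exists
    let f' : M.carrier →ₐ[ℚ] C.carrier := f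
    let F : M.toFFDGA.carrier →ₐ[ℂ] C.carrier :=
      Algebra.TensorProduct.lift (Algebra.ofId ℂ C.carrier) f' fun c _ => Algebra.commutes c _
    have hF : ∀ x, F (M.inclC x) = f x := fun x => by
      refine (Algebra.TensorProduct.lift_tmul _ _ _ _ _).trans ?_
      rw [map_one, one_mul]
      rfl
    refine ⟨F, fun n x hx => ?_, fun i v => ?_⟩
    · refine M.extend_le (U := M.gr n) (Q := (C.gr n).comap F.toLinearMap) (fun y hy => ?_) hx
      change F (M.inclC y) ∈ C.gr n
      exact (hF y).symm ▸ hf n y hy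
    · obtain ⟨w, hw, hwv⟩ := M.extend_le (U := V i) (Q := (LinearMap.eqLocus
        (F.toLinearMap ∘ₗ (M.extend (V i)).subtype) (g i)).map (M.extend (V i)).subtype)
        (fun x hx => ⟨⟨M.inclC x, M.inclC_mem_extend hx⟩, (hF x).trans (hfg i ⟨x, hx⟩), rfl⟩) v.2
      obtain rfl : w = v := Subtype.ext hwv
      exact hw
  V_le_W i := by
    obtain ⟨p, hp⟩ := h.exists_W_top i
    exact ⟨p, M.extend_le fun x hx => DGA.incl_mem (hp hx)⟩
  W_le p := M.extend_le (U := M.W p) fun y hy => by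
    rw [h.W_eq p] at hy
    have key : ∀ {q : ℤ} {z : M.carrier},
        ProdMem (fun r => ⋃ i, ((V i ⊓ M.W r : Submodule ℚ M.carrier) : Set M.carrier)) q z →
        ProdMem (fun r => ⋃ i, ((M.extend (V i) ⊓ M.toFFDGA.W r :
          Submodule ℂ M.toFFDGA.carrier) : Set M.toFFDGA.carrier)) q (M.inclC z) := by
      intro q z hz
      induction hz with
      | one => rw [map_one]; exact ProdMem.one
      | @mul q r z t hz _ ih =>
        rw [map_mul]
        refine ProdMem.mul ?_ ih
        obtain ⟨i, hi⟩ := Set.mem_iUnion.1 hz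
        exact Set.mem_iUnion.2 ⟨i, M.inclC_mem_extend hi.1, DGA.incl_mem hi.2⟩
    induction hy using Submodule.span_induction with
    | zero => rw [map_zero]; exact zero_mem _
    | add a b _ _ ha hb => rw [map_add]; exact add_mem ha hb
    | smul c a _ ha =>
      rw [M.inclC_smul, ← Algebra.smul_def]; exact Submodule.smul_mem _ _ ha
    | mem z hz =>
      obtain ⟨p', hp', hz⟩ := hz
      exact Submodule.subset_span ⟨p', hp', key hz⟩
  F_bot i := by
    obtain ⟨q, hq⟩ := (h.mhs i).F_exists_bot
    refine ⟨q, (Submodule.eq_bot_iff _).2 fun x hx => ?_⟩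
    obtain ⟨y, rfl⟩ := M.mem_extend.1 hx.1
    have : y ∈ (M.F q).comap (M.inclSub (V i)) := hx.2
    rw [hq, mem_bot] at this
    rw [this]
    exact map_zero (M.inclSub (V i))
  F_top i := by
    obtain ⟨q, hq⟩ := (h.mhs i).F_exists_top
    refine ⟨q, fun x hx => ?_⟩
    obtain ⟨y, rfl⟩ := M.mem_extend.1 hx
    have : y ∈ (M.F q).comap (M.inclSub (V i)) := by rw [hq]; trivial
    exact this
  F_le q := by
    refine (h.F_eq q).le.trans (Submodule.span_mono ?_)
    rintro x ⟨q', hq', hx⟩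
    refine ⟨q', hq', hx.mono fun r => Set.iUnion_mono fun i z hz => ?_⟩
    exact ⟨M.mem_extend.2 hz.1, hz.2⟩

lemma gr_zero_le : M.gr 0 ≤ range (Algebra.linearMap ℚ M.carrier) := by
  intro x hx
  obtain ⟨p, hp⟩ := M.W_exhaustive x
  rw [h.W_eq p] at hp
  rw [← M.proj_of_mem hx]
  refine span_le (p := (range (Algebra.linearMap ℚ M.carrier)).comap (M.proj 0)).2 ?_ hp
  rintro y ⟨p', -, hy⟩
  rcases DGA.prodMem_gr (A := M.toDGA) (deg := deg) h.deg_pos (fun r x hx => by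
    obtain ⟨i, hi⟩ := Set.mem_iUnion.1 hx
    exact ⟨i, h.V_le i hi.1⟩) hy with rfl | ⟨n, hn⟩
  · exact ⟨1, by rw [M.proj_of_mem (SetLike.GradedOne.one_mem (A := M.gr))]; simp⟩
  · change M.proj 0 y ∈ range (Algebra.linearMap ℚ M.carrier)
    rw [M.proj_of_mem_ne (Nat.succ_ne_zero n) hn]
    exact zero_mem _

lemma algebraMap_injective : Injective (algebraMap ℚ M.carrier) := by
  obtain ⟨f, -⟩ := (h.free DGA.ratDGA (fun _ => 0) fun _ _ => zero_mem _).exists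
  intro a b hab
  have := congrArg f hab
  rw [AlgHom.commutes, AlgHom.commutes] at this
  exact (algebraMap ℚ (ULift.{u} ℚ)).injective this

lemma unitH0_bijective : Bijective M.unitH0 := by
  constructor
  · rw [injective_iff_map_eq_zero]
    intro c hc
    obtain ⟨y, hy⟩ := (mk_eq_zero _).1 hc
    have hy' : M.d y = algebraMap ℚ M.carrier c := hy
    have h0 : M.d y = 0 := by
      rw [← M.proj_of_mem (hy' ▸ SetLike.algebraMap_mem_graded M.gr c : M.d y ∈ M.gr 0), M.proj_d]
      change M.d 0 = 0
      exact map_zero _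
    rw [h0] at hy'
    exact h.algebraMap_injective (hy'.symm.trans (map_zero _).symm)
  · intro c
    obtain ⟨⟨x, hx⟩, rfl⟩ := mk_surjective _ c
    obtain ⟨a, rfl⟩ := h.gr_zero_le hx.1
    exact ⟨a, rfl⟩

lemma Z1_eq (n : ℕ) (p : ℤ) : M.Z1 n p = M.W p ⊓ M.gr n :=
  le_antisymm inf_le_left fun _ hx => ⟨hx, h.d_W' hx.1⟩

lemma B1_eq (p : ℤ) : M.B1 p = M.W (p - 1) :=
  le_antisymm (sup_le le_rfl (by rintro _ ⟨x, hx, rfl⟩; exact h.d_W' hx)) le_sup_left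

lemma decW_eq (n : ℕ) (p : ℤ) : M.decW n p = M.W (p - n) ⊓ M.gr n :=
  le_antisymm inf_le_left fun _ hx => ⟨hx, h.d_W' hx.1⟩

lemma pure_E1 (n : ℕ) (p : ℤ) : IsPureHS (M.E1 n p) (p + n) fun q =>
    (M.toFFDGA.E1F n p q).comap (M.E1BaseChange n p).toLinearMap :=
  IsPureHS.of_submoduleOf (M.baseChange_Z1_eq n p) (M.baseChange_B1_eq p)
    (P := (M.decW n (p + n)).submoduleOf (M.gr n))
    (Q := (M.decW n (p + n - 1)).submoduleOf (M.gr n)) (fun _ hx => hx.1.2)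
    (fun x => by rw [h.Z1_eq, h.decW_eq, add_sub_cancel_right]; rfl)
    (fun x => by
      rw [h.B1_eq, h.decW_eq, show p + (n : ℤ) - 1 - n = p - 1 by ring]
      exact ⟨fun hx => hx.1, fun hx => ⟨hx, x.2⟩⟩)
    ((M.mhs n).pure (p + n))

lemma toE1_inclZ1_mem {n : ℕ} {p : ℤ} (x : M.Z1 n p) (hx : M.toE1 n p x ∈ M.Z2 n p) :
    M.baseChange.toE1 n p (M.toFDGA.inclZ1 x) ∈ M.baseChange.Z2 n p := by
  rw [FDGA.mem_Z2_iff, M.baseChange_B1_eq]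
  have : M.incl (M.d x.1) ∈ (M.B1 (p - 1)).baseChange ℂ := DGA.incl_mem ((FDGA.mem_Z2_iff x).1 hx)
  rw [← M.d_incl] at this
  exact this

lemma isClass_E1BaseChange {n : ℕ} {p : ℤ} (x : M.Z1 n p) (hx : M.toE1 n p x ∈ M.Z2 n p) :
    M.baseChange.IsClass (M.E1BaseChange n p (1 ⊗ₜ M.toE1 n p x))
      (Submodule.Quotient.mk ⟨_, h.toE1_inclZ1_mem x hx⟩) :=
  ⟨(M.E1BaseChange_tmul x).symm ▸ h.toE1_inclZ1_mem x hx,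
    congrArg _ (Subtype.ext (M.E1BaseChange_tmul x))⟩

lemma isRationalStructure (ℓ : ℕ) :
    IsRationalStructure (M.toDiag ℓ) fun n p => M.E1BaseChange n p where
  map_d1 _ _ _ _ hn hp z := M.E1BaseChange_d1 hn hp z
  compat n p x hx := by
    refine ⟨M.constE2 ℓ (Submodule.Quotient.mk ⟨_, h.toE1_inclZ1_mem x hx⟩), ⟨_, rfl⟩,
      h.isClass_E1BaseChange x hx, fun j => ?_⟩
    rw [M.toDiag_φ_E2, M.toDiag_φ_E2]

lemma isMHD (ℓ : ℕ) (hfin : ∀ n, Module.Finite ℚ (M.H n)) : IsMHD (M.toDiag ℓ) where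
  e1 := M.toDiag_φ_e1 ℓ
  biregular n := by
    have hgr : ∀ x ∈ M.toFFDGA.gr n, ∃ y, M.inclSub (M.gr n) y = x :=
      fun x hx => exists_baseChange_subtype hx
    constructor
    · obtain ⟨q, hq⟩ := (M.mhs n).F_exists_bot
      refine ⟨q, (Submodule.eq_bot_iff _).2 fun x hx => ?_⟩
      obtain ⟨y, rfl⟩ := hgr x hx.2
      have : y ∈ (M.F q).comap (M.inclSub (M.gr n)) := hx.1
      rw [hq, mem_bot] at this
      rw [this]
      exact map_zero (M.inclSub (M.gr n))
    · obtain ⟨q, hq⟩ := (M.mhs n).F_exists_top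
      refine ⟨q, fun x hx => ?_⟩
      obtain ⟨y, rfl⟩ := hgr x hx
      have : y ∈ (M.F q).comap (M.inclSub (M.gr n)) := by rw [hq]; trivial
      exact this
  finite := hfin
  connected := h.unitH0_bijective
  strict p q x hx _ := ⟨0, zero_mem _, by
    rw [map_zero, sub_zero]; exact h.isCellular_baseChange.d_W p x hx⟩
  pure := ⟨_, h.isRationalStructure ℓ, h.pure_E1⟩

end IsMinimalWith

end MixedHodgeDGA

end MixedHodge

open MixedHodge.FDGA

namespace MixedHodge

abbrev FFam.AR {ℓ : ℕ} (A : FFam.{u} ℓ) : FDGA.{u} ℂ := A.AQ.baseChange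

/-! ### Zig-zags -/

namespace Src

variable {ℓ : ℕ}

/-- The position of an even vertex. -/
def idx : Src ℓ → ℕ
  | .rat => 0
  | .mid j => j + 1
  | .hodge => ℓ + 1

lemma idx_false (j : Fin (ℓ + 1)) : idx (src j false) = j := by
  refine Fin.cases ?_ (fun i => ?_) j <;> simp [src, idx]

lemma idx_true (j : Fin (ℓ + 1)) : idx (src j true) = j + 1 := by
  refine Fin.lastCases ?_ (fun i => ?_) j <;> simp [src, idx]

lemma idx_injective : Function.Injective (idx (ℓ := ℓ)) := by
  intro s t h
  cases s <;> cases t <;> simp only [idx] at h <;> first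
    | rfl
    | omega
    | (congr 1; ext; omega)

/-- The distance of an even vertex to one of the ends. -/
def dist (c : Bool) (s : Src ℓ) : ℕ := if c then ℓ + 1 - idx s else idx s

def start : Bool → Src ℓ
  | false => .rat
  | true => .hodge

lemma dist_lt (c : Bool) (j : Fin (ℓ + 1)) : dist c (src j c) < dist c (src j !c) := by
  have := j.2
  cases c <;> simp only [dist, Bool.not_false, Bool.not_true, idx_false, idx_true] <;> simp
  omega

lemma src_injective (c : Bool) : Injective fun j : Fin (ℓ + 1) => src j c := by
  intro i j h
  have h' := congrArg idx h
  cases c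
  · simp only [idx_false] at h'; exact Fin.ext h'
  · simp only [idx_true] at h'; exact Fin.ext (by omega)

lemma eq_start_or (c : Bool) (s : Src ℓ) : s = start c ∨ ∃ j, s = src j !c := by
  cases c
  · cases s with
    | rat => exact Or.inl rfl
    | mid j => exact Or.inr ⟨j.castSucc, idx_injective (by
        rw [Bool.not_false, idx_true]; simp [idx])⟩
    | hodge => exact Or.inr ⟨Fin.last ℓ, idx_injective (by
        rw [Bool.not_false, idx_true]; simp [idx])⟩
  · cases s with
    | rat => exact Or.inr ⟨0, idx_injective (by
        rw [Bool.not_true, idx_false]; simp [idx])⟩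
    | mid j => exact Or.inr ⟨j.succ, idx_injective (by
        rw [Bool.not_true, idx_false]; simp [idx])⟩
    | hodge => exact Or.inl rfl

lemma src_ne_start (c : Bool) (j : Fin (ℓ + 1)) : src j (!c) ≠ start c := by
  intro h
  have h' := congrArg idx h
  have := j.2
  cases c
  · rw [Bool.not_false, idx_true] at h'; simp only [start, idx] at h'; omega
  · rw [Bool.not_true, idx_false] at h'; simp only [start, idx] at h'; omega

lemma chain_induction (c : Bool) {P : Src ℓ → Prop} (h0 : P (start c))
    (h : ∀ j, P (src j c) → P (src j !c)) (s : Src ℓ) : P s := by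
  induction s using (measure (dist c)).wf.induction with
  | _ s ih =>
    rcases eq_start_or c s with rfl | ⟨j, rfl⟩
    · exact h0
    · exact h j (ih _ (dist_lt c j))

lemma exists_chain (c : Bool) {X : Src ℓ → Type*} [∀ s, Inhabited (X s)]
    (R : ∀ j, X (src j c) → X (src j !c) → Prop) (hR : ∀ j x, ∃ y, R j x y) (x₀ : X (start c)) :
    ∃ e : ∀ s, X s, e (start c) = x₀ ∧ ∀ j, R j (e (src j c)) (e (src j !c)) := by
  classical
  obtain ⟨e, he⟩ := exists_forall_of_wellFounded (X := X) (measure (dist (ℓ := ℓ) c)).wf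
    (fun {a b d} h1 h2 => Nat.lt_trans h1 h2)
    (fun s e => (s = start c → e (start c) = x₀) ∧
      ∀ j, s = src j (!c) → R j (e (src j c)) (e (src j !c))) (by
      rintro s g g' hg ⟨h1, h2⟩
      refine ⟨fun h => ?_, fun j hj => ?_⟩
      · rw [← hg _ (Or.inr h.symm)]; exact h1 h
      · rw [← hg (src j !c) (Or.inr hj.symm), ← hg (src j c) (Or.inl (by
          rw [hj]; exact dist_lt c j))]
        exact h2 j hj) (by
      intro s g _
      rcases eq_start_or c s with rfl | ⟨j, rfl⟩
      · exact ⟨x₀, fun _ => update_self _ _ _, fun j hj => absurd hj.symm (src_ne_start c j)⟩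
      · obtain ⟨y, hy⟩ := hR j (g (src j c))
        refine ⟨y, fun h => absurd h (src_ne_start c j), fun i hi => ?_⟩
        obtain rfl : j = i := src_injective _ hi
        rw [update_self, update_of_ne]
        · exact hy
        · intro h
          exact (dist_lt c j).ne (congrArg _ h))
  exact ⟨e, (he _).1 rfl, fun j => (he _).2 j rfl⟩

end Src

namespace FDiag

variable {ℓ : ℕ}

section Tie

variable (A : FDiag.{u} ℓ) (Z B : ∀ s, Submodule ℂ (A.ev s).carrier)
  (Z' B' : ∀ j, Submodule ℂ (A.odd j).carrier)

/-- A family of elements at the even vertices that correspond to each other modulo `B'`. -/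
structure IsTie (e : ∀ s, (A.ev s).carrier) : Prop where
  mem : ∀ s, e s ∈ Z s
  sub_mem : ∀ j, (A.φ j false) (e (src j false)) - (A.φ j true) (e (src j true)) ∈ B' j

/-- The structure maps induce isomorphisms of the quotients of the `Z` by the `B`. -/
structure IsTight : Prop where
  map_Z : ∀ j b, ∀ x ∈ Z (src j b), (A.φ j b) x ∈ Z' j
  map_B : ∀ j b, ∀ x ∈ B (src j b), (A.φ j b) x ∈ B' j
  inj : ∀ j b, ∀ x ∈ Z (src j b), (A.φ j b) x ∈ B' j → x ∈ B (src j b)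
  surj : ∀ j b, ∀ y ∈ Z' j, ∃ x ∈ Z (src j b), y - (A.φ j b) x ∈ B' j

variable {A Z B Z' B'}

lemma IsTight.exists_tie (h : A.IsTight Z B Z' B') (c : Bool) {x : (A.ev (Src.start c)).carrier}
    (hx : x ∈ Z (Src.start c)) : ∃ e, A.IsTie Z B' e ∧ e (Src.start c) = x := by
  have : ∀ s, Inhabited (Z s) := fun s => ⟨0⟩
  obtain ⟨e, he, he'⟩ := Src.exists_chain c (X := fun s => Z s)
    (fun j x y => (A.φ j c) x - (A.φ j !c) y ∈ B' j)
    (fun j x => by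
      obtain ⟨y, hy, hxy⟩ := h.surj j (!c) _ (h.map_Z j c x.1 x.2)
      exact ⟨⟨y, hy⟩, hxy⟩) ⟨x, hx⟩
  refine ⟨fun s => e s, ⟨fun s => (e s).2, fun j => ?_⟩, congrArg Subtype.val he⟩
  have := he' j
  cases c
  · exact this
  · rw [← neg_sub]; exact neg_mem this

lemma IsTight.mem_of_start (h : A.IsTight Z B Z' B') (c : Bool) {e : ∀ s, (A.ev s).carrier}
    (he : A.IsTie Z B' e) (h0 : e (Src.start c) ∈ B (Src.start c)) (s : Src ℓ) : e s ∈ B s := by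
  refine Src.chain_induction c (P := fun s => e s ∈ B s) h0 (fun j hj => ?_) s
  refine h.inj j _ _ (he.mem _) ?_
  have h1 := h.map_B j c _ hj
  have h2 := he.sub_mem j
  cases c
  · have := sub_mem h1 h2
    rwa [sub_sub_cancel] at this
  · have := add_mem h2 h1
    rwa [sub_add_cancel] at this

variable (A Z B' ) in
/-- The elements `x` and `z` at the ends of a diagram correspond to each other. -/
def Tied (x : A.AR.carrier) (z : A.AC.carrier) : Prop :=
  ∃ e, A.IsTie Z B' e ∧ e .rat = x ∧ e .hodge = z

lemma IsTight.exists_tied (h : A.IsTight Z B Z' B') {x : A.AR.carrier}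
    (hx : x ∈ Z .rat) : ∃ z, A.Tied Z B' x z ∧ z ∈ Z .hodge := by
  obtain ⟨e, he, rfl⟩ := h.exists_tie false hx
  exact ⟨_, ⟨e, he, rfl, rfl⟩, he.mem _⟩

lemma IsTight.exists_tied' (h : A.IsTight Z B Z' B') {z : A.AC.carrier}
    (hz : z ∈ Z .hodge) : ∃ x, A.Tied Z B' x z ∧ x ∈ Z .rat := by
  obtain ⟨e, he, rfl⟩ := h.exists_tie true hz
  exact ⟨_, ⟨e, he, rfl, rfl⟩, he.mem _⟩

lemma IsTight.tied_mem_iff (h : A.IsTight Z B Z' B') {x : A.AR.carrier}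
    {z : A.AC.carrier} (hxz : A.Tied Z B' x z) : x ∈ B .rat ↔ z ∈ B .hodge := by
  obtain ⟨e, he, rfl, rfl⟩ := hxz
  exact ⟨fun h0 => h.mem_of_start false he h0 _, fun h0 => h.mem_of_start true he h0 _⟩

lemma Tied.add {x y : A.AR.carrier} {z w : A.AC.carrier} (h : A.Tied Z B' x z)
    (h' : A.Tied Z B' y w) : A.Tied Z B' (x + y) (z + w) := by
  obtain ⟨e, he, rfl, rfl⟩ := h
  obtain ⟨f, hf, rfl, rfl⟩ := h'
  refine ⟨fun s => e s + f s, ⟨fun s => add_mem (he.mem s) (hf.mem s), fun j => ?_⟩, rfl, rfl⟩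
  rw [map_add, map_add, add_sub_add_comm]
  exact add_mem (he.sub_mem j) (hf.sub_mem j)

lemma Tied.smul (c : ℂ) {x : A.AR.carrier} {z : A.AC.carrier} (h : A.Tied Z B' x z) :
    A.Tied Z B' (c • x) (c • z) := by
  obtain ⟨e, he, rfl, rfl⟩ := h
  refine ⟨fun s => c • e s, ⟨fun s => Submodule.smul_mem _ _ (he.mem s), fun j => ?_⟩, rfl, rfl⟩
  rw [map_smul, map_smul, ← smul_sub]
  exact Submodule.smul_mem _ _ (he.sub_mem j)

lemma Tied.sub {x y : A.AR.carrier} {z w : A.AC.carrier} (h : A.Tied Z B' x z)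
    (h' : A.Tied Z B' y w) : A.Tied Z B' (x - y) (z - w) := by
  have := h.add (h'.smul (-1))
  rwa [neg_one_smul, neg_one_smul, ← sub_eq_add_neg, ← sub_eq_add_neg] at this

lemma Tied.mem_left {x : A.AR.carrier} {z : A.AC.carrier} (h : A.Tied Z B' x z) : x ∈ Z .rat := by
  obtain ⟨e, he, rfl, rfl⟩ := h
  exact he.mem _

lemma Tied.mem_right {x : A.AR.carrier} {z : A.AC.carrier} (h : A.Tied Z B' x z) :
    z ∈ Z .hodge := by
  obtain ⟨e, he, rfl, rfl⟩ := h
  exact he.mem _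

lemma IsTight.tied_congr (h : A.IsTight Z B Z' B') {x x' : A.AR.carrier}
    {z z' : A.AC.carrier} (hxz : A.Tied Z B' x z) (hx : x' ∈ Z .rat) (hx' : x - x' ∈ B .rat)
    (hz : z' ∈ Z .hodge) (hz' : z - z' ∈ B .hodge) : A.Tied Z B' x' z' := by
  obtain ⟨e, he, rfl, rfl⟩ := hxz
  let y : ∀ s, (A.ev s).carrier := fun s => match s with
    | .rat => x'
    | .mid j => e (.mid j)
    | .hodge => z'
  have hy : ∀ s, y s ∈ Z s := fun s => match s with
    | .rat => hx
    | .mid j => he.mem _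
    | .hodge => hz
  have hey : ∀ s, e s - y s ∈ B s := fun s => match s with
    | .rat => hx'
    | .mid j => by
      change e (.mid j) - e (.mid j) ∈ _
      rw [sub_self]; exact zero_mem _
    | .hodge => hz'
  refine ⟨y, ⟨hy, fun j => ?_⟩, rfl, rfl⟩
  have h1 := h.map_B j false _ (hey (src j false))
  have h2 := h.map_B j true _ (hey (src j true))
  have := add_mem (sub_mem (he.sub_mem j) h1) h2
  rw [map_sub, map_sub] at this
  convert this using 1
  abel

end Tie

variable (A : FDiag.{u} ℓ)

abbrev CTied (n : ℕ) (p : ℤ) : A.AR.carrier → A.AC.carrier → Prop :=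
  A.Tied (fun s => (A.ev s).cyc ⊤ n p) fun j => (A.odd j).bd ⊤ n (p + 1)

/-- Correspondence of representatives of classes in `E_2`. -/
abbrev ETied (n : ℕ) (p : ℤ) : A.AR.carrier → A.AC.carrier → Prop :=
  A.Tied (fun s => (A.ev s).precyc n p) fun j => (A.odd j).bdry p

variable {A}

lemma _root_.MixedHodge.FDGA.Hom.map_cyc {k : Type} [Field k] {A B : FDGA.{u} k}
    (f : FDGA.Hom A B) {n : ℕ} {p : ℤ}
    {x : A.carrier} (hx : x ∈ A.cyc ⊤ n p) : f x ∈ B.cyc ⊤ n p := by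
  rw [mem_cyc_top] at hx ⊢
  exact ⟨f.map_W _ _ hx.1, f.map_gr _ _ hx.2.1, by rw [← f.map_d, hx.2.2, map_zero]⟩

lemma _root_.MixedHodge.FDGA.Hom.map_bd {k : Type} [Field k] {A B : FDGA.{u} k}
    (f : FDGA.Hom A B) {n : ℕ} {p : ℤ}
    {x : A.carrier} (hx : x ∈ A.bd ⊤ n p) : f x ∈ B.bd ⊤ n p := by
  rw [mem_bd_top] at hx ⊢
  obtain ⟨v, h1, h2, rfl⟩ := hx
  exact ⟨_, f.map_W _ _ h1, f.map_prevGr h2, (f.map_d v).symm⟩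

lemma isTight_cyc (h : ∀ j b, (A.φ j b).IsE1QuasiIso) (n : ℕ) (p : ℤ) :
    A.IsTight (fun s => (A.ev s).cyc ⊤ n p) (fun s => (A.ev s).bd ⊤ n (p + 1))
      (fun j => (A.odd j).cyc ⊤ n p) fun j => (A.odd j).bd ⊤ n (p + 1) where
  map_Z j b _ hx := (A.φ j b).map_cyc hx
  map_B j b _ hx := (A.φ j b).map_bd hx
  inj j b := (h j b).isDecQuasiIso.inj n p
  surj j b := (h j b).isDecQuasiIso.surj n p

lemma isTight_precyc (h : ∀ j b, (A.φ j b).IsE1QuasiIso) (n : ℕ) (p : ℤ) :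
    A.IsTight (fun s => (A.ev s).precyc n p) (fun s => (A.ev s).bdry p)
      (fun j => (A.odd j).precyc n p) fun j => (A.odd j).bdry p where
  map_Z j b _ hx := (A.φ j b).map_precyc hx
  map_B j b _ hx := (A.φ j b).map_bdry hx
  inj j b := (FDGA.Hom.E2_injective_iff _).1 (h j b n p).1
  surj j b := (FDGA.Hom.E2_surjective_iff _).1 (h j b n p).2

lemma _root_.MixedHodge.FDGA.bd_le_bdry {k : Type} [Field k] (A : FDGA.{u} k) (n : ℕ) (p : ℤ) :
    A.bd ⊤ n (p + 1) ≤ A.bdry p := fun x hx => by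
  obtain ⟨v, hv, -, rfl⟩ := mem_bd_top.1 hx
  exact mem_sup_right ⟨v, hv, rfl⟩

lemma _root_.MixedHodge.FDGA.cyc_le_precyc {k : Type} [Field k] (A : FDGA.{u} k) (n : ℕ) (p : ℤ) :
    A.cyc ⊤ n p ≤ A.precyc n p := fun x hx => by
  rw [mem_cyc_top] at hx
  refine ⟨⟨hx.1, hx.2.1⟩, ?_⟩
  change A.d x ∈ A.W (p - 2)
  rw [hx.2.2]; exact zero_mem _

lemma CTied.eTied {n : ℕ} {p : ℤ} {x : A.AR.carrier} {z : A.AC.carrier}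
    (h : A.CTied n p x z) : A.ETied n p x z := by
  obtain ⟨e, he, hx, hz⟩ := h
  exact ⟨e, ⟨fun s => cyc_le_precyc _ n p (he.mem s),
    fun j => bd_le_bdry _ n p (he.sub_mem j)⟩, hx, hz⟩

lemma CTied.mono {n : ℕ} {p q : ℤ} (hpq : p ≤ q) {x : A.AR.carrier} {z : A.AC.carrier}
    (h : A.CTied n p x z) : A.CTied n q x z := by
  obtain ⟨e, he, hx, hz⟩ := h
  refine ⟨e, ⟨fun s => ?_, fun j => bd_mono _ n (by omega) (he.sub_mem j)⟩, hx, hz⟩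
  have := mem_cyc_top.1 (he.mem s)
  exact mem_cyc_top.2 ⟨FDGA.W_mono _ hpq this.1, this.2⟩

lemma ETied.d {n : ℕ} {p : ℤ} {x : A.AR.carrier} {z : A.AC.carrier}
    (h : A.ETied n p x z) : A.CTied (n + 1) (p - 2) (A.AR.d x) (A.AC.d z) := by
  obtain ⟨e, he, rfl, rfl⟩ := h
  refine ⟨fun s => (A.ev s).d (e s), ⟨fun s => ?_, fun j => ?_⟩, rfl, rfl⟩
  · have := he.mem s
    exact mem_cyc_top.2 ⟨this.2, (A.ev s).d_mem this.1.2, (A.ev s).d_d _⟩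
  · rw [FDGA.Hom.map_d, FDGA.Hom.map_d, ← map_sub]
    have h1 := he.sub_mem j
    have h2 : (A.φ j false) (e (src j false)) - (A.φ j true) (e (src j true)) ∈ (A.odd j).gr n :=
      sub_mem ((A.φ j false).map_gr _ _ (he.mem _).1.2) ((A.φ j true).map_gr _ _ (he.mem _).1.2)
    obtain ⟨u, hu, v, hv, e⟩ := bdry_homogeneous h2 h1
    rw [e, map_add, (A.odd j).d_d, add_zero]
    exact mem_bd_top.2 ⟨u, by rw [show p - 2 + 1 = p - 1 by ring]; exact hu.1, hu.2, rfl⟩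

end FDiag

/-! ### Complex conjugation on extensions of scalars -/

lemma conjT_smul {V : Type*} [AddCommGroup V] [Module ℚ V] (c : ℂ) (z : ℂ ⊗[ℚ] V) :
    conjT V (c • z) = (starRingEnd ℂ c) • conjT V z := by
  induction z using TensorProduct.induction_on with
  | zero => simp
  | tmul e v => simp [conjT, TensorProduct.smul_tmul']
  | add x y hx hy => rw [smul_add, map_add, map_add, smul_add, hx, hy]

namespace FDGA

variable (A : FDGA.{u} ℚ)

def conj : A.baseChange.carrier →+ A.baseChange.carrier := (conjT A.carrier).toAddMonoidHom

lemma conj_conj (x : A.baseChange.carrier) : A.conj (A.conj x) = x := conjT_conjT x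

lemma conj_d (x : A.baseChange.carrier) : A.conj (A.baseChange.d x) = A.baseChange.d (A.conj x) :=
  conjT_baseChange A.d x

lemma conj_W {p : ℤ} {x : A.baseChange.carrier} (hx : x ∈ A.baseChange.W p) :
    A.conj x ∈ A.baseChange.W p := conjT_mem_baseChange hx

lemma conj_gr {n : ℕ} {x : A.baseChange.carrier} (hx : x ∈ A.baseChange.gr n) :
    A.conj x ∈ A.baseChange.gr n := conjT_mem_baseChange hx

lemma conj_prevGr {n : ℕ} {x : A.baseChange.carrier} (hx : x ∈ A.baseChange.prevGr n) :
    A.conj x ∈ A.baseChange.prevGr n := by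
  cases n with
  | zero => rw [A.baseChange.eq_zero_of_prevGr_zero hx, map_zero]; exact zero_mem _
  | succ n => exact A.conj_gr hx

lemma conj_smul (c : ℂ) (x : A.baseChange.carrier) :
    A.conj (c • x) = (starRingEnd ℂ c) • A.conj x := conjT_smul c x

lemma conj_cyc {n : ℕ} {p : ℤ} {x : A.baseChange.carrier} (hx : x ∈ A.baseChange.cyc ⊤ n p) :
    A.conj x ∈ A.baseChange.cyc ⊤ n p := by
  rw [mem_cyc_top] at hx ⊢
  exact ⟨A.conj_W hx.1, A.conj_gr hx.2.1, by rw [← A.conj_d, hx.2.2, map_zero]⟩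

lemma conj_bd {n : ℕ} {p : ℤ} {x : A.baseChange.carrier} (hx : x ∈ A.baseChange.bd ⊤ n p) :
    A.conj x ∈ A.baseChange.bd ⊤ n p := by
  rw [mem_bd_top] at hx ⊢
  obtain ⟨v, h1, h2, rfl⟩ := hx
  exact ⟨_, A.conj_W h1, A.conj_prevGr h2, (A.conj_d v).symm⟩

lemma conj_precyc {n : ℕ} {p : ℤ} {x : A.baseChange.carrier} (hx : x ∈ A.baseChange.precyc n p) :
    A.conj x ∈ A.baseChange.precyc n p :=
  ⟨⟨A.conj_W hx.1.1, A.conj_gr hx.1.2⟩, by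
    change A.baseChange.d (A.conj x) ∈ A.baseChange.W (p - 2)
    rw [← A.conj_d]; exact A.conj_W hx.2⟩

lemma conj_bdry {p : ℤ} {x : A.baseChange.carrier} (hx : x ∈ A.baseChange.bdry p) :
    A.conj x ∈ A.baseChange.bdry p := by
  obtain ⟨u, hu, _, ⟨v, hv, rfl⟩, rfl⟩ := mem_sup.1 hx
  rw [map_add, A.conj_d]
  exact add_mem (mem_sup_left (A.conj_W hu)) (mem_sup_right ⟨_, A.conj_W hv, rfl⟩)

lemma conj_Z1 (A : FDGA.{u} ℚ) {n : ℕ} {p : ℤ} {x : A.baseChange.carrier}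
    (hx : x ∈ A.baseChange.Z1 n p) : A.conj x ∈ A.baseChange.Z1 n p :=
  ⟨⟨A.conj_W hx.1.1, A.conj_gr hx.1.2⟩, by
    change A.baseChange.d (A.conj x) ∈ A.baseChange.W (p - 1)
    rw [← A.conj_d]; exact A.conj_W hx.2⟩

lemma conj_B1 (A : FDGA.{u} ℚ) {p : ℤ} {x : A.baseChange.carrier}
    (hx : x ∈ A.baseChange.B1 p) : A.conj x ∈ A.baseChange.B1 p := by
  obtain ⟨u, hu, _, ⟨v, hv, rfl⟩, rfl⟩ := mem_sup.1 hx
  rw [map_add, A.conj_d]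
  exact add_mem (mem_sup_left (A.conj_W hu)) (mem_sup_right ⟨_, A.conj_W hv, rfl⟩)

lemma d_mem_Z1 {k : Type} [Field k] (A : FDGA.{u} k) {n : ℕ} {p : ℤ} {x : A.carrier}
    (hx : x ∈ A.Z1 n p) : A.d x ∈ A.Z1 (n + 1) (p - 1) :=
  ⟨⟨hx.2, A.d_mem hx.1.2⟩, by
    change A.d (A.d x) ∈ A.W (p - 1 - 1)
    rw [A.d_d]; exact zero_mem _⟩

lemma E1BaseChange_conj (A : FDGA.{u} ℚ) {n : ℕ} {p : ℤ} {c : ℂ ⊗[ℚ] A.E1 n p}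
    {x : A.baseChange.carrier} {hx : x ∈ A.baseChange.Z1 n p}
    (h : A.E1BaseChange n p c = A.baseChange.toE1 n p ⟨x, hx⟩) :
    A.E1BaseChange n p (conjT _ c) = A.baseChange.toE1 n p ⟨A.conj x, A.conj_Z1 hx⟩ := by
  have hx' := hx
  rw [A.baseChange_Z1_eq] at hx'
  obtain ⟨y, rfl⟩ := exists_baseChange_subtype hx'
  have h1 := A.E1BaseChange_mkQ y hx
  obtain rfl := (A.E1BaseChange n p).injective (h.trans h1.symm)
  rw [conjT_baseChange]
  have e : (A.Z1 n p).subtype.baseChange ℂ (conjT _ y) =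
      A.conj ((A.Z1 n p).subtype.baseChange ℂ y) := (conjT_baseChange _ y).symm
  refine (A.E1BaseChange_mkQ (conjT _ y) (by rw [e]; exact A.conj_Z1 hx)).trans ?_
  exact congrArg _ (Subtype.ext e)

end FDGA

namespace FDiag

variable {ℓ : ℕ}

/-- A correspondence between `E_1`-terms at the ends of a diagram that comes from an isomorphism
which commutes with `d_1`, is compatible with the diagram, and transports the Hodge filtration to a
pure Hodge structure. -/
structure IsHodgeRel (A : FDiag.{u} ℓ) (R : ℕ → ℤ → A.AR.carrier → A.AC.carrier → Prop) : Prop where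
  left {n p x z} : R n p x z → x ∈ A.AR.Z1 n p
  right {n p x z} : R n p x z → z ∈ A.AC.Z1 n p
  exists_right {n p x} : x ∈ A.AR.Z1 n p → ∃ z, R n p x z
  exists_left {n p z} : z ∈ A.AC.Z1 n p → ∃ x, R n p x z
  sub {n p x z x' z'} : R n p x z → R n p x' z' → R n p (x - x') (z - z')
  mem_iff {n p x z} : R n p x z → (x ∈ A.AR.B1 p ↔ z ∈ A.AC.B1 p)
  congr {n p x z x' z'} : R n p x z → x' ∈ A.AR.Z1 n p →
    x - x' ∈ A.AR.B1 p → z' ∈ A.AC.Z1 n p → z - z' ∈ A.AC.B1 p → R n p x' z'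
  d {n p x z} : R n p x z → R (n + 1) (p - 1) (A.AR.d x) (A.AC.d z)
  tied {n p x z} : R n p x z → x ∈ A.AR.precyc n p → z ∈ A.AC.precyc n p → A.ETied n p x z
  split {n p x} : x ∈ A.AR.Z1 n p → ∀ a b : ℤ, a + b = n + p + 1 →
    ∃ x₁ x₂, x = x₁ + x₂ ∧ (∃ z ∈ A.AC.F a, R n p x₁ z) ∧ ∃ z ∈ A.AC.F b, R n p (A.AQ.conj x₂) z
  indep {n p x z z'} {a b : ℤ} : R n p x z → z ∈ A.AC.F a → R n p (A.AQ.conj x) z' →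
    z' ∈ A.AC.F b → a + b = n + p + 1 → x ∈ A.AR.B1 p

end FDiag

open FDiag

variable {ℓ : ℕ} {A : FDiag.{u} ℓ}

lemma IsRationalStructure.exists_tied {ρ : ∀ n p, ℂ ⊗[ℚ] A.AQ.E1 n p ≃ₗ[ℂ] A.AC.E1 n p}
    (hρ : IsRationalStructure A ρ) {n : ℕ} {p : ℤ} {x : A.AR.carrier}
    (hx : x ∈ A.AR.precyc n p) {z : A.AC.carrier} (hz : z ∈ A.AC.Z1 n p)
    (h : ρ n p ((A.AQ.E1BaseChange n p).symm
      (A.AR.toE1 n p ⟨x, precyc_le_Z1 n p hx⟩)) = A.AC.toE1 n p ⟨z, hz⟩) :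
    ∃ z', A.ETied n p x z' ∧ z - z' ∈ A.AC.bdry p := by
  have key : ∀ y : ℂ ⊗[ℚ] A.AQ.precyc n p, ∃ z', A.ETied n p
      ((A.AQ.precyc n p).subtype.baseChange ℂ y) z' ∧ ∀ z (hz : z ∈ A.AC.Z1 n p),
        ρ n p ((A.AQ.toE1 n p ∘ₗ Submodule.inclusion (precyc_le_Z1 n p)).baseChange ℂ y) =
          A.AC.toE1 n p ⟨z, hz⟩ → z - z' ∈ A.AC.bdry p := by
    intro y
    induction y using TensorProduct.induction_on with
    | zero =>
      refine ⟨0, ⟨fun _ => 0, ⟨fun s => zero_mem _, fun j => ?_⟩, ?_, rfl⟩, ?_⟩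
      · rw [map_zero, map_zero, sub_zero]; exact zero_mem _
      · exact (map_zero ((A.AQ.precyc n p).subtype.baseChange ℂ)).symm
      · intro z hz e
        rw [map_zero, map_zero] at e
        rw [sub_zero]
        exact FDGA.B1_le_bdry p ((toE1_eq_zero_iff ⟨z, hz⟩).1 e.symm)
    | tmul c y =>
      obtain ⟨e, h1, h2, h3⟩ := hρ.compat n p ⟨y.1, precyc_le_Z1 n p y.2⟩ (toE1_precyc_mem y)
      have hr : ∀ s, ∃ w : (A.ev s).precyc n p, (A.ev s).toE2 n p w = e s :=
        fun s => toE2_surjective n p (e s)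
      choose w hw using hr
      let wr : A.AR.precyc n p := w .rat
      let wh : A.AC.precyc n p := w .hodge
      let yi : A.AR.carrier := A.AQ.incl y.1
      have hwr : yi - wr.1 ∈ A.AR.bdry p := by
        rw [← hw .rat] at h1
        exact (isClass_iff _ wr).1 h1
      have ht : A.ETied n p (A.AQ.incl y.1) wh.1 := by
        have hy : A.AQ.incl y.1 ∈ A.AR.precyc n p :=
          ⟨⟨DGA.incl_mem y.2.1.1, DGA.incl_mem y.2.1.2⟩, by
            change A.AR.d (A.AQ.incl y.1) ∈ A.AR.W (p - 2)
            have h : A.AQ.incl (A.AQ.d y.1) ∈ A.AR.W (p - 2) := DGA.incl_mem y.2.2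
            exact (A.AQ.d_incl y.1).symm ▸ h⟩
        let e' : ∀ s, (A.ev s).carrier := fun s => match s with
          | .rat => A.AQ.incl y.1
          | .mid j => (w (.mid j)).1
          | .hodge => (w .hodge).1
        have he' : ∀ s, e' s ∈ (A.ev s).precyc n p := fun s => match s with
          | .rat => hy
          | .mid j => (w (.mid j)).2
          | .hodge => (w .hodge).2
        have hew : ∀ s, e' s - (w s).1 ∈ (A.ev s).bdry p := fun s => match s with
          | .rat => hwr
          | .mid j => by
            change (w (.mid j)).1 - (w (.mid j)).1 ∈ _
            rw [sub_self]; exact zero_mem _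
          | .hodge => by
            change (w .hodge).1 - (w .hodge).1 ∈ _
            rw [sub_self]; exact zero_mem _
        refine ⟨e', ⟨he', fun j => ?_⟩, rfl, rfl⟩
        have h4 := h3 j
        rw [← hw, ← hw, FDGA.Hom.E2_toE2, FDGA.Hom.E2_toE2, ← sub_eq_zero, ← map_sub,
          toE2_eq_zero_iff] at h4
        have h5 := (A.φ j false).map_bdry (hew (src j false))
        have h6 := (A.φ j true).map_bdry (hew (src j true))
        have := add_mem h4 (sub_mem h5 h6)
        rw [map_sub, map_sub] at this
        convert this using 1
        change _ = (A.φ j false) (w (src j false)).1 - (A.φ j true) (w (src j true)).1 + _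
        abel
      refine ⟨c • wh.1, ?_, fun z hz e => ?_⟩
      · have e' : (A.AQ.precyc n p).subtype.baseChange ℂ (c ⊗ₜ y) = c • ((1 : ℂ) ⊗ₜ[ℚ] y.1) := by
          rw [baseChange_tmul, TensorProduct.smul_tmul', smul_eq_mul, mul_one]; rfl
        rw [e']
        exact ht.smul c
      · rw [← hw .hodge] at h2
        obtain ⟨z₁, hz₁⟩ := mk_surjective _ (ρ n p (1 ⊗ₜ A.AQ.toE1 n p ⟨y.1, precyc_le_Z1 n p y.2⟩))
        rw [← hz₁] at h2
        have h5 := (isClass_iff z₁ wh).1 h2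
        have h6 : A.AC.toE1 n p ⟨z, hz⟩ = c • A.AC.toE1 n p z₁ := by
          rw [← e, baseChange_tmul]
          refine Eq.trans ?_ (congrArg (c • ·) hz₁.symm)
          change _ = c • ρ n p _
          rw [← map_smul, TensorProduct.smul_tmul', smul_eq_mul, mul_one]; rfl
        rw [← map_smul, ← sub_eq_zero, ← map_sub, toE1_eq_zero_iff] at h6
        have h7 := add_mem (FDGA.B1_le_bdry p h6) (Submodule.smul_mem _ c h5)
        have h8 : ∀ a b w : A.AC.carrier, a - c • w = a - c • b + c • (b - w) := fun a b w => by
          rw [smul_sub]; abel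
        rw [h8 z z₁.1]
        exact h7
    | add y y' hy hy' =>
      obtain ⟨z₁, ht, h1⟩ := hy
      obtain ⟨z₂, ht', h2⟩ := hy'
      refine ⟨z₁ + z₂, ?_, fun z hz e => ?_⟩
      · rw [map_add]
        exact ht.add ht'
      · obtain ⟨w, hw⟩ := mk_surjective _ (ρ n p
          ((A.AQ.toE1 n p ∘ₗ Submodule.inclusion (precyc_le_Z1 n p)).baseChange ℂ y))
        obtain ⟨w', hw'⟩ := mk_surjective _ (ρ n p
          ((A.AQ.toE1 n p ∘ₗ Submodule.inclusion (precyc_le_Z1 n p)).baseChange ℂ y'))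
        have h3 := h1 w.1 w.2 hw.symm
        have h4 := h2 w'.1 w'.2 hw'.symm
        have h6 : A.AC.toE1 n p (w + w') = A.AC.toE1 n p ⟨z, hz⟩ := by
          rw [← e, map_add, map_add, map_add]
          exact congrArg₂ _ hw hw'
        rw [← sub_eq_zero, ← map_sub, toE1_eq_zero_iff] at h6
        have h7 := add_mem (neg_mem (FDGA.B1_le_bdry p h6)) (add_mem h3 h4)
        have h8 : ∀ a b b' w w' : A.AC.carrier,
          a - (w + w') = -(b + b' - a) + (b - w + (b' - w')) := fun a b b' w w' => by abel
        rw [h8 z w.1 w'.1]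
        exact h7
  have hx' : x ∈ (A.AQ.precyc n p).baseChange ℂ := by
    refine mem_baseChange_of_slice fun l => ⟨⟨slice_mem l hx.1.1, slice_mem l hx.1.2⟩, ?_⟩
    have e : slice A.AQ.carrier l (A.AR.d x) = A.AQ.d (slice A.AQ.carrier l x) :=
      slice_baseChange l A.AQ.d x
    change A.AQ.d (slice A.AQ.carrier l x) ∈ A.AQ.W (p - 2)
    rw [← e]
    exact slice_mem l hx.2
  obtain ⟨y, rfl⟩ := exists_baseChange_subtype hx'
  obtain ⟨z', ht, hz'⟩ := key y
  refine ⟨z', ht, hz' z hz ?_⟩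
  rw [← h]
  congr 1
  rw [LinearEquiv.eq_symm_apply, baseChange_comp]
  refine (A.AQ.E1BaseChange_mkQ ((Submodule.inclusion
    (precyc_le_Z1 n p)).baseChange ℂ y) ?_).trans ?_
  · have : (A.AQ.Z1 n p).subtype.baseChange ℂ ((Submodule.inclusion
        (precyc_le_Z1 n p)).baseChange ℂ y) =
        (A.AQ.precyc n p).subtype.baseChange ℂ y := by
      rw [← LinearMap.comp_apply, ← baseChange_comp]; rfl
    rw [this]; exact precyc_le_Z1 n p hx
  · refine congrArg _ (Subtype.ext ?_)
    change (A.AQ.Z1 n p).subtype.baseChange ℂ ((Submodule.inclusion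
        (precyc_le_Z1 n p)).baseChange ℂ y) = (A.AQ.precyc n p).subtype.baseChange ℂ y
    rw [← LinearMap.comp_apply, ← baseChange_comp]; rfl

section E1Rel

variable (ρ : ∀ n p, ℂ ⊗[ℚ] A.AQ.E1 n p ≃ₗ[ℂ] A.AC.E1 n p)

/-- The classes of `x` and `z` in the `E_1`-terms correspond to each other. -/
def E1Rel (n : ℕ) (p : ℤ) (x : A.AR.carrier) (z : A.AC.carrier) : Prop :=
  ∃ (hx : x ∈ A.AR.Z1 n p) (hz : z ∈ A.AC.Z1 n p),
    ρ n p ((A.AQ.E1BaseChange n p).symm (A.AR.toE1 n p ⟨x, hx⟩)) = A.AC.toE1 n p ⟨z, hz⟩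

variable {ρ} {n : ℕ} {p : ℤ}

lemma E1Rel.mem_iff {x : A.AR.carrier} {z : A.AC.carrier} (h : E1Rel ρ n p x z) :
    x ∈ A.AR.B1 p ↔ z ∈ A.AC.B1 p := by
  obtain ⟨hx, hz, e⟩ := h
  rw [← toE1_eq_zero_iff ⟨x, hx⟩, ← toE1_eq_zero_iff ⟨z, hz⟩, ← e,
    LinearEquiv.map_eq_zero_iff, LinearEquiv.map_eq_zero_iff]

lemma E1Rel.sub {x x' : A.AR.carrier} {z z' : A.AC.carrier} (h : E1Rel ρ n p x z)
    (h' : E1Rel ρ n p x' z') : E1Rel ρ n p (x - x') (z - z') := by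
  obtain ⟨hx, hz, e⟩ := h
  obtain ⟨hx', hz', e'⟩ := h'
  refine ⟨sub_mem hx hx', sub_mem hz hz', ?_⟩
  have h1 : A.AR.toE1 n p ⟨x - x', sub_mem hx hx'⟩ =
    A.AR.toE1 n p ⟨x, hx⟩ - A.AR.toE1 n p ⟨x', hx'⟩ := rfl
  rw [h1, map_sub, map_sub, e, e']; rfl

lemma E1Rel.congr {x x' : A.AR.carrier} {z z' : A.AC.carrier} (h : E1Rel ρ n p x z)
    (hx' : x' ∈ A.AR.Z1 n p) (hxx : x - x' ∈ A.AR.B1 p)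
    (hz' : z' ∈ A.AC.Z1 n p) (hzz : z - z' ∈ A.AC.B1 p) : E1Rel ρ n p x' z' := by
  obtain ⟨hx, hz, e⟩ := h
  refine ⟨hx', hz', ?_⟩
  have h1 : A.AR.toE1 n p ⟨x, hx⟩ = A.AR.toE1 n p ⟨x', hx'⟩ :=
    (Submodule.Quotient.eq ((A.AR.B1 p).submoduleOf (A.AR.Z1 n p))).2 hxx
  have h2 : A.AC.toE1 n p ⟨z, hz⟩ = A.AC.toE1 n p ⟨z', hz'⟩ :=
    (Submodule.Quotient.eq ((A.AC.B1 p).submoduleOf (A.AC.Z1 n p))).2 hzz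
  rw [← h1, ← h2, e]

lemma IsRationalStructure.e1Rel_d (hρ : IsRationalStructure A ρ) {x : A.AR.carrier}
    {z : A.AC.carrier} (h : E1Rel ρ n p x z) :
    E1Rel ρ (n + 1) (p - 1) (A.AR.d x) (A.AC.d z) := by
  obtain ⟨hx, hz, h⟩ := h
  refine ⟨d_mem_Z1 _ hx, d_mem_Z1 _ hz, ?_⟩
  obtain ⟨c, hc⟩ := (A.AQ.E1BaseChange n p).surjective (A.AR.toE1 n p ⟨x, hx⟩)
  have h1 := A.AQ.E1BaseChange_d1 rfl (sub_add_cancel p 1) c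
  have h2 := hρ.map_d1 n (n + 1) p (p - 1) rfl (sub_add_cancel p 1) c
  rw [← hc, LinearEquiv.symm_apply_apply] at h
  rw [h] at h2
  rw [hc] at h1
  refine Eq.trans (congrArg _ ((LinearEquiv.symm_apply_eq _).2 ?_)) h2
  exact h1.symm

lemma mem_E1F_iff {a : ℤ} (x : A.AR.Z1 n p) : (A.AQ.E1BaseChange n p).symm (A.AR.toE1 n p x) ∈
      (A.AC.E1F n p a).comap (ρ n p).toLinearMap ↔ ∃ z ∈ A.AC.F a, E1Rel ρ n p x z := by
  constructor
  · rintro ⟨z, hz, e⟩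
    exact ⟨z.1, hz, x.2, z.2, e.symm⟩
  · rintro ⟨z, hz, hx, hz', e⟩
    exact ⟨⟨z, hz'⟩, hz, e.symm⟩

lemma conjT_E1BaseChange_symm (x : A.AR.Z1 n p) :
    conjT _ ((A.AQ.E1BaseChange n p).symm (A.AR.toE1 n p x)) =
      (A.AQ.E1BaseChange n p).symm (A.AR.toE1 n p ⟨_, A.AQ.conj_Z1 x.2⟩) := by
  refine ((LinearEquiv.symm_apply_eq _).2 ?_).symm
  refine (A.AQ.E1BaseChange_conj (x := x.1) (hx := x.2) ?_).symm
  exact LinearEquiv.apply_symm_apply _ _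

lemma E1Rel.split {w : ℤ} (hp : IsPureHS (A.AQ.E1 n p) w fun q =>
      (A.AC.E1F n p q).comap (ρ n p).toLinearMap) {x : A.AR.carrier}
    (hx : x ∈ A.AR.Z1 n p) (a : ℤ) : ∃ x₁ x₂, x = x₁ + x₂ ∧ (∃ z ∈ A.AC.F a, E1Rel ρ n p x₁ z) ∧
      ∃ z ∈ A.AC.F (w + 1 - a), E1Rel ρ n p (A.AQ.conj x₂) z := by
  have : (A.AQ.E1BaseChange n p).symm (A.AR.toE1 n p ⟨x, hx⟩) ∈
      (A.AC.E1F n p a).comap (ρ n p).toLinearMap ⊔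
        conjSub ((A.AC.E1F n p (w + 1 - a)).comap (ρ n p).toLinearMap) := by
    rw [(hp.compl a).sup_eq_top]; trivial
  obtain ⟨c₁, h1, c₂, h2, e⟩ := mem_sup.1 this
  obtain ⟨x₂, hx₂⟩ := mk_surjective _ (A.AQ.E1BaseChange n p c₂)
  have e₂ : c₂ = (A.AQ.E1BaseChange n p).symm (A.AR.toE1 n p x₂) :=
    (LinearEquiv.eq_symm_apply _).2 hx₂.symm
  let x₁ : A.AR.Z1 n p := ⟨x - x₂.1, sub_mem hx x₂.2⟩
  have e₁ : c₁ = (A.AQ.E1BaseChange n p).symm (A.AR.toE1 n p x₁) := by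
    have : x₁ = ⟨x, hx⟩ - x₂ := rfl
    rw [this, map_sub, map_sub, ← e₂, ← e, add_sub_cancel_right]
  refine ⟨x₁.1, x₂.1, (sub_add_cancel _ _).symm, ?_, ?_⟩
  · rw [e₁] at h1
    exact (mem_E1F_iff x₁).1 h1
  · rw [mem_conjSub, e₂, conjT_E1BaseChange_symm] at h2
    exact (mem_E1F_iff ⟨_, A.AQ.conj_Z1 x₂.2⟩).1 h2

lemma E1Rel.indep {w : ℤ} (hp : IsPureHS (A.AQ.E1 n p) w fun q =>
      (A.AC.E1F n p q).comap (ρ n p).toLinearMap) {x : A.AR.carrier}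
    {z z' : A.AC.carrier} {a : ℤ} (hxz : E1Rel ρ n p x z) (hz : z ∈ A.AC.F a)
    (hxz' : E1Rel ρ n p (A.AQ.conj x) z') (hz' : z' ∈ A.AC.F (w + 1 - a)) :
    x ∈ A.AR.B1 p := by
  have h1 := (mem_E1F_iff ⟨x, hxz.1⟩).2 ⟨z, hz, hxz⟩
  have h2 := (mem_E1F_iff ⟨_, A.AQ.conj_Z1 hxz.1⟩).2 ⟨z', hz', hxz'⟩
  rw [← conjT_E1BaseChange_symm ⟨x, hxz.1⟩] at h2
  have h3 := Submodule.disjoint_def.1 (hp.compl a).disjoint _ h1 (mem_conjSub.2 h2)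
  rw [LinearEquiv.map_eq_zero_iff] at h3
  exact (toE1_eq_zero_iff ⟨x, hxz.1⟩).1 h3

end E1Rel

lemma IsMHD.exists_isHodgeRel (hA : IsMHD A) : ∃ R, A.IsHodgeRel R := by
  obtain ⟨ρ, hρ, hpure⟩ := hA.pure
  refine ⟨E1Rel ρ, ⟨fun h => h.1, fun h => h.2.1, fun {n p x} hx => ?_, fun {n p z} hz => ?_,
    E1Rel.sub, E1Rel.mem_iff, E1Rel.congr, hρ.e1Rel_d, ?_, ?_, ?_⟩⟩
  · obtain ⟨z, hz⟩ := mk_surjective _ (ρ n p ((A.AQ.E1BaseChange n p).symm (A.AR.toE1 n p ⟨x, hx⟩)))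
    exact ⟨z.1, hx, z.2, hz.symm⟩
  · obtain ⟨x, hx⟩ := mk_surjective _ (A.AQ.E1BaseChange n p ((ρ n p).symm (A.AC.toE1 n p ⟨z, hz⟩)))
    exact ⟨x.1, x.2, hz, (LinearEquiv.eq_symm_apply _).1 ((LinearEquiv.symm_apply_eq _).2 hx)⟩
  · rintro n p x z ⟨hx, hz, e⟩ hx' hz'
    obtain ⟨z', ht, hzz⟩ := hρ.exists_tied hx' hz e
    have h0 := FDiag.isTight_precyc hA.e1 n p
    refine h0.tied_congr ht hx' (by rw [sub_self]; exact zero_mem _) hz' ?_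
    rw [← neg_sub]
    exact neg_mem hzz
  · intro n p x hx a b hab
    obtain rfl : b = p + n + 1 - a := by omega
    exact E1Rel.split (hpure n p) hx a
  · rintro n p x z z' a b hxz hz hxz' hz' hab
    obtain rfl : b = p + n + 1 - a := by omega
    exact E1Rel.indep (hpure n p) hxz hz hxz' hz'

variable {ℓ : ℕ} {A : FDiag.{u} ℓ}

namespace FDiag

variable {n : ℕ} {p : ℤ} {x : A.AR.carrier} {z : A.AC.carrier}

lemma ETied.left (h : A.ETied n p x z) : x ∈ A.AR.precyc n p := h.mem_left

lemma ETied.right (h : A.ETied n p x z) : z ∈ A.AC.precyc n p := h.mem_right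

lemma CTied.left (h : A.CTied n p x z) : x ∈ A.AR.cyc ⊤ n p := h.mem_left

lemma CTied.right (h : A.CTied n p x z) : z ∈ A.AC.cyc ⊤ n p := h.mem_right

end FDiag

namespace IsMHD

variable {n : ℕ} {p : ℤ} {x x' : A.AR.carrier} {z z' : A.AC.carrier}

lemma eTied_iff (hA : IsMHD A) (h : A.ETied n p x z) : x ∈ A.AR.bdry p ↔ z ∈ A.AC.bdry p :=
  (FDiag.isTight_precyc hA.e1 n p).tied_mem_iff h

lemma cTied_iff (hA : IsMHD A) (h : A.CTied n p x z) :
    x ∈ A.AR.bd ⊤ n (p + 1) ↔ z ∈ A.AC.bd ⊤ n (p + 1) :=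
  (FDiag.isTight_cyc hA.e1 n p).tied_mem_iff h

lemma eTied_congr_left (hA : IsMHD A) (h : A.ETied n p x z)
    (hx' : x' ∈ A.AR.precyc n p) (hxx : x - x' ∈ A.AR.bdry p) :
    A.ETied n p x' z :=
  (FDiag.isTight_precyc hA.e1 n p).tied_congr h hx' hxx h.right (by rw [sub_self]; exact zero_mem _)

lemma eTied_congr_right (hA : IsMHD A) (h : A.ETied n p x z) (hz' : z' ∈ A.AC.precyc n p)
    (hzz : z - z' ∈ A.AC.bdry p) : A.ETied n p x z' :=
  (FDiag.isTight_precyc hA.e1 n p).tied_congr h h.left (by rw [sub_self]; exact zero_mem _) hz' hzz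

lemma cTied_congr_left (hA : IsMHD A) (h : A.CTied n p x z)
    (hx' : x' ∈ A.AR.cyc ⊤ n p) (hxx : x - x' ∈ A.AR.bd ⊤ n (p + 1)) :
    A.CTied n p x' z :=
  (FDiag.isTight_cyc hA.e1 n p).tied_congr h hx' hxx h.right (by rw [sub_self]; exact zero_mem _)

lemma cTied_congr_right (hA : IsMHD A) (h : A.CTied n p x z) (hz' : z' ∈ A.AC.cyc ⊤ n p)
    (hzz : z - z' ∈ A.AC.bd ⊤ n (p + 1)) : A.CTied n p x z' :=
  (FDiag.isTight_cyc hA.e1 n p).tied_congr h h.left (by rw [sub_self]; exact zero_mem _) hz' hzz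

lemma exists_cTied (hA : IsMHD A) (hx : x ∈ A.AR.cyc ⊤ n p) : ∃ z, A.CTied n p x z :=
  ((FDiag.isTight_cyc hA.e1 n p).exists_tied hx).imp fun _ h => h.1

lemma exists_cTied' (hA : IsMHD A) (hz : z ∈ A.AC.cyc ⊤ n p) : ∃ x, A.CTied n p x z :=
  ((FDiag.isTight_cyc hA.e1 n p).exists_tied' hz).imp fun _ h => h.1

lemma exists_eTied' (hA : IsMHD A) (hz : z ∈ A.AC.precyc n p) : ∃ x, A.ETied n p x z :=
  ((FDiag.isTight_precyc hA.e1 n p).exists_tied' hz).imp fun _ h => h.1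

end IsMHD

lemma IsMHD.strict_gr (hA : IsMHD A) {m : ℕ} {p a : ℤ} {v : A.AC.carrier} (hv : v ∈ A.AC.W p)
    (hvm : v ∈ A.AC.gr m) (h : A.AC.d v ∈ (A.AC.F a ⊓ A.AC.W p) ⊔ A.AC.W (p - 1)) :
    ∃ y ∈ A.AC.F a ⊓ A.AC.W p ⊓ A.AC.gr m, A.AC.d v - A.AC.d y ∈ A.AC.W (p - 1) := by
  obtain ⟨y, hy, h1⟩ := hA.strict p a v hv h
  refine ⟨A.AC.proj m y, ⟨⟨A.AC.proj_mem_F hy.1 m, A.AC.proj_mem_W hy.2 m⟩, A.AC.proj_mem m y⟩, ?_⟩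
  have h2 := A.AC.proj_mem_W h1 (m + 1)
  rw [map_sub, A.AC.proj_d, A.AC.proj_d] at h2
  have e : A.AC.prevProj (m + 1) v = v := A.AC.proj_of_mem hvm
  rw [e] at h2
  exact h2

lemma IsMHD.exists_precyc_F (hA : IsMHD A) {n : ℕ} {p a : ℤ} {z : A.AC.carrier}
    (hz : z ∈ A.AC.Z1 n p) (hza : z ∈ A.AC.F a) (h : A.AC.d z ∈ A.AC.B1 (p - 1)) :
    ∃ y ∈ A.AC.W (p - 1) ⊓ A.AC.gr n, z - y ∈ A.AC.F a ∧ z - y ∈ A.AC.precyc n p := by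
  obtain ⟨u, hu, v, hv, e⟩ := bdry_homogeneous (A.AC.d_mem hz.1.2) h
  obtain ⟨y, hy, h1⟩ := hA.strict_gr hv.1 hv.2 (a := a) (by
    have : A.AC.d v = A.AC.d z + -u := by rw [e]; abel
    rw [this]
    exact add_mem (mem_sup_left ⟨A.AC.d_mem_F hza, hz.2⟩) (mem_sup_right (neg_mem hu.1)))
  refine ⟨y, ⟨hy.1.2, hy.2⟩, sub_mem hza hy.1.1,
    ⟨sub_mem hz.1.1 (A.AC.W_mono (by omega) hy.1.2), sub_mem hz.1.2 hy.2⟩, ?_⟩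
  change A.AC.d (z - y) ∈ A.AC.W (p - 2)
  have e' : A.AC.d (z - y) = u + (A.AC.d v - A.AC.d y) := by rw [map_sub, e]; abel
  rw [e', show p - 2 = p - 1 - 1 by ring]
  exact add_mem hu.1 h1

namespace FDiag.IsHodgeRel

variable {R : ℕ → ℤ → A.AR.carrier → A.AC.carrier → Prop} (hR : A.IsHodgeRel R) {n : ℕ} {p : ℤ}

include hR

lemma neg {x : A.AR.carrier} {z : A.AC.carrier} (h : R n p x z) : R n p (-x) (-z) := by
  have := hR.sub (hR.sub h h) h
  rwa [sub_self, sub_self, zero_sub, zero_sub] at this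

lemma add {x x' : A.AR.carrier} {z z' : A.AC.carrier} (h : R n p x z)
    (h' : R n p x' z') : R n p (x + x') (z + z') := by
  have := hR.sub h (hR.neg h')
  rwa [sub_neg_eq_add, sub_neg_eq_add] at this

lemma d' {m : ℕ} {x : A.AR.carrier} {z : A.AC.carrier} (h : R m (p + 1) x z) :
    R (m + 1) p (A.AR.d x) (A.AC.d z) := by
  have := hR.d h
  rwa [add_sub_cancel_right] at this

lemma strict_d1 {m : ℕ} {a : ℤ} {x : A.AR.carrier}
    (hx : x ∈ A.AR.Z1 m (p + 1)) {z : A.AC.carrier} (hz : z ∈ A.AC.F a)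
    (h : R (m + 1) p (A.AR.d x) z) : ∃ x₁, ∃ z₁ ∈ A.AC.F a, R m (p + 1) x₁ z₁ ∧
      A.AR.d x - A.AR.d x₁ ∈ A.AR.B1 p := by
  obtain ⟨x₁, x₂, rfl, ⟨z₁, hz₁, h1⟩, z₂, hz₂, h2⟩ := hR.split hx a (m + (p + 1) + 1 - a) (by ring)
  refine ⟨x₁, z₁, hz₁, h1, ?_⟩
  have h3 := hR.sub h (hR.d' h1)
  refine hR.indep h3 (sub_mem hz (A.AC.d_mem_F hz₁)) ?_ (A.AC.d_mem_F hz₂) (by push_cast; ring)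
  have h4 := hR.d' h2
  rw [← A.AQ.conj_d] at h4
  convert h4 using 2
  rw [← map_sub, add_sub_cancel_left]

variable (hA : IsMHD A)
include hA

lemma exists_eTied {x : A.AR.carrier} {z : A.AC.carrier} {a : ℤ} (h : R n p x z)
    (hz : z ∈ A.AC.F a) (hx : A.AR.d x ∈ A.AR.B1 (p - 1)) :
    ∃ y ∈ A.AR.W (p - 1) ⊓ A.AR.gr n, ∃ z' ∈ A.AC.F a,
      A.ETied n p (x - y) z' ∧ R n p (x - y) z' := by
  obtain ⟨y, hy, hxy⟩ := exists_precyc (hR.left h) hx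
  obtain ⟨v, hv, hvF, hzv⟩ := hA.exists_precyc_F (hR.right h) hz ((hR.mem_iff (hR.d h)).1 hx)
  have h1 : R n p (x - y) (z - v) := hR.congr h (precyc_le_Z1 n p hxy)
    (by rw [sub_sub_cancel]; exact mem_sup_left hy.1) (precyc_le_Z1 n p hzv)
    (by rw [sub_sub_cancel]; exact mem_sup_left hv.1)
  exact ⟨y, hy, z - v, hvF, hR.tied h1 hxy hzv, h1⟩

lemma eSplit {x : A.AR.carrier} (hx : x ∈ A.AR.precyc n p) {a b : ℤ}
    (hab : a + b = n + p + 1) : ∃ x₁ x₂, x = x₁ + x₂ ∧ (∃ z ∈ A.AC.F a, A.ETied n p x₁ z) ∧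
      ∃ z ∈ A.AC.F b, A.ETied n p (A.AQ.conj x₂) z := by
  obtain ⟨x₁, x₂, rfl, ⟨z₁, hz₁, h1⟩, z₂, hz₂, h2⟩ := hR.split (precyc_le_Z1 n p hx) a b hab
  have hdx : A.AR.d (x₁ + x₂) ∈ A.AR.B1 (p - 1) := mem_sup_left (A.AR.W_mono (by omega) hx.2)
  have hd1 : A.AR.d x₁ ∈ A.AR.B1 (p - 1) := by
    refine hR.indep (hR.d h1) (A.AC.d_mem_F hz₁) ?_ (neg_mem (A.AC.d_mem_F hz₂))
      (by push_cast; omega)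
    have h3 := hR.neg (hR.d h2)
    refine hR.congr h3 (A.AQ.conj_Z1 (hR.left (hR.d h1))) ?_ (hR.right h3)
      (by rw [sub_self]; exact zero_mem _)
    have : -A.AR.d (A.AQ.conj x₂) - A.AQ.conj (A.AR.d x₁) = - A.AQ.conj (A.AR.d (x₁ + x₂)) := by
      rw [map_add, map_add, A.AQ.conj_d, A.AQ.conj_d]; abel
    rw [this]
    exact neg_mem (A.AQ.conj_B1 hdx)
  have hd2 : A.AR.d (A.AQ.conj x₂) ∈ A.AR.B1 (p - 1) := by
    rw [← A.AQ.conj_d]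
    refine A.AQ.conj_B1 ?_
    have : A.AR.d x₂ = A.AR.d (x₁ + x₂) - A.AR.d x₁ := by
      rw [map_add]; abel
    rw [this]
    exact sub_mem hdx hd1
  obtain ⟨y₁, hy₁, z₁', hz₁', h3, -⟩ := hR.exists_eTied hA h1 hz₁ hd1
  obtain ⟨y₂, hy₂, z₂', hz₂', h4, -⟩ := hR.exists_eTied hA h2 hz₂ hd2
  have e : x₂ - A.AQ.conj y₂ = A.AQ.conj (A.AQ.conj x₂ - y₂) := by
    rw [map_sub, A.AQ.conj_conj]
  have e1 : x₁ + A.AQ.conj y₂ = x₁ + x₂ - (x₂ - A.AQ.conj y₂) := by abel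
  refine ⟨x₁ + A.AQ.conj y₂, x₂ - A.AQ.conj y₂, by abel, ⟨z₁', hz₁', ?_⟩, z₂', hz₂', ?_⟩
  · refine hA.eTied_congr_left h3 ?_ ?_
    · rw [e1, e]
      exact sub_mem hx (A.AQ.conj_precyc h4.left)
    · have : x₁ - y₁ - (x₁ + A.AQ.conj y₂) = -(y₁ + A.AQ.conj y₂) := by abel
      rw [this]
      exact mem_sup_left (neg_mem (add_mem hy₁.1 (A.AQ.conj_W hy₂.1)))
  · rw [e, A.AQ.conj_conj]
    exact h4

/-- An element that corresponds to an element of `F^a` has a class in `E_2` represented by a class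
in `F^a E_1`. -/
lemma exists_rel_of_eTied {x : A.AR.carrier} {z : A.AC.carrier} (h : A.ETied n p x z) :
    ∃ v, (∀ m, n = m + 1 → v ∈ A.AR.Z1 m (p + 1)) ∧ (n = 0 → v = 0) ∧ R n p (x - A.AR.d v) z := by
  have hx := h.left
  obtain ⟨z₁, h1⟩ := hR.exists_right (precyc_le_Z1 n p hx)
  obtain ⟨y, hy, hzy⟩ := exists_precyc (hR.right h1) ((hR.mem_iff (hR.d h1)).1
    (mem_sup_left (A.AR.W_mono (by omega) hx.2)))
  have h2 : R n p x (z₁ - y) := hR.congr h1 (hR.left h1)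
    (by rw [sub_self]; exact zero_mem _) (precyc_le_Z1 n p hzy)
    (by rw [sub_sub_cancel]; exact mem_sup_left hy.1)
  have h3 : A.ETied n p 0 (z₁ - y - z) := by
    have := (hR.tied h2 hx hzy).sub h
    rwa [sub_self] at this
  have h4 := (hA.eTied_iff h3).1 (zero_mem _)
  obtain ⟨u, hu, v, hv, e⟩ := bdry_homogeneous h3.right.1.2 h4
  have hzZ : z ∈ A.AC.Z1 n p := precyc_le_Z1 n p h.right
  cases n with
  | zero =>
    obtain rfl := A.AC.eq_zero_of_prevGr_zero hv.2
    refine ⟨0, fun m hm => absurd hm (by omega), fun _ => rfl, ?_⟩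
    rw [map_zero, sub_zero]
    refine hR.congr h2 (hR.left h2) (by rw [sub_self]; exact zero_mem _) hzZ ?_
    rw [e, map_zero, add_zero]
    exact mem_sup_left hu.1
  | succ m =>
    have hvZ : v ∈ A.AC.Z1 m (p + 1) := by
      refine ⟨hv, ?_⟩
      change A.AC.d v ∈ A.AC.W (p + 1 - 1)
      have : A.AC.d v = z₁ - y - z - u := by rw [e]; abel
      rw [this, add_sub_cancel_right]
      exact sub_mem h3.right.1.1 (A.AC.W_mono (by omega) hu.1)
    obtain ⟨v₀, hv₀⟩ := hR.exists_left hvZ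
    refine ⟨v₀, fun m' hm => ?_, fun h => absurd h (by omega), ?_⟩
    · obtain rfl : m = m' := by omega
      exact hR.left hv₀
    · have h5 := hR.sub h2 (hR.d' hv₀)
      refine hR.congr h5 (hR.left h5) (by rw [sub_self]; exact zero_mem _) hzZ ?_
      have : z₁ - y - A.AC.d v - z = u := by
        have : z₁ - y - A.AC.d v - z = z₁ - y - z - A.AC.d v := by abel
        rw [this, e]; abel
      rw [this]
      exact mem_sup_left hu.1

lemma eIndep {x : A.AR.carrier} {z z' : A.AC.carrier} {a b : ℤ} (h : A.ETied n p x z)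
    (hz : z ∈ A.AC.F a) (h' : A.ETied n p (A.AQ.conj x) z') (hz' : z' ∈ A.AC.F b)
    (hab : a + b = n + p + 1) : x ∈ A.AR.bdry p := by
  obtain ⟨v₀, h1, h2, h3⟩ := hR.exists_rel_of_eTied hA h
  obtain ⟨v₁, h1', h2', h3'⟩ := hR.exists_rel_of_eTied hA h'
  cases n with
  | zero =>
    obtain rfl := h2 rfl
    obtain rfl := h2' rfl
    rw [map_zero, sub_zero] at h3 h3'
    exact FDGA.B1_le_bdry p (hR.indep h3 hz h3' hz' hab)
  | succ m =>
    have hv : A.AQ.conj v₀ - v₁ ∈ A.AR.Z1 m (p + 1) := sub_mem (A.AQ.conj_Z1 (h1 m rfl)) (h1' m rfl)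
    obtain ⟨s, t, e, ⟨zs, hzs, hs⟩, zt, hzt, ht⟩ := hR.split hv b a (by push_cast at hab; omega)
    have hy := hR.sub h3' (hR.d' hs)
    have hy' := hR.add h3 (hR.d' ht)
    have key : A.AQ.conj (x - A.AR.d v₀ + A.AR.d (A.AQ.conj t)) =
        A.AQ.conj x - A.AR.d v₁ - A.AR.d s := by
      have : v₁ + s = A.AQ.conj v₀ - t := by rw [← sub_eq_iff_eq_add.2 (e.trans (add_comm s t))]; abel
      rw [map_add, map_sub, A.AQ.conj_d, A.AQ.conj_d, A.AQ.conj_conj, sub_sub (A.AQ.conj x),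
        ← map_add A.AR.d, this, map_sub]
      abel
    rw [← key] at hy
    have hB := hR.indep hy' (add_mem hz (A.AC.d_mem_F hzt)) hy (sub_mem hz' (A.AC.d_mem_F hzs)) hab
    have e2 : x = (x - A.AR.d v₀ + A.AR.d (A.AQ.conj t)) +
        A.AR.d (v₀ - A.AQ.conj t) := by rw [map_sub]; abel
    rw [e2]
    exact add_mem (FDGA.B1_le_bdry p hB) (mem_sup_right
      ⟨_, sub_mem (h1 m rfl).1.1 (hR.left ht).1.1, rfl⟩)

lemma bdry_F {z : A.AC.carrier} {a : ℤ} (hzW : z ∈ A.AC.W p) (hzn : z ∈ A.AC.gr n)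
    (hzF : z ∈ A.AC.F a) (hz : z ∈ A.AC.bdry p) :
    ∃ u ∈ A.AC.F a ⊓ A.AC.W (p - 1) ⊓ A.AC.gr n,
      ∃ v ∈ A.AC.F a ⊓ A.AC.W (p + 1) ⊓ A.AC.prevGr n, z = u + A.AC.d v := by
  obtain ⟨u, hu, v, hv, e⟩ := bdry_homogeneous hzn hz
  cases n with
  | zero =>
    obtain rfl := A.AC.eq_zero_of_prevGr_zero hv.2
    rw [map_zero, add_zero] at e
    subst e
    exact ⟨z, ⟨⟨hzF, hu.1⟩, hu.2⟩, 0, zero_mem _, by rw [map_zero, add_zero]⟩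
  | succ m =>
    have hzZ : z ∈ A.AC.Z1 (m + 1) p := by
      refine ⟨⟨hzW, hzn⟩, ?_⟩
      change A.AC.d z ∈ A.AC.W (p - 1)
      rw [e, map_add, A.AC.d_d, add_zero]
      exact A.AC.d_mem_W hu.1
    have hvZ : v ∈ A.AC.Z1 m (p + 1) := by
      refine ⟨hv, ?_⟩
      change A.AC.d v ∈ A.AC.W (p + 1 - 1)
      have : A.AC.d v = z - u := by rw [e]; abel
      rw [this, add_sub_cancel_right]
      exact sub_mem hzW (A.AC.W_mono (by omega) hu.1)
    obtain ⟨x, hx⟩ := hR.exists_left hvZ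
    have h1 : R (m + 1) p (A.AR.d x) z := by
      refine hR.congr (hR.d' hx) (hR.left (hR.d' hx)) (by rw [sub_self]; exact zero_mem _)
        hzZ ?_
      have : A.AC.d v - z = -u := by rw [e]; abel
      rw [this]
      exact mem_sup_left (neg_mem hu.1)
    obtain ⟨x₁, z₁, hz₁, h2, h3⟩ := hR.strict_d1 (hR.left hx) hzF h1
    have h4 := (hR.mem_iff (hR.sub h1 (hR.d' h2))).1 h3
    have hz₁Z := hR.right h2
    obtain ⟨u', hu', w, hw, e'⟩ := bdry_homogeneous (sub_mem hzn (A.AC.d_mem hz₁Z.1.2)) h4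
    obtain ⟨y, hy, h5⟩ := hA.strict_gr hw.1 hw.2 (a := a) (by
      have : A.AC.d w = (z - A.AC.d z₁) + -u' := by rw [e']; abel
      rw [this]
      refine add_mem (mem_sup_left ⟨sub_mem hzF (A.AC.d_mem_F hz₁), sub_mem hzW ?_⟩)
        (mem_sup_right (neg_mem hu'.1))
      have := hz₁Z.2
      rwa [add_sub_cancel_right] at this)
    have e3 : z - A.AC.d (z₁ + y) = u' + (A.AC.d w - A.AC.d y) := by
      rw [map_add, ← sub_sub, e']; abel
    refine ⟨z - A.AC.d (z₁ + y), ⟨⟨sub_mem hzF (A.AC.d_mem_F (add_mem hz₁ hy.1.1)), ?_⟩, sub_mem hzn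
      (A.AC.d_mem (add_mem hz₁Z.1.2 hy.2))⟩, z₁ + y,
      ⟨⟨add_mem hz₁ hy.1.1, add_mem hz₁Z.1.1
        (A.AC.W_mono (by omega) hy.1.2)⟩, add_mem hz₁Z.1.2 hy.2⟩,
      (sub_add_cancel _ _).symm⟩
    rw [e3]
    exact add_mem hu'.1 h5

end FDiag.IsHodgeRel

namespace FDGA

variable {k : Type} [Field k] {B : FDGA.{u} k}

variable (B) in
/-- The vanishing of the higher differentials of the spectral sequence of `W`. -/
def Degenerates (n : ℕ) (p : ℤ) : Prop := ∀ x ∈ B.precyc n p, B.d x ∈ B.bd ⊤ (n + 1) (p - 1)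

lemma exists_degenerates (B : FDGA.{u} k) (n : ℕ) : ∃ q, ∀ p ≤ q, B.Degenerates n p := by
  obtain ⟨q, hq⟩ := exists_W_eq_bot (A := B) n
  refine ⟨q, fun p hp x hx => ?_⟩
  rw [hq p hp x hx.1, map_zero]
  exact zero_mem _

lemma exact_mem_bd (hB : ∀ n p, B.Degenerates n p) {n : ℕ} {p : ℤ} {x : B.carrier}
    (hn : x ∈ B.gr n) (hp : x ∈ B.W p) (hx : x ∈ range B.d) : x ∈ B.bd ⊤ n (p + 1) := by
  obtain ⟨v, rfl⟩ := hx
  obtain ⟨r, hr⟩ := B.W_exhaustive v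
  have h1 : B.d v ∈ B.bd ⊤ n r := mem_bd_top_of_gr hr hn
  have key : ∀ k : ℕ, B.d v ∈ B.bd ⊤ n (p + 1 + k) → B.d v ∈ B.bd ⊤ n (p + 1) := by
    intro k
    induction k with
    | zero => intro h; simpa using h
    | succ k ih =>
      intro h
      refine ih ?_
      obtain ⟨w, hw, hwn, e⟩ := mem_bd_top.1 h
      rw [← e] at hn hp ⊢
      cases n with
      | zero =>
        rw [B.eq_zero_of_prevGr_zero hwn, map_zero]
        exact zero_mem _
      | succ n =>
        have := hB n _ w ⟨⟨hw, hwn⟩, B.W_mono (by push_cast; omega) hp⟩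
        convert this using 2
        push_cast; ring
  refine key (r - (p + 1)).toNat (bd_mono _ _ ?_ h1)
  omega

end FDGA

namespace IsMHD

variable {ℓ : ℕ} {A : FDiag.{u} ℓ}

lemma degenerates_hodge (hA : IsMHD A) {n : ℕ} {p : ℤ} (h : A.AR.Degenerates n p) :
    A.AC.Degenerates n p := by
  intro z hz
  obtain ⟨x, hx⟩ := hA.exists_eTied' hz
  have := (hA.cTied_iff hx.d).1 (by
    rw [show p - 2 + 1 = p - 1 by ring]; exact h x hx.left)
  rwa [show p - 2 + 1 = p - 1 by ring] at this

lemma cTied_sub_one (hA : IsMHD A) {n : ℕ} {m : ℤ} (hd : A.AC.Degenerates n (m + 1))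
    {y u : A.AR.carrier} {z w : A.AC.carrier} (h : A.CTied (n + 1) m y z)
    (hu : u ∈ A.AR.cyc ⊤ (n + 1) (m - 1))
    (hyu : y - u ∈ A.AR.bd ⊤ (n + 1) (m + 1))
    (hw : w ∈ A.AC.cyc ⊤ (n + 1) (m - 1)) (hzw : z - w ∈ A.AC.bd ⊤ (n + 1) (m + 1)) :
    A.CTied (n + 1) (m - 1) u w := by
  obtain ⟨w', hw'⟩ := hA.exists_cTied hu
  have h1 := hA.cTied_congr_left h (hw'.mono (sub_one_lt m).le).left hyu
  have h2 := (hw'.mono (sub_one_lt m).le).sub h1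
  rw [sub_self] at h2
  have h3 := add_mem ((hA.cTied_iff h2).1 (zero_mem _)) hzw
  rw [sub_add_sub_cancel] at h3
  refine hA.cTied_congr_right hw' hw ?_
  obtain ⟨v, hv, hvn, e⟩ := mem_bd_top.1 h3
  rw [← e, sub_add_cancel]
  have := hd v ⟨⟨hv, hvn⟩, by
    change A.AC.d v ∈ A.AC.W (m + 1 - 2)
    rw [e, show m + 1 - 2 = m - 1 by ring]
    exact sub_mem (mem_cyc_top.1 hw'.right).1 (mem_cyc_top.1 hw).1⟩
  rwa [add_sub_cancel_right] at this

lemma mem_bd_of_opposite (hA : IsMHD A) (n : ℕ) (m : ℤ) : (∀ r ≤ m + 1, A.AR.Degenerates n r) →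
    ∀ {a b : ℤ}, n + 1 + m < a + b → ∀ {y : A.AR.carrier} {z z' : A.AC.carrier},
      A.CTied (n + 1) m y z → z ∈ A.AC.F a → A.CTied (n + 1) m (A.AQ.conj y) z' → z' ∈ A.AC.F b →
      y ∈ A.AR.bd ⊤ (n + 1) (m + 1) := by
  obtain ⟨R, hR⟩ := hA.exists_isHodgeRel
  induction m using weight_induction with
  | h0 =>
    obtain ⟨q, hq⟩ := exists_W_eq_bot (A := A.AR) (n + 1)
    refine ⟨q, fun m hm hd a b hab y z z' h _ _ _ => ?_⟩
    have := mem_cyc_top.1 h.left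
    rw [hq m hm y ⟨this.1, this.2.1⟩]
    exact zero_mem _
  | h1 m ih =>
    intro hd a b hab y z z' h hz h' hz'
    replace hz' := A.AC.F_anti (show n + 1 + m + 1 - a ≤ b by omega) hz'
    have hy := hR.eIndep hA h.eTied hz h'.eTied hz' (by push_cast; ring)
    have hc := mem_cyc_top.1 h.left
    have hcz := mem_cyc_top.1 h.right
    have hcz' := mem_cyc_top.1 h'.right
    obtain ⟨u₀, hu₀, v₀, hv₀, e₀⟩ := bdry_homogeneous hc.2.1 hy
    obtain ⟨u, hu, v, hv, e⟩ := hR.bdry_F hA hcz.1 hcz.2.1 hz ((hA.eTied_iff h.eTied).1 hy)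
    obtain ⟨u', hu', v', hv', e'⟩ := hR.bdry_F hA hcz'.1 hcz'.2.1 hz'
      ((hA.eTied_iff h'.eTied).1 (A.AQ.conj_bdry hy))
    have hu₀c : u₀ ∈ A.AR.cyc ⊤ (n + 1) (m - 1) := mem_cyc_top.2 ⟨hu₀.1, hu₀.2, by
        have := hc.2.2; rwa [e₀, map_add, A.AR.d_d, add_zero] at this⟩
    have huc : u ∈ A.AC.cyc ⊤ (n + 1) (m - 1) := mem_cyc_top.2 ⟨hu.1.2, hu.2, by
        have := hcz.2.2; rwa [e, map_add, A.AC.d_d, add_zero] at this⟩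
    have huc' : u' ∈ A.AC.cyc ⊤ (n + 1) (m - 1) := mem_cyc_top.2 ⟨hu'.1.2, hu'.2, by
        have := hcz'.2.2; rwa [e', map_add, A.AC.d_d, add_zero] at this⟩
    have hb₀ : y - u₀ ∈ A.AR.bd ⊤ (n + 1) (m + 1) := by
      rw [e₀, add_sub_cancel_left]; exact mem_bd_top.2 ⟨v₀, hv₀.1, hv₀.2, rfl⟩
    have hb : z - u ∈ A.AC.bd ⊤ (n + 1) (m + 1) := by
      rw [e, add_sub_cancel_left]; exact mem_bd_top.2 ⟨v, hv.1.2, hv.2, rfl⟩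
    have hb' : z' - u' ∈ A.AC.bd ⊤ (n + 1) (m + 1) := by
      rw [e', add_sub_cancel_left]; exact mem_bd_top.2 ⟨v', hv'.1.2, hv'.2, rfl⟩
    have hdm := hA.degenerates_hodge (hd (m + 1) le_rfl)
    have h1 := hA.cTied_sub_one hdm h hu₀c hb₀ huc hb
    have h2 := hA.cTied_sub_one hdm h' (A.AQ.conj_cyc hu₀c)
      (by rw [← map_sub]; exact A.AQ.conj_bd hb₀) huc' hb'
    have h3 := ih (fun r hr => hd r (by omega)) (by omega) h1 hu.1.1 h2 hu'.1.1
    rw [sub_add_cancel] at h3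
    have := add_mem hb₀ (bd_mono ⊤ (n + 1) (lt_add_one m).le h3)
    rwa [sub_add_cancel] at this

lemma degenerates_rat (hA : IsMHD A) (n : ℕ) (p : ℤ) : A.AR.Degenerates n p := by
  obtain ⟨R, hR⟩ := hA.exists_isHodgeRel
  suffices H : ∀ r ≤ p, A.AR.Degenerates n r from H p le_rfl
  induction p using weight_induction with
  | h0 =>
    obtain ⟨q, hq⟩ := A.AR.exists_degenerates n
    exact ⟨q, fun p hp r hr => hq r (hr.trans hp)⟩
  | h1 p ih =>
    intro r hr
    rcases hr.eq_or_lt with rfl | hr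
    swap
    · exact ih r (by omega)
    obtain ⟨⟨q₀, hq₀⟩, q₁, hq₁⟩ := hA.biregular n
    have key : ∀ (j : ℕ) (x : A.AR.carrier) (z : A.AC.carrier), A.ETied n r x z →
        z ∈ A.AC.F (q₀ - j) → A.AR.d x ∈ A.AR.bd ⊤ (n + 1) (r - 1) := by
      intro j
      induction j with
      | zero =>
        intro x z h hz
        have h1 : z ∈ A.AC.F q₀ ⊓ A.AC.gr n := ⟨by simpa using hz, h.right.1.2⟩
        rw [hq₀, mem_bot] at h1
        have h2 := (hA.eTied_iff h).2 (by rw [h1]; exact zero_mem _)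
        obtain ⟨u, hu, v, hv, rfl⟩ := bdry_homogeneous h.left.1.2 h2
        rw [map_add, A.AR.d_d, add_zero]
        exact mem_bd_top.2 ⟨u, hu.1, hu.2, rfl⟩
      | succ j ihj =>
        intro x z h hz
        obtain ⟨x₁, x₂, rfl, ⟨z₁, hz₁, h1⟩, z₂, hz₂, h2⟩ := hR.eSplit hA h.left
          (a := q₀ - j) (b := n + r + 1 - (q₀ - j)) (by ring)
        rw [map_add]
        refine add_mem (ihj x₁ z₁ h1 hz₁) ?_
        have h3 : A.ETied n r x₂ (z - z₁) := by
          have := h.sub h1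
          rwa [add_sub_cancel_left] at this
        have h4 := h2.d
        rw [← A.AQ.conj_d] at h4
        have := hA.mem_bd_of_opposite n (r - 2) (fun i hi => ih i (by omega))
          (a := q₀ - (j + 1 : ℕ)) (b := n + r + 1 - (q₀ - j)) (by push_cast; omega) h3.d
          (A.AC.d_mem_F (sub_mem hz (A.AC.F_anti (by push_cast; omega) hz₁))) h4 (A.AC.d_mem_F hz₂)
        rwa [show r - 2 + 1 = r - 1 by ring] at this
    intro x hx
    obtain ⟨z, hz, -⟩ := (FDiag.isTight_precyc hA.e1 n r).exists_tied hx
    exact key (q₀ - q₁).toNat x z hz (A.AC.F_anti (by omega) (hq₁ (FDiag.ETied.right hz).1.2))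

lemma degenerates (hA : IsMHD A) (n : ℕ) (p : ℤ) : A.AC.Degenerates n p :=
  hA.degenerates_hodge (hA.degenerates_rat n p)

/-- The filtrations `W` and `F` on the boundaries are induced by those on the complex. -/
lemma exact_mem_bd_F (hA : IsMHD A) {n : ℕ} {p a : ℤ} {x : A.AC.carrier} (hn : x ∈ A.AC.gr n)
    (hp : x ∈ A.AC.W p) (ha : x ∈ A.AC.F a) (hx : x ∈ range A.AC.d) :
    x ∈ A.AC.bd (A.AC.F a) n (p + 1) := by
  obtain ⟨R, hR⟩ := hA.exists_isHodgeRel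
  revert x
  induction p using weight_induction with
  | h0 =>
    obtain ⟨q, hq⟩ := exists_W_eq_bot (A := A.AC.toFDGA) n
    refine ⟨q, fun m hm x hn hp _ _ => ?_⟩
    rw [hq m hm x ⟨hp, hn⟩]
    exact zero_mem _
  | h1 p ih =>
    intro x hn hp ha hx
    obtain ⟨u, hu, v, hv, e⟩ := hR.bdry_F hA hp hn ha
      (bd_le_bdry _ n p (exact_mem_bd hA.degenerates hn hp hx))
    have hu' := ih hu.2 hu.1.2 hu.1.1 (by
      have : u = x - A.AC.d v := by rw [e]; abel
      rw [this]
      exact sub_mem hx ⟨v, rfl⟩)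
    rw [sub_add_cancel] at hu'
    rw [e]
    exact add_mem (bd_mono _ n (by omega) hu') ⟨v, ⟨⟨hv.1.2, hv.2⟩, hv.1.1⟩, rfl⟩

/-- A cohomology class that is in `W_p` and in `F^a` has a representative in the intersection. -/
lemma exists_cyc_F (hA : IsMHD A) {n : ℕ} {p r a : ℤ} {c c' : A.AC.carrier}
    (hc : c ∈ A.AC.cyc ⊤ n p) (hc' : c' ∈ A.AC.cyc (A.AC.F a) n r)
    (h : c - c' ∈ range A.AC.d) :
    ∃ y ∈ A.AC.cyc (A.AC.F a) n p, c' - y ∈ range A.AC.d := by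
  obtain ⟨R, hR⟩ := hA.exists_isHodgeRel
  have key : ∀ (j : ℕ) (c' : A.AC.carrier), c' ∈ A.AC.cyc (A.AC.F a) n (p + j) →
      c - c' ∈ range A.AC.d →
      ∃ y ∈ A.AC.cyc (A.AC.F a) n p, c' - y ∈ range A.AC.d := by
    intro j
    induction j with
    | zero =>
      intro c' hc' _
      exact ⟨c', by simpa using hc', by rw [sub_self]; exact zero_mem _⟩
    | succ j ih =>
      intro c' hc' h
      rw [mem_cyc_top] at hc
      obtain ⟨⟨⟨h1, h2⟩, h3⟩, h4⟩ := hc'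
      have hb := exact_mem_bd hA.degenerates (sub_mem h2 hc.2.1)
        (sub_mem h1 (A.AC.W_mono (by push_cast; omega) hc.1))
        (by rw [← neg_sub]; exact neg_mem h)
      obtain ⟨u, hu, v, hv, e⟩ := hR.bdry_F hA h1 h2 h3 (by
        have := add_mem (bd_le_bdry _ n _ hb)
          (mem_sup_left (A.AC.W_mono (show p ≤ p + (j + 1 : ℕ) - 1 by push_cast; omega)
            hc.1) : c ∈ A.AC.bdry (p + (j + 1 : ℕ)))
        rwa [sub_add_cancel] at this)
      have e' : c' - u = A.AC.d v := by rw [e]; abel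
      obtain ⟨y, hy, hy'⟩ := ih u ⟨⟨⟨by
        have := hu.1.2; rwa [show p + ((j + 1 : ℕ) : ℤ) - 1 = p + j by push_cast; ring] at this,
        hu.2⟩, hu.1.1⟩, by
          have : u = c' - A.AC.d v := by rw [e]; abel
          rw [this]
          exact sub_mem h4 (A.AC.d_d v)⟩ (by
        have : c - u = c - c' + (c' - u) := by abel
        rw [this, e']
        exact add_mem h ⟨v, rfl⟩)
      refine ⟨y, hy, ?_⟩
      have : c' - y = c' - u + (u - y) := by abel
      rw [this, e']
      exact add_mem ⟨v, rfl⟩ hy'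
  exact key (r - p).toNat c' ⟨⟨⟨A.AC.W_mono (by omega) hc'.1.1.1, hc'.1.1.2⟩, hc'.1.2⟩, hc'.2⟩ h

end IsMHD

variable {ℓ : ℕ}

lemma FDGA.mem_cyc_of_mem_bdry {k : Type} [Field k] {B : FDGA.{u} k} {n : ℕ} {p : ℤ}
    {x : B.carrier} (hx : x ∈ B.cyc ⊤ n p) (h : x ∈ B.bdry p) :
    x ∈ B.cyc ⊤ n (p - 1) ⊔ range B.d := by
  rw [FDGA.mem_cyc_top] at hx
  obtain ⟨u, hu, v, hv, rfl⟩ := FDGA.bdry_homogeneous hx.2.1 h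
  refine add_mem_sup (FDGA.mem_cyc_top.2 ⟨hu.1, hu.2, ?_⟩) ⟨v, rfl⟩
  have := hx.2.2
  rwa [map_add, B.d_d, add_zero] at this

namespace FDiag

variable (A : FDiag.{u} ℓ)

abbrev cycles (n : ℕ) : Submodule ℂ A.AC.carrier := A.AC.gr n ⊓ ker A.AC.d

/-- The elements with cohomology class in the `m`-th step of the weight filtration. -/
def cohW (n : ℕ) (m : ℤ) : Submodule ℂ A.AC.carrier := A.AC.cyc ⊤ n (m - n) ⊔ range A.AC.d

/-- The elements with cohomology class in the `a`-th step of the Hodge filtration. -/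
def cohF (n : ℕ) (a : ℤ) : Submodule ℂ A.AC.carrier := (A.cycles n ⊓ A.AC.F a) ⊔ range A.AC.d

variable {A}

lemma cTied_zero (n : ℕ) (p : ℤ) : A.CTied n p 0 0 := ⟨fun _ => 0, ⟨fun _ => zero_mem _, fun j => by
    rw [map_zero, map_zero, sub_zero]; exact zero_mem _⟩, rfl, rfl⟩

variable (A) in
/-- The elements with cohomology class in the conjugate of the `b`-th step of the Hodge
filtration. -/
def cohFConj (n : ℕ) (b : ℤ) : Submodule ℂ A.AC.carrier where
  carrier := {y | ∃ (p : ℤ) (x : A.AR.carrier) (z z' : A.AC.carrier),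
    A.CTied n p x z ∧ y - z ∈ range A.AC.d ∧ A.CTied n p (A.AQ.conj x) z' ∧ z' ∈ A.AC.F b}
  zero_mem' := ⟨0, 0, 0, 0, cTied_zero n 0, by rw [sub_zero]; exact zero_mem _, by
    rw [map_zero]; exact cTied_zero n 0, zero_mem _⟩
  add_mem' := by
    rintro y₁ y₂ ⟨p, x₁, z₁, z₁', h1, h2, h3, h4⟩ ⟨q, x₂, z₂, z₂', g1, g2, g3, g4⟩
    refine ⟨max p q, x₁ + x₂, z₁ + z₂, z₁' + z₂',
      (h1.mono (le_max_left p q)).add (g1.mono (le_max_right p q)), ?_, ?_,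
      add_mem h4 g4⟩
    · rw [add_sub_add_comm]; exact add_mem h2 g2
    · rw [map_add]
      exact (h3.mono (le_max_left p q)).add (g3.mono (le_max_right p q))
  smul_mem' := by
    rintro c y ⟨p, x, z, z', h1, h2, h3, h4⟩
    refine ⟨p, c • x, c • z, (starRingEnd ℂ c) • z', h1.smul c, ?_, ?_, Submodule.smul_mem _ _ h4⟩
    · rw [← smul_sub]; exact Submodule.smul_mem _ _ h2
    · rw [A.AQ.conj_smul]; exact h3.smul _

end FDiag

namespace IsMHD

variable {A : FDiag.{u} ℓ}

lemma exists_cTied_F (hA : IsMHD A) {n : ℕ} {p a : ℤ} {x : A.AR.carrier}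
    {z : A.AC.carrier} (h : A.ETied n p x z) (hz : z ∈ A.AC.F a) :
    ∃ x' z', A.CTied n p x' z' ∧ z' ∈ A.AC.F a ∧ x - x' ∈ A.AR.bdry p := by
  have hz' := h.right
  have hdz := hA.exact_mem_bd_F (A.AC.d_mem hz'.1.2) hz'.2 (A.AC.d_mem_F hz) ⟨z, rfl⟩
  rw [show p - 2 + 1 = p - 1 by ring] at hdz
  obtain ⟨v, hv, e⟩ := hdz
  have hc : z - v ∈ A.AC.cyc ⊤ n p := mem_cyc_top.2
    ⟨sub_mem hz'.1.1 (A.AC.W_mono (by omega) hv.1.1),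
      sub_mem hz'.1.2 hv.1.2, by rw [map_sub, e, sub_self]⟩
  obtain ⟨x', hx'⟩ := hA.exists_cTied' hc
  refine ⟨x', z - v, hx', sub_mem hz hv.2, ?_⟩
  refine (hA.eTied_iff (h.sub hx'.eTied)).2 ?_
  rw [sub_sub_cancel]
  exact mem_sup_left hv.1.1

lemma coh_span (hA : IsMHD A) {n : ℕ} {p a b : ℤ} (hab : a + b = n + p + 1) {c : A.AC.carrier}
    (hc : c ∈ A.AC.cyc ⊤ n p) : ∃ y ∈ A.AC.cyc ⊤ n p, y ∈ A.AC.F a ∧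
      ∃ z ∈ A.AC.cyc ⊤ n p, z ∈ A.cohFConj n b ∧
        c - y - z ∈ A.AC.cyc ⊤ n (p - 1) ⊔ range A.AC.d := by
  obtain ⟨R, hR⟩ := hA.exists_isHodgeRel
  obtain ⟨x, hx⟩ := hA.exists_cTied' hc
  obtain ⟨x₁, x₂, rfl, ⟨z₁, hz₁, h1⟩, z₂, hz₂, h2⟩ := hR.eSplit hA hx.eTied.left hab
  obtain ⟨x₁', z₁', h1', hz₁', hx₁⟩ := hA.exists_cTied_F h1 hz₁
  obtain ⟨x₂', z₂', h2', hz₂', hx₂⟩ := hA.exists_cTied_F h2 hz₂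
  obtain ⟨y, hy⟩ := hA.exists_cTied (A.AQ.conj_cyc h2'.left)
  refine ⟨z₁', h1'.right, hz₁', y, hy.right, ⟨p, _, y, z₂', hy, ?_, ?_, hz₂'⟩, ?_⟩
  · rw [sub_self]; exact zero_mem _
  · rw [A.AQ.conj_conj]; exact h2'
  · have h3 : A.CTied n p _ _ := (hx.sub h1').sub hy
    refine mem_cyc_of_mem_bdry h3.right ((hA.eTied_iff h3.eTied).1 ?_)
    have : x₁ + x₂ - x₁' - A.AQ.conj x₂' = (x₁ - x₁') + A.AQ.conj (A.AQ.conj x₂ - x₂') := by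
      rw [map_sub, A.AQ.conj_conj]; abel
    rw [this]
    exact add_mem hx₁ (A.AQ.conj_bdry hx₂)

lemma coh_indep (hA : IsMHD A) {n : ℕ} {p a b : ℤ} (hab : a + b = n + p + 1)
    {x y : A.AC.carrier} (hx : x ∈ A.AC.cyc (A.AC.F a) n p) (hy : y ∈ A.AC.cyc ⊤ n p)
    (hyb : y ∈ A.cohFConj n b)
    (hxy : x - y ∈ A.AC.cyc ⊤ n (p - 1) ⊔ range A.AC.d) :
    x ∈ A.AC.cyc ⊤ n (p - 1) ⊔ range A.AC.d := by
  obtain ⟨R, hR⟩ := hA.exists_isHodgeRel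
  have hx' : x ∈ A.AC.cyc ⊤ n p := ⟨⟨hx.1.1, trivial⟩, hx.2⟩
  obtain ⟨q, x₁, z₁, z₁', h1, h2, h3, h4⟩ := hyb
  obtain ⟨y₀, h5⟩ := hA.exists_cTied' hy
  have h6 : A.CTied n (max q p) (x₁ - y₀) (z₁ - y) := (h1.mono (le_max_left q p)).sub (h5.mono (le_max_right q p))
  have hz₁ := mem_cyc_top.1 h6.right
  have h7 := (hA.cTied_iff h6).2 (exact_mem_bd hA.degenerates hz₁.2.1 hz₁.1
    (by rw [← neg_sub]; exact neg_mem h2))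
  obtain ⟨w, h8⟩ := hA.exists_cTied (A.AQ.conj_cyc h5.left)
  have h9 : A.CTied n (max q p) (A.AQ.conj (x₁ - y₀)) (z₁' - w) := by
    rw [map_sub]
    exact (h3.mono (le_max_left q p)).sub (h8.mono (le_max_right q p))
  obtain ⟨v, -, -, hv⟩ := mem_bd_top.1 ((hA.cTied_iff h9).1 (A.AQ.conj_bd h7))
  have hz₁' := mem_cyc_top.1 h3.right
  obtain ⟨e, he, he'⟩ := hA.exists_cyc_F (r := q) (a := b) h8.right
    ⟨⟨⟨hz₁'.1, hz₁'.2.1⟩, h4⟩, hz₁'.2.2⟩ ⟨-v, by rw [map_neg, hv]; abel⟩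
  have hw := mem_cyc_top.1 h8.right
  have h10 : A.CTied n p (A.AQ.conj y₀) e := by
    refine hA.cTied_congr_right h8 ⟨⟨he.1.1, trivial⟩, he.2⟩
      (exact_mem_bd hA.degenerates (sub_mem hw.2.1 he.1.1.2) (sub_mem hw.1 he.1.1.1) ?_)
    have : w - e = z₁' - e - (z₁' - w) := by abel
    rw [this]
    exact sub_mem he' ⟨v, hv⟩
  have hyx : y - x ∈ A.AC.bdry p := by
    obtain ⟨u, hu, _, ⟨v, rfl⟩, e⟩ := mem_sup.1 hxy
    have hu' := mem_cyc_top.1 hu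
    have h11 : x - y - u ∈ A.AC.bd ⊤ n (p + 1) := exact_mem_bd hA.degenerates
      (sub_mem (sub_mem hx.1.1.2 hy.1.1.2) hu'.2.1)
      (sub_mem (sub_mem hx.1.1.1 hy.1.1.1) (A.AC.W_mono (by omega) hu'.1)) ⟨v, by rw [← e]; abel⟩
    have : y - x = -(u + (x - y - u)) := by abel
    rw [this]
    exact neg_mem (add_mem (mem_sup_left hu'.1) (bd_le_bdry _ n p h11))
  have h12 := hA.eTied_congr_right h5.eTied (cyc_le_precyc _ n p hx') hyx
  exact mem_cyc_of_mem_bdry hx' ((hA.eTied_iff h12).1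
    (hR.eIndep hA h12 hx.1.2 h10.eTied he.1.2 hab))

/-- The weight filtration, the Hodge filtration and its conjugate on the cohomology of a mixed
Hodge diagram. -/
lemma oppositeFiltrations (hA : IsMHD A) (n : ℕ) :
    OppositeFiltrations (fun m => (A.cohW n m).submoduleOf (A.cycles n))
      (fun a => (A.cohF n a).submoduleOf (A.cycles n))
      (fun b => (A.cohFConj n b).submoduleOf (A.cycles n))
      ((range A.AC.d).submoduleOf (A.cycles n)) where
  W_mono p q hpq := comap_mono (sup_le_sup_right (fun x hx => by
    rw [mem_cyc_top] at hx ⊢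
    exact ⟨A.AC.W_mono (by omega) hx.1, hx.2⟩) _)
  F_anti p q hpq := comap_mono (sup_le_sup_right (inf_le_inf_left _ (A.AC.F_anti hpq)) _)
  G_anti p q hpq := comap_mono (by
    rintro y ⟨r, x, z, z', h1, h2, h3, h4⟩
    exact ⟨r, x, z, z', h1, h2, h3, A.AC.F_anti hpq h4⟩)
  N_le_W m := comap_mono le_sup_right
  N_le_F m := comap_mono le_sup_right
  N_le_G m := comap_mono fun y hy => ⟨0, 0, 0, 0, FDiag.cTied_zero n 0,
    by rwa [sub_zero], by rw [map_zero]; exact FDiag.cTied_zero n 0, zero_mem _⟩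
  W_bot := by
    obtain ⟨q, hq⟩ := exists_W_eq_bot (A := A.AC.toFDGA) n
    refine ⟨q + n, comap_mono (sup_le (fun x hx => ?_) le_rfl)⟩
    rw [mem_cyc_top, add_sub_cancel_right] at hx
    rw [hq q le_rfl x ⟨hx.1, hx.2.1⟩]
    exact zero_mem _
  W_top x := by
    obtain ⟨p, hp⟩ := A.AC.W_exhaustive x.1
    exact ⟨p + n, mem_sup_left (mem_cyc_top.2 ⟨by rwa [add_sub_cancel_right], x.2.1, x.2.2⟩)⟩
  F_bot := by
    obtain ⟨⟨q, hq⟩, -⟩ := hA.biregular n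
    refine ⟨q, comap_mono (sup_le (fun x hx => ?_) le_rfl)⟩
    have : x ∈ A.AC.F q ⊓ A.AC.gr n := ⟨hx.2, hx.1.1⟩
    rw [hq, mem_bot] at this
    rw [this]
    exact zero_mem _
  F_top := by
    obtain ⟨-, q, hq⟩ := hA.biregular n
    exact ⟨q, Submodule.eq_top_iff'.2 fun x => mem_sup_left ⟨x.2, hq x.2.1⟩⟩
  span := by
    rintro m a ⟨x, hx⟩ hxm
    obtain ⟨c, hc, _, ⟨v, rfl⟩, e⟩ := mem_sup.1 hxm
    obtain ⟨y, hy, hya, z, hz, hzb, h⟩ := hA.coh_span (a := a) (b := m + 1 - a) (by ring) hc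
    have hy' := mem_cyc_top.1 hy
    have hz' := mem_cyc_top.1 hz
    refine ⟨⟨y, hy'.2⟩, ⟨mem_sup_left ⟨hy'.2, hya⟩, mem_sup_left hy⟩,
      ⟨z, hz'.2⟩, ⟨hzb, mem_sup_left hz⟩, ?_⟩
    change x - y - z ∈ A.cohW n (m - 1)
    have e' : x - y - z = (c - y - z) + A.AC.d v := by
      have : x = c + A.AC.d v := e.symm
      rw [this]; abel
    rw [e', FDiag.cohW, show m - 1 - n = m - n - 1 by ring]
    exact add_mem h (mem_sup_right ⟨v, rfl⟩)
  indep := by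
    rintro m a b hab ⟨x, hx⟩ ⟨hxa, hxm⟩ ⟨y, hy⟩ ⟨hyb, hym⟩ hxy
    obtain ⟨c, hc, _, ⟨v, rfl⟩, e⟩ := mem_sup.1 hxm
    obtain ⟨c', hc', _, ⟨v', rfl⟩, e'⟩ := mem_sup.1 hxa
    obtain ⟨c₂, hc₂, _, ⟨v₂, rfl⟩, e₂⟩ := mem_sup.1 hym
    replace e : c + A.AC.d v = x := e
    replace e' : c' + A.AC.d v' = x := e'
    replace e₂ : c₂ + A.AC.d v₂ = y := e₂
    obtain ⟨r, hr⟩ := A.AC.W_exhaustive c'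
    obtain ⟨z, hz, w, hw⟩ := hA.exists_cyc_F (a := a) hc ⟨⟨⟨hr, hc'.1.1⟩, hc'.2⟩, hc'.1.2⟩
      ⟨v' - v, by rw [map_sub, eq_sub_iff_add_eq.2 e, eq_sub_iff_add_eq.2 e']; abel⟩
    have exz : x = z + A.AC.d (w + v') := by rw [map_add, hw, ← e']; abel
    have hc₂b : c₂ ∈ A.cohFConj n b := by
      obtain ⟨p, x₁, z₁, z₁', h1, ⟨t, h2⟩, h3⟩ := hyb
      replace h2 : A.AC.d t = y - z₁ := h2
      exact ⟨p, x₁, z₁, z₁', h1, ⟨t - v₂, by rw [map_sub, h2, ← e₂]; abel⟩, h3⟩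
    have h := hA.coh_indep (p := m - n) (a := a) (b := b) (by omega) hz hc₂ hc₂b (by
      have : z - c₂ = (x - y) + A.AC.d (v₂ - (w + v')) := by rw [exz, ← e₂, map_sub]; abel
      rw [this, show m - n - 1 = m - 1 - n by ring]
      exact add_mem hxy (mem_sup_right ⟨_, rfl⟩))
    change x ∈ A.cohW n (m - 1)
    rw [exz, FDiag.cohW, show m - 1 - n = m - n - 1 by ring]
    exact add_mem h (mem_sup_right ⟨_, rfl⟩)

end IsMHD

namespace FDGA

variable {k : Type} [Field k] {A B C : FDGA.{u} k}

lemma Hom.comp_apply (f : Hom A B) (g : Hom B C) (x : A.carrier) : (f.comp g) x = g (f x) := rfl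

lemma Hom.E2_comp (f : Hom A B) (g : Hom B C) (n : ℕ) (p : ℤ) (c : A.E2 n p) :
    (f.comp g).E2 n p c = g.E2 n p (f.E2 n p c) := by
  obtain ⟨x, rfl⟩ := toE2_surjective n p c
  rw [Hom.E2_toE2, Hom.E2_toE2, Hom.E2_toE2]
  rfl

lemma Hom.IsE1QuasiIso.comp {f : Hom A B} {g : Hom B C} (hf : f.IsE1QuasiIso)
    (hg : g.IsE1QuasiIso) : (f.comp g).IsE1QuasiIso := fun n p => by
  have : ⇑((f.comp g).E2 n p) = g.E2 n p ∘ f.E2 n p := funext (f.E2_comp g n p)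
  rw [this]
  exact (hg n p).comp (hf n p)

lemma Hom.IsE1QuasiIso.of_comp_left {f : Hom A B} {g : Hom B C} (hf : f.IsE1QuasiIso)
    (h : (f.comp g).IsE1QuasiIso) : g.IsE1QuasiIso := fun n p => by
  have : ⇑((f.comp g).E2 n p) = g.E2 n p ∘ f.E2 n p := funext (f.E2_comp g n p)
  have h' := h n p
  rw [this] at h'
  exact (Bijective.of_comp_iff _ (hf n p)).1 h'

lemma Hom.IsE1QuasiIso.of_comp_right {f : Hom A B} {g : Hom B C} (hg : g.IsE1QuasiIso)
    (h : (f.comp g).IsE1QuasiIso) : f.IsE1QuasiIso := fun n p => by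
  have : ⇑((f.comp g).E2 n p) = g.E2 n p ∘ f.E2 n p := funext (f.E2_comp g n p)
  have h' := h n p
  rw [this] at h'
  exact (Bijective.of_comp_iff' (hg n p) _).1 h'

lemma Hom.IsQuasiIso.inj {f : Hom A B} (hf : f.IsQuasiIso) {n : ℕ} {x : A.carrier}
    (hx : x ∈ A.gr n) (hd : A.d x = 0) (h : f x ∈ range B.d) :
    x ∈ range A.d := by
  refine (mk_eq_zero ((range A.d).submoduleOf
    (A.gr n ⊓ ker A.d)) (x := ⟨x, hx, hd⟩)).1 ((hf n).1 ?_)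
  rw [map_zero]
  exact (mk_eq_zero _).2 h

lemma Hom.IsQuasiIso.surj {f : Hom A B} (hf : f.IsQuasiIso) {n : ℕ} {y : B.carrier}
    (hy : y ∈ B.gr n) (hd : B.d y = 0) :
    ∃ x ∈ A.gr n, A.d x = 0 ∧ y - f x ∈ range B.d := by
  obtain ⟨c, hc⟩ := (hf n).2 (Submodule.Quotient.mk ⟨y, hy, hd⟩)
  obtain ⟨x, rfl⟩ := mk_surjective _ c
  refine ⟨x.1, x.2.1, x.2.2, ?_⟩
  exact (Submodule.Quotient.eq ((range B.d).submoduleOf (B.gr n ⊓ ker B.d))).1 hc.symm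

lemma Hom.IsDecQuasiIso.of_baseChange {A B : FDGA.{u} ℚ} {f : Hom A B}
    (hf : f.baseChange.IsDecQuasiIso ⊤ ⊤) : f.IsDecQuasiIso ⊤ ⊤ := by
  obtain ⟨l, hl⟩ := exists_slice_one
  have hs : ∀ {A : FDGA.{u} ℚ} (x : A.carrier), slice A.carrier l (A.incl x) = x := fun x => by
    refine (slice_tmul l 1 x).trans ?_
    rw [hl, one_smul]
  have hd : ∀ {A : FDGA.{u} ℚ} (x : A.baseChange.carrier),
      slice A.carrier l (A.baseChange.d x) = A.d (slice A.carrier l x) :=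
    fun x => slice_baseChange l _ x
  have hprev : ∀ {A : FDGA.{u} ℚ} {n : ℕ} {x : A.baseChange.carrier}, x ∈ A.baseChange.prevGr n →
      slice A.carrier l x ∈ A.prevGr n := fun {A n x} hx => by
    cases n with
    | zero =>
      rw [A.baseChange.eq_zero_of_prevGr_zero hx]
      exact (map_zero (slice A.carrier l)).symm ▸ zero_mem _
    | succ n => exact slice_mem l hx
  have hbd : ∀ {A : FDGA.{u} ℚ} {n : ℕ} {p : ℤ} {x : A.baseChange.carrier},
      x ∈ A.baseChange.bd ⊤ n p → slice A.carrier l x ∈ A.bd ⊤ n p := fun {A n p x} hx => by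
    obtain ⟨v, h1, h2, rfl⟩ := mem_bd_top.1 hx
    rw [hd]
    exact mem_bd_top.2 ⟨_, slice_mem l h1, hprev h2, rfl⟩
  have hcyc : ∀ {A : FDGA.{u} ℚ} {n : ℕ} {p : ℤ} {x : A.carrier}, x ∈ A.cyc ⊤ n p →
      (A.incl x : A.baseChange.carrier) ∈ A.baseChange.cyc ⊤ n p := fun {A n p x} hx => by
    rw [mem_cyc_top] at hx
    refine mem_cyc_top.2 ⟨DGA.incl_mem hx.1, DGA.incl_mem hx.2.1, (A.d_incl x).trans ?_⟩
    rw [hx.2.2]; exact map_zero A.incl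
  refine ⟨fun n p a ha h => ?_, fun n p b hb => ?_⟩
  · have h1 : f.baseChange (A.incl a) ∈ B.baseChange.bd ⊤ n (p + 1) := by
      rw [f.baseChange_incl]
      obtain ⟨v, hv, hvn, e⟩ := mem_bd_top.1 h
      rw [← e]
      refine mem_bd_top.2 ⟨B.incl v, DGA.incl_mem hv, ?_, B.d_incl v⟩
      cases n with
      | zero =>
        rw [B.eq_zero_of_prevGr_zero hvn]
        exact (map_zero B.incl).symm ▸ zero_mem _
      | succ n => exact DGA.incl_mem hvn
    have := hbd (hf.inj n p _ (hcyc ha) h1)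
    rwa [hs] at this
  · obtain ⟨a, ha, h⟩ := hf.surj n p _ (hcyc hb)
    rw [mem_cyc_top] at ha
    refine ⟨slice A.carrier l a, mem_cyc_top.2 ⟨slice_mem l ha.1, slice_mem l ha.2.1, ?_⟩, ?_⟩
    · rw [← hd, ha.2.2]; exact map_zero (slice A.carrier l)
    · let b' : B.baseChange.carrier := B.incl b
      have e : slice B.carrier l (b' - f.baseChange a) = b - f (slice A.carrier l a) := by
        refine (map_sub (slice B.carrier l) _ _).trans ?_
        exact congrArg₂ _ (hs b) (slice_baseChange l f.lin a)
      rw [← e]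
      exact hbd h

end FDGA

namespace FDiag

variable {ℓ : ℕ} {A B : FDiag.{u} ℓ}

/-- A family of morphisms that are isomorphisms on the cohomology of the décalage of `W`,
compatibly with `F`. -/
structure _root_.MixedHodge.FFam.Hom.IsDecQuasiIso {A B : FFam.{u} ℓ} (f : FFam.Hom A B) :
    Prop where
  fQ : f.fQ.IsDecQuasiIso ⊤ ⊤
  fmid : ∀ j, (f.fmid j).IsDecQuasiIso ⊤ ⊤
  fodd : ∀ j, (f.fodd j).IsDecQuasiIso ⊤ ⊤
  fC : ∀ q, f.fC.toHom.IsDecQuasiIso (A.AC.F q) (B.AC.F q)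

lemma Hom.comm_apply (f : A.Hom B) (j : Fin (ℓ + 1)) (b : Bool)
    (x : (A.ev (src j b)).carrier) : (f.fodd j) ((A.φ j b) x) =
      (B.φ j b) ((f.toHom.ev (src j b)) x) :=
  congrArg (fun z : FDGA.Hom _ _ => z.toAlgHom x) (f.comm j b)

lemma CTied.map (f : A.Hom B) {n : ℕ} {p : ℤ} {x : A.AR.carrier}
    {z : A.AC.carrier} (h : A.CTied n p x z) :
    B.CTied n p (f.fQ.baseChange x) (f.fC z) := by
  obtain ⟨e, he, rfl, rfl⟩ := h
  refine ⟨fun s => (f.toHom.ev s) (e s), ⟨fun s => (f.toHom.ev s).map_cyc (he.mem s),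
    fun j => ?_⟩, rfl, rfl⟩
  rw [← f.comm_apply, ← f.comm_apply, ← map_sub]
  exact (f.fodd j).map_bd (he.sub_mem j)

lemma _root_.MixedHodge.FDGA.Hom.baseChange_conj {A B : FDGA.{u} ℚ} (f : FDGA.Hom A B)
    (x : A.baseChange.carrier) :
    f.baseChange (A.conj x) = B.conj (f.baseChange x) :=
  (conjT_baseChange f.lin x).symm

section

variable (hA : IsMHD A) (hB : IsMHD B) (f : A.Hom B) (hf : f.fC.toHom.IsQuasiIso)

include hA hB hf

/-- A quasi-isomorphism of mixed Hodge diagrams is strictly compatible with `W` and `F` on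
cohomology. -/
lemma Hom.fC_isDecQuasiIso (q : ℤ) : f.fC.toHom.IsDecQuasiIso (A.AC.F q) (B.AC.F q) := by
  refine ⟨fun n p a ha h => ?_, fun n p b hb => ?_⟩
  · obtain ⟨v, -, hv⟩ := h
    exact hA.exact_mem_bd_F ha.1.1.2 ha.1.1.1 ha.1.2 (hf.inj ha.1.1.2 ha.2 ⟨v, hv⟩)
  · obtain ⟨x, hx, hdx, t, ht⟩ := hf.surj hb.1.1.2 hb.2
    replace ht : B.AC.d t = b - f.fC x := ht
    have hd : ∀ y, B.AC.d (f.fC y) = f.fC (A.AC.d y) := fun y => (f.fC.map_d y).symm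
    let F : A.cycles n →ₗ[ℂ] B.cycles n := f.fC.lin.restrict fun y hy =>
      ⟨f.fC.map_gr n y hy.1, (hd y).trans ((congrArg _ hy.2).trans (map_zero _))⟩
    have hrange : ∀ y ∈ range A.AC.d, f.fC.lin y ∈ range B.AC.d := by
      rintro _ ⟨v, rfl⟩
      exact ⟨_, hd v⟩
    have hmap : ∀ {P : Submodule ℂ A.AC.carrier} {P' : Submodule ℂ B.AC.carrier},
        (∀ y ∈ P, f.fC.lin y ∈ P') → ∀ y ∈ P ⊔ range A.AC.d, f.fC.lin y ∈ P' ⊔ range B.AC.d := by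
      intro P P' hP y hy
      obtain ⟨c, hc, v, hv, rfl⟩ := mem_sup.1 hy
      rw [map_add]
      exact add_mem_sup (hP c hc) (hrange v hv)
    have hFx : f.fC x = b - B.AC.d t := by rw [ht]; abel
    obtain ⟨y, hy, w, hw⟩ := (hA.oppositeFiltrations n).strict (hB.oppositeFiltrations n) F
      (fun m y hy => hmap (fun c hc => f.fC.toHom.map_cyc hc) y.1 hy)
      (fun a y hy => hmap (P := A.cycles n ⊓ A.AC.F a) (P' := B.cycles n ⊓ B.AC.F a)
        (fun c hc => ⟨(F ⟨c, hc.1⟩).2, f.fC.map_F a c hc.2⟩) y.1 hy)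
      (fun b y hy => by
        obtain ⟨p, x, z, z', h1, h2, h3, h4⟩ := hy
        refine ⟨p, _, _, f.fC z', h1.map f, ?_, ?_, f.fC.map_F b z' h4⟩
        · have := hrange _ h2
          rwa [map_sub] at this
        · rw [← FDGA.Hom.baseChange_conj]
          exact h3.map f)
      (a := q) (m := p + n) (x := ⟨x, hx, hdx⟩)
      (by
        change f.fC x ∈ B.cohF n q
        rw [hFx]
        exact sub_mem (mem_sup_left ⟨⟨hb.1.1.2, hb.2⟩, hb.1.2⟩) (mem_sup_right ⟨t, rfl⟩))
      (by
        change f.fC x ∈ B.cohW n (p + n)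
        rw [hFx]
        refine sub_mem (mem_sup_left ?_) (mem_sup_right ⟨t, rfl⟩)
        rw [add_sub_cancel_right]
        exact ⟨⟨hb.1.1, trivial⟩, hb.2⟩)
    replace hw : B.AC.d w = f.fC x - f.fC y := hw
    obtain ⟨c, hc, _, ⟨v, rfl⟩, e⟩ := mem_sup.1 hy.2
    obtain ⟨c', hc', _, ⟨v', rfl⟩, e'⟩ := mem_sup.1 hy.1
    replace e : c + A.AC.d v = y := e
    replace e' : c' + A.AC.d v' = y := e'
    rw [add_sub_cancel_right] at hc
    obtain ⟨r, hr⟩ := A.AC.W_exhaustive c'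
    obtain ⟨z, hz, w', hw'⟩ := hA.exists_cyc_F (a := q) hc ⟨⟨⟨hr, hc'.1.1⟩, hc'.2⟩, hc'.1.2⟩
      ⟨v' - v, by rw [map_sub, eq_sub_iff_add_eq.2 e, eq_sub_iff_add_eq.2 e']; abel⟩
    have hz' : z ∈ A.AC.cyc ⊤ n p := ⟨⟨hz.1.1, trivial⟩, hz.2⟩
    have hfz := mem_cyc_top.1 (f.fC.toHom.map_cyc hz')
    refine ⟨z, hz, hB.exact_mem_bd_F (sub_mem hb.1.1.2 hfz.2.1)
      (sub_mem hb.1.1.1 hfz.1) (sub_mem hb.1.2 (f.fC.map_F q z hz.1.2))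
      ⟨t + w + f.fC (v' + w'), ?_⟩⟩
    have e₃ : A.AC.d (v' + w') = y - z := by rw [map_add, hw', ← e']; abel
    rw [map_add, map_add, ht, hw, hd, e₃, map_sub]
    change _ = b - f.fC z
    abel

lemma Hom.fC_isDecQuasiIso_top : f.fC.toHom.IsDecQuasiIso ⊤ ⊤ := by
  have hq : ∀ n : ℕ, ∃ q, (A.AC.gr n ≤ A.AC.F q ∧ A.AC.prevGr n ≤ A.AC.F q) ∧
      (B.AC.gr n ≤ B.AC.F q ∧ B.AC.prevGr n ≤ B.AC.F q) := by
    have : ∀ {A : FDiag.{u} ℓ} (_ : IsMHD A) (n : ℕ), ∃ q,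
        A.AC.gr n ≤ A.AC.F q ∧ A.AC.prevGr n ≤ A.AC.F q := by
      intro A hA n
      obtain ⟨-, q, hq⟩ := hA.biregular n
      cases n with
      | zero => exact ⟨q, hq, bot_le⟩
      | succ n =>
        obtain ⟨-, r, hr⟩ := hA.biregular n
        exact ⟨min q r, hq.trans (A.AC.F_anti (min_le_left _ _)),
          hr.trans (A.AC.F_anti (min_le_right _ _))⟩
    intro n
    obtain ⟨q, hq, hq'⟩ := this hA n
    obtain ⟨r, hr, hr'⟩ := this hB n
    exact ⟨min q r, ⟨hq.trans (A.AC.F_anti (min_le_left _ _)),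
      hq'.trans (A.AC.F_anti (min_le_left _ _))⟩, hr.trans (B.AC.F_anti (min_le_right _ _)),
      hr'.trans (B.AC.F_anti (min_le_right _ _))⟩
  refine ⟨fun n p a ha h => ?_, fun n p b hb => ?_⟩
  · obtain ⟨q, h1, h2⟩ := hq n
    obtain ⟨v, hv, e⟩ := h
    obtain ⟨w, hw, e'⟩ := (f.fC_isDecQuasiIso hA hB hf q).inj n p a
      ⟨⟨ha.1.1, h1.1 ha.1.1.2⟩, ha.2⟩ ⟨v, ⟨hv.1, h2.2 hv.1.2⟩, e⟩
    exact ⟨w, ⟨hw.1, trivial⟩, e'⟩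
  · obtain ⟨q, h1, h2⟩ := hq n
    obtain ⟨a, ha, v, hv, e⟩ := (f.fC_isDecQuasiIso hA hB hf q).surj n p b
      ⟨⟨hb.1.1, h2.1 hb.1.1.2⟩, hb.2⟩
    exact ⟨a, ⟨⟨ha.1.1, trivial⟩, ha.2⟩, v, ⟨hv.1, trivial⟩, e⟩

lemma Hom.isDecQuasiIso : f.toHom.IsDecQuasiIso := by
  have hC := (f.fC_isDecQuasiIso_top hA hB hf).isE1QuasiIso
  have hodd : ∀ j b, (f.toHom.ev (src j b)).IsE1QuasiIso → (f.fodd j).IsE1QuasiIso :=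
    fun j b h => (hA.e1 j b).of_comp_left (by rw [f.comm]; exact h.comp (hB.e1 j b))
  have hev : ∀ s, (f.toHom.ev s).IsE1QuasiIso := by
    refine fun s => Src.chain_induction true (P := fun s => (f.toHom.ev s).IsE1QuasiIso) hC
      (fun j h => ?_) s
    refine (hB.e1 j _).of_comp_right ?_
    rw [← f.comm]
    exact (hA.e1 j _).comp (hodd j true h)
  exact ⟨(hev .rat).isDecQuasiIso.of_baseChange, fun j => (hev (.mid j)).isDecQuasiIso,
    fun j => (hodd j _ (hev (src j true))).isDecQuasiIso, f.fC_isDecQuasiIso hA hB hf⟩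

end

end FDiag

/-! ## Fibre products of diagrams -/

namespace FDGA

variable {k : Type} [Field k]

lemma pairSub_top {A B C : FDGA.{u} k} (f : Hom A C) (g : Hom B C) :
    pairSub f g ⊤ ⊤ = ⊤ := top_le_iff.1 fun _ _ => ⟨trivial, trivial⟩

lemma pathS_top (A : FDGA.{u} k) : A.pathS ⊤ = ⊤ :=
  top_le_iff.1 fun _ _ => ⟨fun _ => trivial, fun _ => trivial⟩

lemma Hom.path_comp {A B C : FDGA.{u} k} (f : Hom A B) (g : Hom B C) :
    (f.comp g).path = f.path.comp g.path :=
  Hom.ext (AlgHom.ext fun x => path_ext (fun i => by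
    change ((f.comp g).path x : C.PathCarrier).1.coeff i =
      (g.path (f.path x) : C.PathCarrier).1.coeff i
    rw [Hom.path_fst, Hom.path_fst, Hom.path_fst]; rfl) fun i => by
    change ((f.comp g).path x : C.PathCarrier).2.coeff i =
      (g.path (f.path x) : C.PathCarrier).2.coeff i
    rw [Hom.path_snd, Hom.path_snd, Hom.path_snd]; rfl)

lemma Hom.path_id (A : FDGA.{u} k) : (Hom.id A).path = Hom.id A.path :=
  Hom.ext (AlgHom.ext fun x => path_ext ((Hom.id A).path_fst x) ((Hom.id A).path_snd x))

lemma ι_comp_path {A B : FDGA.{u} k} (f : Hom A B) : A.ι.comp f.path = f.comp B.ι :=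
  Hom.ext (AlgHom.ext fun x => f.path_tpow 0 x)

lemma pathBaseChange_nat {A B : FDGA.{u} ℚ} (f : Hom A B) :
    f.path.baseChange.comp B.pathBaseChange = A.pathBaseChange.comp f.baseChange.path := by
  refine Hom.ext_baseChange fun x => ?_
  refine (congrArg B.pathBaseChange (f.path.baseChange_incl x)).trans ?_
  refine (B.pathBaseChangeHom_incl _).trans (Eq.trans ?_
    (congrArg f.baseChange.path (A.pathBaseChangeHom_incl x)).symm)
  refine path_ext (A := B.baseChange) (fun i => ?_) fun i => ?_
  · refine Eq.trans ?_ (f.baseChange.path_fst _ i).symm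
    refine (coeff_map _ _).trans ((congrArg B.incl (f.path_fst x i)).trans ?_)
    refine (f.baseChange_incl _).symm.trans (congrArg f.baseChange.toAlgHom ?_)
    exact (coeff_map A.incl i).symm
  · refine Eq.trans ?_ (f.baseChange.path_snd _ i).symm
    refine (coeff_map _ _).trans ((congrArg B.incl (f.path_snd x i)).trans ?_)
    refine (f.baseChange_incl _).symm.trans (congrArg f.baseChange.toAlgHom ?_)
    exact (coeff_map A.incl i).symm

lemma ι_comp_pathBaseChange (A : FDGA.{u} ℚ) :
    A.ι.baseChange.comp A.pathBaseChange = A.baseChange.ι := by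
  refine Hom.ext_baseChange fun x => ?_
  refine (congrArg A.pathBaseChange (A.ι.baseChange_incl x)).trans ?_
  refine (A.pathBaseChangeHom_incl _).trans ?_
  refine DGA.PathCarrier.ext (Polynomial.map_C A.incl) (Polynomial.map_zero A.incl)

lemma pathLift_evalAt_fst {k : Type} [Field k] {Z A B C : FDGA.{u} k} {f : Hom A C} {g : Hom B C}
    (a : Hom Z A.path) (b : Hom Z B.path) (h : a.comp f.path = b.comp g.path) (c : k) :
    ((pathLift a b h).comp ((pullback f g).evalAt c)).comp (pullbackFst f g) =
      a.comp (A.evalAt c) := by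
  rw [Hom.comp_assoc, ← path_comp_evalAt, ← Hom.comp_assoc, pathLift_fst]

lemma pathLift_evalAt_snd {k : Type} [Field k] {Z A B C : FDGA.{u} k} {f : Hom A C} {g : Hom B C}
    (a : Hom Z A.path) (b : Hom Z B.path) (h : a.comp f.path = b.comp g.path) (c : k) :
    ((pathLift a b h).comp ((pullback f g).evalAt c)).comp (pullbackSnd f g) =
      b.comp (B.evalAt c) := by
  rw [Hom.comp_assoc, ← path_comp_evalAt, ← Hom.comp_assoc, pathLift_snd]

end FDGA

namespace FFDGA

variable {k : Type} [Field k] {A B C : FFDGA.{u} k} (f : Hom A C) (g : Hom B C)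

def pullback : FFDGA.{u} k where
  toFDGA := FDGA.pullback f.toHom g.toHom
  F q := FDGA.pairSub f.toHom g.toHom (A.F q) (B.F q)
  F_anti _ _ h _ hx := ⟨A.F_anti h hx.1, B.F_anti h hx.2⟩
  proj_mem_F hx n := FDGA.proj_mem_pairSub f.toHom g.toHom (fun _ hx => A.proj_mem_F hx)
    (fun _ hx => B.proj_mem_F hx) hx n
  one_mem_F := ⟨A.one_mem_F, B.one_mem_F⟩
  mul_mem_F hx hy := ⟨A.mul_mem_F hx.1 hy.1, B.mul_mem_F hx.2 hy.2⟩
  d_mem_F hx := ⟨A.d_mem_F hx.1, B.d_mem_F hx.2⟩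

end FFDGA

namespace FFam

variable {ℓ : ℕ} {A B C : FFam.{u} ℓ}

def pullback (f : Hom A C) (g : Hom B C) : FFam.{u} ℓ :=
  ⟨FDGA.pullback f.fQ g.fQ, fun j => FDGA.pullback (f.fmid j) (g.fmid j),
    fun j => FDGA.pullback (f.fodd j) (g.fodd j), FFDGA.pullback f.fC g.fC⟩

def pullbackFst (f : Hom A C) (g : Hom B C) : Hom (pullback f g) A :=
  ⟨FDGA.pullbackFst _ _, fun _ => FDGA.pullbackFst _ _, fun _ => FDGA.pullbackFst _ _,
    ⟨FDGA.pullbackFst _ _, fun _ _ hx => hx.1⟩⟩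

def pullbackSnd (f : Hom A C) (g : Hom B C) : Hom (pullback f g) B :=
  ⟨FDGA.pullbackSnd _ _, fun _ => FDGA.pullbackSnd _ _, fun _ => FDGA.pullbackSnd _ _,
    ⟨FDGA.pullbackSnd _ _, fun _ _ hx => hx.2⟩⟩

lemma pullback_condition (f : Hom A C) (g : Hom B C) :
    (pullbackFst f g).comp f = (pullbackSnd f g).comp g :=
  Hom.ext (FDGA.pullback_condition _ _) (funext fun _ => FDGA.pullback_condition _ _)
    (funext fun _ => FDGA.pullback_condition _ _)
    (FFDGA.Hom.ext (congrArg FDGA.Hom.toAlgHom (FDGA.pullback_condition f.fC.toHom g.fC.toHom)))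

def pullbackLift {Z : FFam.{u} ℓ} {f : Hom A C} {g : Hom B C} (a : Hom Z A) (b : Hom Z B)
    (h : a.comp f = b.comp g) : Hom Z (pullback f g) where
  fQ := FDGA.pullbackLift a.fQ b.fQ (congrArg Hom.fQ h)
  fmid j := FDGA.pullbackLift (a.fmid j) (b.fmid j) (congrFun (congrArg Hom.fmid h) j)
  fodd j := FDGA.pullbackLift (a.fodd j) (b.fodd j) (congrFun (congrArg Hom.fodd h) j)
  fC := ⟨FDGA.pullbackLift a.fC.toHom b.fC.toHom (congrArg (fun z : Hom Z C => z.fC.toHom) h),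
    fun p x hx => ⟨a.fC.map_F p x hx, b.fC.map_F p x hx⟩⟩

def ι (A : FFam.{u} ℓ) : Hom A A.path := ⟨A.AQ.ι, fun j => (A.mid j).ι, fun j => (A.odd j).ι,
    ⟨A.AC.toFDGA.ι, fun _ _ hx => FDGA.C_mem_pathSub hx⟩⟩

lemma ι_ev (A : FFam.{u} ℓ) (s : Src ℓ) : (A.ι.ev s).comp (A.evPath s) = (A.ev s).ι := by
  cases s
  · exact A.AQ.ι_comp_pathBaseChange
  · rfl
  · rfl

lemma ι_comp_evalAt (A : FFam.{u} ℓ) (c : ℚ) : A.ι.comp (A.evalAt c) = Hom.id A :=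
  Hom.ext (FDGA.ι_comp_evalAt _ _) (funext fun _ => FDGA.ι_comp_evalAt _ _)
    (funext fun _ => FDGA.ι_comp_evalAt _ _)
    (FFDGA.Hom.ext (congrArg FDGA.Hom.toAlgHom (FDGA.ι_comp_evalAt A.AC.toFDGA c)))

def Hom.path (f : Hom A B) : Hom A.path B.path :=
  ⟨f.fQ.path, fun j => (f.fmid j).path, fun j => (f.fodd j).path, f.fC.path⟩

lemma Hom.path_ev (f : Hom A B) (s : Src ℓ) :
    (f.path.ev s).comp (B.evPath s) = (A.evPath s).comp (f.ev s).path := by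
  cases s
  · exact pathBaseChange_nat f.fQ
  · rfl
  · rfl

lemma Hom.path_comp_evalAt (f : Hom A B) (c : ℚ) : f.path.comp (B.evalAt c) = (A.evalAt c).comp f :=
  Hom.ext (FDGA.path_comp_evalAt _ _) (funext fun _ => FDGA.path_comp_evalAt _ _)
    (funext fun _ => FDGA.path_comp_evalAt _ _)
    (FFDGA.Hom.ext (congrArg FDGA.Hom.toAlgHom (FDGA.path_comp_evalAt f.fC.toHom (c : ℂ))))

end FFam

namespace FDiag

variable {ℓ : ℕ} {A B C : FDiag.{u} ℓ}

lemma Hom.ext_toHom {f g : A ⟶ B} (h : toHom f = toHom g) : f = g := by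
  obtain ⟨f, hf⟩ := f
  obtain ⟨g, hg⟩ := g
  obtain rfl : f = g := h
  rfl

def pathMap (f : A ⟶ B) : A.path ⟶ B.path := Hom.mk (toHom f).path fun j b => by
    change ((A.evPath (src j b)).comp (A.φ j b).path).comp ((toHom f).fodd j).path =
      ((toHom f).path.ev (src j b)).comp ((B.evPath (src j b)).comp (B.φ j b).path)
    rw [← FDGA.Hom.comp_assoc, FFam.Hom.path_ev, FDGA.Hom.comp_assoc, FDGA.Hom.comp_assoc,
      ← FDGA.Hom.path_comp, ← FDGA.Hom.path_comp]
    exact congrArg (fun z => (A.evPath (src j b)).comp (FDGA.Hom.path z)) (FDiag.Hom.comm f j b)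

lemma pathMap_comp_evalAt (f : A ⟶ B) (c : ℚ) : pathMap f ≫ B.evalAt c = A.evalAt c ≫ f :=
  Hom.ext_toHom ((toHom f).path_comp_evalAt c)

def ι (A : FDiag.{u} ℓ) : A ⟶ A.path := Hom.mk A.toFFam.ι fun j b => by
    change (A.φ j b).comp (A.odd j).ι =
      (A.toFFam.ι.ev (src j b)).comp ((A.evPath (src j b)).comp (A.φ j b).path)
    rw [← FDGA.Hom.comp_assoc, FFam.ι_ev, FDGA.ι_comp_path]

lemma ι_comp_evalAt (A : FDiag.{u} ℓ) (c : ℚ) : A.ι ≫ A.evalAt c = 𝟙 A :=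
  Hom.ext_toHom (A.toFFam.ι_comp_evalAt c)

def pullback (f : A ⟶ C) (g : B ⟶ C) : FDiag.{u} ℓ where
  toFFam := FFam.pullback (toHom f) (toHom g)
  φ j b := FDGA.pullbackLift (((FFam.pullbackFst (toHom f) (toHom g)).ev (src j b)).comp (A.φ j b))
    (((FFam.pullbackSnd (toHom f) (toHom g)).ev (src j b)).comp (B.φ j b)) <| by
      rw [FDGA.Hom.comp_assoc, FDGA.Hom.comp_assoc, FDiag.Hom.comm f j b, FDiag.Hom.comm g j b,
        ← FDGA.Hom.comp_assoc, ← FDGA.Hom.comp_assoc, ← FFam.Hom.comp_ev, ← FFam.Hom.comp_ev,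
        FFam.pullback_condition]

def pullbackFst (f : A ⟶ C) (g : B ⟶ C) : pullback f g ⟶ A :=
  Hom.mk (FFam.pullbackFst _ _) fun _ _ => rfl

def pullbackSnd (f : A ⟶ C) (g : B ⟶ C) : pullback f g ⟶ B :=
  Hom.mk (FFam.pullbackSnd _ _) fun _ _ => rfl

def pullbackLift {Z : FDiag.{u} ℓ} {f : A ⟶ C} {g : B ⟶ C} (a : Z ⟶ A) (b : Z ⟶ B)
    (h : a ≫ f = b ≫ g) : Z ⟶ pullback f g :=
  Hom.mk (FFam.pullbackLift (toHom a) (toHom b) (congrArg toHom h)) fun j c => by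
    refine FDGA.pullbackHom_ext ?_ ?_
    · refine (FDiag.Hom.comm a j c).trans ?_
      exact congrArg (fun z => FDGA.Hom.comp z (A.φ j c)) (FFam.Hom.comp_ev
        (FFam.pullbackLift _ _ _) (FFam.pullbackFst (toHom f) (toHom g)) _)
    · refine (FDiag.Hom.comm b j c).trans ?_
      exact congrArg (fun z => FDGA.Hom.comp z (B.φ j c)) (FFam.Hom.comp_ev
        (FFam.pullbackLift _ _ _) (FFam.pullbackSnd (toHom f) (toHom g)) _)

end FDiag

namespace HoMor

variable {ℓ : ℕ} {X A B C : FDiag.{u} ℓ}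

lemma postcomp_comp (h : HoMor X A) (f : A ⟶ B) (g : B ⟶ C) :
    h.postcomp (f ≫ g) = (h.postcomp f).postcomp g :=
  HoMor.ext rfl rfl rfl rfl (funext fun j => funext fun b => by
    change (h.htpy j b).comp (FDGA.Hom.path (((FDiag.Hom.toHom f).fodd j).comp
      ((FDiag.Hom.toHom g).fodd j))) = _
    rw [FDGA.Hom.path_comp]; rfl)

lemma postcomp_id (h : HoMor X A) : h.postcomp (𝟙 A) = h :=
  HoMor.ext rfl rfl rfl rfl (funext fun j => funext fun b => by
    change (h.htpy j b).comp (FDGA.Hom.id (A.odd j)).path = _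
    rw [FDGA.Hom.path_id]; rfl)

def pullbackLift {f : A ⟶ C} {g : B ⟶ C} (a : HoMor X A) (b : HoMor X B)
    (h : a.postcomp f = b.postcomp g) : HoMor X (FDiag.pullback f g) where
  toHom := FFam.pullbackLift a.toHom b.toHom (congrArg HoMor.toHom h)
  htpy j c := FDGA.pathLift (a.htpy j c) (b.htpy j c)
    (congrFun (congrFun (congrArg HoMor.htpy h) j) c)
  h0 j c := by
    refine FDGA.pullbackHom_ext ?_ ?_
    · refine (FDGA.pathLift_evalAt_fst _ _ _ _).trans ?_
      exact a.h0 j c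
    · refine (FDGA.pathLift_evalAt_snd _ _ _ _).trans ?_
      exact b.h0 j c
  h1 j c := by
    refine FDGA.pullbackHom_ext ?_ ?_
    · refine (FDGA.pathLift_evalAt_fst _ _ _ _).trans ?_
      refine (a.h1 j c).trans ?_
      exact congrArg (fun z => FDGA.Hom.comp z (A.φ j c)) (FFam.Hom.comp_ev
        (FFam.pullbackLift _ _ _) (FFam.pullbackFst (FDiag.Hom.toHom f) (FDiag.Hom.toHom g)) _)
    · refine (FDGA.pathLift_evalAt_snd _ _ _ _).trans ?_
      refine (b.h1 j c).trans ?_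
      exact congrArg (fun z => FDGA.Hom.comp z (B.φ j c)) (FFam.Hom.comp_ev
        (FFam.pullbackLift _ _ _) (FFam.pullbackSnd (FDiag.Hom.toHom f) (FDiag.Hom.toHom g)) _)

lemma pullbackLift_fst {f : A ⟶ C} {g : B ⟶ C} (a : HoMor X A) (b : HoMor X B)
    (h : a.postcomp f = b.postcomp g) :
    (pullbackLift a b h).postcomp (FDiag.pullbackFst f g) = a :=
  HoMor.ext rfl rfl rfl rfl (funext fun _ => funext fun _ => FDGA.pathLift_fst _ _ _)

lemma pullbackLift_snd {f : A ⟶ C} {g : B ⟶ C} (a : HoMor X A) (b : HoMor X B)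
    (h : a.postcomp f = b.postcomp g) :
    (pullbackLift a b h).postcomp (FDiag.pullbackSnd f g) = b :=
  HoMor.ext rfl rfl rfl rfl (funext fun _ => funext fun _ => FDGA.pathLift_snd _ _ _)

lemma Homotopic.postcomp {f g : HoMor X A} (h : Homotopic f g) (w : A ⟶ B) :
    Homotopic (f.postcomp w) (g.postcomp w) := by
  obtain ⟨h, rfl, rfl⟩ := h
  refine ⟨h.postcomp (FDiag.pathMap w), ?_, ?_⟩
  · rw [← postcomp_comp, ← postcomp_comp]
    exact congrArg h.postcomp (FDiag.pathMap_comp_evalAt w 0)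
  · rw [← postcomp_comp, ← postcomp_comp]
    exact congrArg h.postcomp (FDiag.pathMap_comp_evalAt w 1)

lemma Homotopic.refl (f : HoMor X A) : Homotopic f f := by
  refine ⟨f.postcomp A.ι, ?_, ?_⟩
  · rw [← postcomp_comp]
    exact (congrArg f.postcomp (A.ι_comp_evalAt 0)).trans f.postcomp_id
  · rw [← postcomp_comp]
    exact (congrArg f.postcomp (A.ι_comp_evalAt 1)).trans f.postcomp_id

end HoMor

/-! ## Trivial fibrations of diagrams and lifting of ho-morphisms -/

namespace FDGA

variable {k : Type} [Field k] [CharZero k] {A B E : FDGA.{u} k}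

lemma fst_isTrivFib (w : Hom A B) {c : k} (hc : c = 0) {S : Submodule k A.carrier}
    {S' : Submodule k B.carrier} (hw : ∀ x ∈ S, w x ∈ S')
    (hS' : ∀ x ∈ S', ∀ n, B.proj n x ∈ S') :
    (pullbackFst w (B.evalAt c)).IsTrivFib (pairSub w (B.evalAt c) S (B.pathS S')) S := by
  subst hc; exact mapPath_fst_isTrivFib hw hS'

lemma end_isTrivFib (w : Hom A B) {c e : k} (hc : c = 0) (he : e = 1) {S : Submodule k A.carrier}
    {S' : Submodule k B.carrier} (hQ : w.IsDecQuasiIso S S') (hw : ∀ x ∈ S, w x ∈ S')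
    (hS' : ∀ x ∈ S', ∀ n, B.proj n x ∈ S') (hd : ∀ x ∈ S', B.d x ∈ S') :
    ((pullbackSnd w (B.evalAt c)).comp (B.evalAt e)).IsTrivFib
      (pairSub w (B.evalAt c) S (B.pathS S')) S' := by
  subst hc he; exact mapPathEnd_isTrivFib hQ hw hS' hd

lemma lift_ends_isTrivFib (π : Hom E B) {c e : k} (hc : c = 0) (he : e = 1)
    {S : Submodule k E.carrier} {S' : Submodule k B.carrier} (hπ : π.IsTrivFib S S')
    (hπS : ∀ x ∈ S, π x ∈ S') (hS : ∀ x ∈ S, ∀ n, E.proj n x ∈ S)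
    (hdS : ∀ x ∈ S, E.d x ∈ S) (hS' : ∀ x ∈ S', ∀ n, B.proj n x ∈ S')
    (hd : ∀ x ∈ S', B.d x ∈ S') (h0 : (E.evalAt c).comp π = π.path.comp (B.evalAt c))
    (h1 : (pullbackLift (E.evalAt c) π.path h0).comp
      ((pullbackSnd π (B.evalAt c)).comp (B.evalAt e)) = (E.evalAt e).comp π) :
    (pullbackLift (pullbackLift (E.evalAt c) π.path h0) (E.evalAt e) h1).IsTrivFib (E.pathS S)
      (pairSub _ _ (pairSub π (B.evalAt c) S (B.pathS S')) S) := by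
  subst hc he; exact toEndPaths_isTrivFib hπ hπS hS hdS hS' hd

lemma fst_isTrivFib_top (w : Hom A B) {c : k} (hc : c = 0) :
    (pullbackFst w (B.evalAt c)).IsTrivFib ⊤ ⊤ := by
  have h := fst_isTrivFib w hc (S := ⊤) (S' := ⊤) (fun _ _ => trivial) (fun _ _ _ => trivial)
  rwa [pathS_top, pairSub_top] at h

lemma end_isTrivFib_top (w : Hom A B) {c e : k} (hc : c = 0) (he : e = 1)
    (hQ : w.IsDecQuasiIso ⊤ ⊤) :
    ((pullbackSnd w (B.evalAt c)).comp (B.evalAt e)).IsTrivFib ⊤ ⊤ := by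
  have h := end_isTrivFib w hc he hQ (fun _ _ => trivial) (fun _ _ _ => trivial)
    (fun _ _ => trivial)
  rwa [pathS_top, pairSub_top] at h

lemma toEndPaths_isTrivFib_top {π : Hom E B} (hπ : π.IsTrivFib ⊤ ⊤) :
    (toEndPaths π).IsTrivFib ⊤ ⊤ := by
  have h := toEndPaths_isTrivFib hπ (fun _ _ => trivial) (fun _ _ _ => trivial)
    (fun _ _ => trivial) (fun _ _ _ => trivial) (fun _ _ => trivial)
  have e : endPathsS π ⊤ ⊤ = ⊤ := top_le_iff.1 fun _ _ =>
    ⟨⟨trivial, fun _ => trivial, fun _ => trivial⟩, trivial⟩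
  rwa [pathS_top, e] at h

lemma lift_ends_isTrivFib_top (π : Hom E B) {c e : k} (hc : c = 0) (he : e = 1)
    (hπ : π.IsTrivFib ⊤ ⊤) (h0 : (E.evalAt c).comp π = π.path.comp (B.evalAt c))
    (h1 : (pullbackLift (E.evalAt c) π.path h0).comp
      ((pullbackSnd π (B.evalAt c)).comp (B.evalAt e)) = (E.evalAt e).comp π) :
    (pullbackLift (pullbackLift (E.evalAt c) π.path h0) (E.evalAt e) h1).IsTrivFib ⊤ ⊤ := by
  subst hc he; exact toEndPaths_isTrivFib_top hπ

end FDGA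

structure FFam.Hom.IsTrivFib {ℓ : ℕ} {A B : FFam.{u} ℓ} (f : FFam.Hom A B) : Prop where
  fQ : f.fQ.IsTrivFib ⊤ ⊤
  fmid : ∀ j, (f.fmid j).IsTrivFib ⊤ ⊤
  fodd : ∀ j, (f.fodd j).IsTrivFib ⊤ ⊤
  fC : ∀ q, f.fC.toHom.IsTrivFib (A.AC.F q) (B.AC.F q)

namespace FDiag

variable {ℓ : ℕ} {A B E : FDiag.{u} ℓ}

abbrev mapPath (w : A ⟶ B) : FDiag.{u} ℓ := pullback w B.δ0

abbrev mapPathEnd (w : A ⟶ B) : mapPath w ⟶ B := pullbackSnd w B.δ0 ≫ B.δ1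

def mapPathConst (w : A ⟶ B) : A ⟶ mapPath w := pullbackLift (𝟙 A) (w ≫ B.ι) (by
    have := B.ι_comp_evalAt 0
    rw [Category.assoc, δ0, this, Category.id_comp, Category.comp_id])

lemma mapPathConst_fst (w : A ⟶ B) : mapPathConst w ≫ pullbackFst w B.δ0 = 𝟙 A := rfl

lemma mapPathConst_end (w : A ⟶ B) : mapPathConst w ≫ mapPathEnd w = w := by
  have h : mapPathConst w ≫ pullbackSnd w B.δ0 = w ≫ B.ι := rfl
  rw [← Category.assoc, h, Category.assoc, δ1, B.ι_comp_evalAt 1, Category.comp_id]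

lemma mapPath_fst_isTrivFib (w : A ⟶ B) : (toHom (pullbackFst w B.δ0)).IsTrivFib where
  fQ := fst_isTrivFib_top _ rfl
  fmid _ := fst_isTrivFib_top _ Rat.cast_zero
  fodd _ := fst_isTrivFib_top _ Rat.cast_zero
  fC q := fst_isTrivFib (toHom w).fC.toHom Rat.cast_zero
    ((toHom w).fC.map_F q) (fun _ hx => B.AC.proj_mem_F hx)

lemma mapPathEnd_isTrivFib (w : A ⟶ B) (hw : (toHom w).IsDecQuasiIso) :
    (toHom (mapPathEnd w)).IsTrivFib where
  fQ := end_isTrivFib_top _ rfl rfl hw.fQ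
  fmid j := end_isTrivFib_top _ Rat.cast_zero Rat.cast_one (hw.fmid j)
  fodd j := end_isTrivFib_top _ Rat.cast_zero Rat.cast_one (hw.fodd j)
  fC q := end_isTrivFib (toHom w).fC.toHom Rat.cast_zero Rat.cast_one (hw.fC q)
    ((toHom w).fC.map_F q) (fun _ hx => B.AC.proj_mem_F hx)
    (fun _ hx => B.AC.d_mem_F hx)

abbrev endPaths (π : E ⟶ B) : FDiag.{u} ℓ := pullback (mapPathEnd π) π

def toEndPaths (π : E ⟶ B) : E.path ⟶ endPaths π :=
  pullbackLift (pullbackLift E.δ0 (pathMap π) (pathMap_comp_evalAt π 0).symm) E.δ1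
    (pathMap_comp_evalAt π 1)

lemma toEndPaths_isTrivFib {π : E ⟶ B} (hπ : (toHom π).IsTrivFib) :
    (toHom (toEndPaths π)).IsTrivFib where
  fQ := lift_ends_isTrivFib_top _ rfl rfl hπ.fQ (path_comp_evalAt _ _).symm (path_comp_evalAt _ _)
  fmid j := lift_ends_isTrivFib_top _ Rat.cast_zero Rat.cast_one (hπ.fmid j)
    (path_comp_evalAt _ _).symm (path_comp_evalAt _ _)
  fodd j := lift_ends_isTrivFib_top _ Rat.cast_zero Rat.cast_one (hπ.fodd j)
    (path_comp_evalAt _ _).symm (path_comp_evalAt _ _)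
  fC q := lift_ends_isTrivFib (toHom π).fC.toHom Rat.cast_zero Rat.cast_one
    (hπ.fC q) ((toHom π).fC.map_F q) (fun _ hx => E.AC.proj_mem_F hx)
    (fun _ hx => E.AC.d_mem_F hx) (fun _ hx => B.AC.proj_mem_F hx) (fun _ hx => B.AC.d_mem_F hx)
    (path_comp_evalAt _ _).symm (path_comp_evalAt _ _)

end FDiag

namespace HoMor

variable {ℓ : ℕ}

def Classes (X A : FDiag.{u} ℓ) : Type u := Quot (Homotopic (A := X) (B := A))

def Classes.map (X : FDiag.{u} ℓ) {A B : FDiag.{u} ℓ} (f : A ⟶ B) : Classes X A → Classes X B :=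
  Quot.map (fun h => h.postcomp f) fun _ _ h => h.postcomp f

lemma Classes.map_comp (X : FDiag.{u} ℓ) {A B C : FDiag.{u} ℓ} (f : A ⟶ B) (g : B ⟶ C) :
    Classes.map X (f ≫ g) = Classes.map X g ∘ Classes.map X f :=
  funext fun c => Quot.inductionOn c fun h => congrArg (Quot.mk _) (h.postcomp_comp f g)

lemma Classes.map_id (X A : FDiag.{u} ℓ) : Classes.map X (𝟙 A) = id :=
  funext fun c => Quot.inductionOn c fun h => congrArg (Quot.mk _) h.postcomp_id

end HoMor

namespace MixedHodgeDGA.IsMinimalWith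

variable {M : MixedHodgeDGA.{u}} {deg : ℕ → ℕ} {V : ℕ → Submodule ℚ M.carrier}
  (h : M.IsMinimalWith deg V) {ℓ : ℕ} {A B E : FDiag.{u} ℓ}

include h

lemma exists_lift_ev {E B : FDGA.{u} ℂ} (π : FDGA.Hom E B) (hπ : π.IsTrivFib ⊤ ⊤) (s : Src ℓ)
    (b : FDGA.Hom ((M.toDiag ℓ).ev s) B) : ∃ e : FDGA.Hom ((M.toDiag ℓ).ev s) E, e.comp π = b := by
  cases s <;> exact h.isCellular_baseChange.toIsCellular.exists_lift_top π hπ b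

/-- Ho-morphisms from a minimal mixed Hodge dga lift along trivial fibrations. -/
lemma exists_hoMor_lift (π : E ⟶ B) (hπ : (toHom π).IsTrivFib)
    (β : HoMor (M.toDiag ℓ) B) : ∃ α : HoMor (M.toDiag ℓ) E, α.postcomp π = β := by
  obtain ⟨eQ, hQ⟩ := h.isCellular.exists_lift_top _ hπ.fQ β.fQ
  choose em hm using fun j =>
    h.isCellular_baseChange.toIsCellular.exists_lift_top _ (hπ.fmid j) (β.fmid j)
  have hodd : ∀ j, ∃ e : FDGA.Hom ((M.toDiag ℓ).odd j) (E.odd j),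
      e.comp ((toHom π).fodd j) = β.fodd j := fun j =>
    h.isCellular_baseChange.toIsCellular.exists_lift_top _ (hπ.fodd j) (β.fodd j)
  choose eo ho using hodd
  obtain ⟨eC, hC⟩ := h.isCellular_baseChange.exists_lift_hom _ hπ.fC β.fC
  let e : FFam.Hom (M.toDiag ℓ).toFFam E.toFFam := ⟨eQ, em, eo, eC⟩
  have he : e.comp (toHom π) = β.toHom := FFam.Hom.ext hQ (funext hm) (funext ho) hC
  have key : ∀ j b, ∃ y : FDGA.Hom ((M.toDiag ℓ).ev (src j b)) (E.odd j).path,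
      y.comp (E.odd j).δ0 = ((M.toDiag ℓ).φ j b).comp (eo j) ∧
      y.comp (E.odd j).δ1 = (e.ev (src j b)).comp (E.φ j b) ∧
      y.comp ((toHom π).fodd j).path = β.htpy j b := by
    intro j b
    have h0 : (((M.toDiag ℓ).φ j b).comp (eo j)).comp ((toHom π).fodd j) =
        (β.htpy j b).comp (B.odd j).δ0 := by
      rw [β.h0, FDGA.Hom.comp_assoc, ho]
    have h1 : ((pullbackLift _ _ h0).comp (mapPathEnd ((toHom π).fodd j))) =
        ((e.ev (src j b)).comp (E.φ j b)).comp ((toHom π).fodd j) := by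
      refine (β.h1 j b).trans ?_
      rw [FDGA.Hom.comp_assoc, FDiag.Hom.comm π j b, ← FDGA.Hom.comp_assoc, ← FFam.Hom.comp_ev, he]
    obtain ⟨y, hy⟩ := h.exists_lift_ev _ (toEndPaths_isTrivFib_top (hπ.fodd j)) (src j b) (pullbackLift _ _ h1)
    exact ⟨y, congrArg (fun z => (FDGA.Hom.comp z (pullbackFst _ _)).comp
        (pullbackFst _ _)) hy, congrArg (fun z => FDGA.Hom.comp z (pullbackSnd _ _)) hy,
      congrArg (fun z => (FDGA.Hom.comp z (pullbackFst _ _)).comp (pullbackSnd _ _)) hy⟩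
  choose y hy0 hy1 hy using key
  exact ⟨⟨e, y, hy0, hy1⟩, HoMor.ext hQ (funext hm) (funext ho) hC
    (funext fun j => funext fun b => hy j b)⟩

lemma homotopic_of_postcomp (π : E ⟶ B) (hπ : (toHom π).IsTrivFib)
    {α α' : HoMor (M.toDiag ℓ) E} (hα : HoMor.Homotopic (α.postcomp π) (α'.postcomp π)) :
    HoMor.Homotopic α α' := by
  obtain ⟨k, h0, h1⟩ := hα
  have e1 : (HoMor.pullbackLift α k h0.symm).postcomp (FDiag.mapPathEnd π) = α'.postcomp π := by
    rw [HoMor.postcomp_comp, HoMor.pullbackLift_snd, h1]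
  obtain ⟨y, hy⟩ := h.exists_hoMor_lift (FDiag.toEndPaths π) (FDiag.toEndPaths_isTrivFib hπ)
    (HoMor.pullbackLift _ _ e1)
  refine ⟨y, ?_, ?_⟩
  · have := congrArg (fun z => (z.postcomp (FDiag.pullbackFst _ _)).postcomp
      (FDiag.pullbackFst _ _)) hy
    simp only [HoMor.pullbackLift_fst] at this
    rw [← this, ← HoMor.postcomp_comp, ← HoMor.postcomp_comp]
    rfl
  · have := congrArg (fun z => z.postcomp (FDiag.pullbackSnd _ _)) hy
    simp only [HoMor.pullbackLift_snd] at this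
    rw [← this, ← HoMor.postcomp_comp]
    rfl

lemma classes_map_bijective_of_isTrivFib (π : E ⟶ B) (hπ : (toHom π).IsTrivFib) :
    Bijective (HoMor.Classes.map (M.toDiag ℓ) π) := by
  constructor
  · have key : ∀ β β' : HoMor (M.toDiag ℓ) B, Relation.EqvGen HoMor.Homotopic β β' →
        ∀ α α' : HoMor (M.toDiag ℓ) E, α.postcomp π = β → α'.postcomp π = β' →
          (Quot.mk _ α : HoMor.Classes (M.toDiag ℓ) E) = Quot.mk _ α' := by
      intro β β' hβ
      induction hβ with
      | rel β β' hβ =>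
        rintro α α' rfl rfl
        exact Quot.sound (h.homotopic_of_postcomp π hπ hβ)
      | refl β =>
        rintro α α' rfl e
        exact Quot.sound (h.homotopic_of_postcomp π hπ (e ▸ HoMor.Homotopic.refl _))
      | symm _ _ _ ih => exact fun α α' e e' => (ih α' α e' e).symm
      | trans _ γ _ _ _ ih ih' =>
        intro α α' e e'
        obtain ⟨δ, hδ⟩ := h.exists_hoMor_lift π hπ γ
        exact (ih α δ e hδ).trans (ih' δ α' hδ e')
    rintro ⟨α⟩ ⟨α'⟩ e
    exact key _ _ (Quot.eqvGen_exact e) α α' rfl rfl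
  · intro c
    refine Quot.inductionOn c fun β => ?_
    obtain ⟨α, rfl⟩ := h.exists_hoMor_lift π hπ β
    exact ⟨Quot.mk _ α, rfl⟩

/-- Quasi-isomorphisms of mixed Hodge diagrams induce bijections on the homotopy classes of
ho-morphisms from a minimal mixed Hodge dga. -/
theorem classes_map_bijective (hA : IsMHD A) (hB : IsMHD B) (w : A ⟶ B)
    (hw : levelwiseQuasiIso ℓ w) : Bijective (HoMor.Classes.map (M.toDiag ℓ) w) := by
  have h1 := h.classes_map_bijective_of_isTrivFib _ (FDiag.mapPath_fst_isTrivFib w)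
  have h2 := h.classes_map_bijective_of_isTrivFib _ (FDiag.mapPathEnd_isTrivFib w
    (FDiag.Hom.isDecQuasiIso hA hB w hw.2.2.2))
  have h3 : Bijective (HoMor.Classes.map (M.toDiag ℓ) (FDiag.mapPathConst w)) := by
    refine (Bijective.of_comp_iff' h1 _).1 ?_
    rw [← HoMor.Classes.map_comp, FDiag.mapPathConst_fst, HoMor.Classes.map_id]
    exact Function.bijective_id
  rw [← FDiag.mapPathConst_end w, HoMor.Classes.map_comp]
  exact h2.comp h3

end MixedHodgeDGA.IsMinimalWith

/-! ## Substitutions in path objects -/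

namespace DGA

variable {k : Type} [Field k] (X : DGA.{u} k)

lemma mul_comm_of_gr_zero {τ : X.carrier} (hτ : τ ∈ X.gr 0) (x : X.carrier) : x * τ = τ * x := by
  induction x using DirectSum.Decomposition.inductionOn X.gr with
  | zero => simp
  | add a b ha hb => rw [add_mul, mul_add, ha, hb]
  | homogeneous a => rw [X.comm a.2 hτ, mul_zero, pow_zero, one_smul]

lemma mul_of_gr_one {τ : X.carrier} (hτ : τ ∈ X.gr 1) (x : X.carrier) : τ * x = X.sgn x * τ := by
  induction x using DirectSum.Decomposition.inductionOn X.gr with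
  | zero => simp
  | add a b ha hb => rw [map_add, add_mul, mul_add, ha, hb]
  | homogeneous a => rw [X.comm hτ a.2, one_mul, X.sgn_of_mem a.2, smul_mul_assoc]

lemma mul_self_of_gr_one [CharZero k] {τ : X.carrier} (hτ : τ ∈ X.gr 1) : τ * τ = 0 := by
  have h := X.comm hτ hτ
  rw [one_mul, pow_one, neg_smul, one_smul] at h
  have h2 : (2 : k) • (τ * τ) = 0 := by rw [two_smul]; nth_rewrite 1 [h]; exact neg_add_cancel _
  exact (smul_eq_zero.1 h2).resolve_left two_ne_zero

lemma d_pow {τ : X.carrier} (hτ : τ ∈ X.gr 0) (i : ℕ) :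
    X.d (τ ^ (i + 1)) = ((i + 1 : ℕ) : X.carrier) * τ ^ i * X.d τ := by
  have hs : X.sgn τ = τ := by rw [X.sgn_of_mem hτ, pow_zero, one_smul]
  induction i with
  | zero => simp
  | succ i ih =>
    have hp : X.sgn (τ ^ (i + 1)) = τ ^ (i + 1) := by
      rw [← DGA.sgnHom_apply, map_pow, DGA.sgnHom_apply, hs]
    rw [pow_succ τ (i + 1), X.leibniz', ih, hp, mul_assoc _ (X.d τ),
      X.mul_comm_of_gr_zero hτ (X.d τ), Nat.cast_succ (i + 1), add_mul, add_mul, one_mul, pow_succ]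
    simp only [mul_assoc]

end DGA

namespace FDGA

variable {k : Type} [Field k]

/-- The elements that can be substituted for the parameter of a path. -/
structure IsParam (X : FDGA.{u} k) (τ : X.carrier) : Prop where
  gr : τ ∈ X.gr 0
  W : τ ∈ X.W 0
  d_W : X.d τ ∈ X.W (-1)

namespace IsParam

variable {X Y : FDGA.{u} k} {σ τ : X.carrier}

lemma add (hσ : X.IsParam σ) (hτ : X.IsParam τ) : X.IsParam (σ + τ) :=
  ⟨add_mem hσ.1 hτ.1, add_mem hσ.2 hτ.2, by rw [map_add]; exact add_mem hσ.3 hτ.3⟩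

lemma sub (hσ : X.IsParam σ) (hτ : X.IsParam τ) : X.IsParam (σ - τ) :=
  ⟨sub_mem hσ.1 hτ.1, sub_mem hσ.2 hτ.2, by rw [map_sub]; exact sub_mem hσ.3 hτ.3⟩

lemma mul (hσ : X.IsParam σ) (hτ : X.IsParam τ) : X.IsParam (σ * τ) := by
  refine ⟨by simpa using DGA.mul_mem_gr hσ.1 hτ.1, by simpa using X.mul_mem_W hσ.2 hτ.2, ?_⟩
  rw [X.leibniz', X.sgn_of_mem hσ.1, pow_zero, one_smul]
  exact add_mem (by simpa using X.mul_mem_W hσ.3 hτ.2) (by simpa using X.mul_mem_W hσ.2 hτ.3)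

lemma map (f : Hom X Y) (hτ : X.IsParam τ) : Y.IsParam (f τ) :=
  ⟨f.map_gr _ _ hτ.1, f.map_W _ _ hτ.2, by rw [← f.map_d]; exact f.map_W _ _ hτ.3⟩

end IsParam

def tvar (A : FDGA.{u} k) : A.path.carrier := A.tpow 1 1

variable {A B X Y : FDGA.{u} k}

lemma evalAt_tvar (c : k) : (A.evalAt c) A.tvar = algebraMap k A.carrier c := by
  rw [tvar, evalAt_tpow, pow_one, Algebra.algebraMap_eq_smul_one]

lemma Hom.path_tvar (f : Hom A B) : f.path A.tvar = B.tvar := by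
  rw [tvar, Hom.path_tpow, map_one]; rfl

lemma d_tvar : (A.path.d A.tvar : A.PathCarrier) = ⟨0, 1⟩ := by
  refine path_ext (A := A) (fun i => ?_) fun i => ?_
  · refine (coeff_polyMap _ _ _).trans ?_
    refine (congrArg A.d (coeff_monomial (n := 1) (m := i) (a := (1 : A.carrier)))).trans ?_
    split_ifs
    · exact A.d_one
    · exact map_zero A.d
  · change (derivative (A.polySgn (monomial 1 1)) +
      polyMap A.d 0).coeff i = (1 : Polynomial A.carrier).coeff i
    rw [map_zero, add_zero, DGA.polySgn, Polynomial.coe_mapRingHom, map_monomial,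
      DGA.sgnHom_apply, A.sgn_one, Polynomial.derivative_monomial]
    simp [Polynomial.coeff_one]

lemma tvar_isParam : A.path.IsParam A.tvar where
  gr := tpow_mem_gr 1 (SetLike.GradedOne.one_mem (A := A.gr))
  W := tpow_mem_W 1 A.one_mem_W
  d_W := by
    have : (⟨0, 1⟩ : A.PathCarrier) ∈ A.path.W (-1) := by
      refine ⟨fun i => by simp, fun i => ?_⟩
      rw [Polynomial.coeff_one]
      split_ifs
      · exact A.one_mem_W
      · exact zero_mem _
    exact (d_tvar (A := A)).symm ▸ this

lemma path_ringHom_ext {R : Type*} [Ring R] {f g : A.path.carrier →+* R}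
    (hι : ∀ a, f (A.ι a) = g (A.ι a)) (ht : f A.tvar = g A.tvar)
    (hdt : f (A.path.d A.tvar) = g (A.path.d A.tvar)) : f = g := by
  let j : Polynomial A.carrier →+* A.path.carrier :=
    { toFun := fun p => (⟨p, 0⟩ : A.PathCarrier)
      map_zero' := rfl
      map_one' := rfl
      map_add' := fun p q => DGA.PathCarrier.ext rfl (add_zero _).symm
      map_mul' := fun p q => DGA.PathCarrier.ext rfl (by
        change (0 : Polynomial A.carrier) = p * 0 + 0 * _
        simp) }
  have hj : f.comp j = g.comp j := Polynomial.ringHom_ext hι ht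
  have hx : ∀ x : A.path.carrier, x = j (x : A.PathCarrier).1 +
      j (x : A.PathCarrier).2 * A.path.d A.tvar := fun x => by
    have : ∀ y : A.PathCarrier, y = (⟨y.1, 0⟩ : A.PathCarrier) +
        (⟨y.2, 0⟩ : A.PathCarrier) * (⟨0, 1⟩ : A.PathCarrier) := fun y => by
      ext1 <;> simp
    refine (this x).trans ?_
    exact congrArg (fun z : A.path.carrier => j (x : A.PathCarrier).1 +
      j (x : A.PathCarrier).2 * z) (d_tvar (A := A)).symm
  have hp : ∀ p, f (j p) = g (j p) := fun p => congrArg (fun z : _ →+* R => z p) hj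
  ext x
  rw [hx x, map_add, map_add, map_mul, map_mul, hdt, hp, hp]

lemma pathSource_ext {f g : Hom A.path X} (hι : A.ι.comp f = A.ι.comp g)
    (ht : f A.tvar = g A.tvar) : f = g := by
  have h : f.toAlgHom.toRingHom = g.toAlgHom.toRingHom :=
    path_ringHom_ext (fun a => congrArg (fun z : Hom A X => z a) hι) ht (by
      change f _ = g _
      rw [f.map_d, g.map_d, ht])
  exact Hom.ext (AlgHom.ext fun x => congrArg (fun z : _ →+* _ => z x) h)

lemma path_ι_apply (f : Hom A B) (x : A.carrier) : f.path (A.ι x) = B.ι (f x) :=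
  congrArg (fun z : Hom A B.path => z x) (ι_comp_path f)

section Subst

variable (f : Hom A X) {τ : X.carrier} (hτ : X.IsParam τ)

/-- The evaluation of polynomials with coefficients in `A` at an element of `X`. -/
def evalParam : Polynomial A.carrier →+* X.carrier :=
  Polynomial.eval₂RingHom' f.toAlgHom.toRingHom τ fun a =>
    X.mul_comm_of_gr_zero hτ.gr (f a)

lemma evalParam_monomial (i : ℕ) (a : A.carrier) : evalParam f hτ (monomial i a) = f a * τ ^ i :=
  Polynomial.eval₂_monomial _ _

lemma evalParam_mem {P : Submodule k A.carrier} {Q : Submodule k X.carrier}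
    (h : ∀ a ∈ P, ∀ i, f a * τ ^ i ∈ Q) {p : Polynomial A.carrier} (hp : p ∈ polySub P) :
    evalParam f hτ p ∈ Q := by
  have : evalParam f hτ p = p.sum fun i a => f a * τ ^ i := Polynomial.eval₂_eq_sum
  rw [this]
  exact Q.sum_mem fun i _ => h _ (hp i) i

lemma evalParam_polySgn (p : Polynomial A.carrier) :
    evalParam f hτ (A.polySgn p) = X.sgn (evalParam f hτ p) := by
  induction p using Polynomial.induction_on' with
  | add p q hp hq => simp only [map_add, hp, hq]
  | monomial i a =>
    have hs : X.sgnHom τ = τ := by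
      rw [DGA.sgnHom_apply, X.sgn_of_mem hτ.gr, pow_zero, one_smul]
    rw [DGA.polySgn, Polynomial.coe_mapRingHom, map_monomial, evalParam_monomial,
      evalParam_monomial, X.sgn_mul, ← DGA.sgnHom_apply X.toDGA (τ ^ i), map_pow, hs]
    exact congrArg (· * τ ^ i) (DGA.map_sgn f.toAlgHom.toRingHom f.map_gr a)

lemma d_evalParam (p : Polynomial A.carrier) :
    X.d (evalParam f hτ p) = evalParam f hτ (polyMap A.d p) +
      evalParam f hτ (derivative (A.polySgn p)) * X.d τ := by
  induction p using Polynomial.induction_on' with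
  | add p q hp hq => simp only [map_add, hp, hq, add_mul]; abel
  | monomial i a =>
    have h1 : polyMap A.d (monomial i a) = monomial i (A.d a) := by
      ext j; rw [coeff_polyMap, coeff_monomial, coeff_monomial]
      split_ifs <;> simp
    have h2 : f (A.sgn a) = X.sgn (f a) := DGA.map_sgn f.toAlgHom.toRingHom f.map_gr a
    rw [h1, DGA.polySgn, Polynomial.coe_mapRingHom, map_monomial, DGA.sgnHom_apply,
      Polynomial.derivative_monomial, evalParam_monomial, evalParam_monomial, evalParam_monomial,
      X.leibniz', f.map_d, map_mul, map_natCast, h2]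
    cases i with
    | zero => simp [X.d_one]
    | succ i =>
      rw [X.d_pow hτ.gr, Nat.add_sub_cancel]
      simp only [mul_assoc]

variable [CharZero k]

/-- The substitution of `τ` for the parameter `t` of paths. -/
def pathSubst : Hom A.path X where
  toAlgHom :=
    { toFun := fun x => evalParam f hτ (x : A.PathCarrier).1 +
        evalParam f hτ (x : A.PathCarrier).2 * X.d τ
      map_one' := by
        change evalParam f hτ 1 + evalParam f hτ 0 * X.d τ = 1
        rw [map_one, map_zero, zero_mul, add_zero]
      map_zero' := by
        change evalParam f hτ 0 + evalParam f hτ 0 * X.d τ = 0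
        rw [map_zero, zero_mul, add_zero]
      map_add' := fun x y => by
        change evalParam f hτ ((x : A.PathCarrier).1 + (y : A.PathCarrier).1) +
          evalParam f hτ ((x : A.PathCarrier).2 + (y : A.PathCarrier).2) * X.d τ = _
        rw [map_add, map_add, add_mul]; abel
      map_mul' := fun x y => by
        change evalParam f hτ ((x : A.PathCarrier).1 * (y : A.PathCarrier).1) +
          evalParam f hτ ((x : A.PathCarrier).1 * (y : A.PathCarrier).2 +
            (x : A.PathCarrier).2 * A.polySgn (y : A.PathCarrier).1) * X.d τ = _
        have h1 := X.d_mem hτ.gr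
        have h2 := X.mul_of_gr_one h1 (evalParam f hτ (y : A.PathCarrier).1)
        have h3 := X.mul_of_gr_one h1 (evalParam f hτ (y : A.PathCarrier).2)
        simp only [map_mul, map_add, evalParam_polySgn, add_mul, mul_add, mul_assoc, h2]
        rw [← mul_assoc (X.d τ) _ (X.d τ), h3, mul_assoc, X.mul_self_of_gr_one h1]
        simp only [mul_zero, add_zero]
        abel
      commutes' := fun c => by
        have e : algebraMap k A.path.carrier c = A.ι (algebraMap k A.carrier c) :=
          (A.ι.toAlgHom.commutes c).symm
        rw [e]
        change evalParam f hτ (Polynomial.C _) + evalParam f hτ 0 * X.d τ = _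
        rw [map_zero, zero_mul, add_zero]
        exact (Polynomial.eval₂_C _ _).trans (f.toAlgHom.commutes c) }
  map_gr n x hx := by
    have hp : ∀ i, τ ^ i ∈ X.gr 0 := fun i => by
      simpa using SetLike.pow_mem_graded (A := X.gr) i hτ.gr
    refine add_mem (evalParam_mem f hτ (P := A.gr n) (fun a ha i => ?_) hx.1) ?_
    · simpa using DGA.mul_mem_gr (f.map_gr _ _ ha) (hp i)
    · have := evalParam_mem f hτ (P := A.prevGr n) (Q := X.prevGr n) (fun a ha i => by
        simpa using DGA.mul_mem_prevGr' (f.map_prevGr ha) (hp i)) hx.2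
      cases n with
      | zero => rw [X.eq_zero_of_prevGr_zero this, zero_mul]; exact zero_mem _
      | succ n => exact DGA.mul_mem_gr this (X.d_mem hτ.gr)
  map_d x := by
    change evalParam f hτ (polyMap A.d (x : A.PathCarrier).1) +
      evalParam f hτ (derivative (A.polySgn (x : A.PathCarrier).1) +
        polyMap A.d (x : A.PathCarrier).2) * X.d τ =
      X.d (evalParam f hτ (x : A.PathCarrier).1 +
        evalParam f hτ (x : A.PathCarrier).2 * X.d τ)
    rw [map_add X.d, X.leibniz', X.d_d, d_evalParam, d_evalParam, map_add, add_mul, add_mul,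
      mul_assoc _ (X.d τ), X.mul_self_of_gr_one (X.d_mem hτ.gr), mul_zero, mul_zero, add_zero,
      add_zero, add_assoc]
  map_W p x hx := by
    have hp : ∀ i, τ ^ i ∈ X.W 0 := fun i => by
      induction i with
      | zero => rw [pow_zero]; exact X.one_mem_W
      | succ i ih => rw [pow_succ]; simpa using X.mul_mem_W ih hτ.W
    refine add_mem (evalParam_mem f hτ (P := A.W p) (fun a ha i => ?_) hx.1) ?_
    · simpa using X.mul_mem_W (f.map_W _ _ ha) (hp i)
    · have := evalParam_mem f hτ (P := A.W (p + 1)) (Q := X.W (p + 1)) (fun a ha i => by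
        simpa using X.mul_mem_W (f.map_W _ _ ha) (hp i)) hx.2
      simpa using X.mul_mem_W this hτ.d_W

lemma ι_comp_pathSubst : A.ι.comp (pathSubst f hτ) = f := by
  refine Hom.ext (AlgHom.ext fun a => ?_)
  change evalParam f hτ (Polynomial.C a) + evalParam f hτ 0 * X.d τ = _
  rw [map_zero, zero_mul, add_zero]
  exact Polynomial.eval₂_C _ _

lemma pathSubst_tvar : (pathSubst f hτ) A.tvar = τ := by
  change evalParam f hτ (monomial 1 1) + evalParam f hτ 0 * X.d τ = _
  rw [map_zero, zero_mul, add_zero, evalParam_monomial, map_one, one_mul, pow_one]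

end Subst

variable [CharZero k]

variable (A)

/-- The substitution `t ↦ t s`. -/
def contract : Hom A.path A.path.path :=
  pathSubst (A.ι.comp A.path.ι) ((tvar_isParam.map A.path.ι).mul tvar_isParam)

/-- The substitution `t ↦ r + s - r s`. -/
def connect : Hom A.path A.path.path :=
  pathSubst (A.ι.comp A.path.ι) ((tvar_isParam.add (tvar_isParam.map A.path.ι)).sub
    (tvar_isParam.mul (tvar_isParam.map A.path.ι)))

variable {A}

lemma contract_tvar : A.contract A.tvar = A.path.ι A.tvar * A.path.tvar := pathSubst_tvar _ _

lemma connect_tvar : A.connect A.tvar = A.path.tvar + A.path.ι A.tvar -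
    A.path.tvar * A.path.ι A.tvar :=
  pathSubst_tvar _ _

lemma ι_comp_contract : A.ι.comp A.contract = A.ι.comp A.path.ι := ι_comp_pathSubst _ _

lemma ι_comp_connect : A.ι.comp A.connect = A.ι.comp A.path.ι := ι_comp_pathSubst _ _

lemma path_contract (f : Hom A B) : f.path.comp B.contract = A.contract.comp f.path.path := by
  refine pathSource_ext ?_ ?_
  · rw [← Hom.comp_assoc, ← Hom.comp_assoc, ι_comp_path, ι_comp_contract, Hom.comp_assoc,
      ι_comp_contract, Hom.comp_assoc, ι_comp_path f.path, ← Hom.comp_assoc, ← Hom.comp_assoc,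
      ι_comp_path f]
  · rw [Hom.comp_apply, Hom.comp_apply, Hom.path_tvar, contract_tvar, contract_tvar, map_mul,
      Hom.path_tvar, path_ι_apply, Hom.path_tvar]

lemma contract_evalAt_zero : A.contract.comp (A.path.evalAt 0) = (A.evalAt 0).comp A.ι := by
  refine pathSource_ext ?_ ?_
  · rw [← Hom.comp_assoc, ← Hom.comp_assoc, ι_comp_contract, Hom.comp_assoc, ι_comp_evalAt,
      ι_comp_evalAt]; rfl
  · rw [Hom.comp_apply, Hom.comp_apply, contract_tvar, map_mul, evalAt_tvar, evalAt_tvar, map_zero,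
      map_zero, mul_zero, map_zero]

lemma contract_evalAt_one : A.contract.comp (A.path.evalAt 1) = Hom.id A.path := by
  refine pathSource_ext ?_ ?_
  · rw [← Hom.comp_assoc, ι_comp_contract, Hom.comp_assoc, ι_comp_evalAt]
  · rw [Hom.comp_apply, contract_tvar, map_mul, evalAt_tvar, evalAt_ι, map_one, mul_one]; rfl

lemma contract_path_evalAt_zero : A.contract.comp (A.evalAt 0).path = (A.evalAt 0).comp A.ι := by
  refine pathSource_ext ?_ ?_
  · rw [← Hom.comp_assoc, ← Hom.comp_assoc, ι_comp_contract, Hom.comp_assoc, ι_comp_path,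
      ← Hom.comp_assoc]
  · rw [Hom.comp_apply, Hom.comp_apply, contract_tvar, map_mul, path_ι_apply, evalAt_tvar,
      map_zero, map_zero, zero_mul]

lemma contract_path_evalAt_one : A.contract.comp (A.evalAt 1).path = Hom.id A.path := by
  refine pathSource_ext ?_ ?_
  · rw [← Hom.comp_assoc, ι_comp_contract, Hom.comp_assoc, ι_comp_path, ← Hom.comp_assoc,
      ι_comp_evalAt]; rfl
  · rw [Hom.comp_apply, contract_tvar, map_mul, path_ι_apply, evalAt_tvar, Hom.path_tvar,
      map_one, map_one, one_mul]; rfl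

lemma connect_evalAt_zero : A.connect.comp (A.path.evalAt 0) = Hom.id A.path := by
  refine pathSource_ext ?_ ?_
  · rw [← Hom.comp_assoc, ι_comp_connect, Hom.comp_assoc, ι_comp_evalAt]
  · rw [Hom.comp_apply, connect_tvar, map_sub, map_add, map_mul, evalAt_tvar, evalAt_ι, map_zero,
      zero_mul, zero_add, sub_zero]; rfl

lemma connect_evalAt_one : A.connect.comp (A.path.evalAt 1) = (A.evalAt 1).comp A.ι := by
  refine pathSource_ext ?_ ?_
  · rw [← Hom.comp_assoc, ← Hom.comp_assoc, ι_comp_connect, Hom.comp_assoc, ι_comp_evalAt,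
      ι_comp_evalAt]; rfl
  · rw [Hom.comp_apply, Hom.comp_apply, connect_tvar, map_sub, map_add, map_mul, evalAt_tvar,
      evalAt_ι, evalAt_tvar, map_one, map_one, map_one, one_mul, add_sub_cancel_right]

lemma connect_path_evalAt_zero : A.connect.comp (A.evalAt 0).path = Hom.id A.path := by
  refine pathSource_ext ?_ ?_
  · rw [← Hom.comp_assoc, ι_comp_connect, Hom.comp_assoc, ι_comp_path, ← Hom.comp_assoc,
      ι_comp_evalAt]; rfl
  · rw [Hom.comp_apply, connect_tvar, map_sub, map_add, map_mul, path_ι_apply, evalAt_tvar,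
      Hom.path_tvar, map_zero, map_zero, mul_zero, add_zero, sub_zero]; rfl

lemma connect_path_evalAt_one : A.connect.comp (A.evalAt 1).path = (A.evalAt 1).comp A.ι := by
  refine pathSource_ext ?_ ?_
  · rw [← Hom.comp_assoc, ← Hom.comp_assoc, ι_comp_connect, Hom.comp_assoc, ι_comp_path,
      ← Hom.comp_assoc]
  · rw [Hom.comp_apply, Hom.comp_apply, connect_tvar, map_sub, map_add, map_mul, path_ι_apply,
      evalAt_tvar, Hom.path_tvar, map_one, map_one, mul_one, add_sub_cancel_left]

end FDGA

def FFDGA.contract {k : Type} [Field k] [CharZero k] (A : FFDGA.{u} k) :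
    FFDGA.Hom A.path A.path.path where
  toHom := A.toFDGA.contract
  map_F p x hx := by
    have hs : ∀ A : FFDGA.{u} k, A.toFDGA.tvar ∈ A.path.F 0 := fun A =>
      tpow_mem_pathS 1 A.one_mem_F
    have ht : A.path.toFDGA.ι A.toFDGA.tvar * A.path.toFDGA.tvar ∈ A.path.path.F 0 :=
      A.path.path.mul_mem_F (p := 0) (q := 0) (FDGA.C_mem_pathSub (hs A)) (hs A.path)
    have hp : ∀ i, (A.path.toFDGA.ι A.toFDGA.tvar * A.path.toFDGA.tvar) ^ i ∈
        A.path.path.F 0 := fun i => by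
      induction i with
      | zero => rw [pow_zero]; exact A.path.path.one_mem_F
      | succ i ih => rw [pow_succ]; exact A.path.path.mul_mem_F (p := 0) (q := 0) ih ht
    have key : ∀ q ∈ polySub (A.F p), evalParam (A.toFDGA.ι.comp A.toFDGA.path.ι)
        ((tvar_isParam.map A.path.toFDGA.ι).mul tvar_isParam) q ∈ A.path.path.F p :=
      fun q hq => evalParam_mem _ _ (fun a ha i => by
        have := A.path.path.mul_mem_F (FDGA.C_mem_pathSub (FDGA.C_mem_pathSub ha)) (hp i)
        rwa [add_zero] at this) hq
    refine add_mem (key _ hx.1) ?_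
    have := A.path.path.mul_mem_F (key _ hx.2) (A.path.path.d_mem_F ht)
    rwa [add_zero] at this

lemma FDGA.pathBaseChange_contract (A : FDGA.{u} ℚ) :
    A.contract.baseChange.comp (A.path.pathBaseChange.comp A.pathBaseChange.path) =
      A.pathBaseChange.comp A.baseChange.contract := by
  refine FDGA.Hom.ext_baseChange fun x => ?_
  let i : A.path.carrier →+* A.path.baseChange.carrier := A.path.incl
  let F : A.path.carrier →+* A.baseChange.path.path.carrier := (A.contract.baseChange.comp
      (A.path.pathBaseChange.comp A.pathBaseChange.path)).toAlgHom.toRingHom.comp i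
  let G : A.path.carrier →+* A.baseChange.path.path.carrier :=
    (A.pathBaseChange.comp A.baseChange.contract).toAlgHom.toRingHom.comp i
  have hι : ∀ {B : FDGA.{u} ℚ} (b : B.carrier), B.pathBaseChange.toAlgHom
      (B.path.incl (B.ι.toAlgHom b)) = B.baseChange.ι.toAlgHom (B.incl b) := fun {B} b => by
    rw [← B.ι_comp_pathBaseChange]
    exact congrArg B.pathBaseChange.toAlgHom (B.ι.baseChange_incl b).symm
  have ht : ∀ B : FDGA.{u} ℚ, B.pathBaseChange.toAlgHom (B.path.incl B.tvar) =
      B.baseChange.tvar := fun B => by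
    refine (B.pathBaseChangeHom_incl _).trans ?_
    refine DGA.PathCarrier.ext ?_ (Polynomial.map_zero B.incl)
    exact (map_monomial B.incl).trans (congrArg _ (map_one B.incl))
  have hF : ∀ y, F y = A.pathBaseChange.path.toAlgHom (A.path.pathBaseChange.toAlgHom
      (A.path.path.incl (A.contract.toAlgHom y))) := fun y =>
    congrArg (fun z => A.pathBaseChange.path.toAlgHom (A.path.pathBaseChange.toAlgHom z))
      (A.contract.baseChange_incl y)
  have hG : ∀ y, G y = A.baseChange.contract.toAlgHom (A.pathBaseChange.toAlgHom
      (A.path.incl y)) := fun _ => rfl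
  have hpι : ∀ y : A.path.baseChange.carrier,
      A.pathBaseChange.path.toAlgHom (A.path.baseChange.ι.toAlgHom y) =
        A.baseChange.path.ι.toAlgHom (A.pathBaseChange.toAlgHom y) := fun y => path_ι_apply _ y
  have htv : F A.tvar = G A.tvar := by
    rw [hF, hG, ht, contract_tvar, contract_tvar]
    refine (congrArg (fun z => A.pathBaseChange.path.toAlgHom (A.path.pathBaseChange.toAlgHom z))
      (map_mul A.path.path.incl _ _)).trans ?_
    refine (congrArg A.pathBaseChange.path.toAlgHom
      (map_mul A.path.pathBaseChange.toAlgHom _ _)).trans ?_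
    rw [hι, ht, map_mul, Hom.path_tvar]
    exact congrArg (· * A.baseChange.path.tvar)
      ((hpι _).trans (congrArg A.baseChange.path.ι.toAlgHom (ht A)))
  have h : F = G := by
    refine path_ringHom_ext (fun a => ?_) htv ?_
    · rw [hF, hG, hι]
      have e1 : A.contract.toAlgHom (A.ι.toAlgHom a) = A.path.ι.toAlgHom (A.ι.toAlgHom a) :=
        congrArg (fun z : Hom A _ => z.toAlgHom a) ι_comp_contract
      have e2 : A.baseChange.contract.toAlgHom (A.baseChange.ι.toAlgHom (A.incl a)) =
          A.baseChange.path.ι.toAlgHom (A.baseChange.ι.toAlgHom (A.incl a)) :=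
        congrArg (fun z : Hom A.baseChange _ => z.toAlgHom (A.incl a)) ι_comp_contract
      rw [e1, e2, hι]
      exact (hpι _).trans (congrArg A.baseChange.path.ι.toAlgHom (hι a))
    · have hd : ∀ y, F (A.path.d y) = A.baseChange.path.path.d (F y) := fun y =>
        (congrArg (A.contract.baseChange.comp
          (A.path.pathBaseChange.comp A.pathBaseChange.path)).toAlgHom
          (A.path.d_incl y).symm).trans (Hom.map_d _ _)
      have hd' : ∀ y, G (A.path.d y) = A.baseChange.path.path.d (G y) := fun y =>
        (congrArg (A.pathBaseChange.comp A.baseChange.contract).toAlgHom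
          (A.path.d_incl y).symm).trans (Hom.map_d _ _)
      rw [hd, hd', htv]
  exact congrArg (fun z : _ →+* _ => z x) h

/-! ## Ho-equivalences -/

namespace FFam

variable {ℓ : ℕ}

def contract (A : FFam.{u} ℓ) : Hom A.path A.path.path :=
  ⟨A.AQ.contract, fun j => (A.mid j).contract, fun j => (A.odd j).contract, A.AC.contract⟩

lemma contract_ev (A : FFam.{u} ℓ) (s : Src ℓ) :
    (A.contract.ev s).comp ((A.path.evPath s).comp (A.evPath s).path) =
      (A.evPath s).comp (A.ev s).contract := by
  cases s
  · exact A.AQ.pathBaseChange_contract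
  · change (A.mid _).contract.comp ((FDGA.Hom.id _).comp (FDGA.Hom.id _).path) = _
    rw [FDGA.Hom.path_id]; rfl
  · change A.AC.toFDGA.contract.comp ((FDGA.Hom.id _).comp (FDGA.Hom.id A.AC.toFDGA.path).path) = _
    rw [FDGA.Hom.path_id]; rfl

end FFam

namespace FDiag

variable {ℓ : ℕ} (A : FDiag.{u} ℓ)

def contract : A.path ⟶ A.path.path := Hom.mk A.toFFam.contract fun j b => by
    change ((A.evPath (src j b)).comp (A.φ j b).path).comp (A.odd j).contract =
      (A.toFFam.contract.ev (src j b)).comp ((A.toFFam.path.evPath (src j b)).comp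
        ((A.evPath (src j b)).comp (A.φ j b).path).path)
    rw [FDGA.Hom.comp_assoc, path_contract, FDGA.Hom.path_comp,
      ← FDGA.Hom.comp_assoc (A.evPath (src j b)), ← FFam.contract_ev]
    rfl

lemma contract_δ0 : A.contract ≫ A.path.δ0 = A.δ0 ≫ A.ι := by
  have h : ∀ {k : Type} [Field k] [CharZero k] (B : FDGA.{u} k) (c : k), c = 0 →
      B.contract.comp (B.path.evalAt c) = (B.evalAt c).comp B.ι := fun B c hc => by
    subst hc; exact contract_evalAt_zero
  exact Hom.ext_toHom (FFam.Hom.ext (h _ _ rfl) (funext fun _ => h _ _ Rat.cast_zero)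
    (funext fun _ => h _ _ Rat.cast_zero) (FFDGA.Hom.ext
      (congrArg FDGA.Hom.toAlgHom (h A.AC.toFDGA _ Rat.cast_zero))))

lemma contract_δ1 : A.contract ≫ A.path.δ1 = 𝟙 A.path := by
  have h : ∀ {k : Type} [Field k] [CharZero k] (B : FDGA.{u} k) (c : k), c = 1 →
      B.contract.comp (B.path.evalAt c) = FDGA.Hom.id B.path := fun B c hc => by
    subst hc; exact contract_evalAt_one
  exact Hom.ext_toHom (FFam.Hom.ext (h _ _ rfl) (funext fun _ => h _ _ Rat.cast_one)
    (funext fun _ => h _ _ Rat.cast_one) (FFDGA.Hom.ext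
      (congrArg FDGA.Hom.toAlgHom (h A.AC.toFDGA _ Rat.cast_one))))

end FDiag

namespace HoMor

variable {ℓ : ℕ} {A B C : FDiag.{u} ℓ}

lemma ofHom_postcomp (f : A ⟶ B) (g : B ⟶ C) : (ofHom f).postcomp g = ofHom (f ≫ g) :=
  HoMor.ext rfl rfl rfl rfl (funext fun j => funext fun b => by
    change (((A.φ j b).comp ((FDiag.Hom.toHom f).fodd j)).comp (B.odd j).ι).comp
      (FDGA.Hom.path ((FDiag.Hom.toHom g).fodd j)) = _
    rw [FDGA.Hom.comp_assoc, FDGA.ι_comp_path]; rfl)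

lemma ofHom_precomp (f : A ⟶ B) (g : B ⟶ C) : (ofHom g).precomp f = ofHom (f ≫ g) :=
  HoMor.ext rfl rfl rfl rfl (funext fun j => funext fun b => by
    change ((FDiag.Hom.toHom f).ev (src j b)).comp (((B.φ j b).comp
      ((FDiag.Hom.toHom g).fodd j)).comp (C.odd j).ι) = _
    rw [← FDGA.Hom.comp_assoc, ← FDGA.Hom.comp_assoc, ← FDiag.Hom.comm f j b]; rfl)

end HoMor

lemma hoEquiv_ι {ℓ : ℕ} (A : FDiag.{u} ℓ) : hoEquiv ℓ A.ι := by
  refine ⟨HoMor.ofHom A.δ0, ?_, Relation.ReflTransGen.single ⟨HoMor.ofHom A.contract, ?_, ?_⟩⟩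
  · rw [HoMor.ofHom_precomp]
    exact (A.ι_comp_evalAt 0).symm ▸ Relation.ReflTransGen.refl
  · rw [HoMor.ofHom_postcomp, HoMor.ofHom_postcomp, FDiag.contract_δ0]
  · rw [HoMor.ofHom_postcomp, FDiag.contract_δ1]

/-! ## The cylinder of a ho-morphism -/

namespace FDGA

variable {k : Type} [Field k] {D A B : FDGA.{u} k} (f : Hom D A)

def mapPathConst : Hom D (mapPath f) :=
  pullbackLift (Hom.id D) (f.comp A.ι) (by rw [Hom.comp_assoc, ι_comp_evalAt]; rfl)

variable [CharZero k]

def mapPathContract : Hom (mapPath f) (mapPath f).path :=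
  pathLift ((pullbackFst f (A.evalAt 0)).comp D.ι) ((pullbackSnd f (A.evalAt 0)).comp A.contract) (by
    rw [Hom.comp_assoc, ι_comp_path, ← Hom.comp_assoc, pullback_condition, Hom.comp_assoc,
      Hom.comp_assoc, contract_path_evalAt_zero])

lemma mapPathContract_fst : (mapPathContract f).comp (pullbackFst f (A.evalAt 0)).path =
    (pullbackFst f (A.evalAt 0)).comp D.ι := pathLift_fst _ _ _

lemma mapPathContract_end : (mapPathContract f).comp (mapPathEnd f).path =
    pullbackSnd f (A.evalAt 0) := by
  rw [Hom.path_comp, ← Hom.comp_assoc, mapPathContract, pathLift_snd, Hom.comp_assoc,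
    contract_path_evalAt_one]; rfl

lemma mapPathContract_zero {c : k} (hc : c = 0) : (mapPathContract f).comp ((mapPath f).evalAt c) =
    (pullbackFst f (A.evalAt 0)).comp (mapPathConst f) := by
  subst hc
  refine pullbackHom_ext ?_ ?_
  · rw [mapPathContract, pathLift_evalAt_fst, Hom.comp_assoc, ι_comp_evalAt]; rfl
  · rw [mapPathContract, pathLift_evalAt_snd, Hom.comp_assoc, contract_evalAt_zero,
      ← Hom.comp_assoc, ← pullback_condition]; rfl

lemma mapPathContract_one {c : k} (hc : c = 1) :
    (mapPathContract f).comp ((mapPath f).evalAt c) = Hom.id _ := by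
  subst hc
  refine pullbackHom_ext ?_ ?_
  · rw [mapPathContract, pathLift_evalAt_fst, Hom.comp_assoc, ι_comp_evalAt]; rfl
  · rw [mapPathContract, pathLift_evalAt_snd, Hom.comp_assoc, contract_evalAt_one]; rfl

end FDGA

namespace FFam

variable {ℓ : ℕ}

def setOdd (D : FFam.{u} ℓ) (O : Fin (ℓ + 1) → FDGA.{u} ℂ) : FFam.{u} ℓ := ⟨D.AQ, D.mid, O, D.AC⟩

def Hom.setOdd {D B : FFam.{u} ℓ} (f : Hom D B) {O O' : Fin (ℓ + 1) → FDGA.{u} ℂ}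
    (q : ∀ j, FDGA.Hom (O j) (O' j)) : Hom (D.setOdd O) (B.setOdd O') :=
  ⟨f.fQ, f.fmid, q, f.fC⟩

lemma Hom.setOdd_ev_comp {D B : FFam.{u} ℓ} (f : Hom D B) {O O' : Fin (ℓ + 1) → FDGA.{u} ℂ}
    (q : ∀ j, FDGA.Hom (O j) (O' j)) (s : Src ℓ) {Z : FDGA.{u} ℂ} (x : FDGA.Hom (B.ev s) Z) :
    FDGA.Hom.comp (B := B.ev s) ((f.setOdd q).ev s) x = (f.ev s).comp x := by
  cases s <;> rfl

lemma Hom.setOdd_id_comp {D : FFam.{u} ℓ} {O O' : Fin (ℓ + 1) → FDGA.{u} ℂ}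
    (q : ∀ j, FDGA.Hom (O j) (O' j)) (s : Src ℓ) {Z : FDGA.{u} ℂ} (x : FDGA.Hom (D.ev s) Z) :
    FDGA.Hom.comp (B := D.ev s) (((Hom.id D).setOdd q).ev s) x = x := by
  rw [Hom.setOdd_ev_comp, Hom.id_ev]; rfl

end FFam

namespace HoMor

variable {ℓ : ℕ} {D A B : FDiag.{u} ℓ} (f : HoMor D A)

abbrev cylObj (j : Fin (ℓ + 1)) : FDGA.{u} ℂ := mapPath (f.fodd j)

abbrev cylProj (j : Fin (ℓ + 1)) : FDGA.Hom (f.cylObj j) (D.odd j) :=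
  pullbackFst (f.fodd j) ((A.odd j).evalAt 0)

/-- The cylinder of a ho-morphism `f : D ⇝ A`: the diagram with the dga's of `D` at the even
vertices and `D_j ×_{A_j} P(A_j)` at the odd vertices. -/
def cyl : FDiag.{u} ℓ where
  toFFam := D.toFFam.setOdd f.cylObj
  φ j b := FDGA.pullbackLift (D.φ j b) (f.htpy j b) (f.h0 j b).symm

def cylFst : f.cyl ⟶ D :=
  FDiag.Hom.mk ((FFam.Hom.id D.toFFam).setOdd (O := f.cylObj) (O' := D.odd) f.cylProj)
    fun j b => (FFam.Hom.setOdd_id_comp (D := D.toFFam) (O := f.cylObj) (O' := D.odd) f.cylProj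
      (src j b) (D.φ j b)).symm

def cylEnd : f.cyl ⟶ A :=
  FDiag.Hom.mk (f.toHom.setOdd (O := f.cylObj) (O' := A.odd) fun j => FDGA.mapPathEnd (f.fodd j))
    fun j b => (f.h1 j b).trans (f.toHom.setOdd_ev_comp (O := f.cylObj) (O' := A.odd)
      (fun j => FDGA.mapPathEnd (f.fodd j)) (src j b) (A.φ j b)).symm

/-- The ho-morphism from the source to the cylinder. -/
def cylConst : HoMor D f.cyl where
  toHom := (FFam.Hom.id D.toFFam).setOdd (O := D.odd) (O' := f.cylObj)
    fun j => FDGA.mapPathConst (f.fodd j)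
  htpy j b := (f.cyl.φ j b).comp (FDGA.mapPathContract (f.fodd j))
  h0 j b := congrArg (fun z => FDGA.Hom.comp (f.cyl.φ j b) z)
    (FDGA.mapPathContract_zero (f.fodd j) rfl)
  h1 j b := by
    refine (congrArg (fun z => FDGA.Hom.comp (f.cyl.φ j b) z)
      (FDGA.mapPathContract_one (f.fodd j) rfl)).trans ?_
    exact (FFam.Hom.setOdd_id_comp (D := D.toFFam) (O := D.odd) (O' := f.cylObj)
      (fun j => FDGA.mapPathConst (f.fodd j)) (src j b) (f.cyl.φ j b)).symm

lemma cylConst_fst : f.cylConst.postcomp f.cylFst = ofHom (𝟙 D) :=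
  HoMor.ext rfl rfl rfl rfl (funext fun j => funext fun b =>
    congrArg (fun z => FDGA.Hom.comp (f.cyl.φ j b) z) (FDGA.mapPathContract_fst (f.fodd j)))

lemma cylConst_end : f.cylConst.postcomp f.cylEnd = f := HoMor.ext rfl rfl (funext fun j => by
    change ((f.fodd j).comp (A.odd j).ι).comp ((A.odd j).evalAt 1) = _
    rw [FDGA.Hom.comp_assoc, FDGA.ι_comp_evalAt]; rfl) rfl (funext fun j => funext fun b =>
    congrArg (fun z => FDGA.Hom.comp (f.cyl.φ j b) z) (FDGA.mapPathContract_end (f.fodd j)))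

/-- The contraction of the cylinder to its source. -/
def cylContract : HoMor f.cyl f.cyl.path where
  toHom := D.toFFam.ι.setOdd (O := f.cylObj) (O' := fun j => (f.cylObj j).path)
    fun j => mapPathContract (f.fodd j)
  htpy j b := ((f.cyl.φ j b).comp (mapPathContract (f.fodd j))).comp (connect (mapPath (f.fodd j)))
  h0 j b := congrArg (fun z => FDGA.Hom.comp
    ((f.cyl.φ j b).comp (mapPathContract (f.fodd j))) z) connect_evalAt_zero
  h1 j b := by
    refine (congrArg (fun z => FDGA.Hom.comp
      ((f.cyl.φ j b).comp (mapPathContract (f.fodd j))) z) connect_evalAt_one).trans ?_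
    refine (congrArg (fun z => ((f.cyl.φ j b).comp z).comp (FDGA.ι _))
      (mapPathContract_one (f.fodd j) rfl)).trans ?_
    have h : (D.toFFam.ι.setOdd (O := f.cylObj) (O' := fun j => (f.cylObj j).path)
        fun j => mapPathContract (f.fodd j)).ev (src j b) =
      f.cyl.toFFam.ι.ev (src j b) := by cases src j b <;> rfl
    refine Eq.trans ?_ (congrArg (fun z => FDGA.Hom.comp z (f.cyl.path.φ j b)) h).symm
    change (f.cyl.φ j b).comp (FDGA.ι _) = (f.cyl.toFFam.ι.ev (src j b)).comp
      ((f.cyl.toFFam.evPath (src j b)).comp (f.cyl.φ j b).path)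
    rw [← FDGA.Hom.comp_assoc, FFam.ι_ev, FDGA.ι_comp_path]

lemma cylContract_δ0 : f.cylContract.postcomp f.cyl.δ0 = f.cylConst.precomp f.cylFst := by
  have hQ := congrArg FFam.Hom.fQ (D.toFFam.ι_comp_evalAt 0)
  have hm := congrArg FFam.Hom.fmid (D.toFFam.ι_comp_evalAt 0)
  have hC := congrArg FFam.Hom.fC (D.toFFam.ι_comp_evalAt 0)
  refine HoMor.ext hQ hm (funext fun j => mapPathContract_zero _ Rat.cast_zero) hC
    (funext fun j => funext fun b => ?_)
  have e1 : ∀ (Y : FDGA.{u} ℂ) (c : ℂ), c = 0 →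
      Y.connect.comp (Y.evalAt c).path = FDGA.Hom.id _ := fun Y c hc => by
    subst hc; exact connect_path_evalAt_zero
  refine (congrArg (fun z => FDGA.Hom.comp
    ((f.cyl.φ j b).comp (mapPathContract (f.fodd j))) z) (e1 _ _ Rat.cast_zero)).trans ?_
  exact (FFam.Hom.setOdd_id_comp (D := D.toFFam) (O := f.cylObj) (O' := f.cylObj)
    (fun j => (f.cylProj j).comp (mapPathConst (f.fodd j))) (src j b)
    ((f.cyl.φ j b).comp (mapPathContract (f.fodd j)))).symm

lemma cylContract_δ1 : f.cylContract.postcomp f.cyl.δ1 = ofHom (𝟙 f.cyl) := by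
  have hQ := congrArg FFam.Hom.fQ (D.toFFam.ι_comp_evalAt 1)
  have hm := congrArg FFam.Hom.fmid (D.toFFam.ι_comp_evalAt 1)
  have hC := congrArg FFam.Hom.fC (D.toFFam.ι_comp_evalAt 1)
  refine HoMor.ext hQ hm (funext fun j => mapPathContract_one _ Rat.cast_one) hC
    (funext fun j => funext fun b => ?_)
  have e1 : ∀ (Y : FDGA.{u} ℂ) (c : ℂ), c = 1 →
      Y.connect.comp (Y.evalAt c).path = (Y.evalAt 1).comp Y.ι := fun Y c hc => by
    subst hc; exact connect_path_evalAt_one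
  refine (congrArg (fun z => FDGA.Hom.comp
    ((f.cyl.φ j b).comp (mapPathContract (f.fodd j))) z) (e1 _ _ Rat.cast_one)).trans ?_
  exact congrArg (fun z => ((f.cyl.φ j b).comp z).comp (FDGA.ι _))
      (mapPathContract_one (f.fodd j) rfl)

lemma hoEquiv_cylFst : hoEquiv ℓ f.cylFst :=
  ⟨f.cylConst, Relation.ReflTransGen.single ⟨f.cylContract, f.cylContract_δ0, f.cylContract_δ1⟩,
    f.cylConst_fst ▸ Relation.ReflTransGen.refl⟩

def cylMapOdd (h : A ⟶ B) (j : Fin (ℓ + 1)) : FDGA.Hom (f.cylObj j) ((f.postcomp h).cylObj j) :=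
  FDGA.pullbackLift (f.cylProj j) ((FDGA.pullbackSnd (f.fodd j) ((A.odd j).evalAt 0)).comp
    ((FDiag.Hom.toHom h).fodd j).path) (by
      rw [FDGA.Hom.comp_assoc, FDGA.path_comp_evalAt, ← FDGA.Hom.comp_assoc,
        ← FDGA.pullback_condition]; rfl)

def cylMap (h : A ⟶ B) : f.cyl ⟶ (f.postcomp h).cyl :=
  FDiag.Hom.mk ((FFam.Hom.id D.toFFam).setOdd (O := f.cylObj) (O' := (f.postcomp h).cylObj)
    (f.cylMapOdd h)) fun j b => (FFam.Hom.setOdd_id_comp (D := D.toFFam) (O := f.cylObj)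
      (O' := (f.postcomp h).cylObj) (f.cylMapOdd h) (src j b) ((f.postcomp h).cyl.φ j b)).symm

lemma cylMap_fst (h : A ⟶ B) : f.cylMap h ≫ (f.postcomp h).cylFst = f.cylFst := rfl

lemma cylMap_end (h : A ⟶ B) : f.cylMap h ≫ (f.postcomp h).cylEnd = f.cylEnd ≫ h :=
  FDiag.Hom.ext_toHom (FFam.Hom.ext rfl rfl (funext fun j => congrArg
    (fun z => FDGA.Hom.comp (FDGA.pullbackSnd (f.fodd j) ((A.odd j).evalAt 0)) z)
    (FDGA.path_comp_evalAt ((FDiag.Hom.toHom h).fodd j) (1 : ℂ))) rfl)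

/-- The morphism from the source to the cylinder of a morphism of diagrams. -/
def cylSection (h : D ⟶ A) : D ⟶ (ofHom h).cyl :=
  FDiag.Hom.mk ((FFam.Hom.id D.toFFam).setOdd (O := D.odd) (O' := (ofHom h).cylObj)
    fun j => FDGA.mapPathConst ((FDiag.Hom.toHom h).fodd j)) fun j b =>
      (FFam.Hom.setOdd_id_comp (D := D.toFFam) (O := D.odd) (O' := (ofHom h).cylObj)
        (fun j => FDGA.mapPathConst ((FDiag.Hom.toHom h).fodd j)) (src j b)
        ((ofHom h).cyl.φ j b)).symm

lemma cylSection_fst (h : D ⟶ A) : cylSection h ≫ (ofHom h).cylFst = 𝟙 D := rfl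

lemma cylSection_end (h : D ⟶ A) : cylSection h ≫ (ofHom h).cylEnd = h :=
  FDiag.Hom.ext_toHom (FFam.Hom.ext rfl rfl (funext fun j => congrArg
    (fun z => FDGA.Hom.comp ((FDiag.Hom.toHom h).fodd j) z) ((A.odd j).ι_comp_evalAt (1 : ℂ))) rfl)

lemma cyl_isMHD (hD : IsMHD D) : IsMHD f.cyl := by
  have he : ∀ j, (FDGA.pullbackFst (f.fodd j) ((A.odd j).evalAt 0)).IsE1QuasiIso := fun j =>
    (FDGA.fst_isTrivFib_top (f.fodd j) rfl).isDecQuasiIso.isE1QuasiIso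
  refine ⟨fun j b => FDGA.Hom.IsE1QuasiIso.of_comp_right (he j) (hD.e1 j b), hD.biregular,
    hD.finite, hD.connected, hD.strict, ?_⟩
  obtain ⟨ρ, ⟨h1, h2⟩, h3⟩ := hD.pure
  refine ⟨ρ, ⟨h1, fun n p x hx => ?_⟩, h3⟩
  obtain ⟨e, he0, he1, he2⟩ := h2 n p x hx
  refine ⟨e, he0, he1, fun j => (he j n p).1 ?_⟩
  refine (FDGA.Hom.E2_comp _ _ n p _).symm.trans (Eq.trans ?_ (FDGA.Hom.E2_comp _ _ n p _))
  exact he2 j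

end HoMor

/-! ## Ho-equivalences are level-wise quasi-isomorphisms -/

namespace FDGA

variable {k : Type} [Field k] {A B C : FDGA.{u} k}

lemma Hom.H_comp (f : Hom A B) (g : Hom B C) (n : ℕ) : (f.comp g).H n = g.H n ∘ₗ f.H n :=
  linearMap_qext _ rfl

lemma Hom.H_id (A : FDGA.{u} k) (n : ℕ) : (Hom.id A).H n = LinearMap.id := linearMap_qext _ rfl

lemma Hom.isQuasiIso_id (A : FDGA.{u} k) : (Hom.id A).IsQuasiIso := fun n => by
  rw [H_id]; exact Function.bijective_id

lemma Hom.IsQuasiIso.comp {f : Hom A B} {g : Hom B C} (hf : f.IsQuasiIso) (hg : g.IsQuasiIso) :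
    (f.comp g).IsQuasiIso := fun n => by
  rw [Hom.H_comp]; exact (hg n).comp (hf n)

lemma Hom.isQuasiIso_of_H {f : Hom A B} {g : Hom B A}
    (h : ∀ n, (f.comp g).H n = (Hom.id A).H n) (h' : ∀ n, (g.comp f).H n = (Hom.id B).H n) :
    f.IsQuasiIso := fun n => by
  simp only [Hom.H_comp, H_id] at h h'
  exact Function.bijective_iff_has_inverse.2 ⟨g.H n, fun x => LinearMap.congr_fun (h n) x,
    fun x => LinearMap.congr_fun (h' n) x⟩

lemma Hom.isDecQuasiIso_of_homotopy {f : Hom A B} {g : Hom B A} (hfg : f.comp g = Hom.id A)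
    (s : B.carrier →ₗ[k] B.carrier) (hs : ∀ x, B.d (s x) + s (B.d x) =
      x - f (g x)) (hW : ∀ p, ∀ x ∈ B.W p, s x ∈ B.W (p + 1))
    (hgr : ∀ n, ∀ x ∈ B.gr n, s x ∈ B.prevGr n) : f.IsDecQuasiIso ⊤ ⊤ := by
  have hgf : ∀ x, g (f x) = x := fun x =>
    congrArg (fun e : Hom A A => e x) hfg
  refine ⟨fun n p a ha hb => ?_, fun n p b hb => ?_⟩
  · obtain ⟨b, hb1, hb2, hb3⟩ := mem_bd_top.1 hb
    exact mem_bd_top.2 ⟨g b, g.map_W _ _ hb1, g.map_prevGr hb2, by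
      rw [← g.map_d, hb3, hgf]⟩
  · obtain ⟨h1, h2, h3⟩ := mem_cyc_top.1 hb
    refine ⟨g b, mem_cyc_top.2 ⟨g.map_W _ _ h1, g.map_gr _ _ h2, by
      rw [← g.map_d, h3, map_zero]⟩, mem_bd_top.2 ⟨s b, hW _ _ h1, hgr _ _ h2, ?_⟩⟩
    have := hs b
    rwa [h3, map_zero, add_zero] at this

variable [CharZero k]

lemma ι_isDecQuasiIso (A : FDGA.{u} k) : A.ι.IsDecQuasiIso ⊤ ⊤ :=
  Hom.isDecQuasiIso_of_homotopy (A.ι_comp_evalAt 0) A.integ d_integ_add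
    (fun _ _ h => integ_mem_W h) (fun _ _ h => integ_mem_prevGr h)

lemma comp_evalAt_H (h : Hom B A.path) (c e : k) (n : ℕ) :
    (h.comp (A.evalAt c)).H n = (h.comp (A.evalAt e)).H n := by
  have key : ∀ c : k, (A.evalAt c).H n ∘ₗ A.ι.H n = LinearMap.id := fun c => by
    rw [← Hom.H_comp, ι_comp_evalAt, Hom.H_id]
  rw [Hom.H_comp, Hom.H_comp]
  congr 1
  refine LinearMap.ext fun z => ?_
  obtain ⟨y, rfl⟩ := (A.ι_isDecQuasiIso.isQuasiIso n).2 z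
  exact (LinearMap.congr_fun (key c) y).trans (LinearMap.congr_fun (key e) y).symm

end FDGA

section

variable {ℓ : ℕ}

/-- Two families of morphisms induce the same maps on cohomology. -/
def FFam.Hom.SameH {A B : FFam.{u} ℓ} (f g : FFam.Hom A B) : Prop :=
  ((∀ n, f.fQ.H n = g.fQ.H n) ∧ ∀ j n, (f.fmid j).H n = (g.fmid j).H n) ∧
    (∀ j n, (f.fodd j).H n = (g.fodd j).H n) ∧ ∀ n, f.fC.toHom.H n = g.fC.toHom.H n

lemma HoMor.Homotopic.sameH {A B : FDiag.{u} ℓ} {f g : HoMor A B} (h : Homotopic f g) :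
    f.toHom.SameH g.toHom := by
  obtain ⟨h, rfl, rfl⟩ := h
  exact ⟨⟨fun n => comp_evalAt_H _ _ _ n, fun j n => comp_evalAt_H _ _ _ n⟩,
    fun j n => comp_evalAt_H _ _ _ n, fun n => comp_evalAt_H _ _ _ n⟩

lemma HoMor.sameH_of_reflTransGen {A B : FDiag.{u} ℓ} {f g : HoMor A B}
    (h : Relation.ReflTransGen Homotopic f g) : f.toHom.SameH g.toHom := by
  induction h with
  | refl => exact ⟨⟨fun _ => rfl, fun _ _ => rfl⟩, fun _ _ => rfl, fun _ => rfl⟩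
  | tail _ h ih =>
    have h' := h.sameH
    exact ⟨⟨fun n => (ih.1.1 n).trans (h'.1.1 n), fun j n => (ih.1.2 j n).trans (h'.1.2 j n)⟩,
      fun j n => (ih.2.1 j n).trans (h'.2.1 j n), fun n => (ih.2.2 n).trans (h'.2.2 n)⟩

lemma hoEquiv_le_levelwiseQuasiIso : hoEquiv.{u} ℓ ≤ levelwiseQuasiIso ℓ := by
  rintro A B f ⟨g, h, h'⟩
  obtain ⟨⟨h1, h2⟩, h3, h4⟩ := HoMor.sameH_of_reflTransGen h
  obtain ⟨⟨h1', h2'⟩, h3', h4'⟩ := HoMor.sameH_of_reflTransGen h'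
  exact ⟨FDGA.Hom.isQuasiIso_of_H h1 h1', fun j => FDGA.Hom.isQuasiIso_of_H (h2 j) (h2' j),
    fun j => FDGA.Hom.isQuasiIso_of_H (h3 j) (h3' j),
    FDGA.Hom.isQuasiIso_of_H (g := g.fC.toHom) h4 h4'⟩

instance : (levelwiseQuasiIso.{u} ℓ).IsMultiplicative where
  id_mem _ := ⟨FDGA.Hom.isQuasiIso_id _, fun _ => FDGA.Hom.isQuasiIso_id _,
    fun _ => FDGA.Hom.isQuasiIso_id _, FDGA.Hom.isQuasiIso_id _⟩
  comp_mem _ _ hf hg := ⟨hf.1.comp hg.1, fun j => (hf.2.1 j).comp (hg.2.1 j),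
    fun j => (hf.2.2.1 j).comp (hg.2.2.1 j), hf.2.2.2.comp hg.2.2.2⟩

lemma MHD.H_le_Q : MHD.H.{u} ℓ ≤ MHD.Q ℓ := fun _ _ _ hf =>
  (MorphismProperty.multiplicativeClosure_le_iff _ _).2 hoEquiv_le_levelwiseQuasiIso _ hf

end

/-! ## Direct sums of pure Hodge structures -/

section Decomp

variable {k : Type*} [Field k] {J : Type*} {X X' : Type*} [AddCommGroup X] [Module k X]
  [AddCommGroup X'] [Module k X'] {Y Y' : J → Type*} [∀ j, AddCommGroup (Y j)]
  [∀ j, Module k (Y j)] [∀ j, AddCommGroup (Y' j)] [∀ j, Module k (Y' j)]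

/-- The space `X` is the direct sum of the `Y j`, with inclusions `m j` and projections `c j`. -/
structure IsDecomp (m : ∀ j, Y j →ₗ[k] X) (c : ∀ j, X →ₗ[k] Y j) : Prop where
  same : ∀ j, c j ∘ₗ m j = LinearMap.id
  ne : ∀ i j, i ≠ j → c i ∘ₗ m j = 0
  top : ⊤ ≤ ⨆ j, range (m j)

namespace IsDecomp

variable {m : ∀ j, Y j →ₗ[k] X} {c : ∀ j, X →ₗ[k] Y j} {m' : ∀ j, Y' j →ₗ[k] X'}
  {c' : ∀ j, X' →ₗ[k] Y' j} (h : IsDecomp m c) (h' : IsDecomp m' c')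
include h

lemma exists_sum (x : X) : ∃ s : Finset J, ∀ t, s ⊆ t → x = ∑ j ∈ t, m j (c j x) := by
  classical
  refine Submodule.iSup_induction _ (motive := fun x => ∃ s : Finset J, ∀ t, s ⊆ t →
    x = ∑ j ∈ t, m j (c j x)) (h.top trivial) ?_ ⟨∅, fun t _ => by simp⟩ ?_
  · rintro j _ ⟨y, rfl⟩
    refine ⟨{j}, fun t ht => ?_⟩
    rw [Finset.sum_eq_single_of_mem j (ht (Finset.mem_singleton_self j)) fun i _ hi => ?_]
    · exact congrArg (m j) (LinearMap.congr_fun (h.same j) y).symm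
    · exact (congrArg (m i) (LinearMap.congr_fun (h.ne i j hi) y)).trans (map_zero _)
  · rintro x y ⟨s, hs⟩ ⟨t, ht⟩
    refine ⟨s ∪ t, fun r hr => ?_⟩
    simp only [map_add, Finset.sum_add_distrib]
    rw [← hs r (Finset.union_subset_left hr), ← ht r (Finset.union_subset_right hr)]

lemma mem_of_forall {S : Submodule k X} {x : X} (hx : ∀ j, m j (c j x) ∈ S) : x ∈ S := by
  obtain ⟨s, hs⟩ := h.exists_sum x
  rw [hs s subset_rfl]
  exact S.sum_mem fun j _ => hx j

lemma ext {x y : X} (hxy : ∀ j, c j x = c j y) : x = y := by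
  refine sub_eq_zero.1 ((mem_bot k).1 (h.mem_of_forall fun j => ?_))
  rw [map_sub, hxy, sub_self, map_zero]
  exact zero_mem _

lemma bijective [DecidableEq J] : Bijective (DirectSum.toModule k J X m) := by
  have hc : ∀ j x, c j (DirectSum.toModule k J X m x) = x j := fun j x => by
    refine LinearMap.congr_fun (f := c j ∘ₗ DirectSum.toModule k J X m)
      (g := DirectSum.component k J Y j) (DirectSum.linearMap_ext k fun i => LinearMap.ext
        fun y => ?_) x
    simp only [LinearMap.comp_apply, DirectSum.toModule_lof]
    by_cases hij : i = j
    · subst hij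
      rw [DirectSum.component.lof_self]
      exact LinearMap.congr_fun (h.same i) y
    · rw [DirectSum.component.of, dif_neg hij]
      exact LinearMap.congr_fun (h.ne j i (Ne.symm hij)) y
  refine ⟨(injective_iff_map_eq_zero _).2 fun x hx => DFinsupp.ext fun j => ?_, fun x => ?_⟩
  · rw [← hc, hx, map_zero]; rfl
  · refine h.mem_of_forall (S := range _) fun j =>
      ⟨DirectSum.lof k J Y j (c j x), DirectSum.toModule_lof _ _ _⟩

include h' in
lemma exists_equiv [DecidableEq J] (e : ∀ j, Y j ≃ₗ[k] Y' j) :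
    ∃ r : X ≃ₗ[k] X', ∀ j x, c' j (r x) = e j (c j x) := by
  let e1 := LinearEquiv.ofBijective _ h.bijective
  let e2 := LinearEquiv.ofBijective _ h'.bijective
  refine ⟨e1.symm ≪≫ₗ DFinsupp.mapRange.linearEquiv e ≪≫ₗ e2, fun j x => ?_⟩
  obtain ⟨z, rfl⟩ := e1.surjective x
  change c' j (e2 (DFinsupp.mapRange.linearEquiv e (e1.symm (e1 z)))) = e j (c j (e1 z))
  rw [LinearEquiv.symm_apply_apply]
  induction z using DirectSum.induction_on with
  | zero => simp only [map_zero]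
  | add x y hx hy => simp only [map_add, hx, hy]
  | of i y =>
    have h1 : e1 (DirectSum.of Y i y) = m i y := DirectSum.toModule_lof _ _ _
    have h2 : DFinsupp.mapRange.linearEquiv e (DirectSum.of Y i y) = DirectSum.of Y' i (e i y) :=
      DFinsupp.mapRange_single (hf := fun i => map_zero (e i))
    have h3 : e2 (DirectSum.of Y' i (e i y)) = m' i (e i y) := DirectSum.toModule_lof _ _ _
    rw [h1, h2, h3]
    by_cases hij : j = i
    · subst hij
      exact (LinearMap.congr_fun (h'.same j) _).trans
        (congrArg (e j) (LinearMap.congr_fun (h.same j) y).symm)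
    · exact (LinearMap.congr_fun (h'.ne j i hij) _).trans
        ((congrArg (e j) (LinearMap.congr_fun (h.ne j i hij) y)).trans (map_zero _)).symm

end IsDecomp

end Decomp

namespace IsDecomp

variable {J : Type*} {X : Type*} [AddCommGroup X] [Module ℚ X] {Y : J → Type*}
  [∀ j, AddCommGroup (Y j)] [∀ j, Module ℚ (Y j)] {m : ∀ j, Y j →ₗ[ℚ] X}
  {c : ∀ j, X →ₗ[ℚ] Y j} (h : IsDecomp m c)
include h

lemma baseChange : IsDecomp (fun j => (m j).baseChange ℂ) (fun j => (c j).baseChange ℂ) where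
  same j := by rw [← baseChange_comp, h.same, LinearMap.baseChange_id]
  ne i j hij := by rw [← baseChange_comp, h.ne i j hij, LinearMap.baseChange_zero]
  top := by
    intro z _
    induction z using TensorProduct.induction_on with
    | zero => exact zero_mem _
    | add x y hx hy => exact add_mem (hx trivial) (hy trivial)
    | tmul a x =>
      refine h.mem_of_forall (S := ((⨆ j, range ((m j).baseChange ℂ)).restrictScalars
        ℚ).comap (TensorProduct.mk ℚ ℂ X a)) fun j => ?_
      exact mem_iSup_of_mem (p := fun j => range ((m j).baseChange ℂ)) j ⟨a ⊗ₜ c j x, rfl⟩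

lemma isPureHS {w : ℤ} {G : ∀ j, ℤ → Submodule ℂ (ℂ ⊗[ℚ] Y j)} (hG : ∀ j, IsPureHS (Y j) w (G j))
    (htop : ∃ p, ∀ j, G j p = ⊤) (hbot : ∃ p, ∀ j, G j p = ⊥)
    {F : ℤ → Submodule ℂ (ℂ ⊗[ℚ] X)} (hF : ∀ q z, z ∈ F q ↔ ∀ j, (c j).baseChange ℂ z ∈ G j q) :
    IsPureHS X w F where
  anti p q hpq z hz := (hF p z).2 fun j => (hG j).anti hpq ((hF q z).1 hz j)
  exists_top := by
    obtain ⟨p, hp⟩ := htop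
    exact ⟨p, top_le_iff.1 fun z _ => (hF p z).2 fun j => hp j ▸ Submodule.mem_top⟩
  exists_bot := by
    obtain ⟨p, hp⟩ := hbot
    refine ⟨p, (Submodule.eq_bot_iff _).2 fun z hz => h.baseChange.ext fun j => ?_⟩
    have := (hF p z).1 hz j
    rw [hp, mem_bot] at this
    rw [this, map_zero]
  compl p := by
    have hm : ∀ q j y, y ∈ G j q → (m j).baseChange ℂ y ∈ F q := fun q j y hy => by
      refine (hF q _).2 fun i => ?_
      by_cases hij : i = j
      · subst hij
        exact (LinearMap.congr_fun (h.baseChange.same i) y).symm ▸ hy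
      · exact (LinearMap.congr_fun (h.baseChange.ne i j hij) y).symm ▸ zero_mem _
    refine ⟨Submodule.disjoint_def.2 fun z hz hz' => h.baseChange.ext fun j => ?_,
      codisjoint_iff_le_sup.2 fun z _ => h.baseChange.mem_of_forall fun j => ?_⟩
    · rw [map_zero]
      refine Submodule.disjoint_def.1 ((hG j).compl p).disjoint _ ((hF p z).1 hz j) ?_
      rw [mem_conjSub, conjT_baseChange]
      exact (hF _ _).1 hz' j
    · obtain ⟨a, ha, b, hb, hab⟩ := mem_sup.1
        (((hG j).compl p).sup_eq_top ▸ Submodule.mem_top : (c j).baseChange ℂ z ∈ _)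
      rw [← hab, map_add]
      refine add_mem_sup (hm p j a ha) ?_
      rw [mem_conjSub, conjT_baseChange]
      exact hm _ j _ hb

end IsDecomp

lemma IsPureHS.of_subsingleton {V : Type*} [AddCommGroup V] [Module ℚ V] [Subsingleton V] (w : ℤ)
    (F : ℤ → Submodule ℂ (ℂ ⊗[ℚ] V)) : IsPureHS V w F := by
  have : ∀ P Q : Submodule ℂ (ℂ ⊗[ℚ] V), P = Q := fun P Q => Subsingleton.elim P Q
  exact ⟨fun _ _ _ => (this _ _).le, ⟨0, this _ _⟩, ⟨0, this _ _⟩, fun _ =>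
    ⟨disjoint_iff.2 (this _ _), codisjoint_iff.2 (this _ _)⟩⟩

/-! ## The spectral sequence of the path object -/

namespace FDGA

variable {k : Type} [Field k] (A : FDGA.{u} k)

/-- The monomials `a t^i` and `a t^i dt`. -/
def pathMon : Bool → ℕ → A.carrier →ₗ[k] A.path.carrier
  | false, i => A.tpow i
  | true, i =>
    { toFun := fun a => (⟨0, monomial i a⟩ : A.PathCarrier)
      map_add' := fun a b => DGA.PathCarrier.ext (add_zero 0).symm (map_add _ a b)
      map_smul' := fun r a => DGA.PathCarrier.ext (smul_zero r).symm
        (Polynomial.smul_monomial r i a).symm }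

/-- The coefficients of `t^i` and `t^i dt`. -/
def pathCoeff : Bool → ℕ → A.path.carrier →ₗ[k] A.carrier
  | false, i =>
    { toFun := fun x => (x : A.PathCarrier).1.coeff i
      map_add' := fun _ _ => coeff_add _ _ i
      map_smul' := fun r _ => Polynomial.coeff_smul r _ i }
  | true, i =>
    { toFun := fun x => (x : A.PathCarrier).2.coeff i
      map_add' := fun _ _ => coeff_add _ _ i
      map_smul' := fun r _ => Polynomial.coeff_smul r _ i }

def pathWt (p : ℤ) : Bool → ℤ
  | false => p
  | true => p + 1

def pathCoeffGr (n : ℕ) : Bool → Submodule k A.carrier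
  | false => A.gr n
  | true => A.prevGr n

variable {A}

lemma pathWt_sub (p : ℤ) (b : Bool) : pathWt (p - 1) b = pathWt p b - 1 := by
  cases b
  · rfl
  · change p - 1 + 1 = p + 1 - 1; omega

lemma pathCoeff_mon_same (b : Bool) (i : ℕ) (a : A.carrier) :
    A.pathCoeff b i (A.pathMon b i a) = a := by
  cases b <;> exact Polynomial.coeff_monomial_same i a

lemma pathCoeff_mon_ne {b b' : Bool} {i i' : ℕ} (h : (b, i) ≠ (b', i')) (a : A.carrier) :
    A.pathCoeff b i (A.pathMon b' i' a) = 0 := by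
  cases b <;> cases b'
  · exact Polynomial.coeff_monomial_of_ne _ fun e => h (by rw [e])
  · exact Polynomial.coeff_zero i
  · exact Polynomial.coeff_zero i
  · exact Polynomial.coeff_monomial_of_ne _ fun e => h (by rw [e])

lemma pathMon_mem {S : Bool → Submodule k A.carrier} {b : Bool} {i : ℕ} {a : A.carrier}
    (ha : a ∈ S b) (b' : Bool) (i' : ℕ) : A.pathCoeff b' i' (A.pathMon b i a) ∈ S b' := by
  by_cases h : (b', i') = (b, i)
  · obtain ⟨rfl, rfl⟩ := Prod.mk.inj h
    rwa [pathCoeff_mon_same]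
  · rw [pathCoeff_mon_ne h]; exact zero_mem _

lemma pathCoeff_ext {x y : A.path.carrier} (h : ∀ b i, A.pathCoeff b i x = A.pathCoeff b i y) :
    x = y := path_ext (A := A) (h false) (h true)

lemma path_mem_of_coeff {S : Submodule k A.path.carrier} {x : A.path.carrier}
    (h : ∀ b i, A.pathMon b i (A.pathCoeff b i x) ∈ S) : x ∈ S := by
  have e : x = ∑ i ∈ (x : A.PathCarrier).1.support, A.pathMon false i
      (A.pathCoeff false i x) + ∑ i ∈ (x : A.PathCarrier).2.support, A.pathMon true i
      (A.pathCoeff true i x) := by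
    have h0 : ∀ b i, i ∉ (bif b then (x : A.PathCarrier).2 else
        (x : A.PathCarrier).1).support → A.pathCoeff b i x = 0 := fun b i hi => by
      cases b <;> exact Polynomial.notMem_support_iff.1 hi
    refine pathCoeff_ext fun b i => ?_
    rw [map_add, map_sum, map_sum]
    cases b
    · rw [Finset.sum_eq_zero (s := (x : A.PathCarrier).2.support)
        fun j _ => pathCoeff_mon_ne (by simp) _, add_zero,
        Finset.sum_eq_single i (fun j _ hj => pathCoeff_mon_ne (by simpa using hj.symm) _)
        fun hi => by rw [h0 false i hi, map_zero, map_zero], pathCoeff_mon_same]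
    · rw [Finset.sum_eq_zero (s := (x : A.PathCarrier).1.support)
        fun j _ => pathCoeff_mon_ne (by simp) _, zero_add,
        Finset.sum_eq_single i (fun j _ hj => pathCoeff_mon_ne (by simpa using hj.symm) _)
        fun hi => by rw [h0 true i hi, map_zero, map_zero], pathCoeff_mon_same]
  rw [e]
  exact S.add_mem (S.sum_mem fun i _ => h _ i) (S.sum_mem fun i _ => h _ i)

lemma mem_path_W_iff {p : ℤ} {x : A.path.carrier} :
    x ∈ A.path.W p ↔ ∀ b i, A.pathCoeff b i x ∈ A.W (pathWt p b) :=
  ⟨fun h b i => by cases b; exacts [h.1 i, h.2 i], fun h => ⟨h false, h true⟩⟩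

lemma mem_path_gr_iff {n : ℕ} {x : A.path.carrier} :
    x ∈ A.path.gr n ↔ ∀ b i, A.pathCoeff b i x ∈ A.pathCoeffGr n b :=
  ⟨fun h b i => by cases b; exacts [h.1 i, h.2 i], fun h => ⟨h false, h true⟩⟩

lemma pathMon_mem_W {p : ℤ} {b : Bool} (i : ℕ) {a : A.carrier} (ha : a ∈ A.W (pathWt p b)) :
    A.pathMon b i a ∈ A.path.W p :=
  mem_path_W_iff.2 (pathMon_mem (S := fun b => A.W (pathWt p b)) ha)

lemma pathCoeff_d_false (i : ℕ) (x : A.path.carrier) :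
    A.pathCoeff false i (A.path.d x) = A.d (A.pathCoeff false i x) := coeff_polyMap _ _ _

lemma pathCoeff_d_true (i : ℕ) (x : A.path.carrier) : A.pathCoeff true i (A.path.d x) =
      (i + 1) • A.sgn (A.pathCoeff false (i + 1) x) + A.d (A.pathCoeff true i x) := by
  change (derivative (A.polySgn (x : A.PathCarrier).1) +
    polyMap A.d (x : A.PathCarrier).2).coeff i = _
  rw [coeff_add, coeff_polyMap, Polynomial.coeff_derivative, DGA.coeff_polySgn,
    ← Nat.cast_succ, ← nsmul_eq_mul']
  rfl

lemma pathCoeff_d_sub {p : ℤ} {x : A.path.carrier} (hx : x ∈ A.path.W p) (b : Bool) (i : ℕ) :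
    A.pathCoeff b i (A.path.d x) - A.d (A.pathCoeff b i x) ∈ A.W (pathWt p b - 1) := by
  cases b
  · rw [pathCoeff_d_false, sub_self]; exact zero_mem _
  · rw [pathCoeff_d_true, add_sub_cancel_right]
    change _ ∈ A.W (p + 1 - 1)
    rw [add_sub_cancel_right]
    exact nsmul_mem (A.sgn_mem (fun _ h n => A.proj_mem_W h n) (hx.1 _)) _

lemma d_pathMon_sub {p : ℤ} {b : Bool} (i : ℕ) {a : A.carrier} (ha : a ∈ A.W (pathWt p b)) :
    A.path.d (A.pathMon b i a) - A.pathMon b i (A.d a) ∈ A.path.W (p - 1) := by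
  refine mem_path_W_iff.2 fun b' i' => ?_
  have h := pathCoeff_d_sub (pathMon_mem_W i ha) b' i'
  rw [pathWt_sub]
  by_cases e : (b', i') = (b, i)
  · obtain ⟨rfl, rfl⟩ := Prod.mk.inj e
    rw [pathCoeff_mon_same] at h
    rwa [map_sub, pathCoeff_mon_same]
  · rwa [map_sub, pathCoeff_mon_ne e, ← map_zero A.d, ← pathCoeff_mon_ne e a]

variable (A)

/-- The coefficients of the elements of `Z_1` of the path object. -/
def pathZ1 (n : ℕ) (p : ℤ) (b : Bool) : Submodule k A.carrier :=
  A.W (pathWt p b) ⊓ A.pathCoeffGr n b ⊓ (A.W (pathWt p b - 1)).comap A.d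

abbrev pathE1 (n : ℕ) (p : ℤ) (b : Bool) : Type u := SubQuot (A.pathZ1 n p b) (A.B1 (pathWt p b))

variable {A}

lemma mem_path_Z1_iff {n : ℕ} {p : ℤ} {x : A.path.carrier} :
    x ∈ A.path.Z1 n p ↔ ∀ b i, A.pathCoeff b i x ∈ A.pathZ1 n p b := by
  constructor
  · rintro ⟨⟨h1, h2⟩, h3⟩ b i
    refine ⟨⟨mem_path_W_iff.1 h1 b i, mem_path_gr_iff.1 h2 b i⟩, ?_⟩
    have h4 := mem_path_W_iff.1 h3 b i
    rw [pathWt_sub] at h4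
    exact (Submodule.sub_mem_iff_right _ h4).1 (pathCoeff_d_sub h1 b i)
  · intro h
    have h1 := mem_path_W_iff.2 fun b i => (h b i).1.1
    refine ⟨⟨h1, mem_path_gr_iff.2 fun b i => (h b i).1.2⟩, mem_path_W_iff.2 fun b i => ?_⟩
    rw [pathWt_sub]
    have h2 : A.d (A.pathCoeff b i x) ∈ A.W (pathWt p b - 1) := (h b i).2
    exact (Submodule.sub_mem_iff_left _ h2).1 (pathCoeff_d_sub h1 b i)

lemma pathCoeff_mem_B1 {p : ℤ} {x : A.path.carrier} (hx : x ∈ A.path.B1 p) (b : Bool) (i : ℕ) :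
    A.pathCoeff b i x ∈ A.B1 (pathWt p b) := by
  obtain ⟨u, hu, _, ⟨v, hv, rfl⟩, rfl⟩ := mem_sup.1 hx
  have h1 := mem_path_W_iff.1 hu b i
  rw [pathWt_sub] at h1
  rw [map_add, ← sub_add_cancel (A.pathCoeff b i (A.path.d v)) (A.d (A.pathCoeff b i v)),
    ← add_assoc]
  exact add_mem_sup (add_mem h1 (pathCoeff_d_sub hv b i)) ⟨_, mem_path_W_iff.1 hv b i, rfl⟩

lemma pathMon_mem_B1 {p : ℤ} {b : Bool} {a : A.carrier} (ha : a ∈ A.B1 (pathWt p b)) (i : ℕ) :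
    A.pathMon b i a ∈ A.path.B1 p := by
  obtain ⟨u, hu, _, ⟨v, hv, rfl⟩, rfl⟩ := mem_sup.1 ha
  rw [← pathWt_sub] at hu
  rw [map_add, ← sub_sub_cancel (A.path.d (A.pathMon b i v)) (A.pathMon b i (A.d v)),
    sub_eq_neg_add, ← add_assoc]
  exact add_mem_sup (add_mem (pathMon_mem_W i hu)
    (neg_mem (d_pathMon_sub i hv))) ⟨_, pathMon_mem_W i hv, rfl⟩

variable (A)

/-- The inclusion in `E_1` of the path object of the classes of monomials. -/
def E1Mon (n : ℕ) (p : ℤ) (j : Bool × ℕ) : A.pathE1 n p j.1 →ₗ[k] A.path.E1 n p :=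
  SubQuot.map (A.pathMon j.1 j.2) (fun _ hx => mem_path_Z1_iff.2 (pathMon_mem hx))
    fun _ hx => pathMon_mem_B1 hx j.2

/-- The coefficients of a class in `E_1` of the path object. -/
def E1Coeff (n : ℕ) (p : ℤ) (j : Bool × ℕ) : A.path.E1 n p →ₗ[k] A.pathE1 n p j.1 :=
  SubQuot.map (A.pathCoeff j.1 j.2) (fun _ hx => mem_path_Z1_iff.1 hx j.1 j.2)
    fun _ hx => pathCoeff_mem_B1 hx j.1 j.2

lemma E1_isDecomp (n : ℕ) (p : ℤ) : IsDecomp (k := k)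
    (Y := fun j : Bool × ℕ => A.pathE1 n p j.1) (A.E1Mon n p) (A.E1Coeff n p) where
  same j := linearMap_qext _ (LinearMap.ext fun a => congrArg Submodule.Quotient.mk
    (Subtype.ext (pathCoeff_mon_same j.1 j.2 a.1)))
  ne i j hij := linearMap_qext _ (LinearMap.ext fun a => congrArg Submodule.Quotient.mk
    (Subtype.ext (pathCoeff_mon_ne hij a.1)))
  top := by
    intro z _
    obtain ⟨x, rfl⟩ := mk_surjective _ z
    let S := ((⨆ j, range (A.E1Mon n p j)).comap (A.path.toE1 n p)).map (A.path.Z1 n p).subtype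
    have hx : x.1 ∈ S := path_mem_of_coeff fun b i =>
      ⟨⟨_, mem_path_Z1_iff.2 (pathMon_mem (mem_path_Z1_iff.1 x.2 b i))⟩,
        mem_iSup_of_mem (b, i) ⟨Submodule.Quotient.mk ⟨_, mem_path_Z1_iff.1 x.2 b i⟩, rfl⟩, rfl⟩
    obtain ⟨y, hy, e⟩ := hx
    exact (Subtype.ext e : y = x) ▸ hy

/-- The differential on the coefficients of `E_1` of the path object. -/
def pathE1d (n : ℕ) {p p' : ℤ} (hp : p' + 1 = p) (b : Bool) :
    A.pathE1 n p b →ₗ[k] A.pathE1 (n + 1) p' b :=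
  SubQuot.map A.d (by
      obtain rfl : p' = p - 1 := by omega
      intro x (hx : x ∈ A.pathZ1 n p b)
      change A.d x ∈ A.pathZ1 (n + 1) (p - 1) b
      refine ⟨⟨(pathWt_sub p b).symm ▸ hx.2, ?_⟩, ?_⟩
      · cases b
        · exact A.d_mem hx.1.2
        · exact DGA.d_mem_prev A.toDGA hx.1.2
      · change A.d (A.d x) ∈ A.W _
        rw [A.d_d]; exact zero_mem _)
    (by
      obtain rfl : p' = p - 1 := by omega
      intro x (hx : x ∈ A.B1 (pathWt p b))
      change A.d x ∈ A.B1 (pathWt (p - 1) b)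
      obtain ⟨y, hy, z, ⟨w, -, rfl⟩, rfl⟩ := mem_sup.1 hx
      rw [map_add, A.d_d, add_zero]
      exact mem_sup_right ⟨y, (pathWt_sub p b).symm ▸ hy, rfl⟩)

/-- The term of the differential of `E_1` of the path object that comes from `d(t^{i+1})`. -/
def pathE1Shift (n : ℕ) {p p' : ℤ} (hp : p' + 1 = p) :
    A.pathE1 n p false →ₗ[k] A.pathE1 (n + 1) p' true :=
  SubQuot.map LinearMap.id (by subst hp; exact fun x hx => hx) (by subst hp; exact fun x hx => hx)

lemma E1Coeff_d1_false (n : ℕ) {p p' : ℤ} (hp : p' + 1 = p) (i : ℕ) :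
    A.E1Coeff (n + 1) p' (false, i) ∘ₗ A.path.d1 rfl hp =
      A.pathE1d n hp false ∘ₗ A.E1Coeff n p (false, i) :=
  linearMap_qext _ (LinearMap.ext fun x => congrArg Submodule.Quotient.mk
    (Subtype.ext (pathCoeff_d_false i x.1)))

lemma E1Coeff_d1_true (n : ℕ) {p p' : ℤ} (hp : p' + 1 = p) (i : ℕ) :
    A.E1Coeff (n + 1) p' (true, i) ∘ₗ A.path.d1 rfl hp =
      ((-1) ^ n * (i + 1) : ℤ) • (A.pathE1Shift n hp ∘ₗ A.E1Coeff n p (false, i + 1)) +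
        A.pathE1d n hp true ∘ₗ A.E1Coeff n p (true, i) :=
  linearMap_qext _ (LinearMap.ext fun x => congrArg Submodule.Quotient.mk (Subtype.ext (by
      refine (pathCoeff_d_true i x.1).trans ?_
      have h : A.pathCoeff false (i + 1) x.1 ∈ A.gr n := (mem_path_Z1_iff.1 x.2 false (i + 1)).1.2
      rw [A.sgn_of_mem h]
      change _ = ((-1) ^ n * (i + 1) : ℤ) • A.pathCoeff false (i + 1) x.1 + _
      congr 1
      rcases Nat.even_or_odd n with hn | hn
      · rw [hn.neg_one_pow, hn.neg_one_pow, one_smul, one_mul, ← Nat.cast_smul_eq_nsmul ℤ]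
        push_cast; rfl
      · rw [hn.neg_one_pow, hn.neg_one_pow, ← Nat.cast_smul_eq_nsmul ℤ, neg_one_smul, smul_neg,
          ← neg_smul]
        push_cast; congr 1; ring)))

instance (p : ℤ) : Subsingleton (A.pathE1 0 p true) := by
  have : Subsingleton (A.pathZ1 0 p true) := ⟨fun x y => Subtype.ext
    ((A.eq_zero_of_prevGr_zero x.2.1.2).trans (A.eq_zero_of_prevGr_zero y.2.1.2).symm)⟩
  exact (Submodule.mkQ_surjective _).subsingleton

end FDGA

/-! ## The path object of a mixed Hodge diagram -/

namespace FDGA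

lemma Hom.E2_id {k : Type} [Field k] (A : FDGA.{u} k) (n : ℕ) (p : ℤ) :
    (Hom.id A).E2 n p = LinearMap.id :=
  linearMap_qext _ (LinearMap.ext fun c => congrArg Submodule.Quotient.mk
    (Subtype.ext (LinearMap.congr_fun (linearMap_qext _ rfl :
      (Hom.id A).E1 n p = LinearMap.id) c.1)))

lemma Hom.isE1QuasiIso_id {k : Type} [Field k] (A : FDGA.{u} k) : (Hom.id A).IsE1QuasiIso :=
  fun n p => by rw [Hom.E2_id]; exact Function.bijective_id

lemma E1Mon_eq_ι {k : Type} [Field k] (A : FDGA.{u} k) (n : ℕ) (p : ℤ) :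
    A.E1Mon n p (false, 0) = A.ι.E1 n p := linearMap_qext _ rfl

lemma ι_baseChange_isDecQuasiIso (A : FDGA.{u} ℚ) : A.ι.baseChange.IsDecQuasiIso ⊤ ⊤ := by
  refine Hom.isDecQuasiIso_of_homotopy (g := (A.evalAt 0).baseChange)
    (by rw [← Hom.baseChange_comp, ι_comp_evalAt, Hom.baseChange_id])
    (A.integ.baseChange ℂ) (fun x => ?_) (fun p x hx => ?_) (fun n x hx => ?_)
  · refine DGA.baseChange_ext (A := A.path.toDGA)
      (f := A.path.d.baseChange ℂ ∘ₗ A.integ.baseChange ℂ +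
        A.integ.baseChange ℂ ∘ₗ A.path.d.baseChange ℂ)
      (g := LinearMap.id - A.ι.baseChange.lin ∘ₗ (A.evalAt 0).baseChange.lin) (fun y => ?_) x
    have h := congrArg (fun z : A.path.carrier => (1 : ℂ) ⊗ₜ[ℚ] z) (d_integ_add y)
    simp only [TensorProduct.tmul_add, TensorProduct.tmul_sub] at h
    exact h
  · exact baseChange_le_comap (A.integ.baseChange ℂ) (fun y hy =>
      Submodule.tmul_mem_baseChange_of_mem _ (integ_mem_W hy)) x hx
  · have h : A.integ.baseChange ℂ x ∈ (A.path.prevGr n).baseChange ℂ :=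
      baseChange_le_comap (A.integ.baseChange ℂ) (fun y hy =>
        Submodule.tmul_mem_baseChange_of_mem _ (integ_mem_prevGr hy)) x hx
    cases n with
    | zero => exact (Submodule.baseChange_bot (R := ℚ) (A := ℂ) (M := A.path.carrier)).le h
    | succ n => exact h

variable {k : Type} [Field k] {A B : FDGA.{u} k}

lemma IsClass.map (f : Hom A B) {n : ℕ} {p : ℤ} {c : A.E1 n p} {e : A.E2 n p}
    (h : A.IsClass c e) : B.IsClass (f.E1 n p c) (f.E2 n p e) := by
  obtain ⟨hc, rfl⟩ := h
  exact ⟨f.map_Z2 c hc, rfl⟩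

lemma IsClass.of_sub_mem {n : ℕ} {p : ℤ} {c c' : A.E1 n p} {e : A.E2 n p} (h : A.IsClass c e)
    (hc' : c' ∈ A.Z2 n p) (hcc : c' - c ∈ A.B2 n p) : A.IsClass c' e := by
  obtain ⟨hc, rfl⟩ := h
  exact ⟨hc', (Submodule.Quotient.eq ((A.B2 n p).submoduleOf (A.Z2 n p))).2 hcc⟩

section

variable {A : FDGA.{u} ℚ} {B : FDGA.{u} ℂ} (ρ : ∀ n p, ℂ ⊗[ℚ] A.E1 n p →ₗ[ℂ] B.E1 n p)
  (hρ : ∀ (n n' : ℕ) (p p' : ℤ) (hn : n + 1 = n') (hp : p' + 1 = p) (z : ℂ ⊗[ℚ] A.E1 n p),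
    ρ n' p' ((A.d1 hn hp).baseChange ℂ z) = B.d1 hn hp (ρ n p z))
include hρ

lemma tmul_mem_Z2 {n : ℕ} {p : ℤ} {c : A.E1 n p} (hc : c ∈ A.Z2 n p) :
    ρ n p (1 ⊗ₜ c) ∈ B.Z2 n p := by
  have h : A.d1 rfl (sub_add_cancel p 1) c = 0 := hc
  change B.d1 rfl (sub_add_cancel p 1) _ = 0
  rw [← hρ, baseChange_tmul, h, TensorProduct.tmul_zero, map_zero]

lemma tmul_mem_B2 {n : ℕ} {p : ℤ} {c : A.E1 n p} (hc : c ∈ A.B2 n p) :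
    ρ n p (1 ⊗ₜ c) ∈ B.B2 n p := by
  revert c
  change A.B2 n p ≤ (((B.B2 n p).comap (ρ n p)).restrictScalars ℚ).comap
    (TensorProduct.mk ℚ ℂ (A.E1 n p) 1)
  refine iSup₂_le fun m h => ?_
  rintro _ ⟨c, rfl⟩
  change ρ n p (1 ⊗ₜ A.d1 h rfl c) ∈ B.B2 n p
  rw [← baseChange_tmul, hρ]
  exact mem_iSup_of_mem m (mem_iSup_of_mem h ⟨_, rfl⟩)

end

lemma mem_pathS_iff {F : Submodule k A.carrier} {x : A.path.carrier} :
    x ∈ A.pathS F ↔ ∀ b i, A.pathCoeff b i x ∈ F :=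
  ⟨fun h b i => by cases b; exacts [h.1 i, h.2 i], fun h => ⟨h false, h true⟩⟩

lemma path_strict {F : Submodule k A.carrier} (h : ∀ (p : ℤ) (x : A.carrier), x ∈ A.W p →
      A.d x ∈ (F ⊓ A.W p) ⊔ A.W (p - 1) → ∃ y ∈ F ⊓ A.W p, A.d x - A.d y ∈ A.W (p - 1))
    (p : ℤ) (x : A.path.carrier) (hx : x ∈ A.path.W p)
    (hd : A.path.d x ∈ (A.pathS F ⊓ A.path.W p) ⊔ A.path.W (p - 1)) :
    ∃ y ∈ A.pathS F ⊓ A.path.W p, A.path.d x - A.path.d y ∈ A.path.W (p - 1) := by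
  suffices hS : A.path.d x ∈ (A.pathS F ⊓ A.path.W p).map A.path.d ⊔ A.path.W (p - 1) by
    obtain ⟨_, ⟨y, hy, rfl⟩, w, hw, e⟩ := mem_sup.1 hS
    exact ⟨y, hy, by rw [← e, add_sub_cancel_left]; exact hw⟩
  refine path_mem_of_coeff fun b i => ?_
  obtain ⟨u, hu, w, hw, e⟩ := mem_sup.1 hd
  have hw' := mem_path_W_iff.1 hw b i
  rw [pathWt_sub] at hw'
  have hs := pathCoeff_d_sub hx b i
  obtain ⟨y, hy, hy'⟩ := h (pathWt p b) _ (mem_path_W_iff.1 hx b i) (by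
    rw [← sub_sub_cancel (A.pathCoeff b i (A.path.d x)) (A.d _)]
    rw [← e, map_add] at hs ⊢
    rw [add_sub_assoc]
    exact add_mem_sup ⟨mem_pathS_iff.1 hu.1 b i, mem_path_W_iff.1 hu.2 b i⟩ (sub_mem hw' hs))
  have h1 : A.pathCoeff b i (A.path.d x) - A.d y ∈ A.W (pathWt p b - 1) := by
    rw [← sub_add_sub_cancel _ (A.d (A.pathCoeff b i x))]; exact add_mem hs hy'
  rw [← pathWt_sub] at h1
  have h2 := pathMon_mem_W i h1
  have h3 := d_pathMon_sub i hy.2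
  rw [map_sub] at h2
  refine mem_sup.2 ⟨_, ⟨A.pathMon b i y, ⟨mem_pathS_iff.2 (pathMon_mem (S := fun _ => F)
    hy.1), pathMon_mem_W i hy.2⟩, rfl⟩, _, sub_mem h2 h3, ?_⟩
  abel

section

variable {A : FDGA.{u} ℚ} {B : FDGA.{u} ℂ} (ρ : ∀ n p, ℂ ⊗[ℚ] A.E1 n p ≃ₗ[ℂ] B.E1 n p)

/-- The rational structure on the coefficients of `E_1` of the path object. -/
def pathRho : ∀ (n : ℕ) (p : ℤ) (b : Bool), ℂ ⊗[ℚ] A.pathE1 n p b ≃ₗ[ℂ] B.pathE1 n p b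
  | n, p, false => ρ n p
  | n + 1, p, true => ρ n (p + 1)
  | 0, p, true =>
    { (0 : ℂ ⊗[ℚ] A.pathE1 0 p true →ₗ[ℂ] B.pathE1 0 p true) with
      invFun := 0
      left_inv := fun _ => Subsingleton.elim _ _
      right_inv := fun _ => Subsingleton.elim _ _ }

lemma pathRho_d (hρ : ∀ (n n' : ℕ) (p p' : ℤ) (hn : n + 1 = n') (hp : p' + 1 = p)
      (z : ℂ ⊗[ℚ] A.E1 n p), ρ n' p' ((A.d1 hn hp).baseChange ℂ z) =
        B.d1 hn hp (ρ n p z)) (n : ℕ) {p p' : ℤ} (hp : p' + 1 = p) (b : Bool)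
    (z : ℂ ⊗[ℚ] A.pathE1 n p b) :
    pathRho ρ (n + 1) p' b ((A.pathE1d n hp b).baseChange ℂ z) =
      B.pathE1d n hp b (pathRho ρ n p b z) := by
  cases b
  · exact hρ n (n + 1) p p' rfl hp z
  · cases n with
    | zero => rw [Subsingleton.elim z 0]; simp only [map_zero]
    | succ n => exact hρ n (n + 1) (p + 1) (p' + 1) rfl (by omega) z

lemma pathRho_shift (n : ℕ) {p p' : ℤ} (hp : p' + 1 = p) (z : ℂ ⊗[ℚ] A.pathE1 n p false) :
    pathRho ρ (n + 1) p' true ((A.pathE1Shift n hp).baseChange ℂ z) =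
      B.pathE1Shift n hp (pathRho ρ n p false z) := by
  subst hp
  have h2 : B.pathE1Shift n (rfl : p' + 1 = p' + 1) = LinearMap.id := linearMap_qext _ rfl
  refine Eq.trans ?_ (LinearMap.congr_fun h2 (pathRho ρ n (p' + 1) false z)).symm
  induction z using TensorProduct.induction_on with
  | zero => simp only [map_zero]; rfl
  | add x y hx hy => simp only [map_add, hx, hy]; rfl
  | tmul a x =>
    obtain ⟨x, rfl⟩ := mk_surjective _ x
    rfl

lemma pathRho_isPureHS {F : ℤ → Submodule ℂ B.carrier}
    (hρ : ∀ (n : ℕ) (p : ℤ), IsPureHS (A.E1 n p) (p + n) fun q =>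
      (SubQuot.induced (B.Z1 n p) (B.B1 p) (F q)).comap (ρ n p).toLinearMap) (n : ℕ) (p : ℤ) (b : Bool) :
    IsPureHS (A.pathE1 n p b) (p + n) fun q =>
      (SubQuot.induced (B.pathZ1 n p b) (B.B1 (pathWt p b)) (F q)).comap
        (pathRho ρ n p b).toLinearMap := by
  cases b
  · exact hρ n p
  · cases n with
    | zero => exact IsPureHS.of_subsingleton _ _
    | succ n =>
      have h := hρ n (p + 1)
      rwa [show p + 1 + (n : ℤ) = p + ((n + 1 : ℕ) : ℤ) by push_cast; ring] at h

lemma path_exists_rationalStructure (hρ : ∀ (n n' : ℕ) (p p' : ℤ) (hn : n + 1 = n') (hp : p' + 1 = p)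
      (z : ℂ ⊗[ℚ] A.E1 n p), ρ n' p' ((A.d1 hn hp).baseChange ℂ z) = B.d1 hn hp (ρ n p z)) :
    ∃ r : ∀ n p, ℂ ⊗[ℚ] A.path.E1 n p ≃ₗ[ℂ] B.path.E1 n p,
      (∀ n p (j : Bool × ℕ) z, B.E1Coeff n p j (r n p z) =
        pathRho ρ n p j.1 ((A.E1Coeff n p j).baseChange ℂ z)) ∧
      (∀ n p z, r n p ((A.ι.E1 n p).baseChange ℂ z) = B.ι.E1 n p (ρ n p z)) ∧
      ∀ (n n' : ℕ) (p p' : ℤ) (hn : n + 1 = n') (hp : p' + 1 = p) (z : ℂ ⊗[ℚ] A.path.E1 n p),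
        r n' p' ((A.path.d1 hn hp).baseChange ℂ z) = B.path.d1 hn hp (r n p z) := by
  have hex : ∀ n p, ∃ r : ℂ ⊗[ℚ] A.path.E1 n p ≃ₗ[ℂ] B.path.E1 n p,
      ∀ (j : Bool × ℕ) z, B.E1Coeff n p j (r z) =
        pathRho ρ n p j.1 ((A.E1Coeff n p j).baseChange ℂ z) := fun n p =>
    (A.E1_isDecomp n p).baseChange.exists_equiv (B.E1_isDecomp n p)
      fun j => pathRho ρ n p j.1
  choose r hr using hex
  refine ⟨r, hr, fun n p z => (B.E1_isDecomp n p).ext fun j => ?_, ?_⟩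
  · rw [hr, ← E1Mon_eq_ι]
    have e2 := E1Mon_eq_ι B n p
    refine Eq.trans ?_ (congrArg (fun f => B.E1Coeff n p j (f (ρ n p z))) e2)
    by_cases hj : j = (false, 0)
    · subst hj
      refine (congrArg (ρ n p) (LinearMap.congr_fun
        ((A.E1_isDecomp n p).baseChange.same (false, 0)) z)).trans ?_
      exact (LinearMap.congr_fun ((B.E1_isDecomp n p).same (false, 0)) (ρ n p z)).symm
    · refine (congrArg (pathRho ρ n p j.1) (LinearMap.congr_fun
        ((A.E1_isDecomp n p).baseChange.ne j (false, 0) hj) z)).trans ((map_zero _).trans ?_)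
      exact (LinearMap.congr_fun ((B.E1_isDecomp n p).ne j (false, 0) hj) (ρ n p z)).symm
  · rintro n _ p p' rfl hp z
    refine (B.E1_isDecomp _ _).ext ?_
    rintro ⟨b, i⟩
    rw [hr, ← LinearMap.comp_apply, ← baseChange_comp]
    cases b
    · rw [E1Coeff_d1_false]
      have h2 := LinearMap.congr_fun (B.E1Coeff_d1_false n hp i) (r n p z)
      refine Eq.trans ?_ h2.symm
      rw [baseChange_comp, LinearMap.comp_apply, LinearMap.comp_apply, hr]
      exact pathRho_d ρ hρ n hp false _
    · rw [E1Coeff_d1_true]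
      have h2 := LinearMap.congr_fun (B.E1Coeff_d1_true n hp i) (r n p z)
      refine Eq.trans ?_ h2.symm
      have hz : ∀ {U V : Type u} [AddCommGroup U] [Module ℚ U] [AddCommGroup V] [Module ℚ V]
          (f : U →ₗ[ℚ] V) (a : ℤ), (a • f).baseChange ℂ = a • f.baseChange ℂ :=
        fun f a => map_zsmul (LinearMap.baseChangeHom ℚ ℂ _ _) a f
      rw [LinearMap.baseChange_add, hz, baseChange_comp, baseChange_comp]
      simp only [LinearMap.add_apply, LinearMap.smul_apply, LinearMap.comp_apply, map_add,
        map_zsmul, hr]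
      rw [pathRho_d ρ hρ n hp true, pathRho_shift]

end

lemma mem_path_E1F_iff (B : FDGA.{u} ℂ) (S : Submodule ℂ B.carrier) {n : ℕ} {p : ℤ}
    (y : B.path.E1 n p) : y ∈ SubQuot.induced (B.path.Z1 n p) (B.path.B1 p) (B.pathS S) ↔
      ∀ j : Bool × ℕ, B.E1Coeff n p j y ∈
        SubQuot.induced (B.pathZ1 n p j.1) (B.B1 (pathWt p j.1)) S := by
  constructor
  · rintro ⟨x, hx, rfl⟩ j
    exact ⟨⟨_, mem_path_Z1_iff.1 x.2 j.1 j.2⟩, mem_pathS_iff.1 hx j.1 j.2, rfl⟩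
  · refine fun h => (B.E1_isDecomp n p).mem_of_forall fun j => ?_
    obtain ⟨a, ha, e⟩ := h j
    rw [← e]
    exact ⟨⟨_, mem_path_Z1_iff.2 (pathMon_mem a.2)⟩,
      mem_pathS_iff.2 (pathMon_mem (S := fun _ => S) ha), rfl⟩

end FDGA

namespace FFDGA

variable {k : Type} [Field k] (A : FFDGA.{u} k)

lemma mem_path_F {q : ℤ} {x : A.path.carrier} :
    x ∈ A.path.F q ↔ ∀ b i, A.toFDGA.pathCoeff b i x ∈ A.F q :=
  ⟨fun h b i => by cases b; exacts [h.1 i, h.2 i], fun h => ⟨h false, h true⟩⟩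

lemma path_biregular (h : ∀ n, (∃ q, A.F q ⊓ A.gr n = ⊥) ∧ ∃ q, A.gr n ≤ A.F q) (n : ℕ) :
    (∃ q, A.path.F q ⊓ A.path.gr n = ⊥) ∧ ∃ q, A.path.gr n ≤ A.path.F q := by
  have h' : ∀ b, (∃ q, A.F q ⊓ A.toFDGA.pathCoeffGr n b = ⊥) ∧
      ∃ q, A.toFDGA.pathCoeffGr n b ≤ A.F q := by
    rintro (_ | _)
    · exact h n
    · cases n with
      | zero => exact ⟨⟨0, inf_bot_eq _⟩, 0, bot_le⟩
      | succ n => exact h n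
  obtain ⟨⟨q1, h1⟩, q2, h2⟩ := h' false
  obtain ⟨⟨q3, h3⟩, q4, h4⟩ := h' true
  refine ⟨⟨max q1 q3, (Submodule.eq_bot_iff _).2 fun x hx => pathCoeff_ext fun b i => ?_⟩,
    min q2 q4, fun x hx => A.mem_path_F.2 fun b i => ?_⟩
  · have hF := A.mem_path_F.1 hx.1 b i
    have hg := mem_path_gr_iff.1 hx.2 b i
    refine Eq.trans ?_ (map_zero (A.toFDGA.pathCoeff b i)).symm
    cases b
    · exact (mem_bot k).1 (h1 ▸ ⟨A.F_anti (le_max_left _ _) hF, hg⟩)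
    · exact (mem_bot k).1 (h3 ▸ ⟨A.F_anti (le_max_right _ _) hF, hg⟩)
  · have hg := mem_path_gr_iff.1 hx b i
    cases b
    · exact A.F_anti (min_le_left _ _) (h2 hg)
    · exact A.F_anti (min_le_right _ _) (h4 hg)

end FFDGA

namespace FDiag

variable {ℓ : ℕ} {A : FDiag.{u} ℓ}

lemma evPath_isE1QuasiIso (A : FDiag.{u} ℓ) (s : Src ℓ) : (A.evPath s).IsE1QuasiIso := by
  cases s
  · refine FDGA.Hom.IsE1QuasiIso.of_comp_left A.AQ.ι_baseChange_isDecQuasiIso.isE1QuasiIso ?_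
    exact A.AQ.ι_comp_pathBaseChange ▸ (FDGA.ι_isDecQuasiIso _).isE1QuasiIso
  · exact FDGA.Hom.isE1QuasiIso_id _
  · exact FDGA.Hom.isE1QuasiIso_id A.AC.toFDGA.path

lemma path_isE1QuasiIso {k : Type} [Field k] [CharZero k] {B C : FDGA.{u} k} {f : FDGA.Hom B C}
    (hf : f.IsE1QuasiIso) : f.path.IsE1QuasiIso := by
  refine FDGA.Hom.IsE1QuasiIso.of_comp_left B.ι_isDecQuasiIso.isE1QuasiIso ?_
  rw [FDGA.ι_comp_path]
  exact hf.comp C.ι_isDecQuasiIso.isE1QuasiIso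

lemma _root_.MixedHodge.IsMHD.exists_path_rationalStructure (hA : IsMHD A) :
    ∃ ρ : ∀ n p, ℂ ⊗[ℚ] A.path.AQ.E1 n p ≃ₗ[ℂ] A.path.AC.E1 n p, IsRationalStructure A.path ρ ∧
      ∀ (n : ℕ) (p : ℤ), IsPureHS (A.path.AQ.E1 n p) (p + n) fun q =>
        (A.path.AC.E1F n p q).comap (ρ n p).toLinearMap := by
  obtain ⟨ρ, ⟨hd, hc⟩, hp⟩ := hA.pure
  obtain ⟨r, hr, hι, hrd⟩ := path_exists_rationalStructure (B := A.AC.toFDGA) ρ hd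
  refine ⟨r, ⟨hrd, fun n p x hx => ?_⟩, fun n p => ?_⟩
  · obtain ⟨z, hz⟩ := (A.AQ.ι_isDecQuasiIso.isE1QuasiIso n p).2 (Submodule.Quotient.mk ⟨_, hx⟩)
    obtain ⟨⟨c, hcZ⟩, rfl⟩ := mk_surjective _ z
    obtain ⟨x0, rfl⟩ := mk_surjective _ c
    have hB : A.AQ.path.toE1 n p x - A.AQ.ι.E1 n p (A.AQ.toE1 n p x0) ∈ A.AQ.path.B2 n p :=
      (Submodule.Quotient.eq ((A.AQ.path.B2 n p).submoduleOf (A.AQ.path.Z2 n p))).1 hz.symm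
    obtain ⟨e, he1, he2, he3⟩ := hc n p x0 hcZ
    refine ⟨fun s => (A.ι.toHom.ev s).E2 n p (e s), ?_, ?_, fun j => ?_⟩
    · have h1 : ∀ y : A.AQ.path.Z1 n p, A.AQ.path.baseChange.toE1 n p (A.AQ.path.inclZ1 y) =
        A.AQ.path.E1BaseChange n p (1 ⊗ₜ A.AQ.path.toE1 n p y) := fun y =>
          (A.AQ.path.E1BaseChange_tmul y).symm
      have hρ := fun n n' p p' hn hp => A.AQ.path.E1BaseChange_d1 (n := n) (n' := n') (p := p)
        (p' := p') hn hp
      refine FDGA.IsClass.of_sub_mem (FDGA.IsClass.map A.AQ.ι.baseChange he1) ?_ ?_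
      · exact (h1 x).symm ▸ tmul_mem_Z2 (fun n p => (A.AQ.path.E1BaseChange n p).toLinearMap)
          hρ hx
      · have h2 : A.AQ.ι.baseChange.E1 n p (A.AR.toE1 n p (A.AQ.inclZ1 x0)) =
            A.AQ.path.E1BaseChange n p (1 ⊗ₜ A.AQ.ι.E1 n p (A.AQ.toE1 n p x0)) :=
          (A.AQ.path.E1BaseChange_tmul ⟨_, A.AQ.ι.map_Z1 x0.1 x0.2⟩).symm
        have h3 := tmul_mem_B2 (fun n p => (A.AQ.path.E1BaseChange n p).toLinearMap) hρ hB
        rw [TensorProduct.tmul_sub, map_sub] at h3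
        exact (h1 x).symm ▸ h2.symm ▸ h3
    · refine FDGA.IsClass.of_sub_mem (FDGA.IsClass.map A.AC.ι he2) ?_ ?_
      · exact tmul_mem_Z2 (B := A.AC.toFDGA.path) (fun n p => (r n p).toLinearMap) hrd hx
      · have h3 := tmul_mem_B2 (B := A.AC.toFDGA.path) (fun n p => (r n p).toLinearMap) hrd hB
        rw [TensorProduct.tmul_sub, map_sub] at h3
        exact hι n p (1 ⊗ₜ A.AQ.toE1 n p x0) ▸ h3
    · have h1 : ∀ b, (A.path.φ j b).E2 n p ((A.ι.toHom.ev (src j b)).E2 n p (e (src j b))) =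
          (A.odd j).ι.E2 n p ((A.φ j b).E2 n p (e (src j b))) := fun b => by
        refine (FDGA.Hom.E2_comp _ _ n p _).symm.trans (Eq.trans ?_ (FDGA.Hom.E2_comp _ _ n p _))
        exact congrArg (fun f => FDGA.Hom.E2 f n p (e (src j b))) (FDiag.Hom.comm A.ι j b).symm
      exact (h1 false).trans ((congrArg _ (he3 j)).trans (h1 true).symm)
  · have h := fun b => pathRho_isPureHS (B := A.AC.toFDGA) ρ hp n p b
    refine IsDecomp.isPureHS (J := Bool × ℕ) (Y := fun j => A.AQ.pathE1 n p j.1)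
      (A.AQ.E1_isDecomp n p) (fun j => h j.1) ?_ ?_ fun q z => ?_
    · obtain ⟨p1, h1⟩ := (h false).exists_top
      obtain ⟨p2, h2⟩ := (h true).exists_top
      refine ⟨min p1 p2, ?_⟩
      rintro ⟨_ | _, i⟩
      · exact top_le_iff.1 (h1 ▸ (h false).anti (min_le_left _ _))
      · exact top_le_iff.1 (h2 ▸ (h true).anti (min_le_right _ _))
    · obtain ⟨p1, h1⟩ := (h false).exists_bot
      obtain ⟨p2, h2⟩ := (h true).exists_bot
      refine ⟨max p1 p2, ?_⟩
      rintro ⟨_ | _, i⟩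
      · exact le_bot_iff.1 (h1 ▸ (h false).anti (le_max_left _ _))
      · exact le_bot_iff.1 (h2 ▸ (h true).anti (le_max_right _ _))
    · refine (mem_path_E1F_iff A.AC.toFDGA (A.AC.F q) (r n p z)).trans (forall_congr' fun j => ?_)
      rw [hr]; rfl

lemma _root_.MixedHodge.IsMHD.path (hA : IsMHD A) : IsMHD A.path where
  e1 j b := (evPath_isE1QuasiIso A (src j b)).comp (path_isE1QuasiIso (hA.e1 j b))
  biregular := A.AC.path_biregular hA.biregular
  finite n := by
    have := hA.finite n
    exact Module.Finite.of_surjective (A.AQ.ι.H n) (A.AQ.ι_isDecQuasiIso.isQuasiIso n).2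
  connected := by
    have h : A.path.AQ.unitH0 = A.AQ.ι.H 0 ∘ₗ A.AQ.unitH0 := LinearMap.ext fun c =>
      congrArg Submodule.Quotient.mk (Subtype.ext (A.AQ.ι.toAlgHom.commutes c).symm)
    rw [h]
    exact (A.AQ.ι_isDecQuasiIso.isQuasiIso 0).comp hA.connected
  strict p q := path_strict (A := A.AC.toFDGA) (fun p => hA.strict p q) p
  pure := hA.exists_path_rationalStructure

end FDiag

/-! ## Cofibrant objects -/

/-- A criterion for Cartan-Eilenberg cofibrant objects: the functor represented by the object in
the localization is induced by a functor `T` that inverts the weak equivalences. -/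
lemma CECofibrant.of_functor {C : Type*} [Category C] {S W : MorphismProperty C} {D : C}
    (T : C ⥤ Type*) (hS : S.IsInvertedBy T)
    (hW : ∀ {A B : C} (w : A ⟶ B), W w → Bijective (T.map w))
    (θ : ∀ A, T.obj A → (S.Q.obj D ⟶ S.Q.obj A))
    (hθ : ∀ {A B : C} (f : A ⟶ B) (x : T.obj A), θ B (T.map f x) = θ A x ≫ S.Q.map f)
    (u : T.obj D) (hu : θ D u = 𝟙 _)
    (hθu : ∀ (A : C) (x : T.obj A), ∃ (Z : C) (p : Z ⟶ D) (q : Z ⟶ A) (v : T.obj Z),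
      S.Q.map p ≫ θ A x = S.Q.map q ∧ T.map p v = u ∧ T.map q v = x) :
    CECofibrant S W D := by
  let L := Localization.Construction.lift T hS
  let θ' : ∀ X : S.Localization, L.obj X → (S.Q.obj D ⟶ X) := fun X => θ X.as.obj
  have hQ : ∀ {A B : C} (f : A ⟶ B), L.map (S.Q.map f) = T.map f := fun f => by
    exact (Functor.congr_hom (Localization.Construction.fac T hS) f).trans
      ((Category.id_comp _).trans (Category.comp_id _))
  let P : MorphismProperty S.Localization := fun X Y φ => ∀ x, θ' Y (L.map φ x) = θ' X x ≫ φ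
  have hL : ∀ {X Y Z : S.Localization} (φ : X ⟶ Y) (ψ : Y ⟶ Z) (x : L.obj X),
      L.map (φ ≫ ψ) x = L.map ψ (L.map φ x) := fun φ ψ x => by rw [L.map_comp]; rfl
  have : P.IsStableUnderComposition := ⟨fun f g hf hg x => by
    rw [hL]
    exact (hg _).trans ((congrArg (· ≫ g) (hf x)).trans (Category.assoc _ _ _))⟩
  have hP : P = ⊤ := by
    refine Localization.Construction.morphismProperty_eq_top _ (fun A B f x => ?_)
      fun A B w hw x => ?_
    · rw [hQ]; exact hθ f x
    · have h := hθ w (L.map (Localization.Construction.wInv w hw) x)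
      have e : T.map w (L.map (Localization.Construction.wInv w hw) x) = x := by
        let y : L.obj (S.Q.obj A) := L.map (Localization.Construction.wInv w hw) x
        have e1 := hL (Localization.Construction.wInv w hw) (S.Q.map w) x
        have e2 := (Localization.Construction.wIso w hw).inv_hom_id
        refine (congrArg (fun φ : T.obj A ⟶ T.obj B => φ (y : T.obj A)) (hQ w)).symm.trans
          (e1.symm.trans ((congrArg (fun φ => L.map φ x) e2).trans ?_))
        rw [L.map_id]; rfl
      rw [e] at h
      exact ((Iso.comp_inv_eq (Localization.Construction.wIso w hw)).2 h).symm
  have hθu' : ∀ A x, L.map (θ A x) u = x := fun A x => by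
    obtain ⟨Z, p, q, v, h1, rfl, h3⟩ := hθu A x
    have e := hL (S.Q.map p) (θ A x) v
    rw [h1, hQ, hQ] at e
    exact e.symm.trans h3
  have hbij : ∀ A, Bijective (θ A) := fun A => by
    refine ⟨fun x y h => by rw [← hθu' A x, h, hθu'], fun φ => ⟨L.map φ u, ?_⟩⟩
    have h : P φ := hP ▸ MorphismProperty.top_apply φ
    exact (h u).trans ((congrArg (· ≫ φ) hu).trans (Category.id_comp φ))
  intro A B w hw
  have e : (fun g : S.Q.obj D ⟶ S.Q.obj A => g ≫ S.Q.map w) ∘ θ A = θ B ∘ T.map w :=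
    funext fun x => (hθ w x).symm
  refine (Bijective.of_comp_iff _ (hbij A)).1 ?_
  rw [e]
  exact (hbij B).comp (hW w hw)

lemma inv_comp_of_comp {C E : Type*} [Category C] [Category E] (F : C ⥤ E) {X Y Z : C}
    (c : X ⟶ Y) (p : X ⟶ Z) (p' : Y ⟶ Z) [IsIso (F.map p)] [IsIso (F.map p')]
    (h : c ≫ p' = p) : inv (F.map p) ≫ F.map c = inv (F.map p') := by
  rw [IsIso.inv_comp_eq, IsIso.eq_comp_inv, ← F.map_comp, h]

namespace MHD

variable {ℓ : ℕ} (D : MHD.{u} ℓ)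

def classes : MHD.{u} ℓ ⥤ Type u where
  obj A := HoMor.Classes D.obj A.obj
  map f := TypeCat.ofHom (HoMor.Classes.map D.obj f.hom)
  map_id A := by
    ext x
    exact congrFun (HoMor.Classes.map_id D.obj A.obj) x
  map_comp f g := by
    ext x
    exact congrFun (HoMor.Classes.map_comp D.obj f.hom g.hom) x

variable {D} {A B : MHD.{u} ℓ} (f : HoMor D.obj A.obj)

def cyl : MHD.{u} ℓ := ⟨f.cyl, f.cyl_isMHD D.property⟩

/-- The projection of the cylinder. -/
def cylFst : cyl f ⟶ D := ObjectProperty.homMk f.cylFst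

def cylEnd : cyl f ⟶ A := ObjectProperty.homMk f.cylEnd

lemma H_of_hoEquiv {w : A ⟶ B} (hw : hoEquiv ℓ w.hom) : MHD.H ℓ w :=
  MorphismProperty.le_multiplicativeClosure _ _ hw

instance : IsIso ((MHD.H ℓ).Q.map (cylFst f)) :=
  (MHD.H ℓ).Q_inverts _ (H_of_hoEquiv f.hoEquiv_cylFst)

/-- The morphism in the localization that is defined by a ho-morphism. -/
def ofHoMor : (MHD.H ℓ).Q.obj D ⟶ (MHD.H ℓ).Q.obj A :=
  inv ((MHD.H ℓ).Q.map (cylFst f)) ≫ (MHD.H ℓ).Q.map (cylEnd f)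

lemma ofHoMor_postcomp (w : A ⟶ B) :
    ofHoMor (f.postcomp w.hom : HoMor D.obj B.obj) = ofHoMor f ≫ (MHD.H ℓ).Q.map w := by
  let c : cyl f ⟶ cyl (f.postcomp w.hom : HoMor D.obj B.obj) := ObjectProperty.homMk (f.cylMap w.hom)
  have h1 : c ≫ cylFst _ = cylFst f := ObjectProperty.hom_ext _ (f.cylMap_fst w.hom)
  have h2 : c ≫ cylEnd _ = cylEnd f ≫ w := ObjectProperty.hom_ext _ (f.cylMap_end w.hom)
  rw [ofHoMor, ofHoMor, ← inv_comp_of_comp _ c _ _ h1, Category.assoc, Category.assoc,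
    ← Functor.map_comp, ← Functor.map_comp, h2]

lemma ofHoMor_ofHom (w : D ⟶ A) :
    ofHoMor (HoMor.ofHom w.hom : HoMor D.obj A.obj) = (MHD.H ℓ).Q.map w := by
  let c : D ⟶ cyl (HoMor.ofHom w.hom : HoMor D.obj A.obj) :=
    ObjectProperty.homMk (HoMor.cylSection w.hom)
  have h1 : c ≫ cylFst _ = 𝟙 D := ObjectProperty.hom_ext _ (HoMor.cylSection_fst w.hom)
  have h2 : c ≫ cylEnd _ = w := ObjectProperty.hom_ext _ (HoMor.cylSection_end w.hom)
  rw [ofHoMor, ← inv_comp_of_comp _ c _ _ h1, Category.assoc, ← Functor.map_comp, h2,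
    IsIso.inv_comp_eq, CategoryTheory.Functor.map_id, Category.id_comp]

lemma ofHoMor_homotopic {f g : HoMor D.obj A.obj} (h : HoMor.Homotopic f g) :
    ofHoMor f = ofHoMor g := by
  obtain ⟨h, rfl, rfl⟩ := h
  let P : MHD ℓ := ⟨A.obj.path, A.property.path⟩
  let d0 : P ⟶ A := ObjectProperty.homMk A.obj.δ0
  let d1 : P ⟶ A := ObjectProperty.homMk A.obj.δ1
  let i : A ⟶ P := ObjectProperty.homMk A.obj.ι
  have hi : IsIso ((MHD.H ℓ).Q.map i) := (MHD.H ℓ).Q_inverts _ (H_of_hoEquiv (hoEquiv_ι A.obj))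
  have h0 : i ≫ d0 = 𝟙 A := ObjectProperty.hom_ext _ (A.obj.ι_comp_evalAt 0)
  have h1 : i ≫ d1 = 𝟙 A := ObjectProperty.hom_ext _ (A.obj.ι_comp_evalAt 1)
  have e : (MHD.H ℓ).Q.map d0 = (MHD.H ℓ).Q.map d1 := by
    rw [← cancel_epi ((MHD.H ℓ).Q.map i), ← Functor.map_comp, ← Functor.map_comp, h0, h1]
  have e0 := ofHoMor_postcomp (A := P) (f := h) d0
  have e1 := ofHoMor_postcomp (A := P) (f := h) d1
  exact e0.trans ((congrArg _ e).trans e1.symm)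

theorem cofibrant (hD : ∀ {A B : MHD.{u} ℓ} (w : A ⟶ B), MHD.Q ℓ w →
    Bijective (HoMor.Classes.map D.obj w.hom)) :
    CECofibrant (MHD.H ℓ) (MHD.Q ℓ) D := by
  have hW : ∀ {A B : MHD.{u} ℓ} (w : A ⟶ B), MHD.Q ℓ w →
      Bijective ((classes D).map w) := fun w hw => hD w hw
  have hS : (MHD.H ℓ).IsInvertedBy (classes D) := fun A B w hw =>
    (isIso_iff_bijective _).2 (hW w (H_le_Q _ hw))
  refine CECofibrant.of_functor (classes D) hS hW
    (fun A => Quot.lift ofHoMor fun _ _ => ofHoMor_homotopic) ?_ (Quot.mk _ (HoMor.ofHom (𝟙 _)))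
    ?_ ?_
  · rintro A B f ⟨x⟩
    exact ofHoMor_postcomp x f
  · exact (ofHoMor_ofHom (𝟙 D)).trans ((MHD.H ℓ).Q.map_id D)
  · rintro A ⟨x⟩
    exact ⟨cyl x, cylFst x, cylEnd x, Quot.mk _ x.cylConst, IsIso.hom_inv_id_assoc _ _,
      congrArg (Quot.mk _) x.cylConst_fst, congrArg (Quot.mk _) x.cylConst_end⟩

end MHD

namespace DGA

variable {k : Type} [Field k]

/-- The elements of degree at least `m`. -/
def grGE (A : DGA.{u} k) (m : ℕ) : Submodule k A.carrier := ⨆ n, A.gr (n + m)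

variable {A B : DGA.{u} k}

lemma gr_le_grGE {m n : ℕ} (h : m ≤ n) : A.gr n ≤ A.grGE m := by
  obtain ⟨l, rfl⟩ := Nat.exists_eq_add_of_le' h
  exact le_iSup (fun n => A.gr (n + m)) l

lemma grGE_mul {m n : ℕ} {x y : A.carrier} (hx : x ∈ A.grGE m) (hy : y ∈ A.grGE n) :
    x * y ∈ A.grGE (m + n) := by
  have h1 : A.grGE m ≤ (A.grGE (m + n)).comap (LinearMap.mulRight k y) := by
    refine iSup_le fun a x hx => ?_
    have h2 : A.grGE n ≤ (A.grGE (m + n)).comap (LinearMap.mulLeft k x) := iSup_le fun b y hy =>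
      gr_le_grGE (by omega : m + n ≤ a + m + (b + n)) (SetLike.GradedMul.mul_mem hx hy)
    exact h2 hy
  exact h1 hx

lemma mem_grGE_zero (x : A.carrier) : x ∈ A.grGE 0 := by
  induction x using DirectSum.Decomposition.inductionOn A.gr with
  | zero => exact zero_mem _
  | homogeneous a => exact gr_le_grGE (Nat.zero_le _) a.2
  | add a b ha hb => exact add_mem ha hb

lemma eq_zero_of_grGE {m n : ℕ} (h : n < m) {x : A.carrier} (hx : x ∈ A.gr n)
    (hx' : x ∈ A.grGE m) : x = 0 := by
  have : A.grGE m ≤ ker (A.proj n) := iSup_le fun a y hy =>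
    A.proj_of_mem_ne (by omega) hy
  rw [← A.proj_of_mem hx]
  exact this hx'

lemma sgn_mem_grGE {m : ℕ} {x : A.carrier} (hx : x ∈ A.grGE m) : A.sgn x ∈ A.grGE m := by
  have : A.grGE m ≤ (A.grGE m).comap A.sgn := by
    refine iSup_le fun a y hy => ?_
    change A.sgn y ∈ A.grGE m
    rw [A.sgn_of_mem hy]
    exact Submodule.smul_mem _ _ (gr_le_grGE (by omega) hy)
  exact this hx

lemma map_grGE {f : A.carrier →ₐ[k] B.carrier} (hf : ∀ n, ∀ x ∈ A.gr n, f x ∈ B.gr n) {m : ℕ}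
    {x : A.carrier} (hx : x ∈ A.grGE m) : f x ∈ B.grGE m := by
  have : A.grGE m ≤ (B.grGE m).comap f.toLinearMap := iSup_le fun a y hy =>
    gr_le_grGE (by omega) (hf _ _ hy)
  exact this hx

lemma mul_sub_mem_grGE {m l : ℕ} {x y : A.carrier} {x' y' : A.carrier} (hx : x - x' ∈ A.grGE m)
    (hy : y - y' ∈ A.grGE m) (hy' : y ∈ A.grGE l) (hx' : x' ∈ A.grGE l) :
    x * y - x' * y' ∈ A.grGE (m + l) := by
  have : x * y - x' * y' = (x - x') * y + x' * (y - y') := by noncomm_ring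
  rw [this]
  exact add_mem (grGE_mul hx hy') (add_comm m l ▸ grGE_mul hx' hy)

lemma sub_mem_grGE {f g : A.carrier →ₐ[k] B.carrier} {m : ℕ} {s : Set A.carrier}
    (hs : ∀ x ∈ s, f x - g x ∈ B.grGE m) {x : A.carrier} (hx : x ∈ Algebra.adjoin k s) :
    f x - g x ∈ B.grGE m := by
  induction hx using Algebra.adjoin_induction with
  | mem x hx => exact hs x hx
  | algebraMap c => rw [AlgHom.commutes, AlgHom.commutes, sub_self]; exact zero_mem _
  | add x y _ _ hx hy =>
    rw [map_add, map_add, add_sub_add_comm]; exact add_mem hx hy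
  | mul x y _ _ hx hy =>
    rw [map_mul, map_mul]
    exact mul_sub_mem_grGE (l := 0) hx hy (mem_grGE_zero _) (mem_grGE_zero _)

lemma map_d_mul (f : A.carrier →ₐ[k] B.carrier) (hf : ∀ n, ∀ x ∈ A.gr n, f x ∈ B.gr n)
    (x y : A.carrier) : f (A.d (x * y)) - B.d (f (x * y)) =
      (f (A.d x) - B.d (f x)) * f y + f (A.sgn x) * (f (A.d y) - B.d (f y)) := by
  have : f (A.sgn x) = B.sgn (f x) := DGA.map_sgn f.toRingHom hf x
  rw [A.leibniz', map_add, map_mul, map_mul, map_mul, B.leibniz', this]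
  noncomm_ring

lemma map_d_mem_grGE {f : A.carrier →ₐ[k] B.carrier} (hf : ∀ n, ∀ x ∈ A.gr n, f x ∈ B.gr n)
    {m : ℕ} {s : Set A.carrier} (hs : ∀ x ∈ s, f (A.d x) - B.d (f x) ∈ B.grGE m)
    {x : A.carrier} (hx : x ∈ Algebra.adjoin k s) : f (A.d x) - B.d (f x) ∈ B.grGE m := by
  induction hx using Algebra.adjoin_induction with
  | mem x hx => exact hs x hx
  | algebraMap c =>
    rw [A.d_algebraMap, AlgHom.commutes, B.d_algebraMap, map_zero, sub_zero]
    exact zero_mem _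
  | add x y _ _ hx hy =>
    rw [map_add, map_add, map_add, map_add, add_sub_add_comm]; exact add_mem hx hy
  | mul x y _ _ hx hy =>
    rw [map_d_mul f hf]
    have h1 := grGE_mul (n := 0) hx (mem_grGE_zero (f y))
    have h2 := grGE_mul (m := 0) (mem_grGE_zero (f (A.sgn x))) hy
    rw [zero_add] at h2
    exact add_mem h1 h2

end DGA

namespace MixedHodgeDGA.IsMinimalWith

variable {M : MixedHodgeDGA.{u}} {deg : ℕ → ℕ} {V : ℕ → Submodule ℚ M.carrier}
  (h : M.IsMinimalWith deg V)

include h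

lemma d_induction {i : ℕ} {v : M.carrier} (hv : v ∈ V i) (P : Submodule ℚ M.carrier)
    (hP : ∀ x ∈ M.stage V i, x ∈ M.grGE 1 → ∀ y ∈ M.stage V i, y ∈ M.grGE 1 → x * y ∈ P) :
    M.d v ∈ P := by
  have : M.stagePos V i * M.stagePos V i ≤ P :=
    Submodule.mul_le.2 fun x hx y hy => hP x hx.1 hx.2 y hy.1 hy.2
  exact this (h.d_mem i v hv)

variable {B : DGA.{u} ℚ} {s t : M.carrier →ₐ[ℚ] B.carrier}

lemma eq_of_gr (hs : ∀ n, ∀ x ∈ M.gr n, s x ∈ B.gr n) (ht : ∀ n, ∀ x ∈ M.gr n, t x ∈ B.gr n)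
    {n : ℕ} (hst : ∀ j, deg j ≤ n → ∀ v ∈ V j, s v = t v) {x : M.carrier} (hx : x ∈ M.gr n) :
    s x = t x := by
  refine sub_eq_zero.1 (DGA.eq_zero_of_grGE (m := n + 1) (Nat.lt_succ_self n)
    (sub_mem (hs n x hx) (ht n x hx)) (DGA.sub_mem_grGE (fun v hv => ?_)
    (h.isCellular.adjoin_eq_top ▸ trivial : x ∈ Algebra.adjoin ℚ (⋃ j, (V j : Set M.carrier)))))
  obtain ⟨j, hj⟩ := Set.mem_iUnion.1 hv
  by_cases hjn : deg j ≤ n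
  · rw [hst j hjn v hj, sub_self]; exact zero_mem _
  · exact DGA.gr_le_grGE (by omega : n + 1 ≤ deg j)
      (sub_mem (hs _ v (h.V_le j hj)) (ht _ v (h.V_le j hj)))

lemma eq_of_d (hs : ∀ n, ∀ x ∈ M.gr n, s x ∈ B.gr n) (ht : ∀ n, ∀ x ∈ M.gr n, t x ∈ B.gr n)
    {i : ℕ} (hst : ∀ j < i, deg j ≤ deg i → ∀ v ∈ V j, s v = t v) {v : M.carrier} (hv : v ∈ V i) :
    s (M.d v) = t (M.d v) := by
  have key : ∀ x ∈ M.stage V i, s x - t x ∈ B.grGE (deg i + 1) := fun x hx => by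
    refine DGA.sub_mem_grGE (fun v hv => ?_) hx
    simp only [Set.mem_iUnion] at hv
    obtain ⟨j, hji, hj⟩ := hv
    by_cases hjn : deg j ≤ deg i
    · rw [hst j hji hjn v hj, sub_self]; exact zero_mem _
    · exact DGA.gr_le_grGE (by omega : deg i + 1 ≤ deg j)
        (sub_mem (hs _ v (h.V_le j hj)) (ht _ v (h.V_le j hj)))
  have hdv := M.d_mem (h.V_le i hv)
  refine sub_eq_zero.1 (DGA.eq_zero_of_grGE (m := deg i + 2) (Nat.lt_succ_self (deg i + 1))
    (sub_mem (hs _ _ hdv) (ht _ _ hdv)) ?_)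
  refine h.d_induction hv ((B.grGE (deg i + 2)).comap (s.toLinearMap - t.toLinearMap))
    fun x hx hx1 y hy hy1 => ?_
  change s (x * y) - t (x * y) ∈ B.grGE (deg i + 2)
  rw [map_mul, map_mul]
  exact DGA.mul_sub_mem_grGE (l := 1) (key x hx) (key y hy) (DGA.map_grGE hs hy1)
    (DGA.map_grGE ht hx1)

lemma map_d_of_d (hs : ∀ n, ∀ x ∈ M.gr n, s x ∈ B.gr n) {i : ℕ}
    (hd : ∀ j < i, deg j ≤ deg i → ∀ v ∈ V j, s (M.d v) = B.d (s v)) {v : M.carrier}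
    (hv : v ∈ V i) : B.d (s (M.d v)) = 0 := by
  have key : ∀ x ∈ M.stage V i, s (M.d x) - B.d (s x) ∈ B.grGE (deg i + 2) := fun x hx => by
    refine DGA.map_d_mem_grGE hs (fun v hv => ?_) hx
    simp only [Set.mem_iUnion] at hv
    obtain ⟨j, hji, hj⟩ := hv
    by_cases hjn : deg j ≤ deg i
    · rw [hd j hji hjn v hj, sub_self]; exact zero_mem _
    · exact DGA.gr_le_grGE (by omega : deg i + 2 ≤ deg j + 1)
        (sub_mem (hs _ _ (M.d_mem (h.V_le j hj))) (B.d_mem (hs _ v (h.V_le j hj))))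
  have hdv := hs _ _ (M.d_mem (h.V_le i hv))
  refine DGA.eq_zero_of_grGE (m := deg i + 3) (Nat.lt_succ_self (deg i + 2)) (B.d_mem hdv) ?_
  have := h.d_induction hv
    ((B.grGE (deg i + 3)).comap (s.toLinearMap ∘ₗ M.d - B.d ∘ₗ s.toLinearMap))
    fun x hx hx1 y hy hy1 => by
      change s (M.d (x * y)) - B.d (s (x * y)) ∈ B.grGE (deg i + 3)
      rw [DGA.map_d_mul s hs]
      have h2 := DGA.grGE_mul (DGA.map_grGE hs (DGA.sgn_mem_grGE hx1)) (key y hy)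
      rw [show 1 + (deg i + 2) = deg i + 3 by omega] at h2
      exact add_mem (DGA.grGE_mul (n := 1) (key x hx) (DGA.map_grGE hs hy1)) h2
  replace this : s (M.d (M.d v)) - B.d (s (M.d v)) ∈ B.grGE (deg i + 3) := this
  rw [M.d_d, map_zero, zero_sub] at this
  exact neg_mem_iff.1 this

/-- A quasi-isomorphism to a minimal dga has a section. -/
lemma exists_section {A : DGA.{u} ℚ} (f : A.carrier →ₐ[ℚ] M.carrier)
    (hgr : ∀ n, ∀ x ∈ A.gr n, f x ∈ M.gr n) (hd : ∀ x, f (A.d x) = M.d (f x))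
    (hinj : ∀ n, ∀ x ∈ A.gr n, A.d x = 0 → f x ∈ range M.d → x ∈ range A.d)
    (hsurj : ∀ n, ∀ y ∈ M.gr n, M.d y = 0 → ∃ x ∈ A.gr n, A.d x = 0 ∧ y - f x ∈ range M.d) :
    ∃ s : M.carrier →ₐ[ℚ] A.carrier, (∀ n, ∀ x ∈ M.gr n, s x ∈ A.gr n) ∧
      (∀ x, s (M.d x) = A.d (s x)) ∧ ∀ x, f (s x) = x := by
  classical
  have hexact : ∀ {C : DGA.{u} ℚ} {n : ℕ} {x : C.carrier}, x ∈ C.gr n → x ∈ range C.d →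
      ∃ y ∈ C.prevGr n, C.d y = x := by
    rintro C n _ hx ⟨y, rfl⟩
    exact ⟨_, C.prevProj_mem n y, by rw [← C.proj_d, C.proj_of_mem hx]⟩
  let r : ℕ → ℕ → Prop := fun j i => deg j < deg i ∨ deg j = deg i ∧ j < i
  have hwf : WellFounded r := by
    refine Subrelation.wf (r := InvImage (Prod.Lex (· < ·) (· < ·)) fun i => (deg i, i)) ?_
      (InvImage.wf _ (WellFounded.prod_lex wellFounded_lt wellFounded_lt))
    intro j i hji
    exact Prod.lex_def.2 hji
  let P : ℕ → (∀ i, V i →ₗ[ℚ] A.carrier) → Prop := fun i g =>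
    (∀ v, g i v ∈ A.gr (deg i)) ∧ (∀ v : V i, f (g i v) = v) ∧
    ∀ s : M.carrier →ₐ[ℚ] A.carrier, (∀ n, ∀ x ∈ M.gr n, s x ∈ A.gr n) →
      (∀ j, r j i → ∀ v : V j, s v = g j v) → ∀ v : V i, A.d (g i v) = s (M.d v)
  have hext : ∃ g : ∀ i, V i →ₗ[ℚ] A.carrier, ∀ i, P i g := by
    refine exists_forall_of_wellFounded hwf (fun {a b c} hab hbc => by simp only [r] at *; omega)
      P ?_ ?_
    · rintro i g g' hg ⟨h1, h2, h3⟩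
      have e : g i = g' i := hg i (Or.inr rfl)
      refine ⟨by rwa [← e], by rwa [← e], fun s hs hsg => ?_⟩
      rw [← e]
      exact h3 s hs fun j hj v => (hsg j hj v).trans (by rw [hg j (Or.inl hj)])
    · intro i g hg
      obtain ⟨s, ⟨hsgr, hs⟩, -⟩ := h.free A (fun j => if r j i then g j else 0) fun j v => by
        split_ifs with hj
        · exact (hg j hj).1 v
        · exact zero_mem _
      have hs1 : ∀ j, r j i → ∀ v : V j, s v = g j v := fun j hj v => by rw [hs, if_pos hj]
      have hsd : ∀ j, r j i → ∀ v ∈ V j, s (M.d v) = A.d (s v) := fun j hj v hv => by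
        have := (hg j hj).2.2 s hsgr (fun l hl => hs1 l (by simp only [r] at *; omega)) ⟨v, hv⟩
        rw [← this]
        exact congrArg A.d (hs1 j hj ⟨v, hv⟩).symm
      have hfs : ∀ j, r j i → ∀ v ∈ V j, f.comp s v = AlgHom.id ℚ _ v := fun j hj v hv =>
        (congrArg f (hs1 j hj ⟨v, hv⟩)).trans ((hg j hj).2.1 ⟨v, hv⟩)
      have hfgr : ∀ n, ∀ x ∈ M.gr n, f.comp s x ∈ M.gr n := fun n x hx => hgr n _ (hsgr n x hx)
      have hlow : ∀ {j}, j < i → deg j ≤ deg i → r j i := fun {j} h1 h2 => by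
        simp only [r]; omega
      have hmem : ∀ v : V i, ∃ m ∈ A.gr (deg i), f m = v ∧ A.d m = s (M.d v) := by
        intro v
        have hv := h.V_le i v.2
        have hfdv : f (s (M.d v)) = M.d v :=
          h.eq_of_d hfgr (fun _ _ hx => hx) (fun j h1 h2 => hfs j (hlow h1 h2)) v.2
        obtain ⟨y, hy, hdy⟩ := hexact (hsgr _ _ (M.d_mem hv)) (hinj _ _ (hsgr _ _ (M.d_mem hv))
          (h.map_d_of_d hsgr (fun j h1 h2 => hsd j (hlow h1 h2)) v.2) ⟨v, hfdv.symm⟩)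
        replace hy : y ∈ A.gr (deg i) := hy
        have hyv := sub_mem (hgr _ _ hy) hv
        obtain ⟨c, hc, hdc, he⟩ := hsurj _ _ hyv (by
          rw [map_sub, ← hd, hdy, hfdv, sub_self])
        obtain ⟨e, he, hde⟩ := hexact (sub_mem hyv (hgr _ _ hc)) he
        obtain ⟨n, hn⟩ := Nat.exists_eq_succ_of_ne_zero (Nat.one_le_iff_ne_zero.1 (h.deg_pos i))
        rw [hn] at he
        replace he : e ∈ M.gr n := he
        have hr : ∀ j, deg j ≤ n → r j i := fun j hj => Or.inl (by omega)
        have hfe : f (s e) = e :=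
          h.eq_of_gr hfgr (fun _ _ hx => hx) (fun j hj => hfs j (hr j hj)) he
        have hse : A.d (s e) ∈ A.gr (deg i) := hn ▸ A.d_mem (hsgr _ _ he)
        refine ⟨y - c - A.d (s e), sub_mem (sub_mem hy hc) hse, ?_, ?_⟩
        · rw [map_sub, map_sub, hd, hfe, hde]; abel
        · rw [map_sub, map_sub, hdc, A.d_d, hdy, sub_zero, sub_zero]
      let β := Module.Basis.ofVectorSpace ℚ (V i)
      choose m hm hfm hdm using fun a => hmem (β a)
      have hxa : ∀ a, β.constr ℚ m (β a) = m a := fun a => by rw [Module.Basis.constr_basis]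
      refine ⟨β.constr ℚ m, fun v => ?_, fun v => ?_, fun s' hs' hsg v => ?_⟩
      · rw [update_self]
        have : range (β.constr ℚ m) ≤ A.gr (deg i) := by
          rw [Module.Basis.constr_range, span_le]
          rintro _ ⟨a, rfl⟩
          exact hm a
        exact this ⟨v, rfl⟩
      · rw [update_self]
        have : f.toLinearMap ∘ₗ β.constr ℚ m = (V i).subtype := β.ext fun a => by
          change f (β.constr ℚ m (β a)) = _
          rw [hxa]; exact hfm a
        exact LinearMap.congr_fun this v
      · rw [update_self]
        have hne : ∀ j, r j i → j ≠ i := by rintro j hj rfl; simp only [r] at hj; omega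
        have e : s' (M.d v) = s (M.d v) := h.eq_of_d hs' hsgr (fun j h1 h2 v hv => by
          have hj := hlow h1 h2
          refine (hsg j hj ⟨v, hv⟩).trans ?_
          rw [update_of_ne (hne j hj), ← hs1 j hj]) v.2
        rw [e]
        have : A.d ∘ₗ β.constr ℚ m = s.toLinearMap ∘ₗ M.d ∘ₗ (V i).subtype := β.ext fun a => by
          change A.d (β.constr ℚ m (β a)) = _
          rw [hxa]; exact hdm a
        exact LinearMap.congr_fun this v
  obtain ⟨g, hg⟩ := hext
  obtain ⟨s, ⟨hsgr, hs⟩, -⟩ := h.free A g fun i v => (hg i).1 v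
  refine ⟨s, hsgr, fun x => ?_, fun x => ?_⟩
  · refine FDGA.IsCellular.map_d_adjoin s hsgr (fun x hx => ?_)
      (show x ∈ Algebra.adjoin ℚ (⋃ j, (V j : Set M.carrier)) by
        rw [h.isCellular.adjoin_eq_top]; trivial)
    obtain ⟨j, hj⟩ := Set.mem_iUnion.1 hx
    rw [← (hg j).2.2 s hsgr (fun l _ v => hs l v) ⟨x, hj⟩]
    exact congrArg A.d (hs j ⟨x, hj⟩).symm
  · refine FDGA.IsCellular.eqOn_adjoin (f.comp s) (AlgHom.id ℚ _) (fun x hx => ?_)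
      (show x ∈ Algebra.adjoin ℚ (⋃ j, (V j : Set M.carrier)) by
        rw [h.isCellular.adjoin_eq_top]; trivial)
    obtain ⟨j, hj⟩ := Set.mem_iUnion.1 hx
    exact (congrArg f (hs j ⟨x, hj⟩)).trans ((hg j).2.1 ⟨x, hj⟩)

end MixedHodgeDGA.IsMinimalWith

namespace FDGA

variable {A : FDGA.{u} ℚ} {p : ℤ} {x y : A.baseChange.carrier}

lemma conj_sub_conj_mem_W (h : x - y ∈ A.baseChange.W p) :
    A.conj x - A.conj y ∈ A.baseChange.W p := by
  rw [← map_sub]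
  exact A.conj_W h

lemma sub_conj_mem_W (h : A.conj x - y ∈ A.baseChange.W p) : x - A.conj y ∈ A.baseChange.W p := by
  have := conj_sub_conj_mem_W h
  rwa [A.conj_conj] at this

end FDGA

namespace MixedHodgeDGA

variable {M N L : MixedHodgeDGA.{u}} {deg deg' : ℕ → ℕ} {V : ℕ → Submodule ℚ M.carrier}
  {V' : ℕ → Submodule ℚ N.carrier}

def conjF (M : MixedHodgeDGA.{u}) (b : ℤ) : Submodule ℂ M.toFFDGA.carrier := conjSub (M.F b)

namespace IsMinimalWith

/-- Quasi-isomorphisms between minimal dga's are bijective. -/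
lemma bijective_of_isQuasiIso (hM : M.IsMinimalWith deg V) (hN : N.IsMinimalWith deg' V')
    {f : FDGA.Hom M.toFDGA N.toFDGA} (hf : f.IsQuasiIso) : Bijective f.toAlgHom := by
  obtain ⟨s, hs, hsd, hfs⟩ := hN.exists_section f.toAlgHom f.map_gr f.map_d
    (fun n x hx hd => hf.inj hx hd) fun n y hy hd => hf.surj hy hd
  obtain ⟨t, -, -, hst⟩ := hM.exists_section s hs hsd
    (fun n x _ _ ⟨y, hy⟩ => ⟨f.toAlgHom y, by rw [← f.map_d, hy, hfs]⟩) fun n y hy hd =>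
      ⟨f.toAlgHom y, f.map_gr n y hy, by rw [← f.map_d, hd, map_zero],
        hf.inj (sub_mem hy (hs n _ (f.map_gr n y hy)))
          (by rw [map_sub, ← hsd, ← f.map_d, hd, map_zero, map_zero, sub_zero])
          (by rw [map_sub, hfs, sub_self]; exact zero_mem _)⟩
  have hft : ∀ x, f.toAlgHom x = t x := fun x => by rw [← hfs (t x), hst]
  exact ⟨fun x y hxy => by rw [← hst x, ← hst y, ← hft, ← hft, hxy], fun y => ⟨s y, hfs y⟩⟩

variable (h : M.IsMinimalWith deg V)

include h

lemma mem_baseChange_Z1 {n : ℕ} {p : ℤ} {x : M.toFFDGA.carrier} :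
    x ∈ M.baseChange.Z1 n p ↔ x ∈ M.toFFDGA.W p ∧ x ∈ M.toFFDGA.gr n := by
  refine ⟨fun hx => hx.1, fun hx => ⟨hx, ?_⟩⟩
  exact baseChange_le_comap (P := M.W p) (M.baseChange.d)
    (fun y hy => (M.d_incl y).symm ▸ DGA.incl_mem (h.d_W' hy)) x hx.1

lemma mem_baseChange_B1 {p : ℤ} {x : M.toFFDGA.carrier} :
    x ∈ M.baseChange.B1 p ↔ x ∈ M.toFFDGA.W (p - 1) := by
  rw [M.baseChange_B1_eq, h.B1_eq]; rfl

lemma e1Rel_of_sub {ℓ : ℕ} {n : ℕ} {p : ℤ} {x z : M.toFFDGA.carrier}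
    (hx : x ∈ M.toFFDGA.W p ∧ x ∈ M.toFFDGA.gr n) (hz : z ∈ M.toFFDGA.W p ∧ z ∈ M.toFFDGA.gr n)
    (hxz : x - z ∈ M.toFFDGA.W (p - 1)) :
    E1Rel (A := M.toDiag ℓ) (fun n p => M.E1BaseChange n p) n p x z := by
  refine ⟨h.mem_baseChange_Z1.2 hx, h.mem_baseChange_Z1.2 hz, ?_⟩
  refine (LinearEquiv.apply_symm_apply _ _).trans ?_
  exact (Submodule.Quotient.eq ((M.baseChange.B1 p).submoduleOf
    (M.baseChange.Z1 n p))).2 (h.mem_baseChange_B1.2 hxz)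

lemma of_e1Rel {ℓ : ℕ} {n : ℕ} {p : ℤ} {x z : M.toFFDGA.carrier}
    (hxz : E1Rel (A := M.toDiag ℓ) (fun n p => M.E1BaseChange n p) n p x z) :
    (z ∈ M.toFFDGA.W p ∧ z ∈ M.toFFDGA.gr n) ∧ x - z ∈ M.toFFDGA.W (p - 1) := by
  obtain ⟨hx, hz, e⟩ := hxz
  replace e := (LinearEquiv.apply_symm_apply _ _).symm.trans e
  exact ⟨hz.1, h.mem_baseChange_B1.1 ((Submodule.Quotient.eq ((M.baseChange.B1 p).submoduleOf
    (M.baseChange.Z1 n p))).1 e)⟩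

/-- The filtrations of a minimal mixed Hodge dga are opposite in every degree. -/
lemma oppositeFiltrations {ℓ : ℕ} (hA : IsMHD (M.toDiag ℓ)) (n : ℕ) :
    OppositeFiltrations (fun m : ℤ => (M.toFFDGA.W (m - n)).submoduleOf (M.toFFDGA.gr n))
      (fun a => (M.toFFDGA.F a).submoduleOf (M.toFFDGA.gr n))
      (fun b => (M.conjF b).submoduleOf (M.toFFDGA.gr n))
      ⊥ where
  W_mono p q hpq := comap_mono (M.toFFDGA.W_mono (by omega))
  F_anti p q hpq := comap_mono (M.toFFDGA.F_anti hpq)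
  G_anti p q hpq := comap_mono fun x hx => M.F_anti hpq hx
  N_le_W _ := bot_le
  N_le_F _ := bot_le
  N_le_G _ := bot_le
  W_bot := by
    obtain ⟨q, hq⟩ := exists_W_eq_bot (A := M.toFFDGA.toFDGA) n
    refine ⟨q + n, fun x hx => Subtype.ext (hq q le_rfl x.1 ⟨?_, x.2⟩)⟩
    have hx' : x.1 ∈ M.toFFDGA.W (q + n - n) := hx
    rwa [add_sub_cancel_right] at hx'
  W_top x := by
    obtain ⟨p, hp⟩ := M.toFFDGA.W_exhaustive x.1
    exact ⟨p + n, show x.1 ∈ M.toFFDGA.W (p + n - n) by rwa [add_sub_cancel_right]⟩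
  F_bot := by
    obtain ⟨⟨q, hq⟩, -⟩ := hA.biregular n
    exact ⟨q, fun x hx => Subtype.ext ((Submodule.eq_bot_iff _).1 hq x.1 ⟨hx, x.2⟩)⟩
  F_top := by
    obtain ⟨-, q, hq⟩ := hA.biregular n
    exact ⟨q, Submodule.eq_top_iff'.2 fun x => hq x.2⟩
  span := by
    rintro m a ⟨x, hx⟩ hxm
    obtain ⟨x₁, x₂, rfl, ⟨z₁, hz₁, h1⟩, z₂, hz₂, h2⟩ := E1Rel.split (A := M.toDiag ℓ)
      (ρ := fun n p => M.E1BaseChange n p) (h.pure_E1 n (m - n))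
      (h.mem_baseChange_Z1.2 ⟨hxm, hx⟩) a
    obtain ⟨hz₁', e1⟩ := h.of_e1Rel h1
    obtain ⟨hz₂', e2⟩ := h.of_e1Rel h2
    have e2' := sub_conj_mem_W e2
    refine ⟨⟨z₁, hz₁'.2⟩, ⟨hz₁, hz₁'.1⟩, ⟨M.conj z₂, M.conj_gr hz₂'.2⟩, ⟨?_, M.conj_W hz₂'.1⟩, ?_⟩
    · refine (congrArg (· ∈ M.F (m + 1 - a)) (M.conj_conj z₂)).mpr ?_
      rw [show m + 1 - a = m - n + n + 1 - a by ring]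
      exact hz₂
    · have e := Submodule.add_mem (M.toFFDGA.W (m - n - 1)) e1 e2'
      have key : ∀ a b c d : M.toFFDGA.carrier, a - c + (b - d) = a + b - c - d :=
        fun a b c d => by abel
      rw [show m - n - 1 = m - 1 - n by ring] at e
      exact (congrArg (· ∈ M.toFFDGA.W (m - 1 - n)) (key _ _ _ _)).mp e
  indep := by
    rintro m a b hab ⟨x, hx⟩ ⟨hxa, hxm⟩ ⟨y, hy⟩ ⟨hyb, hym⟩ hxy
    replace hxy : x - y ∈ M.toFFDGA.W (m - 1 - n) := hxy
    rw [show m - 1 - n = m - n - 1 by ring] at hxy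
    have := E1Rel.indep (A := M.toDiag ℓ) (ρ := fun n p => M.E1BaseChange n p)
      (h.pure_E1 n (m - n)) (h.e1Rel_of_sub ⟨hxm, hx⟩ ⟨hxm, hx⟩ (by
        rw [sub_self]; exact zero_mem _)) hxa (z' := M.conj y)
      (h.e1Rel_of_sub ⟨M.conj_W hxm, M.conj_gr hx⟩
        ⟨M.conj_W hym, M.conj_gr hy⟩ (conj_sub_conj_mem_W hxy))
      (by rw [show m - n + n + 1 - a = b by omega]; exact hyb)
    have := h.mem_baseChange_B1.1 this
    rw [show m - n - 1 = m - 1 - n by ring] at this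
    exact this

end IsMinimalWith

lemma IsMinimalWith.mem_of_map_mem (hM : M.IsMinimalWith deg V) (hN : N.IsMinimalWith deg' V')
    {ℓ : ℕ} (hA : IsMHD (M.toDiag ℓ)) (hB : IsMHD (N.toDiag ℓ))
    {f : FDGA.Hom M.toFDGA N.toFDGA} (hf : Injective f.toAlgHom)
    (hF : ∀ q, ∀ x ∈ M.toFFDGA.F q, f.baseChange x ∈ N.toFFDGA.F q) {n : ℕ} {p q : ℤ}
    {x : M.toFFDGA.carrier} (hx : x ∈ M.toFFDGA.gr n)
    (hxW : f.baseChange x ∈ N.toFFDGA.W p)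
    (hxF : f.baseChange x ∈ N.toFFDGA.F q) : x ∈ M.toFFDGA.W p ∧ x ∈ M.toFFDGA.F q := by
  let φ : M.toFFDGA.gr n →ₗ[ℂ] N.toFFDGA.gr n :=
    f.baseChange.lin.restrict fun y hy => f.baseChange.map_gr n y hy
  obtain ⟨y, hy, e⟩ := (hM.oppositeFiltrations hA n).strict (hN.oppositeFiltrations hB n) φ
    (fun m y hy => f.baseChange.map_W _ y.1 hy) (fun m y hy => hF m y.1 hy)
    (fun m y hy => by
      change N.toFDGA.conj (f.baseChange y.1) ∈ N.F m
      exact (congrArg (· ∈ N.F m) (FDGA.Hom.baseChange_conj f y.1)).mp (hF m _ hy)) (a := q) (m := p + n) (x := ⟨x, hx⟩) hxF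
    (show f.baseChange x ∈ N.toFFDGA.W (p + n - n) by rwa [add_sub_cancel_right])
  have e' : x = y.1 := baseChange_injective (f := f.lin) hf
    (congrArg Subtype.val (sub_eq_zero.1 ((mem_bot ℂ).1 e)))
  have hyW : y.1 ∈ M.toFFDGA.W (p + n - n) := hy.2
  rw [add_sub_cancel_right] at hyW
  exact e' ▸ ⟨hyW, hy.1⟩

section

variable (ℓ : ℕ)

def diagHom (g : FDGA.Hom M.toFDGA N.toFDGA)
    (hF : ∀ q, ∀ x ∈ M.toFFDGA.F q, g.baseChange x ∈ N.toFFDGA.F q) :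
    M.toDiag ℓ ⟶ N.toDiag ℓ :=
  FDiag.Hom.mk ⟨g, fun _ => g.baseChange, fun _ => g.baseChange, ⟨g.baseChange, hF⟩⟩
    fun j b => by
      rw [toDiag_φ, toDiag_φ]
      generalize src j b = s
      cases s <;> rfl

variable {ℓ}

lemma idHom_cancel {s : Src ℓ} {B : FDGA.{u} ℂ} {f g : FDGA.Hom M.baseChange B}
    (h : (M.idHom ℓ s).comp f = (M.idHom ℓ s).comp g) : f = g := by
  cases s <;> exact h

lemma ev_comp_idHom (w : M.toDiag ℓ ⟶ N.toDiag ℓ) (s : Src ℓ) :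
    ((toHom w).ev s).comp (N.idHom ℓ s) = (M.idHom ℓ s).comp (toHom w).fQ.baseChange := by
  refine Src.chain_induction false (P := fun s => ((toHom w).ev s).comp (N.idHom ℓ s) =
    (M.idHom ℓ s).comp (toHom w).fQ.baseChange) rfl (fun j h => ?_) s
  have h1 := FDiag.Hom.comm w j false
  have h2 := FDiag.Hom.comm w j true
  rw [toDiag_φ, toDiag_φ] at h1 h2
  have h3 := idHom_cancel (h1.trans h)
  exact h2.symm.trans (congrArg _ h3)

lemma fodd_eq (w : M.toDiag ℓ ⟶ N.toDiag ℓ) (j : Fin (ℓ + 1)) :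
    (toHom w).fodd j = (toHom w).fQ.baseChange := by
  have h1 := FDiag.Hom.comm w j false
  rw [toDiag_φ, toDiag_φ] at h1
  exact idHom_cancel (h1.trans (ev_comp_idHom w _))

lemma map_F (w : M.toDiag ℓ ⟶ N.toDiag ℓ) (q : ℤ) (x : M.toFFDGA.carrier) (hx : x ∈ M.toFFDGA.F q) :
    (toHom w).fQ.baseChange x ∈ N.toFFDGA.F q := by
  have : (toHom w).fC.toHom = (toHom w).fQ.baseChange := ev_comp_idHom w .hodge
  rw [← this]
  exact (toHom w).fC.map_F q x hx

lemma eq_diagHom (w : M.toDiag ℓ ⟶ N.toDiag ℓ) : w = diagHom ℓ (toHom w).fQ (map_F w) :=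
  FDiag.Hom.ext_toHom (FFam.Hom.ext rfl (funext fun j => ev_comp_idHom w (.mid j))
    (funext fun j => fodd_eq w j) (FFDGA.Hom.ext (congrArg FDGA.Hom.toAlgHom (ev_comp_idHom w .hodge))))

/-- Quasi-isomorphisms between minimal mixed Hodge dga's are isomorphisms of diagrams. -/
lemma IsMinimalWith.isIso (hM : M.IsMinimalWith deg V) (hN : N.IsMinimalWith deg' V')
    (hA : IsMHD (M.toDiag ℓ)) (hB : IsMHD (N.toDiag ℓ)) (w : M.toDiag ℓ ⟶ N.toDiag ℓ)
    (hw : levelwiseQuasiIso ℓ w) : IsIso w := by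
  let f : FDGA.Hom M.toFDGA N.toFDGA := (toHom w).fQ
  have hbij := hM.bijective_of_isQuasiIso hN (f := f) hw.1
  have hstrict := fun {n p q x} => hM.mem_of_map_mem hN hA hB hbij.1 (map_F w) (n := n) (p := p)
    (q := q) (x := x)
  have hW : ∀ p (x : M.carrier), f.toAlgHom x ∈ N.W p → x ∈ M.W p := by
    intro p x hx
    have hn : ∀ n, M.proj n x ∈ M.W p := fun n => by
      obtain ⟨-, q, hq⟩ := hB.biregular n
      have hxn : M.proj n x ∈ M.gr n := M.proj_mem n x
      have e := f.baseChange_incl (M.proj n x)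
      have := (hstrict (p := p) (DGA.incl_mem hxn) (e.symm ▸ DGA.incl_mem (by
        rw [f.map_proj]; exact N.proj_mem_W hx n)) (hq (f.baseChange.map_gr n _
          (DGA.incl_mem hxn)))).1
      obtain ⟨l, hl⟩ := exists_slice_one
      have e' : slice M.carrier l (M.toFDGA.incl (M.proj n x)) = M.proj n x :=
        (slice_tmul l 1 _).trans (by rw [hl, one_smul])
      exact e' ▸ slice_mem l this
    obtain ⟨s, hs⟩ := M.sum_proj x
    rw [hs]
    exact sum_mem fun n _ => hn n
  have hF : ∀ q (x : M.toFFDGA.carrier), f.baseChange.toAlgHom x ∈ N.toFFDGA.F q →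
      x ∈ M.toFFDGA.F q := by
    intro q x hx
    obtain ⟨s, hs⟩ := M.toFFDGA.sum_proj x
    rw [hs]
    refine sum_mem fun n _ => ?_
    obtain ⟨p, hp⟩ := N.toFFDGA.W_exhaustive (f.baseChange.toAlgHom (M.toFFDGA.proj n x))
    refine (hstrict (M.toFFDGA.proj_mem n x) hp ?_).2
    have := f.baseChange.map_proj n x
    exact this.symm ▸ N.toFFDGA.proj_mem_F hx n
  let g := f.inverse hbij hW
  have hgf : ∀ x, f.baseChange.toAlgHom (g.baseChange.toAlgHom x) = x := fun x => by
    have := congrArg FDGA.Hom.baseChange (f.inverse_comp hbij hW)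
    rw [FDGA.Hom.baseChange_comp, FDGA.Hom.baseChange_id] at this
    exact congrArg (fun z : FDGA.Hom _ _ => z.toAlgHom x) this
  let v : N.toDiag ℓ ⟶ M.toDiag ℓ := diagHom ℓ g fun q x hx => hF q _ ((hgf x).symm ▸ hx)
  rw [eq_diagHom w]
  refine ⟨v, FDiag.Hom.ext_toHom ?_, FDiag.Hom.ext_toHom ?_⟩
  · have h1 := f.comp_inverse hbij hW
    have h2 := congrArg FDGA.Hom.baseChange h1
    rw [FDGA.Hom.baseChange_comp, FDGA.Hom.baseChange_id] at h2
    exact FFam.Hom.ext h1 (funext fun _ => h2) (funext fun _ => h2)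
      (FFDGA.Hom.ext (congrArg FDGA.Hom.toAlgHom h2))
  · have h1 := f.inverse_comp hbij hW
    have h2 := congrArg FDGA.Hom.baseChange h1
    rw [FDGA.Hom.baseChange_comp, FDGA.Hom.baseChange_id] at h2
    exact FFam.Hom.ext h1 (funext fun _ => h2) (funext fun _ => h2)
      (FFDGA.Hom.ext (congrArg FDGA.Hom.toAlgHom h2))

end

end MixedHodgeDGA

end MixedHodge

end

theorem mainTheorem12 (ℓ : ℕ) (M : MixedHodge.MixedHodgeDGA.{u}) (hM : M.IsMinimal)
    (hfin : ∀ n, Module.Finite ℚ (M.H n)) :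
    ∃ h : MixedHodge.IsMHD (M.toDiag ℓ),
      MixedHodge.CECofibrant (MixedHodge.MHD.H ℓ) (MixedHodge.MHD.Q ℓ) ⟨M.toDiag ℓ, h⟩ ∧
      MixedHodge.CEMinimal (MixedHodge.MHD.Q ℓ) ⟨M.toDiag ℓ, h⟩ ∧
      ∀ N : MixedHodge.MixedHodgeDGA.{u}, N.IsMinimal → ∀ hN : MixedHodge.IsMHD (N.toDiag ℓ),
        ∀ w : (⟨M.toDiag ℓ, h⟩ : MixedHodge.MHD.{u} ℓ) ⟶ ⟨N.toDiag ℓ, hN⟩,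
          MixedHodge.MHD.Q ℓ w → IsIso w := by
  obtain ⟨deg, V, hV⟩ := hM
  have h := hV.isMHD ℓ hfin
  have hiso : ∀ N : MixedHodge.MixedHodgeDGA.{u}, N.IsMinimal →
      ∀ hN : MixedHodge.IsMHD (N.toDiag ℓ),
        ∀ w : (⟨M.toDiag ℓ, h⟩ : MixedHodge.MHD.{u} ℓ) ⟶ ⟨N.toDiag ℓ, hN⟩,
          MixedHodge.MHD.Q ℓ w → IsIso w := by
    rintro N ⟨deg', V', hV'⟩ hN w hw
    exact (ObjectProperty.isIso_hom_iff w).1 (hV.isIso hV' h hN w.hom hw)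
  exact ⟨h, MixedHodge.MHD.cofibrant fun {A B} w hw =>
    hV.classes_map_bijective A.property B.property w.hom hw, hiso M ⟨deg, V, hV⟩ h, hiso⟩
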